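/- **Setting.** Manifolds are smooth, second countable and without boundary. $\mathcal M$ and $\mathcal N$ are nonempty compact connected Riemannian manifolds, $m:=\dim\mathcal M\ge 1$, $\pi:\widetilde{\mathcal N}\to\mathcal N$ is a Riemannian covering (a smooth covering map which preserves the metric tensor), $d_{\mathcal M},d_{\mathcal N},d_{\widetilde{\mathcal N}}$ are the geodesic distances (with $d_{\widetilde{\mathcal N}}=\infty$ between different connected components), integrals over $\mathcal M$ are with respect to the Riemannian volume, and $\operatorname{inj}(\mathcal N)$ is the injectivity radius. Let $$X(\mathcal M,\widetilde{\mathcal N}):=\Big\{\tilde u:\mathcal M\to\widetilde{\mathcal N}\ \text{measurable}:\ \iint_{\{(x,y)\in\mathcal M\times\mathcal M\,:\,d_{\widetilde{\mathcal N}}(\tilde u(x),\tilde u(y))\ge \operatorname{inj}(\mathcal N)/2\}}\frac{dy\,dx}{d_{\mathcal M}(x,y)^{m+1}}<\infty\Big\},$$ and let $\dot W^{s,p}(\mathcal M,\widetilde{\mathcal N})$ be the set of measurable maps $v:\mathcal M\to\widetilde{\mathcal N}$ with $\iint_{\mathcal M\times\mathcal M} d_{\widetilde{\mathcal N}}(v(y),v(x))^p\,d_{\mathcal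 M}(y,x)^{-(m+sp)}\,dy\,dx<\infty$. **Theorem.** Let $0<s<1<p<\infty$ with $sp>1$. (i) There is a constant $C\in(0,\infty)$, depending only on $\mathcal M,\mathcal N,\pi,s,p$, such that for every $\tilde u\in X(\mathcal M,\widetilde{\mathcal N})$, with $u:=\pi\circ\tilde u$, one has (in $[0,\infty]$) $$\iint_{\mathcal M\times\mathcal M}\frac{d_{\widetilde{\mathcal N}}(\tilde u(y),\tilde u(x))^p}{d_{\mathcal M}(y,x)^{m+sp}}\,dy\,dx\le C\Big(1+\iint_{\mathcal M\times\mathcal M}\frac{d_{\mathcal N}(u(y),u(x))^p}{d_{\mathcal M}(y,x)^{2m}}\,dy\,dx\Big)^{\frac{(1-s)p}{m}}\iint_{\mathcal M\times\mathcal M}\frac{d_{\mathcal N}(u(y),u(x))^p}{d_{\mathcal M}(y,x)^{m+sp}}\,dy\,dx .$$ In particular, if both integrals on the right-hand side are finite, then $\tilde u\in\dot W^{s,p}(\mathcal M,\widetilde{\mathcal N})$. (ii) If moreover $p>m$, the exponent $\frac{(1-s)p}{m}$ is optimal: for the universal covering $\pi:\mathbb R\to\mathbb S^1$ of the unit circle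 (with its arc-length distance), for every real $\gamma<\frac{(1-s)p}{m}$ and every $C\in(0,\infty)$ there is a smooth function $\tilde u:\mathcal M\to\mathbb R$ with $\tilde u\in X(\mathcal M,\mathbb R)$ for which, with $u:=\pi\circ\tilde u$, both integrals on the right-hand side are finite and $$\iint_{\mathcal M\times\mathcal M}\frac{|\tilde u(y)-\tilde u(x)|^p}{d_{\mathcal M}(y,x)^{m+sp}}\,dy\,dx> C\Big(1+\iint_{\mathcal M\times\mathcal M}\frac{d_{\mathbb S^1}(u(y),u(x))^p}{d_{\mathcal M}(y,x)^{2m}}\,dy\,dx\Big)^{\gamma}\iint_{\mathcal M\times\mathcal M}\frac{d_{\mathbb S^1}(u(y),u(x))^p}{d_{\mathcal M}(y,x)^{m+sp}}\,dy\,dx .$$ -/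

import Mathlib

open MeasureTheory Bundle Manifold Topology
open scoped ENNReal NNReal ContDiff

noncomputable section

/-! ### Riemannian volume -/

section Volume

variable (m : ℕ) (M : Type*) [EMetricSpace M] [MeasurableSpace M]
  [ChartedSpace (EuclideanSpace ℝ (Fin m)) M]
  [RiemannianBundle (fun x : M ↦ TangentSpace (𝓡 m) x)]

/-- Coefficients `g_{ij} = ⟨∂_i, ∂_j⟩` of the metric tensor in the preferred chart at `x`, at the
point whose coordinate vector in that chart is `z`. -/
def metricCoeff {m : ℕ} {M : Type*} [EMetricSpace M]
    [ChartedSpace (EuclideanSpace ℝ (Fin m)) M]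
    [RiemannianBundle (fun x : M ↦ TangentSpace (𝓡 m) x)]
    (x : M) (z : EuclideanSpace ℝ (Fin m)) : Matrix (Fin m) (Fin m) ℝ :=
  Matrix.of fun i j ↦
    inner ℝ
      (mfderiv (𝓡 m) (𝓡 m) (chartAt (EuclideanSpace ℝ (Fin m)) x).symm z
        (EuclideanSpace.single i (1 : ℝ)))
      (mfderiv (𝓡 m) (𝓡 m) (chartAt (EuclideanSpace ℝ (Fin m)) x).symm z
        (EuclideanSpace.single j (1 : ℝ)))

/-- The measure `√(det g) dz` of the preferred chart at `x`, carried over to the domain of that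
chart (a subset of `M`). -/
def chartVolume (x : M) : Measure M :=
  Measure.map (chartAt (EuclideanSpace ℝ (Fin m)) x).symm
    ((volume.restrict (chartAt (EuclideanSpace ℝ (Fin m)) x).target).withDensity
      fun z ↦ ENNReal.ofReal √(metricCoeff x z).det)

/-- The Riemannian volume measure. The measures `√(det g) dz` of two charts agree on the
intersection of their domains; the measure that they define together is their least upper bound. -/
def riemannianVolume : Measure M := ⨆ x : M, chartVolume m M x

end Volume

/-! ### Riemannian coverings -/

/-- A Riemannian covering: a smooth covering map that preserves the metric tensor. -/
structure IsRiemannianCovering {n : ℕ} {N' N : Type*}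
    [EMetricSpace N'] [ChartedSpace (EuclideanSpace ℝ (Fin n)) N']
    [RiemannianBundle (fun x : N' ↦ TangentSpace (𝓡 n) x)]
    [EMetricSpace N] [ChartedSpace (EuclideanSpace ℝ (Fin n)) N]
    [RiemannianBundle (fun x : N ↦ TangentSpace (𝓡 n) x)]
    (cov : N' → N) : Prop where
  isCoveringMap : IsCoveringMap cov
  contMDiff : ContMDiff (𝓡 n) (𝓡 n) ∞ cov
  inner_mfderiv : ∀ (y : N') (v w : TangentSpace (𝓡 n) y),
    inner ℝ (mfderiv (𝓡 n) (𝓡 n) cov y v) (mfderiv (𝓡 n) (𝓡 n) cov y w) = inner ℝ v w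

/-! ### Injectivity radius -/

/-- `γ : [0,1] → N` is a geodesic of constant speed `ℓ` (hence of length `ℓ`): locally, it
minimizes the distance and is parametrized proportionally to arc length. On a smooth Riemannian
manifold without boundary these are exactly the curves `t ↦ exp_x (t v)` with `‖v‖ = ℓ`. -/
def IsGeodesicPath {N : Type*} [EMetricSpace N] (γ : unitInterval → N) (ℓ : ℝ≥0) : Prop :=
  ∀ t : unitInterval, ∀ᶠ q : unitInterval × unitInterval in 𝓝 (t, t),
    edist (γ q.1) (γ q.2) = ℓ * edist q.1 q.2

/-- The injectivity radius at `x`: the supremum of the `r` such that the exponential map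
`exp_x` is injective on the open ball of radius `r`, that is, such that two geodesics
`t ↦ exp_x (t v)` and `t ↦ exp_x (t w)` with `‖v‖, ‖w‖ < r` and the same endpoint coincide. -/
def injectivityRadiusAt {N : Type*} [EMetricSpace N] (x : N) : ℝ≥0∞ :=
  sSup {r : ℝ≥0∞ | ∀ (γ₁ γ₂ : unitInterval → N) (ℓ₁ ℓ₂ : ℝ≥0),
    IsGeodesicPath γ₁ ℓ₁ → IsGeodesicPath γ₂ ℓ₂ → γ₁ 0 = x → γ₂ 0 = x →
    (ℓ₁ : ℝ≥0∞) < r → (ℓ₂ : ℝ≥0∞) < r → γ₁ 1 = γ₂ 1 → γ₁ = γ₂}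

/-- The injectivity radius of a complete Riemannian manifold. -/
def injectivityRadius (N : Type*) [EMetricSpace N] : ℝ≥0∞ :=
  ⨅ x : N, injectivityRadiusAt x

/-! ### Fractional energies and function spaces -/

/-- The double integral `∬ d(u(y),u(x))^p / d(y,x)^κ dy dx`. -/
def gagliardoEnergy {M E : Type*} [EMetricSpace M] [MeasurableSpace M] [EMetricSpace E]
    (μ : Measure M) (p κ : ℝ) (u : M → E) : ℝ≥0∞ :=
  ∫⁻ x, ∫⁻ y, edist (u y) (u x) ^ p / edist y x ^ κ ∂μ ∂μ

/-- `u` belongs to the homogeneous fractional Sobolev space `Ẇ^{s,p}(M, E)`, for `M` of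
dimension `m` with volume measure `μ`. -/
def MemFracSobolev {M E : Type*} [EMetricSpace M] [MeasurableSpace M] [EMetricSpace E]
    [MeasurableSpace E] (m : ℕ) (μ : Measure M) (s p : ℝ) (u : M → E) : Prop :=
  AEMeasurable u μ ∧ gagliardoEnergy μ p (m + s * p) u < ⊤

/-- `v` belongs to the space `X(M, N')` associated with the base manifold `N`, for `M` of
dimension `m` with volume measure `μ`. -/
def MemLiftingSpace {M N' : Type*} [EMetricSpace M] [MeasurableSpace M] [EMetricSpace N']
    [MeasurableSpace N'] (m : ℕ) (μ : Measure M) (N : Type*) [EMetricSpace N]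
    (v : M → N') : Prop :=
  AEMeasurable v μ ∧
    ∫⁻ x, ∫⁻ y in {y | injectivityRadius N / 2 ≤ edist (v x) (v y)},
      1 / edist x y ^ ((m : ℝ) + 1) ∂μ ∂μ < ⊤

end

/-! Put q = sp > 1 and δ = inj(N)/2, and write ρ(x,y), σ(x,y) for the distances between the values
of the lift and between their projections. Then σ ≤ ρ, and σ = ρ where ρ < 2δ. The second fact is
`IsRiemannianCovering.edist_eq`: if the covering shortened a distance smaller than inj(N), path
lifting would give two points of one fibre at distance less than 2 inj(N). Almost minimizing curves
between them project, in the limit, to a geodesic loop of that length, whereas a geodesic loop has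
length at least 2 inj(N). From there on the estimate only concerns pairs of functions as in
`IsLiftPair`.

On a convex set of dimension d, let ν_q be the measure |x-y|^{-(d+q)} dx dy. Replacing the pairs by
the ends of a subsegment of relative length t costs a factor t^q
(`lintegral_segMap_kernelMeasure_le`), so cutting the segment into k equal links gains k^{1-q}
altogether. For q = 1 nothing is gained, but membership in X says that ν_1{ρ ≥ δ} is finite, and
this allows the halving inequality to be subtracted. The outcome for q > 1 is ν_q{ρ ≥ δ} ≤ C ν_q{δ ≤
ρ < 2δ} (`kernelMeasure_farSet_le`), and on the last set ρ = σ. Subdivision also gives ν_q{ρ ≥ λδ} ≤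
C λ^{-q} ν_q{ρ ≥ δ}, so that the p-moment of ρ over δ ≤ ρ < λδ is at most C λ^{p-q} ν_q{ρ ≥ δ}. With
λ^d comparable to 1 + E, where E is the integral of σ^p for ν_d, the factor λ^{p-q} is the power
(1-s)p/d of 1 + E. What remains is to control the values of ρ above T = λδ.

If d ≥ 2, the tail estimate for q = d makes ν_d{ρ ≥ T} small. As |x-y|^{-2d} dx dy is invariant
under scaling, at every scale most pairs taken near x and near y have ρ < T. Inserting such a pair
between x and y bounds the p-moment of the excess over 3T by a small multiple of the p-moment of the
excess over T, which is absorbed (`exists_lintegral_excess_rpow_le`).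

If d = 1, the exponent q = d = 1 gives no decay. Let m(x,y) be the ν_1-measure of the pairs of (x,y]
with δ ≤ ρ < 2δ. A randomly shifted chain from x to y has on average at most C(1 + m(x,y)) far
links, whatever the number of links (`lintegral_sum_far_links_le`). As m is superadditive, Hölder's
inequality with the weights 1 + m(link) propagates the weighted quantity ρ^p (1+m)^{1-p}, again with
the gain k^{1-q} (`lintegral_sub_weight_le`). A fixed large k bounds the weighted moment by
absorption; then k = 2^n ≥ 1 + (total mass) removes the weight.

On the manifold, charts are locally bi-Lipschitz and the volume is comparable to Lebesgue measure
(`hasGoodCharts_riemannianVolume`); finitely many charts contain all pairs at small distance, and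
connectedness controls the other pairs (`exists_lintegral_le_near`).

For optimality, take v = Lφ with φ smooth and nonconstant and L → ∞. The energy of v grows as L^p,
while those of the projection at the exponents 2m and m + sp grow at most as L^{m+η} and L^{sp+η}
for small η > 0, because circle distances are bounded. -/

set_option linter.unusedSectionVars false

noncomputable section

/-! ### Fractional kernels on convex sets and affine reparametrization -/

section SegMap

variable {E : Type*} [NormedAddCommGroup E] [NormedSpace ℝ E]

/-- The pair of points of parameters `a` and `b` on the segment between two points. -/
def segMap (a b : ℝ) (p : E × E) : E × E :=
  (p.1 + a • (p.2 - p.1), p.1 + b • (p.2 - p.1))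

lemma edist_segMap {a b : ℝ} (h : a ≤ b) (p : E × E) :
    edist (segMap a b p).1 (segMap a b p).2 = ENNReal.ofReal (b - a) * edist p.1 p.2 := by
  rw [edist_comm, edist_comm p.1, edist_eq_enorm_sub, edist_eq_enorm_sub, segMap]
  have : p.1 + b • (p.2 - p.1) - (p.1 + a • (p.2 - p.1)) = (b - a) • (p.2 - p.1) := by
    module
  rw [this, enorm_smul, Real.enorm_of_nonneg (sub_nonneg.2 h)]

variable [MeasurableSpace E] [BorelSpace E] [FiniteDimensional ℝ E]

lemma measurable_segMap (a b : ℝ) : Measurable (segMap a b : E × E → E × E) := by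
  have := FiniteDimensional.proper ℝ E
  have : SecondCountableTopology E := inferInstance
  unfold segMap
  fun_prop

variable (μ : Measure E) [μ.IsAddHaarMeasure]

-- Change of variables for the homothety of centre x and ratio b, of Jacobian b^d; convexity keeps
-- the image of Ω inside Ω.
open Module in
lemma lintegral_homothety_le {Ω : Set E} (hΩ : Convex ℝ Ω) (hm : MeasurableSet Ω) {x : E}
    (hx : x ∈ Ω) {b : ℝ} (hb0 : 0 < b) (hb1 : b ≤ 1) (f : E → ℝ≥0∞) :
    ENNReal.ofReal (b ^ finrank ℝ E) * ∫⁻ y in Ω, f (x + b • (y - x)) ∂μ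
      ≤ ∫⁻ y in Ω, f y ∂μ := by
  set T : E → E := fun y ↦ x + b • (y - x) with hT
  have hder : ∀ y ∈ Ω, HasFDerivWithinAt T (b • ContinuousLinearMap.id ℝ E) Ω y := fun y _ ↦ by
    have := (((hasFDerivWithinAt_id (𝕜 := ℝ) y Ω).sub_const x).const_smul b).const_add x
    exact this
  have hinj : Set.InjOn T Ω := fun y _ z _ h ↦ by
    have h1 : b • (y - x) = b • (z - x) := add_left_cancel h
    simpa using smul_right_injective E hb0.ne' h1
  have him : T '' Ω ⊆ Ω := by
    rintro _ ⟨y, hy, rfl⟩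
    exact hΩ.add_smul_sub_mem hx hy ⟨hb0.le, hb1⟩
  have := lintegral_image_eq_lintegral_abs_det_fderiv_mul μ hm hder hinj f
  have hdet : (b • ContinuousLinearMap.id ℝ E).det = b ^ finrank ℝ E := by
    simp [ContinuousLinearMap.det]
  rw [hdet, abs_of_nonneg (by positivity), lintegral_const_mul' _ _ ENNReal.ofReal_ne_top] at this
  rw [← this]
  exact lintegral_mono_set him

-- The map is a composition of two homotheties, each moving one point of the pair only: first y is
-- contracted towards x with ratio b, then x towards the new point with ratio 1 - a/b. The product
-- of the ratios is b - a.
open Module in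
lemma lintegral_segMap_le {Ω : Set E} (hΩ : Convex ℝ Ω) (hm : MeasurableSet Ω)
    {a b : ℝ} (ha : 0 ≤ a) (hab : a < b) (hb : b ≤ 1) {F : E × E → ℝ≥0∞} (hF : Measurable F) :
    ENNReal.ofReal ((b - a) ^ finrank ℝ E) *
        ∫⁻ p, F (segMap a b p) ∂((μ.restrict Ω).prod (μ.restrict Ω))
      ≤ ∫⁻ p, F p ∂((μ.restrict Ω).prod (μ.restrict Ω)) := by
  have := FiniteDimensional.proper ℝ E
  have : SecondCountableTopology E := inferInstance
  have hb0 : 0 < b := ha.trans_lt hab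
  set c := a / b with hc
  have hc0 : 0 ≤ c := by positivity
  have hc1 : c < 1 := (div_lt_one hb0).2 hab
  set G : E × E → ℝ≥0∞ := fun p ↦ F (p.2 + (1 - c) • (p.1 - p.2), p.2) with hG
  have hGm : Measurable G := by
    refine hF.comp ?_
    fun_prop
  have key : ∀ p : E × E, F (segMap a b p) = G (p.1, p.1 + b • (p.2 - p.1)) := fun p ↦ by
    simp only [hG, segMap]
    congr 2
    have : a = c * b := by rw [hc]; field_simp
    rw [this]
    module
  have hsplit : ENNReal.ofReal ((b - a) ^ finrank ℝ E)
      = ENNReal.ofReal ((1 - c) ^ finrank ℝ E) * ENNReal.ofReal (b ^ finrank ℝ E) := by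
    rw [← ENNReal.ofReal_mul (pow_nonneg (by linarith) _), ← mul_pow]
    congr 2
    rw [hc]; field_simp
  calc _ = ENNReal.ofReal ((1 - c) ^ finrank ℝ E) * (ENNReal.ofReal (b ^ finrank ℝ E) *
        ∫⁻ p, G (p.1, p.1 + b • (p.2 - p.1)) ∂((μ.restrict Ω).prod (μ.restrict Ω))) := by
        simp_rw [key]; rw [hsplit, mul_assoc]
    _ ≤ ENNReal.ofReal ((1 - c) ^ finrank ℝ E) *
        ∫⁻ p, G p ∂((μ.restrict Ω).prod (μ.restrict Ω)) := by
        gcongr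
        rw [lintegral_prod _ (by fun_prop), lintegral_prod _ (by fun_prop),
          ← lintegral_const_mul' _ _ ENNReal.ofReal_ne_top]
        refine setLIntegral_mono' hm fun x hx ↦ ?_
        exact lintegral_homothety_le μ hΩ hm hx hb0 hb fun w ↦ G (x, w)
    _ ≤ _ := by
        rw [lintegral_prod_symm _ (by fun_prop), lintegral_prod_symm _ (by fun_prop),
          ← lintegral_const_mul' _ _ ENNReal.ofReal_ne_top]
        refine setLIntegral_mono' hm fun w hw ↦ ?_
        exact lintegral_homothety_le μ hΩ hm hw (by linarith) (by linarith) fun x ↦ F (x, w)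

/-- The measure `|x - y|^{-(d+q)} dx dy` on `Ω × Ω`, where `d` is the dimension. -/
def kernelMeasure (Ω : Set E) (q : ℝ) : Measure (E × E) :=
  ((μ.restrict Ω).prod (μ.restrict Ω)).withDensity
    fun p ↦ (edist p.1 p.2 ^ ((Module.finrank ℝ E : ℝ) + q))⁻¹

lemma measurable_kernel (κ : ℝ) : Measurable fun p : E × E ↦ (edist p.1 p.2 ^ κ)⁻¹ := by
  have := FiniteDimensional.proper ℝ E
  have : SecondCountableTopology E := inferInstance
  fun_prop

lemma lintegral_kernelMeasure (Ω : Set E) (q : ℝ) {F : E × E → ℝ≥0∞} (hF : Measurable F) :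
    ∫⁻ p, F p ∂(kernelMeasure μ Ω q) = ∫⁻ p, F p / edist p.1 p.2 ^ ((Module.finrank ℝ E : ℝ) + q)
      ∂((μ.restrict Ω).prod (μ.restrict Ω)) := by
  rw [kernelMeasure, lintegral_withDensity_eq_lintegral_mul _ (measurable_kernel _) hF]
  refine lintegral_congr fun p ↦ ?_
  simp [div_eq_mul_inv, mul_comm]

instance (Ω : Set E) (q : ℝ) : SFinite (kernelMeasure μ Ω q) := by
  unfold kernelMeasure; infer_instance

-- The distance is multiplied by b - a, hence the kernel by (b-a)^{-(d+q)}, and the Jacobian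
-- accounts for (b-a)^d; the factor (b-a)^q is what is left. All the gains from subdivision come
-- from here.
open Module in
lemma lintegral_segMap_kernelMeasure_le {Ω : Set E} (hΩ : Convex ℝ Ω) (hm : MeasurableSet Ω)
    {a b : ℝ} (ha : 0 ≤ a) (hab : a < b) (hb : b ≤ 1) (q : ℝ) {F : E × E → ℝ≥0∞}
    (hF : Measurable F) :
    ∫⁻ p, F (segMap a b p) ∂(kernelMeasure μ Ω q)
      ≤ ENNReal.ofReal ((b - a) ^ q) * ∫⁻ p, F p ∂(kernelMeasure μ Ω q) := by
  rw [lintegral_kernelMeasure μ Ω q (F := fun p ↦ F (segMap a b p))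
      (hF.comp (measurable_segMap a b)),
    lintegral_kernelMeasure μ Ω q hF]
  have hba : 0 < b - a := sub_pos.2 hab
  set κ : ℝ := finrank ℝ E + q
  have hκ : ENNReal.ofReal (b - a) ^ κ
      = ENNReal.ofReal ((b - a) ^ q) * ENNReal.ofReal ((b - a) ^ finrank ℝ E) := by
    rw [ENNReal.ofReal_rpow_of_pos hba, ← ENNReal.ofReal_mul (by positivity),
      Real.rpow_add hba, Real.rpow_natCast, mul_comm]
  have hpos : ENNReal.ofReal (b - a) ≠ 0 := by simpa using hab
  have hκ0 : ENNReal.ofReal (b - a) ^ κ ≠ 0 := by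
    simp [ENNReal.rpow_eq_zero_iff, hpos]
  have hκt : ENNReal.ofReal (b - a) ^ κ ≠ ⊤ := by
    simp [ENNReal.rpow_eq_top_iff, hpos]
  have hpt : ∀ p : E × E, F (segMap a b p) / edist p.1 p.2 ^ κ
      = ENNReal.ofReal (b - a) ^ κ * (F (segMap a b p) /
        edist (segMap a b p).1 (segMap a b p).2 ^ κ) := fun p ↦ by
    rw [edist_segMap hab.le, ENNReal.mul_rpow_of_ne_top ENNReal.ofReal_ne_top (edist_ne_top _ _),
      div_eq_mul_inv, div_eq_mul_inv, ENNReal.mul_inv (Or.inl hκ0) (Or.inl hκt)]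
    have : ∀ c f c' e : ℝ≥0∞, c * (f * (c' * e)) = (c * c') * (f * e) := fun _ _ _ _ ↦ by ring
    rw [this, ENNReal.mul_inv_cancel hκ0 hκt, one_mul]
  simp only [hpt]
  rw [lintegral_const_mul' _ _ hκt, hκ, mul_assoc]
  gcongr
  refine lintegral_segMap_le μ hΩ hm ha hab hb
    (F := fun p ↦ F p / edist p.1 p.2 ^ κ) ?_
  simp only [div_eq_mul_inv]
  exact hF.mul (measurable_kernel κ)

end SegMap


/-! ### Chains along segments -/

/-- Absorption. It is useless when g is infinite, which is why the moments below are first taken for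
truncated distances. -/
lemma ENNReal.le_mul_of_le_mul_add {g b : ℝ≥0∞} {θ : ℝ} (h0 : 0 ≤ θ) (hθ : θ < 1) (hg : g ≠ ⊤)
    (h : g ≤ ENNReal.ofReal θ * g + b) : g ≤ ENNReal.ofReal (1 - θ)⁻¹ * b := by
  rcases eq_or_ne b ⊤ with rfl | hb
  · rw [ENNReal.mul_top (by simpa using hθ)]
    exact le_top
  lift g to ℝ≥0 using hg
  lift b to ℝ≥0 using hb
  have h1 : (0 : ℝ) < 1 - θ := by linarith
  have h2 : (g : ℝ) ≤ θ * g + b := by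
    rw [ENNReal.ofReal, ← ENNReal.coe_mul, ← ENNReal.coe_add, ENNReal.coe_le_coe] at h
    simpa [h0] using NNReal.coe_le_coe.2 h
  rw [ENNReal.ofReal, ← ENNReal.coe_mul, ENNReal.coe_le_coe, ← NNReal.coe_le_coe, NNReal.coe_mul,
    Real.coe_toNNReal _ (by positivity), inv_mul_eq_div, le_div_iff₀ h1]
  linarith

/-- A measurable extended pseudo-distance. -/
structure IsPairDist {X : Type*} [MeasurableSpace X] (ρ : X → X → ℝ≥0∞) : Prop where
  measurable : Measurable fun p : X × X ↦ ρ p.1 p.2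
  self : ∀ x, ρ x x = 0
  comm : ∀ x y, ρ x y = ρ y x
  triangle : ∀ x y z, ρ x z ≤ ρ x y + ρ y z

/-- Truncation keeps the triangle inequality, so the chain arguments apply to min(ρ, T), whose
moments over far pairs are finite before absorption. -/
lemma IsPairDist.min {X : Type*} [MeasurableSpace X] {ρ : X → X → ℝ≥0∞} (h : IsPairDist ρ)
    (T : ℝ≥0∞) : IsPairDist fun x y ↦ min (ρ x y) T where
  measurable := h.measurable.min measurable_const
  self x := by simp [h.self]
  comm x y := by rw [h.comm]
  triangle x y z := by
    rcases le_total T (ρ x y) with h1 | h1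
    · exact (min_le_right _ _).trans (by rw [min_eq_right h1]; exact le_self_add)
    rcases le_total T (ρ y z) with h2 | h2
    · exact (min_le_right _ _).trans (by rw [min_eq_right h2]; exact le_add_self)
    rw [min_eq_left h1, min_eq_left h2]
    exact (min_le_left _ _).trans (h.triangle x y z)

/-- Two pseudo-distances `ρ` and `σ` which agree where `ρ < 2 δ`: the model is the distance of the
values of a map into a covering space and that of their projections. -/
structure IsLiftPair {X : Type*} [MeasurableSpace X] (δ : ℝ≥0∞) (ρ σ : X → X → ℝ≥0∞) : Prop where
  dist : IsPairDist ρ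
  measurable : Measurable fun p : X × X ↦ σ p.1 p.2
  le : ∀ x y, σ x y ≤ ρ x y
  eq : ∀ x y, ρ x y < 2 * δ → σ x y = ρ x y

/-- The pairs at distance at least `δ`. -/
def farSet {X : Type*} (ρ : X → X → ℝ≥0∞) (δ : ℝ≥0∞) : Set (X × X) := {p | δ ≤ ρ p.1 p.2}

/-- The pairs at distance at least `δ` and less than `2 δ`. -/
def midSet {X : Type*} (ρ : X → X → ℝ≥0∞) (δ : ℝ≥0∞) : Set (X × X) :=
  {p | δ ≤ ρ p.1 p.2 ∧ ρ p.1 p.2 < 2 * δ}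

section Pair

variable {X : Type*} [MeasurableSpace X] {ρ : X → X → ℝ≥0∞} (h : IsPairDist ρ)
include h

lemma IsPairDist.measurableSet_farSet (δ : ℝ≥0∞) : MeasurableSet (farSet ρ δ) :=
  measurableSet_le measurable_const h.measurable

lemma IsPairDist.measurableSet_midSet (δ : ℝ≥0∞) : MeasurableSet (midSet ρ δ) :=
  (measurableSet_le measurable_const h.measurable).inter
    (measurableSet_lt h.measurable measurable_const)

lemma IsPairDist.le_sum_range (z : ℕ → X) (k : ℕ) :
    ρ (z 0) (z k) ≤ ∑ i ∈ Finset.range k, ρ (z i) (z (i + 1)) := by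
  induction k with
  | zero => simp [h.self]
  | succ k ih =>
    rw [Finset.sum_range_succ]
    exact (h.triangle _ (z k) _).trans (by gcongr)

end Pair

/-- An allowance kδ on the whole chain is shared as δ on each link, so that only the links longer
than δ contribute. -/
lemma ENNReal.sub_mul_le_sum_sub {a δ : ℝ≥0∞} {k : ℕ} {b : ℕ → ℝ≥0∞}
    (h : a ≤ ∑ i ∈ Finset.range k, b i) :
    a - k * δ ≤ ∑ i ∈ Finset.range k, (b i - δ) := by
  rw [tsub_le_iff_right]
  have : (k : ℝ≥0∞) * δ = ∑ i ∈ Finset.range k, δ := by simp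
  rw [this, ← Finset.sum_add_distrib]
  exact h.trans (Finset.sum_le_sum fun i _ ↦ le_tsub_add)

section Chain

variable {E : Type*} [NormedAddCommGroup E] [NormedSpace ℝ E] [MeasurableSpace E] [BorelSpace E]
  [FiniteDimensional ℝ E] (μ : Measure E) [μ.IsAddHaarMeasure] {Ω : Set E} {ρ : E → E → ℝ≥0∞}

omit [MeasurableSpace E] [BorelSpace E] [FiniteDimensional ℝ E] in
lemma segMap_chain_le [MeasurableSpace E] (h : IsPairDist ρ) {k : ℕ} (hk : k ≠ 0) (p : E × E) :
    ρ p.1 p.2 ≤ ∑ i ∈ Finset.range k, ρ (segMap (i / k : ℝ) ((i + 1) / k : ℝ) p).1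
      (segMap (i / k : ℝ) ((i + 1) / k : ℝ) p).2 := by
  have := h.le_sum_range (fun i : ℕ ↦ p.1 + (i / k : ℝ) • (p.2 - p.1)) k
  have hk' : (k : ℝ) ≠ 0 := by exact_mod_cast hk
  simpa [segMap, div_self hk'] using this

lemma measurable_edist_pair : Measurable fun p : E × E ↦ edist p.1 p.2 := by
  have := FiniteDimensional.proper ℝ E
  have : SecondCountableTopology E := inferInstance
  fun_prop

/-- Halving: a pair at distance at least `δ` is at distance less than `2 δ`, or one of the two
halves of its segment joins a pair at distance at least `δ`. -/
lemma setLIntegral_farSet_le (hΩ : Convex ℝ Ω) (hm : MeasurableSet Ω) (h : IsPairDist ρ)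
    (δ : ℝ≥0∞) {W : ℝ≥0∞ → ℝ≥0∞} (hW : Measurable W) :
    ∫⁻ p in farSet ρ δ, W (edist p.1 p.2) ∂(kernelMeasure μ Ω 1)
      ≤ ∫⁻ p in midSet ρ δ, W (edist p.1 p.2) ∂(kernelMeasure μ Ω 1)
        + ∫⁻ p in farSet ρ δ, W (2 * edist p.1 p.2) ∂(kernelMeasure μ Ω 1) := by
  have hS := h.measurableSet_farSet δ
  have hD := h.measurableSet_midSet δ
  have hWm : Measurable fun p : E × E ↦ W (edist p.1 p.2) := hW.comp measurable_edist_pair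
  have hWm2 : Measurable fun p : E × E ↦ W (2 * edist p.1 p.2) :=
    hW.comp (measurable_edist_pair.const_mul 2)
  rw [← lintegral_indicator hS, ← lintegral_indicator hD, ← lintegral_indicator hS]
  set F : E × E → ℝ≥0∞ := (farSet ρ δ).indicator fun p ↦ W (2 * edist p.1 p.2) with hF
  have hFm : Measurable F := hWm2.indicator hS
  have hpt : ∀ p : E × E, (farSet ρ δ).indicator (fun p ↦ W (edist p.1 p.2)) p
      ≤ (midSet ρ δ).indicator (fun p ↦ W (edist p.1 p.2)) p
        + (F (segMap 0 (1 / 2) p) + F (segMap (1 / 2) 1 p)) := fun p ↦ by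
    by_cases hp : p ∈ farSet ρ δ
    swap
    · simp [hp]
    rw [Set.indicator_of_mem hp]
    by_cases hp2 : p ∈ midSet ρ δ
    · rw [Set.indicator_of_mem hp2]; exact le_self_add
    have hge : 2 * δ ≤ ρ p.1 p.2 := by
      by_contra hc
      exact hp2 ⟨hp, not_le.1 hc⟩
    have e1 : 2 * edist (segMap 0 (1 / 2) p).1 (segMap 0 (1 / 2) p).2 = edist p.1 p.2 := by
      rw [edist_segMap (by norm_num), ← mul_assoc]
      have : (2 : ℝ≥0∞) * ENNReal.ofReal (1 / 2 - 0) = 1 := by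
        rw [← ENNReal.ofReal_ofNat, ← ENNReal.ofReal_mul (by norm_num)]; norm_num
      rw [this, one_mul]
    have e2 : 2 * edist (segMap (1 / 2) 1 p).1 (segMap (1 / 2) 1 p).2 = edist p.1 p.2 := by
      rw [edist_segMap (by norm_num), ← mul_assoc]
      have : (2 : ℝ≥0∞) * ENNReal.ofReal (1 - 1 / 2) = 1 := by
        rw [← ENNReal.ofReal_ofNat, ← ENNReal.ofReal_mul (by norm_num)]; norm_num
      rw [this, one_mul]
    have htri : ρ p.1 p.2 ≤ ρ (segMap 0 (1 / 2) p).1 (segMap 0 (1 / 2) p).2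
        + ρ (segMap (1 / 2) 1 p).1 (segMap (1 / 2) 1 p).2 := by
      have := segMap_chain_le h (k := 2) (by norm_num) p
      norm_num [Finset.sum_range_succ] at this ⊢
      exact this
    -- A far pair that is not intermediate has ρ ≥ 2δ, so both halves cannot be shorter than δ.
    have hor : segMap 0 (1 / 2) p ∈ farSet ρ δ ∨ segMap (1 / 2) 1 p ∈ farSet ρ δ := by
      by_contra! hc
      have h1 : ρ (segMap 0 (1 / 2) p).1 (segMap 0 (1 / 2) p).2 < δ := not_le.1 hc.1
      have h2 : ρ (segMap (1 / 2) 1 p).1 (segMap (1 / 2) 1 p).2 < δ := not_le.1 hc.2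
      exact absurd (hge.trans htri) (not_le.2 (by rw [two_mul]; exact ENNReal.add_lt_add h1 h2))
    rcases hor with h1 | h1
    · rw [hF, Set.indicator_of_mem h1, e1]
      exact le_add_left le_self_add
    · rw [hF, Set.indicator_of_mem h1, e2]
      exact le_add_left le_add_self
  have hF0 : Measurable fun p ↦ F (segMap 0 (1 / 2) p) := hFm.comp (measurable_segMap _ _)
  refine (lintegral_mono hpt).trans ?_
  rw [lintegral_add_left (hWm.indicator hD), lintegral_add_left hF0]
  gcongr
  -- For q = 1 each half carries the factor 1/2: the two halves restore the far integral with
  -- coefficient exactly one.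
  refine (add_le_add
    (lintegral_segMap_kernelMeasure_le μ hΩ hm le_rfl (by norm_num) (by norm_num) 1 hFm)
    (lintegral_segMap_kernelMeasure_le μ hΩ hm (by norm_num) (by norm_num) le_rfl 1 hFm)).trans ?_
  rw [← add_mul, ← ENNReal.ofReal_add (by norm_num) (by norm_num)]
  norm_num

/-- Subdivision into `k` equal pieces. -/
lemma lintegral_sub_le_chain (hΩ : Convex ℝ Ω) (hm : MeasurableSet Ω) (h : IsPairDist ρ)
    (q : ℝ) (δ : ℝ≥0∞) {k : ℕ} (hk : k ≠ 0) :
    ∫⁻ p, (ρ p.1 p.2 - k * δ) ∂(kernelMeasure μ Ω q)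
      ≤ ENNReal.ofReal ((k : ℝ) ^ (1 - q)) * ∫⁻ p, (ρ p.1 p.2 - δ) ∂(kernelMeasure μ Ω q) := by
  have hk0 : (0 : ℝ) < k := by exact_mod_cast Nat.pos_of_ne_zero hk
  have hFm : Measurable fun p : E × E ↦ ρ p.1 p.2 - δ := h.measurable.sub_const δ
  refine (lintegral_mono fun p ↦ ENNReal.sub_mul_le_sum_sub (segMap_chain_le h hk p)).trans ?_
  have hFi : ∀ i ∈ Finset.range k, Measurable fun p : E × E ↦
      (ρ (segMap (i / k : ℝ) ((i + 1) / k : ℝ) p).1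
        (segMap (i / k : ℝ) ((i + 1) / k : ℝ) p).2 - δ) :=
    fun i _ ↦ hFm.comp (measurable_segMap _ _)
  rw [lintegral_finsetSum _ hFi]
  have hi : ∀ i ∈ Finset.range k, ∫⁻ p, (ρ (segMap (i / k : ℝ) ((i + 1) / k : ℝ) p).1
      (segMap (i / k : ℝ) ((i + 1) / k : ℝ) p).2 - δ) ∂(kernelMeasure μ Ω q)
      ≤ ENNReal.ofReal ((1 / k : ℝ) ^ q) * ∫⁻ p, (ρ p.1 p.2 - δ) ∂(kernelMeasure μ Ω q) := by
    intro i hi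
    have hik : (i : ℝ) + 1 ≤ k := by exact_mod_cast Finset.mem_range.1 hi
    have := lintegral_segMap_kernelMeasure_le μ hΩ hm (a := i / k) (b := (i + 1) / k)
      (by positivity) (by gcongr; linarith) ((div_le_one hk0).2 hik) q hFm
    have e : ((i : ℝ) + 1) / k - i / k = 1 / k := by ring
    rwa [e] at this
  refine (Finset.sum_le_sum hi).trans (le_of_eq ?_)
  rw [Finset.sum_const, Finset.card_range, nsmul_eq_mul, ← mul_assoc]
  congr 1
  rw [← ENNReal.ofReal_natCast, ← ENNReal.ofReal_mul (by positivity), Real.rpow_sub hk0,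
    Real.rpow_one, one_div, Real.inv_rpow hk0.le]
  rfl

end Chain


/-! ### Estimates of the far pairs by subdivision -/

/-- Monotone convergence: it removes the truncation at level n once a bound independent of n is
known. -/
lemma lintegral_mul_le_of_forall_min {X : Type*} [MeasurableSpace X] {ν : Measure X}
    {w f : X → ℝ≥0∞} (hw : Measurable w) (hf : Measurable f) {g : ℝ≥0∞ → ℝ≥0∞} (hg : Monotone g)
    (hgc : Continuous g) {C : ℝ≥0∞} (h : ∀ n : ℕ, ∫⁻ x, w x * g (min (f x) n) ∂ν ≤ C) :
    ∫⁻ x, w x * g (f x) ∂ν ≤ C := by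
  have hsup : ∀ x, w x * g (f x) = ⨆ n : ℕ, w x * g (min (f x) n) := fun x ↦ by
    rw [← ENNReal.mul_iSup]
    congr 1
    have h1 : ⨆ n : ℕ, min (f x) (n : ℝ≥0∞) = f x := by
      have := inf_iSup_eq (f x) (fun n : ℕ ↦ (n : ℝ≥0∞))
      rw [ENNReal.iSup_natCast, inf_top_eq] at this
      exact this.symm
    conv_lhs => rw [← h1]
    exact hg.map_ciSup_of_continuousAt hgc.continuousAt (OrderTop.bddAbove _)
  simp_rw [hsup]
  rw [lintegral_iSup]
  · exact iSup_le h
  · intro n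
    exact hw.mul (hgc.measurable.comp (hf.min measurable_const))
  · intro n k hnk x
    dsimp only
    gcongr
    exact hg (min_le_min_left _ (by exact_mod_cast hnk))

/-- The constant `1 / (1 - 2^{1-q})` produced by the halving argument. -/
def halvingConst (q : ℝ) : ℝ≥0∞ := ENNReal.ofReal (1 - (2 : ℝ) ^ (1 - q))⁻¹

lemma two_rpow_one_sub_lt_one {q : ℝ} (hq : 1 < q) : (2 : ℝ) ^ (1 - q) < 1 :=
  Real.rpow_lt_one_of_one_lt_of_neg (by norm_num) (by linarith)

lemma halvingConst_ne_zero {q : ℝ} (hq : 1 < q) : halvingConst q ≠ 0 := by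
  have := two_rpow_one_sub_lt_one hq
  simp [halvingConst, this]

lemma halvingConst_ne_top (q : ℝ) : halvingConst q ≠ ⊤ := ENNReal.ofReal_ne_top

section Far

variable {E : Type*} [NormedAddCommGroup E] [NormedSpace ℝ E] [MeasurableSpace E] [BorelSpace E]
  [FiniteDimensional ℝ E] (μ : Measure E) [μ.IsAddHaarMeasure] {Ω : Set E} {ρ : E → E → ℝ≥0∞}

lemma setLIntegral_kernelMeasure_eq {S : Set (E × E)} (hS : MeasurableSet S)
    (h0 : ∀ p ∈ S, p.1 ≠ p.2) (q : ℝ) :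
    kernelMeasure μ Ω q S = ∫⁻ p in S, edist p.1 p.2 ^ (1 - q) ∂(kernelMeasure μ Ω 1) := by
  rw [← lintegral_indicator hS, ← lintegral_indicator_one hS, lintegral_kernelMeasure,
    lintegral_kernelMeasure]
  rotate_left
  · exact (measurable_edist_pair.pow_const _).indicator hS
  · exact measurable_one.indicator hS
  refine lintegral_congr fun p ↦ ?_
  by_cases hp : p ∈ S
  swap
  · simp [hp]
  have he : edist p.1 p.2 ≠ 0 := by simpa using h0 p hp
  have ht : edist p.1 p.2 ≠ ⊤ := edist_ne_top _ _
  rw [Set.indicator_of_mem hp, Set.indicator_of_mem hp, Pi.one_apply, one_div, ← ENNReal.rpow_neg,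
    div_eq_mul_inv, ← ENNReal.rpow_neg, ← ENNReal.rpow_add _ _ he ht]
  congr 1; ring

lemma IsPairDist.ne_of_mem_farSet (h : IsPairDist ρ) {δ : ℝ≥0∞} (hδ : δ ≠ 0) {p : E × E}
    (hp : p ∈ farSet ρ δ) : p.1 ≠ p.2 := by
  intro heq
  have : δ ≤ ρ p.1 p.2 := hp
  rw [heq, h.self] at this
  exact hδ (le_antisymm this bot_le)

/-- Among the far pairs at mutual distance of a given order, the proportion is controlled by the
pairs at intermediate distance. -/
lemma kernelMeasure_farSet_annulus_le (hΩ : Convex ℝ Ω) (hm : MeasurableSet Ω) (h : IsPairDist ρ)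
    {δ : ℝ≥0∞} (hfin : kernelMeasure μ Ω 1 (farSet ρ δ) ≠ ⊤) (r : ℝ≥0∞) :
    kernelMeasure μ Ω 1 (farSet ρ δ ∩ {p | r < 2 * edist p.1 p.2 ∧ edist p.1 p.2 ≤ r})
      ≤ kernelMeasure μ Ω 1 (midSet ρ δ) := by
  have hS := h.measurableSet_farSet δ
  have hD := h.measurableSet_midSet δ
  have hA : MeasurableSet {p : E × E | edist p.1 p.2 ≤ r} :=
    measurableSet_le measurable_edist_pair measurable_const
  have hB : MeasurableSet {p : E × E | 2 * edist p.1 p.2 ≤ r} :=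
    measurableSet_le (measurable_edist_pair.const_mul 2) measurable_const
  -- With W the indicator of [0, r], the two far integrals in the halving inequality differ exactly
  -- by the annulus r/2 < |x-y| ≤ r; finiteness allows the subtraction.
  have key := setLIntegral_farSet_le μ hΩ hm h δ (W := (Set.Iic r).indicator 1)
    (measurable_one.indicator measurableSet_Iic)
  have e1 : ∀ s : Set (E × E), ∫⁻ p in s, (Set.Iic r).indicator 1 (edist p.1 p.2)
      ∂(kernelMeasure μ Ω 1) = kernelMeasure μ Ω 1 ({p | edist p.1 p.2 ≤ r} ∩ s) := fun s ↦ by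
    rw [← Measure.restrict_apply hA, ← lintegral_indicator_one hA]
    rfl
  have e2 : ∀ s : Set (E × E), ∫⁻ p in s, (Set.Iic r).indicator 1 (2 * edist p.1 p.2)
      ∂(kernelMeasure μ Ω 1) = kernelMeasure μ Ω 1 ({p | 2 * edist p.1 p.2 ≤ r} ∩ s) := fun s ↦ by
    rw [← Measure.restrict_apply hB, ← lintegral_indicator_one hB]
    rfl
  rw [e1, e1, e2] at key
  have hsub : {p : E × E | 2 * edist p.1 p.2 ≤ r} ∩ farSet ρ δ
      ⊆ {p | edist p.1 p.2 ≤ r} ∩ farSet ρ δ := fun p hp ↦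
    by
    have h1 : 2 * edist p.1 p.2 ≤ r := hp.1
    have h2 : edist p.1 p.2 ≤ 2 * edist p.1 p.2 := by rw [two_mul]; exact le_self_add
    exact ⟨h2.trans h1, hp.2⟩
  have hft : kernelMeasure μ Ω 1 ({p | 2 * edist p.1 p.2 ≤ r} ∩ farSet ρ δ) ≠ ⊤ :=
    ne_top_of_le_ne_top hfin (measure_mono Set.inter_subset_right)
  have hdiff : farSet ρ δ ∩ {p | r < 2 * edist p.1 p.2 ∧ edist p.1 p.2 ≤ r}
      = ({p | edist p.1 p.2 ≤ r} ∩ farSet ρ δ) \ ({p | 2 * edist p.1 p.2 ≤ r} ∩ farSet ρ δ) := by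
    ext p
    simp only [Set.mem_inter_iff, Set.mem_sdiff, Set.mem_ofPred_eq, not_and]
    grind
  rw [hdiff, measure_sdiff hsub (hB.inter hS).nullMeasurableSet hft, tsub_le_iff_right]
  exact key.trans (by gcongr; exact Set.inter_subset_right)

/-- For `q > 1` the far pairs are controlled by the pairs at intermediate distance. -/
lemma kernelMeasure_farSet_le (hΩ : Convex ℝ Ω) (hm : MeasurableSet Ω) (h : IsPairDist ρ)
    {δ : ℝ≥0∞} (hδ : δ ≠ 0) (hfin : kernelMeasure μ Ω 1 (farSet ρ δ) ≠ ⊤) {q : ℝ} (hq : 1 < q) :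
    kernelMeasure μ Ω q (farSet ρ δ) ≤ halvingConst q * kernelMeasure μ Ω q (midSet ρ δ) := by
  have hS := h.measurableSet_farSet δ
  have hD := h.measurableSet_midSet δ
  have hSne : ∀ p ∈ farSet ρ δ, p.1 ≠ p.2 := fun p hp ↦ h.ne_of_mem_farSet hδ hp
  have hwm : Measurable fun p : E × E ↦ edist p.1 p.2 ^ (1 - q) :=
    measurable_edist_pair.pow_const _
  set θ : ℝ := 2 ^ (1 - q) with hθ
  have hθ1 : θ < 1 := two_rpow_one_sub_lt_one hq
  have hθ0 : 0 < θ := by positivity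
  set Sn : ℕ → Set (E × E) := fun n ↦ farSet ρ δ ∩ {p | edist p.1 p.2 ^ (1 - q) ≤ n} with hSn
  have hSnm : ∀ n, MeasurableSet {p : E × E | edist p.1 p.2 ^ (1 - q) ≤ (n : ℝ≥0∞)} := fun n ↦
    measurableSet_le hwm measurable_const
  have hmono : Monotone Sn := fun n k hnk p hp ↦
by
    have h1 : edist p.1 p.2 ^ (1 - q) ≤ (n : ℝ≥0∞) := hp.2
    exact ⟨hp.1, h1.trans (by exact_mod_cast hnk)⟩
  have hU : ⋃ n, Sn n = farSet ρ δ := by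
    refine Set.Subset.antisymm (Set.iUnion_subset fun n ↦ Set.inter_subset_left) fun p hp ↦ ?_
    have hne : edist p.1 p.2 ^ (1 - q) ≠ ⊤ := by
      have : edist p.1 p.2 ≠ 0 := by simpa using hSne p hp
      simp [ENNReal.rpow_eq_top_iff, this, edist_ne_top]
    obtain ⟨n, hn⟩ := ENNReal.exists_nat_gt hne
    exact Set.mem_iUnion.2 ⟨n, hp, hn.le⟩
  rw [← hU, hmono.measure_iUnion]
  refine iSup_le fun n ↦ ?_
  -- The weight t^{1-q} turns ν_1 into ν_q. It is truncated at n so that the far integral of W(2t)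
  -- is finite and can be cancelled.
  set W : ℝ≥0∞ → ℝ≥0∞ := fun t ↦ min (t ^ (1 - q)) n with hW
  have hWm : Measurable W := (measurable_id.pow_const _).min measurable_const
  have key := setLIntegral_farSet_le μ hΩ hm h δ hWm
  set I2 := ∫⁻ p in farSet ρ δ, W (2 * edist p.1 p.2) ∂(kernelMeasure μ Ω 1)
  have hI2 : I2 ≠ ⊤ := by
    refine ne_top_of_le_ne_top (ENNReal.mul_ne_top (ENNReal.natCast_ne_top n) hfin) ?_
    rw [← setLIntegral_const]
    exact lintegral_mono fun p ↦ min_le_right _ _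
  have hDle : ∫⁻ p in midSet ρ δ, W (edist p.1 p.2) ∂(kernelMeasure μ Ω 1)
      ≤ kernelMeasure μ Ω q (midSet ρ δ) := by
    rw [setLIntegral_kernelMeasure_eq μ hD (fun p hp ↦ hSne p hp.1)]
    exact lintegral_mono fun p ↦ min_le_left _ _
  have hWm2 : Measurable fun p : E × E ↦ W (2 * edist p.1 p.2) :=
    hWm.comp (measurable_edist_pair.const_mul 2)
  -- Pointwise, W(t) ≥ W(2t) + (1-θ) t^{1-q} where t^{1-q} ≤ n, since (2t)^{1-q} = θ t^{1-q};
  -- elsewhere W(t) = n ≥ W(2t).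
  have hlow : I2 + ENNReal.ofReal (1 - θ) * kernelMeasure μ Ω q (Sn n)
      ≤ ∫⁻ p in farSet ρ δ, W (edist p.1 p.2) ∂(kernelMeasure μ Ω 1) := by
    rw [setLIntegral_kernelMeasure_eq μ (hS.inter (hSnm n)) (fun p hp ↦ hSne p hp.1),
      Set.inter_comm, ← setLIntegral_indicator (hSnm n), ← lintegral_const_mul _
        (hwm.indicator (hSnm n)), ← lintegral_add_left hWm2]
    refine lintegral_mono fun p ↦ ?_
    have h2 : (2 * edist p.1 p.2) ^ (1 - q)
        = ENNReal.ofReal θ * edist p.1 p.2 ^ (1 - q) := by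
      rw [ENNReal.mul_rpow_of_ne_top (by simp) (edist_ne_top _ _), hθ,
        ← ENNReal.ofReal_rpow_of_pos (by norm_num), ENNReal.ofReal_ofNat]
    simp only [hW]
    by_cases hp : edist p.1 p.2 ^ (1 - q) ≤ n
    · rw [Set.indicator_of_mem (show p ∈ {p : E × E | edist p.1 p.2 ^ (1 - q) ≤ (n : ℝ≥0∞)} from hp),
        min_eq_left hp, h2]
      refine (add_le_add_left (min_le_left _ _) _).trans ?_
      rw [← add_mul, ← ENNReal.ofReal_add hθ0.le (by linarith)]
      simp
    · rw [Set.indicator_of_notMem (show p ∉ {p : E × E | edist p.1 p.2 ^ (1 - q) ≤ (n : ℝ≥0∞)} from hp),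
        min_eq_right (not_le.1 hp).le]
      simp
  have hfinal : ENNReal.ofReal (1 - θ) * kernelMeasure μ Ω q (Sn n)
      ≤ kernelMeasure μ Ω q (midSet ρ δ) := by
    have := hlow.trans (key.trans (add_le_add_left hDle _))
    rw [add_comm] at this
    exact (ENNReal.add_le_add_iff_right hI2).1 this
  rw [halvingConst, ← hθ, ENNReal.ofReal_inv_of_pos (by linarith), mul_comm, ← div_eq_mul_inv,
    ENNReal.le_div_iff_mul_le (by simp [hθ1]) (by simp), mul_comm]
  exact hfinal

/-- The first moment of the excess is controlled by the measure of the far pairs. -/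
lemma lintegral_sub_kernelMeasure_le (hΩ : Convex ℝ Ω) (hm : MeasurableSet Ω) (h : IsPairDist ρ)
    {δ : ℝ≥0∞} (hδ : δ ≠ 0) {q : ℝ} (hq : 1 < q) :
    ∫⁻ p, (ρ p.1 p.2 - δ) ∂(kernelMeasure μ Ω q)
      ≤ halvingConst q * (δ * kernelMeasure μ Ω q (farSet ρ δ)) := by
  have hS := h.measurableSet_farSet δ
  by_cases hfin : kernelMeasure μ Ω q (farSet ρ δ) = ⊤
  · rw [hfin, ENNReal.mul_top hδ, ENNReal.mul_top (halvingConst_ne_zero hq)]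
    exact le_top
  have := lintegral_mul_le_of_forall_min (ν := kernelMeasure μ Ω q) (w := 1) measurable_one
    h.measurable (g := fun t ↦ t - δ) (fun a b hab ↦ tsub_le_tsub_right hab _)
    (ENNReal.continuous_sub_right δ) (C := halvingConst q * (δ * kernelMeasure μ Ω q (farSet ρ δ)))
  simp only [Pi.one_apply, one_mul] at this
  refine this fun n ↦ ?_
  have hmin := h.min (n : ℝ≥0∞)
  have hle : ∀ p : E × E, (min (ρ p.1 p.2) n - δ) ≤ (farSet ρ δ).indicator (fun _ ↦ (n : ℝ≥0∞)) p :=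
    fun p ↦ by
    by_cases hp : p ∈ farSet ρ δ
    · rw [Set.indicator_of_mem hp]
      exact tsub_le_self.trans (min_le_right _ _)
    · have : ρ p.1 p.2 < δ := not_le.1 hp
      rw [tsub_eq_zero_of_le ((min_le_left _ _).trans this.le)]
      exact bot_le
  -- For the truncated distance a, the excess over δ is at most the excess over 2δ plus δ on the far
  -- set, and halving bounds the integral of the former by 2^{1-q} < 1 times that of the excess over
  -- δ.
  refine ENNReal.le_mul_of_le_mul_add (by positivity) (two_rpow_one_sub_lt_one hq) ?_ ?_
  · refine ne_top_of_le_ne_top (ENNReal.mul_ne_top (ENNReal.natCast_ne_top n) hfin) ?_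
    rw [← lintegral_indicator_const hS]
    exact lintegral_mono hle
  have hch := lintegral_sub_le_chain μ hΩ hm hmin q δ (k := 2) (by norm_num)
  refine le_trans ?_ (add_le_add_left hch _)
  rw [← lintegral_indicator_const hS, ← lintegral_add_left (hmin.measurable.sub_const _)]
  refine lintegral_mono fun p ↦ ?_
  by_cases hp : p ∈ farSet ρ δ
  · rw [Set.indicator_of_mem hp, tsub_le_iff_right, add_assoc, ← two_mul, Nat.cast_ofNat]
    exact le_tsub_add
  · exact (hle p).trans (by simp [hp])

/-- Tail estimate. -/
lemma kernelMeasure_farSet_nat_mul_le (hΩ : Convex ℝ Ω) (hm : MeasurableSet Ω) (h : IsPairDist ρ)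
    {δ : ℝ≥0∞} (hδ : δ ≠ 0) (hδt : δ ≠ ⊤) {q : ℝ} (hq : 1 < q) {k : ℕ} (hk : k ≠ 0) :
    kernelMeasure μ Ω q (farSet ρ (2 * (k * δ)))
      ≤ (k : ℝ≥0∞) ^ (-q) * halvingConst q * kernelMeasure μ Ω q (farSet ρ δ) := by
  have hk0 : (0 : ℝ) < k := by exact_mod_cast Nat.pos_of_ne_zero hk
  have hkδ : (k : ℝ≥0∞) * δ ≠ 0 := mul_ne_zero (by exact_mod_cast hk) hδ
  have hkδt : (k : ℝ≥0∞) * δ ≠ ⊤ := ENNReal.mul_ne_top (by simp) hδt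
  have hk0' : (k : ℝ≥0∞) ≠ 0 := by exact_mod_cast hk
  have h1 := (lintegral_sub_le_chain μ hΩ hm h q δ hk).trans
    (mul_le_mul_right (lintegral_sub_kernelMeasure_le μ hΩ hm h hδ hq) _)
  -- Markov's inequality for the excess over kδ, at level kδ. The chain gives k^{1-q}, and the
  -- division by the level kδ gives the other factor 1/k.
  have h2 := mul_meas_ge_le_lintegral (μ := kernelMeasure μ Ω q)
    (h.measurable.sub_const (k * δ)) (k * δ)
  have hsub : farSet ρ (2 * (k * δ)) ⊆ {p : E × E | k * δ ≤ ρ p.1 p.2 - k * δ} := fun p hp ↦ by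
    have hp' : 2 * (k * δ) ≤ ρ p.1 p.2 := hp
    exact ENNReal.le_sub_of_add_le_right hkδt (by rwa [← two_mul])
  have h3 := ((mul_le_mul_right (measure_mono hsub) _).trans h2).trans h1
  have e : ENNReal.ofReal ((k : ℝ) ^ (1 - q)) = (k : ℝ≥0∞) * (k : ℝ≥0∞) ^ (-q) := by
    rw [← ENNReal.ofReal_rpow_of_pos hk0, ENNReal.ofReal_natCast, sub_eq_add_neg,
      ENNReal.rpow_add _ _ hk0' (by simp), ENNReal.rpow_one]
  rw [e] at h3
  refine (ENNReal.mul_le_mul_iff_right hkδ hkδt).1 (h3.trans (le_of_eq ?_))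
  ring

end Far


/-! ### Tails at dyadic levels, and moments below a level -/

section Dyadic

variable {E : Type*} [NormedAddCommGroup E] [NormedSpace ℝ E] [MeasurableSpace E] [BorelSpace E]
  [FiniteDimensional ℝ E] (μ : Measure E) [μ.IsAddHaarMeasure] {Ω : Set E} {ρ : E → E → ℝ≥0∞}

/-- Constant of the tail estimate along powers of two. -/
def tailConst (q : ℝ) : ℝ≥0∞ := 2 ^ q * halvingConst q + 1

lemma tailConst_ne_top (q : ℝ) : tailConst q ≠ ⊤ := by
  simp [tailConst, ENNReal.mul_eq_top, halvingConst_ne_top]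

lemma kernelMeasure_farSet_two_pow_le (hΩ : Convex ℝ Ω) (hm : MeasurableSet Ω) (h : IsPairDist ρ)
    {δ : ℝ≥0∞} (hδ : δ ≠ 0) (hδt : δ ≠ ⊤) {q : ℝ} (hq : 1 < q) (n : ℕ) :
    kernelMeasure μ Ω q (farSet ρ (2 ^ n * δ))
      ≤ tailConst q * (2 : ℝ≥0∞) ^ (-(q * n)) * kernelMeasure μ Ω q (farSet ρ δ) := by
  -- The tail estimate with k = 2^n concerns the level 2^{n+1}δ; the shift costs the factor 2^q in
  -- `tailConst`, and its summand 1 covers the level δ itself.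
  rcases n with _ | n
  · simp only [pow_zero, one_mul, CharP.cast_eq_zero, mul_zero, neg_zero, ENNReal.rpow_zero, mul_one]
    exact le_mul_of_one_le_left bot_le le_add_self
  have := kernelMeasure_farSet_nat_mul_le μ hΩ hm h hδ hδt hq (k := 2 ^ n) (by positivity)
  have e : (2 : ℝ≥0∞) ^ (n + 1) * δ = 2 * (((2 ^ n : ℕ) : ℝ≥0∞) * δ) := by push_cast; ring
  rw [e]
  refine this.trans (mul_le_mul' ?_ le_rfl)
  have e2 : (((2 ^ n : ℕ) : ℝ≥0∞)) ^ (-q) = 2 ^ q * (2 : ℝ≥0∞) ^ (-(q * (n + 1 : ℕ))) := by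
    rw [← ENNReal.rpow_add _ _ (by simp) (by simp)]
    push_cast
    rw [← ENNReal.rpow_natCast, ← ENNReal.rpow_mul]
    congr 1; ring
  rw [e2, tailConst, add_mul]
  refine le_trans (le_of_eq ?_) le_self_add
  ring

/-- Constant of the estimate of the `p`-moment at intermediate distances. -/
def dyadicConst (p q : ℝ) : ℝ≥0∞ := 2 ^ p * tailConst q * ENNReal.ofReal ((2 : ℝ) ^ (p - q) - 1)⁻¹

lemma dyadicConst_ne_top (p q : ℝ) : dyadicConst p q ≠ ⊤ := by
  simp [dyadicConst, ENNReal.mul_eq_top, tailConst_ne_top]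

/-- The layer between 2^n δ and 2^{n+1} δ contributes at most a constant times (2^n δ)^p 2^{-qn} by
the tail estimate. As p > q, these layers form a growing geometric sequence, whose sum is comparable
to its last term. -/
lemma setLIntegral_rpow_dyadic_le (hΩ : Convex ℝ Ω) (hm : MeasurableSet Ω) (h : IsPairDist ρ)
    {δ : ℝ≥0∞} (hδ : δ ≠ 0) (hδt : δ ≠ ⊤) {p q : ℝ} (hq : 1 < q) (hqp : q < p) (n : ℕ) :
    ∫⁻ z in {z | δ ≤ ρ z.1 z.2 ∧ ρ z.1 z.2 < 2 ^ n * δ}, ρ z.1 z.2 ^ p ∂(kernelMeasure μ Ω q)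
      ≤ dyadicConst p q * δ ^ p * (2 : ℝ≥0∞) ^ ((p - q) * n)
        * kernelMeasure μ Ω q (farSet ρ δ) := by
  have hp0 : 0 < p := by linarith
  set B := dyadicConst p q * δ ^ p * kernelMeasure μ Ω q (farSet ρ δ) with hB
  suffices H : ∫⁻ z in {z | δ ≤ ρ z.1 z.2 ∧ ρ z.1 z.2 < 2 ^ n * δ}, ρ z.1 z.2 ^ p
      ∂(kernelMeasure μ Ω q) ≤ B * (2 : ℝ≥0∞) ^ ((p - q) * n) by
    refine H.trans (le_of_eq ?_); rw [hB]; ring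
  induction n with
  | zero =>
    have : {z : E × E | δ ≤ ρ z.1 z.2 ∧ ρ z.1 z.2 < 2 ^ 0 * δ} = ∅ := by
      ext z; simp
    rw [this]; simp
  | succ n ih =>
    have hsub : {z : E × E | δ ≤ ρ z.1 z.2 ∧ ρ z.1 z.2 < 2 ^ (n + 1) * δ}
        ⊆ {z | δ ≤ ρ z.1 z.2 ∧ ρ z.1 z.2 < 2 ^ n * δ}
          ∪ {z | 2 ^ n * δ ≤ ρ z.1 z.2 ∧ ρ z.1 z.2 < 2 ^ (n + 1) * δ} := fun z hz ↦ by
      have hz1 : δ ≤ ρ z.1 z.2 ∧ ρ z.1 z.2 < 2 ^ (n + 1) * δ := hz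
      rcases lt_or_ge (ρ z.1 z.2) (2 ^ n * δ) with h1 | h1
      · exact Or.inl ⟨hz1.1, h1⟩
      · exact Or.inr ⟨h1, hz1.2⟩
    have hlast : ∫⁻ z in {z | 2 ^ n * δ ≤ ρ z.1 z.2 ∧ ρ z.1 z.2 < 2 ^ (n + 1) * δ}, ρ z.1 z.2 ^ p
        ∂(kernelMeasure μ Ω q)
        ≤ 2 ^ p * tailConst q * δ ^ p * kernelMeasure μ Ω q (farSet ρ δ)
          * (2 : ℝ≥0∞) ^ ((p - q) * n) := by
      calc _ ≤ ∫⁻ _ in {z : E × E | 2 ^ n * δ ≤ ρ z.1 z.2 ∧ ρ z.1 z.2 < 2 ^ (n + 1) * δ},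
            (2 ^ (n + 1) * δ) ^ p ∂(kernelMeasure μ Ω q) := by
            refine setLIntegral_mono measurable_const fun z hz ↦ ?_
            exact ENNReal.rpow_le_rpow hz.2.le hp0.le
        _ = (2 ^ (n + 1) * δ) ^ p * kernelMeasure μ Ω q
            {z : E × E | 2 ^ n * δ ≤ ρ z.1 z.2 ∧ ρ z.1 z.2 < 2 ^ (n + 1) * δ} :=
            setLIntegral_const _ _
        _ ≤ (2 ^ (n + 1) * δ) ^ p * (tailConst q * (2 : ℝ≥0∞) ^ (-(q * n)) *
            kernelMeasure μ Ω q (farSet ρ δ)) := by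
            gcongr
            refine le_trans (measure_mono fun z hz ↦ ?_)
              (kernelMeasure_farSet_two_pow_le μ hΩ hm h hδ hδt hq n)
            exact hz.1
        _ = _ := by
            have e2 : (2 : ℝ≥0∞) ^ ((p - q) * n)
                = (2 : ℝ≥0∞) ^ (p * n) * (2 : ℝ≥0∞) ^ (-(q * n)) := by
              rw [← ENNReal.rpow_add _ _ (by simp) (by simp)]
              congr 1; ring
            have e3 : ((2 : ℝ≥0∞) ^ (n + 1)) ^ p = 2 ^ p * (2 : ℝ≥0∞) ^ (p * n) := by
              rw [← ENNReal.rpow_natCast, ← ENNReal.rpow_mul,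
                ← ENNReal.rpow_add _ _ (by simp) (by simp)]
              congr 1; push_cast; ring
            rw [ENNReal.mul_rpow_of_nonneg _ _ hp0.le, e2, e3]
            ring
    refine (lintegral_mono_set hsub).trans ((lintegral_union_le _ _ _).trans
      ((add_le_add ih hlast).trans (le_of_eq ?_)))
    have hr1 : (1 : ℝ) < 2 ^ (p - q) := Real.one_lt_rpow (by norm_num) (by linarith)
    have hone : ENNReal.ofReal ((2 : ℝ) ^ (p - q) - 1)⁻¹ * ENNReal.ofReal ((2 : ℝ) ^ (p - q) - 1)
        = 1 := by
      rw [← ENNReal.ofReal_mul (inv_nonneg.2 (by linarith)), inv_mul_cancel₀ (by linarith)]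
      simp
    -- With r = 2^{p-q}, the factor 1/(r-1) in `dyadicConst` makes the induction close exactly: B +
    -- B(r-1) = Br.
    have hBc : 2 ^ p * tailConst q * δ ^ p * kernelMeasure μ Ω q (farSet ρ δ)
        = B * ENNReal.ofReal ((2 : ℝ) ^ (p - q) - 1) := by
      rw [hB, dyadicConst]
      calc _ = 2 ^ p * tailConst q * δ ^ p * kernelMeasure μ Ω q (farSet ρ δ) * 1 := by ring
        _ = _ := by rw [← hone]; ring
    have e4 : (2 : ℝ≥0∞) ^ ((p - q) * (n + 1 : ℕ))
        = (1 + ENNReal.ofReal ((2 : ℝ) ^ (p - q) - 1)) * (2 : ℝ≥0∞) ^ ((p - q) * n) := by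
      have : 1 + ENNReal.ofReal ((2 : ℝ) ^ (p - q) - 1) = 2 ^ (p - q) := by
        rw [← ENNReal.ofReal_one, ← ENNReal.ofReal_add (by norm_num) (by linarith),
          add_sub_cancel, ← ENNReal.ofReal_rpow_of_pos (by norm_num), ENNReal.ofReal_ofNat]
      rw [this, ← ENNReal.rpow_add _ _ (by simp) (by simp)]
      congr 1; push_cast; ring
    rw [hBc, e4]
    ring

end Dyadic

/-! ### Absorption of large distances in dimension at least two -/

section Absorb

open Module

variable {E : Type*} [NormedAddCommGroup E] [NormedSpace ℝ E] [MeasurableSpace E] [BorelSpace E]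
  [FiniteDimensional ℝ E] (μ : Measure E) [μ.IsAddHaarMeasure] {Ω : Set E} {ρ : E → E → ℝ≥0∞}

/-- Ratio of the homothetic copy of `Ω` near `y` used for averaging. -/
def avgRatio (R : ℝ) (x y : E) : ℝ := dist x y / (2 * R)

/-- Point of the homothetic copy of `Ω` near `y`. -/
def avgPoint (R : ℝ) (x y η : E) : E := y + avgRatio R x y • (η - y)

lemma avgRatio_nonneg {R : ℝ} (hR : 0 < R) (x y : E) : 0 ≤ avgRatio R x y := by
  unfold avgRatio; positivity

lemma avgRatio_le {R : ℝ} (hR : 0 < R) {x y : E} (h : dist x y ≤ R) : avgRatio R x y ≤ 1 := by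
  rw [avgRatio, div_le_one (by positivity)]
  linarith

lemma dist_avgPoint_le {R : ℝ} (hR : 0 < R) {x y η : E} (h : dist η y ≤ R) :
    dist (avgPoint R x y η) y ≤ dist x y / 2 := by
  rw [avgPoint, dist_eq_norm, add_sub_cancel_left, norm_smul, Real.norm_of_nonneg
    (avgRatio_nonneg hR x y), ← dist_eq_norm, avgRatio]
  calc dist x y / (2 * R) * dist η y ≤ dist x y / (2 * R) * R := by gcongr
    _ = dist x y / 2 := by field_simp

lemma measurable_avgPoint (R : ℝ) :
    Measurable fun z : (E × E) × E ↦ avgPoint R z.1.1 z.1.2 z.2 := by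
  have := FiniteDimensional.proper ℝ E
  have : SecondCountableTopology E := inferInstance
  unfold avgPoint avgRatio
  fun_prop

lemma measurable_avgPoint_right (R : ℝ) (x y : E) : Measurable (avgPoint R x y) := by
  have := FiniteDimensional.proper ℝ E
  have : SecondCountableTopology E := inferInstance
  unfold avgPoint
  fun_prop

/-- Constant of the averaging lemma. -/
def avgConst (R q : ℝ) : ℝ≥0∞ :=
  ENNReal.ofReal ((2 * R) ^ finrank ℝ E) * 2 ^ (2 * (finrank ℝ E : ℝ) + q) * μ (Metric.ball 0 1)

lemma avgConst_ne_top (R q : ℝ) : avgConst μ R q ≠ ⊤ := by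
  have := FiniteDimensional.proper ℝ E
  unfold avgConst
  refine ENNReal.mul_ne_top (ENNReal.mul_ne_top (by simp) ?_) measure_ball_lt_top.ne
  simp [ENNReal.rpow_eq_top_iff]

/-- Spreading y over the copy of Ω of size comparable to |x-y| around y does not change the kernel
by more than a constant. The substitution ζ = `avgPoint` gives the density (2R/|x-y|)^d on |ζ-y| ≤
|x-y|/2. After exchanging the integrals, for fixed x and ζ such y lie in the ball of centre ζ and
radius |x-ζ| and satisfy |x-ζ| ≤ 2|x-y|, so the integral over y is at most a constant times
|x-ζ|^{-(d+q)}. -/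
lemma lintegral_avgPoint_le [Nontrivial E] (hΩ : Convex ℝ Ω) (hm : MeasurableSet Ω) {R : ℝ}
    (hR : 0 < R)
    (hdiam : ∀ x ∈ Ω, ∀ y ∈ Ω, dist x y ≤ R) {q : ℝ} (hq : 0 < q) {Φ : E × E → ℝ≥0∞}
    (hΦ : Measurable Φ) (hΦ0 : ∀ x, Φ (x, x) = 0) :
    ∫⁻ z, (∫⁻ η in Ω, Φ (z.1, avgPoint R z.1 z.2 η) ∂μ) ∂(kernelMeasure μ Ω q)
      ≤ avgConst μ R q * ∫⁻ z, Φ z ∂(kernelMeasure μ Ω q) := by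
  have := FiniteDimensional.proper ℝ E
  have : SecondCountableTopology E := inferInstance
  set d : ℝ := ((finrank ℝ E : ℕ) : ℝ) with hd
  set c : ℝ≥0∞ := ENNReal.ofReal ((2 * R) ^ finrank ℝ E) with hc
  have hin : Measurable fun z : E × E ↦ ∫⁻ η in Ω, Φ (z.1, avgPoint R z.1 z.2 η) ∂μ := by
    refine Measurable.lintegral_prod_right' (f := fun w : (E × E) × E ↦
      Φ (w.1.1, avgPoint R w.1.1 w.1.2 w.2)) ?_
    exact hΦ.comp ((measurable_fst.comp measurable_fst).prodMk (measurable_avgPoint R))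
  rw [lintegral_kernelMeasure μ Ω q hin, lintegral_kernelMeasure μ Ω q hΦ]
  have hpow : ∀ e : ℝ≥0∞, e ≠ 0 → e ≠ ⊤ → e ^ d * (e ^ (2 * d + q))⁻¹ = (e ^ (d + q))⁻¹ := by
    intro e h0 ht
    rw [← ENNReal.rpow_neg, ← ENNReal.rpow_neg, ← ENNReal.rpow_add _ _ h0 ht]
    congr 1; ring
  set N : E → Set (E × E) := fun x ↦ {w | dist w.2 w.1 ≤ dist x w.1 / 2} with hN
  have hNm : MeasurableSet {w : E × E × E | dist w.2.2 w.2.1 ≤ dist w.1 w.2.1 / 2} :=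
    measurableSet_le (by fun_prop) (by fun_prop)
  have hNx : ∀ x, MeasurableSet (N x) := fun x ↦ measurableSet_le (by fun_prop) (by fun_prop)
  set k : E → E × E → ℝ≥0∞ := fun x w ↦
    (N x).indicator (fun w ↦ c * (edist x w.1 ^ (2 * d + q))⁻¹) w with hk
  have hkx : ∀ x, Measurable (k x) := fun x ↦
    Measurable.indicator (by fun_prop) (hNx x)
  have hfin : Measurable fun z : E × E ↦ (∫⁻ η in Ω, Φ (z.1, avgPoint R z.1 z.2 η) ∂μ)
      / edist z.1 z.2 ^ (d + q) := by
    simp only [div_eq_mul_inv]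
    exact hin.mul (measurable_kernel _)
  rw [lintegral_prod _ hfin.aemeasurable, lintegral_prod _ (by
    simp only [div_eq_mul_inv]
    exact (hΦ.mul (measurable_kernel _)).aemeasurable),
    ← lintegral_const_mul' _ _ (avgConst_ne_top μ R q)]
  refine setLIntegral_mono' hm fun x hx ↦ ?_
  -- for fixed `x` and `y`
  have h1 : ∀ y ∈ Ω, (∫⁻ η in Ω, Φ (x, avgPoint R x y η) ∂μ) / edist x y ^ (d + q)
      ≤ ∫⁻ ζ in Ω, k x (y, ζ) * Φ (x, ζ) ∂μ := by
    intro y hy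
    rcases eq_or_ne x y with rfl | hxy
    · simp [avgPoint, avgRatio, hΦ0]
    have hxy0 : 0 < dist x y := dist_pos.2 hxy
    have ht0 : 0 < avgRatio R x y := by unfold avgRatio; positivity
    have hh := lintegral_homothety_le μ hΩ hm hy ht0 (avgRatio_le hR (hdiam x hx y hy))
      (fun ζ ↦ k x (y, ζ) * Φ (x, ζ))
    refine le_trans (le_of_eq ?_) hh
    have hev : ∀ η ∈ Ω, k x (y, avgPoint R x y η) * Φ (x, avgPoint R x y η)
        = c * (edist x y ^ (2 * d + q))⁻¹ * Φ (x, avgPoint R x y η) := fun η hη ↦ by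
      have : (y, avgPoint R x y η) ∈ N x := dist_avgPoint_le hR (hdiam η hη y hy)
      simp only [hk]
      rw [Set.indicator_of_mem this]
    have hev' : ∫⁻ η in Ω, k x (y, y + avgRatio R x y • (η - y)) *
        Φ (x, y + avgRatio R x y • (η - y)) ∂μ
        = c * (edist x y ^ (2 * d + q))⁻¹ * ∫⁻ η in Ω, Φ (x, avgPoint R x y η) ∂μ := by
      have hmη : Measurable fun η ↦ Φ (x, avgPoint R x y η) := hΦ.comp (measurable_const.prodMk
        (measurable_avgPoint_right R x y))
      rw [← lintegral_const_mul _ hmη]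
      exact setLIntegral_congr_fun hm hev
    have hct : ENNReal.ofReal (avgRatio R x y ^ finrank ℝ E) * c = edist x y ^ d := by
      rw [hc, ← ENNReal.ofReal_mul (by positivity), ← mul_pow, avgRatio,
        div_mul_cancel₀ _ (by positivity), edist_dist, hd, ENNReal.rpow_natCast,
        ENNReal.ofReal_pow dist_nonneg]
    rw [hev', ← mul_assoc, ← mul_assoc, hct, hpow _ (by simpa using hxy) (edist_ne_top _ _),
      div_eq_mul_inv, mul_comm]
  refine (setLIntegral_mono' hm h1).trans ?_
  have hkΦ : Measurable fun w : E × E ↦ k x w * Φ (x, w.2) :=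
    (hkx x).mul (hΦ.comp (measurable_const.prodMk measurable_snd))
  rw [lintegral_lintegral_swap hkΦ.aemeasurable, ← lintegral_const_mul' _ _ (avgConst_ne_top μ R q)]
  refine lintegral_mono fun ζ ↦ ?_
  have hkζ : Measurable fun y ↦ k x (y, ζ) := (hkx x).comp (measurable_id.prodMk measurable_const)
  rw [lintegral_mul_const _ hkζ]
  rcases eq_or_ne x ζ with rfl | hxζ
  · simp [hΦ0]
  have h2 : ∫⁻ y in Ω, k x (y, ζ) ∂μ ≤ avgConst μ R q * (edist x ζ ^ (d + q))⁻¹ := by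
    set κ : ℝ := 2 * d + q with hκ
    have hκ0 : 0 ≤ κ := by positivity
    have hpt : ∀ y, k x (y, ζ) ≤ (Metric.closedBall ζ (dist x ζ)).indicator
        (fun _ ↦ c * (2 ^ κ * (edist x ζ ^ κ)⁻¹)) y := fun y ↦ by
      by_cases hy : (y, ζ) ∈ N x
      swap
      · simp only [hk]
        rw [Set.indicator_of_notMem hy]
        exact bot_le
      have hy1 : dist ζ y ≤ dist x y / 2 := hy
      have t1 := dist_triangle x ζ y
      have t2 := dist_triangle x y ζ
      rw [dist_comm y ζ] at t2
      have hmem : y ∈ Metric.closedBall ζ (dist x ζ) := by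
        rw [Metric.mem_closedBall, dist_comm]; linarith
      simp only [hk]
      rw [Set.indicator_of_mem hy, Set.indicator_of_mem hmem]
      have hle : edist x ζ ≤ 2 * edist x y := by
        rw [edist_dist, edist_dist, ← ENNReal.ofReal_ofNat, ← ENNReal.ofReal_mul (by norm_num)]
        exact ENNReal.ofReal_le_ofReal (by linarith [dist_nonneg (x := x) (y := y)])
      gcongr
      rw [← ENNReal.inv_le_inv, inv_inv, ENNReal.mul_inv (by simp) (by simp), inv_inv,
        mul_comm, ← div_eq_mul_inv]
      refine ENNReal.div_le_of_le_mul ?_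
      rw [← ENNReal.mul_rpow_of_nonneg _ _ hκ0, mul_comm]
      exact ENNReal.rpow_le_rpow hle hκ0
    calc ∫⁻ y in Ω, k x (y, ζ) ∂μ
        ≤ ∫⁻ y, (Metric.closedBall ζ (dist x ζ)).indicator
          (fun _ ↦ c * (2 ^ κ * (edist x ζ ^ κ)⁻¹)) y ∂μ :=
          (lintegral_mono hpt).trans (setLIntegral_le_lintegral _ _)
      _ = c * (2 ^ κ * (edist x ζ ^ κ)⁻¹) * (edist x ζ ^ d * μ (Metric.ball 0 1)) := by
          rw [lintegral_indicator_const Metric.isClosed_closedBall.measurableSet,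
            Measure.addHaar_closedBall _ _ dist_nonneg, edist_dist, hd, ENNReal.rpow_natCast,
            ENNReal.ofReal_pow dist_nonneg]
      _ = c * 2 ^ κ * μ (Metric.ball 0 1) * (edist x ζ ^ d * (edist x ζ ^ κ)⁻¹) := by ring
      _ = _ := by rw [hpow _ (by simpa using hxζ) (edist_ne_top _ _), avgConst]
  calc _ ≤ avgConst μ R q * (edist x ζ ^ (d + q))⁻¹ * Φ (x, ζ) := by gcongr
    _ = _ := by rw [div_eq_mul_inv]; ring

lemma lintegral_kernelMeasure_swap (Ω : Set E) (q : ℝ) {F : E × E → ℝ≥0∞} (hF : Measurable F) :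
    ∫⁻ z, F z.swap ∂(kernelMeasure μ Ω q) = ∫⁻ z, F z ∂(kernelMeasure μ Ω q) := by
  have := FiniteDimensional.proper ℝ E
  have : SecondCountableTopology E := inferInstance
  rw [lintegral_kernelMeasure μ Ω q (F := fun z ↦ F z.swap) (hF.comp measurable_swap),
    lintegral_kernelMeasure μ Ω q hF]
  rw [← lintegral_prod_swap]
  simp only [Prod.swap_swap, Prod.fst_swap, Prod.snd_swap, edist_comm]

/-- Most pairs of points taken near `x` and near `y` are at distance less than `T`, when the
measure of the far pairs is small. -/
lemma measure_bad_pairs_le (hΩ : Convex ℝ Ω) (hm : MeasurableSet Ω) (h : IsPairDist ρ) {R : ℝ}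
    (hR : 0 < R) (hdiam : ∀ x ∈ Ω, ∀ y ∈ Ω, dist x y ≤ R) {lam : ℝ} (hl0 : 0 < lam)
    (hl1 : lam ≤ 1 / 4) (T : ℝ≥0∞) {x y : E} (hx : x ∈ Ω) (hy : y ∈ Ω) (hxy : x ≠ y) :
    ((μ.restrict Ω).prod (μ.restrict Ω)) {η | T ≤ ρ (x + lam • (avgPoint R x y η.1 - x))
        (y + lam • (avgPoint R y x η.2 - y))}
      ≤ ENNReal.ofReal ((4 * R / lam) ^ (2 * finrank ℝ E))
        * kernelMeasure μ Ω (finrank ℝ E) (farSet ρ T) := by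
  have := FiniteDimensional.proper ℝ E
  have : SecondCountableTopology E := inferInstance
  set d := finrank ℝ E with hd
  have hxy0 : 0 < dist x y := dist_pos.2 hxy
  have ht : avgRatio R y x = avgRatio R x y := by rw [avgRatio, avgRatio, dist_comm]
  set t := avgRatio R x y with htdef
  have ht0 : 0 < t := by rw [htdef, avgRatio]; positivity
  have ht1 : t ≤ 1 := avgRatio_le hR (hdiam x hx y hy)
  set V : Set (E × E) := farSet ρ T ∩ {w | dist w.1 w.2 ≤ 2 * dist x y} with hV
  have hVm : MeasurableSet V := (h.measurableSet_farSet T).inter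
    (measurableSet_le (by fun_prop) measurable_const)
  set f : E × E → ℝ≥0∞ := V.indicator 1 with hf
  have hfm : Measurable f := measurable_one.indicator hVm
  set Z : E → E := fun η ↦ x + lam • (avgPoint R x y η - x) with hZ
  set Y : E → E := fun η ↦ y + lam • (avgPoint R y x η - y) with hY
  have hZm : Measurable Z := by
    have : Measurable fun η ↦ avgPoint R x y η :=
      measurable_avgPoint_right R _ _
    fun_prop
  have hYm : Measurable Y := by
    have : Measurable fun η ↦ avgPoint R y x η :=
      measurable_avgPoint_right R _ _
    fun_prop
  have hlt : ENNReal.ofReal ((lam * t) ^ d)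
      = ENNReal.ofReal (lam ^ d) * ENNReal.ofReal (t ^ d) := by
    rw [mul_pow, ENNReal.ofReal_mul (by positivity)]
  have hZint : ∀ g : E → ℝ≥0∞, ENNReal.ofReal ((lam * t) ^ d) * ∫⁻ η in Ω, g (Z η) ∂μ
      ≤ ∫⁻ z in Ω, g z ∂μ := fun g ↦ by
    rw [hlt, mul_assoc]
    refine le_trans ?_ (lintegral_homothety_le μ hΩ hm hx hl0 (by linarith) g)
    gcongr
    exact lintegral_homothety_le μ hΩ hm hy ht0 ht1 fun ζ ↦ g (x + lam • (ζ - x))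
  have hYint : ∀ g : E → ℝ≥0∞, ENNReal.ofReal ((lam * t) ^ d) * ∫⁻ η in Ω, g (Y η) ∂μ
      ≤ ∫⁻ z in Ω, g z ∂μ := fun g ↦ by
    rw [hlt, mul_assoc]
    refine le_trans ?_ (lintegral_homothety_le μ hΩ hm hy hl0 (by linarith) g)
    gcongr
    have := lintegral_homothety_le μ hΩ hm hx ht0 ht1 fun ζ ↦ g (y + lam • (ζ - y))
    simpa only [hY, avgPoint, ht] using this
  -- closeness of the two points
  have hclose : ∀ η ∈ Ω, ∀ η' ∈ Ω, dist (Z η) (Y η') ≤ 2 * dist x y := by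
    intro η hη η' hη'
    have a1 := dist_avgPoint_le (x := x) hR (hdiam η hη y hy)
    have a2 := dist_avgPoint_le (x := y) hR (hdiam η' hη' x hx)
    have b1 : dist (Z η) x ≤ 1 / 4 * (3 / 2 * dist x y) := by
      simp only [hZ]
      rw [dist_eq_norm, add_sub_cancel_left, norm_smul, Real.norm_of_nonneg hl0.le, ← dist_eq_norm]
      have := dist_triangle (avgPoint R x y η) y x
      rw [dist_comm y x] at this
      gcongr; linarith
    have b2 : dist (Y η') y ≤ 1 / 4 * (3 / 2 * dist x y) := by
      simp only [hY]
      rw [dist_eq_norm, add_sub_cancel_left, norm_smul, Real.norm_of_nonneg hl0.le, ← dist_eq_norm]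
      have := dist_triangle (avgPoint R y x η') x y
      rw [dist_comm y x] at a2
      gcongr; linarith
    have c1 := dist_triangle (Z η) x (Y η')
    have c2 := dist_triangle x y (Y η')
    rw [dist_comm y (Y η')] at c2
    linarith
  have hB : MeasurableSet {η : E × E | T ≤ ρ (Z η.1) (Y η.2)} :=
    measurableSet_le measurable_const
      (h.measurable.comp ((hZm.comp measurable_fst).prodMk (hYm.comp measurable_snd)))
  have hfZY : Measurable fun η : E × E ↦ f (Z η.1, Y η.2) :=
    hfm.comp ((hZm.comp measurable_fst).prodMk (hYm.comp measurable_snd))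
  have hstep : ((μ.restrict Ω).prod (μ.restrict Ω)) {η : E × E | T ≤ ρ (Z η.1) (Y η.2)}
      ≤ ∫⁻ η in Ω, ∫⁻ η' in Ω, f (Z η, Y η') ∂μ ∂μ := by
    rw [← lintegral_indicator_one hB, lintegral_prod _ (measurable_one.indicator hB).aemeasurable]
    refine setLIntegral_mono' hm fun η hη ↦ setLIntegral_mono' hm fun η' hη' ↦ ?_
    by_cases hbad : T ≤ ρ (Z η) (Y η')
    · have : (Z η, Y η') ∈ V := ⟨hbad, hclose η hη η' hη'⟩
      simp [hf, this, Set.indicator]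
      split_ifs <;> simp
    · rw [Set.indicator_of_notMem (by simpa using hbad)]
      exact bot_le
  have hVK : ∫⁻ z in Ω, ∫⁻ w in Ω, f (z, w) ∂μ ∂μ
      ≤ ENNReal.ofReal ((2 * dist x y) ^ (2 * d)) * kernelMeasure μ Ω d (farSet ρ T) := by
    rw [← lintegral_prod _ hfm.aemeasurable, ← lintegral_indicator_one (h.measurableSet_farSet T),
      lintegral_kernelMeasure μ Ω d (measurable_one.indicator (h.measurableSet_farSet T)),
      ← lintegral_const_mul' _ _ ENNReal.ofReal_ne_top]
    refine lintegral_mono fun w ↦ ?_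
    by_cases hw : w ∈ V
    swap
    · simp [hf, hw]
    rw [hf, Set.indicator_of_mem hw, Set.indicator_of_mem hw.1]
    simp only [Pi.one_apply]
    rw [mul_one_div]
    have hle : edist w.1 w.2 ^ ((finrank ℝ E : ℝ) + (d : ℝ))
        ≤ ENNReal.ofReal ((2 * dist x y) ^ (2 * d)) := by
      rw [← hd, ← two_mul, show (2 * (d : ℝ)) = ((2 * d : ℕ) : ℝ) by push_cast; ring,
        ENNReal.rpow_natCast, edist_dist, ← ENNReal.ofReal_pow dist_nonneg]
      exact ENNReal.ofReal_le_ofReal (by gcongr; exact hw.2)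
    rw [ENNReal.le_div_iff_mul_le]
    · simpa using hle
    · right
      simp only [ne_eq, ENNReal.ofReal_eq_zero, not_le]; positivity
    · right; exact ENNReal.ofReal_ne_top
  have hmain : ENNReal.ofReal ((lam * t) ^ d) * ENNReal.ofReal ((lam * t) ^ d) *
      ((μ.restrict Ω).prod (μ.restrict Ω)) {η : E × E | T ≤ ρ (Z η.1) (Y η.2)}
      ≤ ENNReal.ofReal ((2 * dist x y) ^ (2 * d)) * kernelMeasure μ Ω d (farSet ρ T) := by
    refine le_trans ?_ hVK
    refine le_trans (mul_le_mul' le_rfl hstep) ?_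
    rw [mul_assoc, ← lintegral_const_mul' _ _ ENNReal.ofReal_ne_top]
    refine le_trans ?_ (hZint fun z ↦ ∫⁻ w in Ω, f (z, w) ∂μ)
    gcongr with η
    exact hYint fun w ↦ f (Z η, w)
  have hne : ENNReal.ofReal ((lam * t) ^ d) ≠ 0 := by
    simp only [ne_eq, ENNReal.ofReal_eq_zero, not_le]; positivity
  -- The factor (2|x-y|)^{2d}, from comparing the kernel of exponent 2d with 1, against the Jacobian
  -- (λt)^{2d} with t = |x-y|/(2R). The distance |x-y| cancels: this uses the scale invariant
  -- exponent.
  have hratio : ENNReal.ofReal ((2 * dist x y) ^ (2 * d))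
      = ENNReal.ofReal ((lam * t) ^ d) * ENNReal.ofReal ((lam * t) ^ d) *
        ENNReal.ofReal ((4 * R / lam) ^ (2 * d)) := by
    rw [← ENNReal.ofReal_mul (by positivity), ← ENNReal.ofReal_mul (by positivity)]
    congr 1
    rw [← pow_add, ← two_mul d, ← mul_pow]
    congr 1
    rw [htdef, avgRatio]
    field_simp
    ring
  rw [hratio, mul_assoc] at hmain
  exact (ENNReal.mul_le_mul_iff_right (mul_ne_zero hne hne)
    (ENNReal.mul_ne_top ENNReal.ofReal_ne_top ENNReal.ofReal_ne_top)).1 (by simpa [mul_assoc] using hmain)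

end Absorb


/-! ### Absorption of the excess over a level -/

section AbsorbMain

open Module

variable {E : Type*} [NormedAddCommGroup E] [NormedSpace ℝ E] [MeasurableSpace E] [BorelSpace E]
  [FiniteDimensional ℝ E] (μ : Measure E) [μ.IsAddHaarMeasure] {Ω : Set E} {ρ : E → E → ℝ≥0∞}

lemma ae_mem_kernelMeasure (hm : MeasurableSet Ω) (q : ℝ) :
    ∀ᵐ z ∂(kernelMeasure μ Ω q), z.1 ∈ Ω ∧ z.2 ∈ Ω := by
  have := FiniteDimensional.proper ℝ E
  have : SecondCountableTopology E := inferInstance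
  refine (withDensity_absolutelyContinuous _ _).ae_le ?_
  rw [Measure.prod_restrict]
  exact ae_restrict_mem (hm.prod hm)

/-- For at least half of the pairs (Z, Y), with Z near x and Y near y at scale λ|x-y|, one has
ρ(Z,Y) < T, hence a(x,y) - 3T ≤ (a(x,Z) - T) + (a(y,Y) - T). Averaging over the good pairs leaves
the excess over T between x and Z, which is λ times as far from x as an averaged point; this gives
the factor λ^q. Smallness is assumed for ρ, while the moments are those of a smaller distance a,
later a truncation of ρ. -/
lemma lintegral_excess_rpow_step [Nontrivial E] (hΩ : Convex ℝ Ω) (hm : MeasurableSet Ω)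
    (hμ : μ Ω ≠ ⊤) (h : IsPairDist ρ) {a : E → E → ℝ≥0∞} (ha : IsPairDist a)
    (haρ : ∀ x y, a x y ≤ ρ x y) {R : ℝ}
    (hR : 0 < R) (hdiam : ∀ x ∈ Ω, ∀ y ∈ Ω, dist x y ≤ R) {lam : ℝ} (hl0 : 0 < lam)
    (hl1 : lam ≤ 1 / 4) {p q : ℝ} (hp : 1 ≤ p) (hq : 0 < q) {T : ℝ≥0∞}
    (hsmall : ENNReal.ofReal ((4 * R / lam) ^ (2 * finrank ℝ E))
        * kernelMeasure μ Ω (finrank ℝ E) (farSet ρ T) ≤ μ Ω * μ Ω / 2) :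
    μ Ω * μ Ω / 2 * ∫⁻ z, (a z.1 z.2 - 3 * T) ^ p ∂(kernelMeasure μ Ω q)
      ≤ 2 ^ p * μ Ω * avgConst μ R q * ENNReal.ofReal (lam ^ q)
        * ∫⁻ z, (a z.1 z.2 - T) ^ p ∂(kernelMeasure μ Ω q) := by
  have := FiniteDimensional.proper ℝ E
  have : SecondCountableTopology E := inferInstance
  have hp0 : 0 < p := by linarith
  set P := (μ.restrict Ω).prod (μ.restrict Ω) with hP
  have : IsFiniteMeasure (μ.restrict Ω) := ⟨by simpa [lt_top_iff_ne_top] using hμ⟩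
  set G : E × E → ℝ≥0∞ := fun w ↦ (a w.1 w.2 - T) ^ p with hG
  have hGm : Measurable G := (ha.measurable.sub_const T).pow_const p
  set Φ : E × E → ℝ≥0∞ := fun z ↦ G (segMap 0 lam z) with hΦ
  have hΦm : Measurable Φ := hGm.comp (measurable_segMap _ _)
  have hΦ0 : ∀ x, Φ (x, x) = 0 := fun x ↦ by simp [hΦ, hG, segMap, ha.self, hp0]
  set A : E × E → ℝ≥0∞ := fun z ↦ ∫⁻ η in Ω, Φ (z.1, avgPoint R z.1 z.2 η) ∂μ with hA
  have hAm : Measurable A := by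
    refine Measurable.lintegral_prod_right' (f := fun w : (E × E) × E ↦
      Φ (w.1.1, avgPoint R w.1.1 w.1.2 w.2)) ?_
    exact hΦm.comp ((measurable_fst.comp measurable_fst).prodMk (measurable_avgPoint R))
  have h2t : (2 : ℝ≥0∞) ^ (p - 1) ≠ ⊤ := by simp [ENNReal.rpow_eq_top_iff]
  have hpt : ∀ z : E × E, z.1 ∈ Ω ∧ z.2 ∈ Ω → μ Ω * μ Ω / 2 * (a z.1 z.2 - 3 * T) ^ p
      ≤ 2 ^ (p - 1) * μ Ω * (A z + A z.swap) := by
    rintro ⟨x, y⟩ ⟨hx, hy⟩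
    dsimp only at hx hy
    rcases eq_or_ne x y with rfl | hxy
    · simp [ha.self, hp0]
    set Z : E → E := fun η ↦ x + lam • (avgPoint R x y η - x) with hZ
    set Y : E → E := fun η ↦ y + lam • (avgPoint R y x η - y) with hY
    have hZm : Measurable Z := by
      have : Measurable fun η ↦ avgPoint R x y η := measurable_avgPoint_right R _ _
      fun_prop
    have hYm : Measurable Y := by
      have : Measurable fun η ↦ avgPoint R y x η := measurable_avgPoint_right R _ _
      fun_prop
    set bad : Set (E × E) := {η | T ≤ ρ (Z η.1) (Y η.2)} with hbad
    have hbm : MeasurableSet bad := measurableSet_le measurable_const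
      (h.measurable.comp ((hZm.comp measurable_fst).prodMk (hYm.comp measurable_snd)))
    have hbadle : P bad ≤ μ Ω * μ Ω / 2 :=
      (measure_bad_pairs_le μ hΩ hm h hR hdiam hl0 hl1 T hx hy hxy).trans hsmall
    have hgood : μ Ω * μ Ω / 2 ≤ P badᶜ := by
      have h1 : P Set.univ = μ Ω * μ Ω := by
        rw [hP, ← Set.univ_prod_univ, Measure.prod_prod]; simp
      have h2 : μ Ω * μ Ω / 2 + μ Ω * μ Ω / 2 ≤ P badᶜ + μ Ω * μ Ω / 2 := by
        calc μ Ω * μ Ω / 2 + μ Ω * μ Ω / 2 = P bad + P badᶜ := by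
              rw [ENNReal.add_halves, ← h1, measure_add_measure_compl hbm]
          _ ≤ P badᶜ + μ Ω * μ Ω / 2 := by rw [add_comm]; gcongr
      refine (ENNReal.add_le_add_iff_right ?_).1 h2
      exact (ENNReal.div_lt_top (ENNReal.mul_ne_top hμ hμ) (by simp)).ne
    have hη : ∀ η ∈ badᶜ, (a x y - 3 * T) ^ p ≤ 2 ^ (p - 1) *
        (Φ (x, avgPoint R x y η.1) + Φ (y, avgPoint R y x η.2)) := by
      intro η hη
      have hlt : ρ (Z η.1) (Y η.2) < T := not_le.1 hη
      have htri : a x y - 3 * T ≤ (a x (Z η.1) - T) + (a y (Y η.2) - T) := by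
        rw [tsub_le_iff_right]
        have t1 : a x (Z η.1) ≤ (a x (Z η.1) - T) + T := le_tsub_add
        have t2 : a y (Y η.2) ≤ (a y (Y η.2) - T) + T := le_tsub_add
        calc a x y ≤ a x (Z η.1) + (a (Z η.1) (Y η.2) + a (Y η.2) y) :=
              (ha.triangle x (Z η.1) y).trans (by gcongr; exact ha.triangle _ _ _)
          _ ≤ ((a x (Z η.1) - T) + T) + (T + ((a y (Y η.2) - T) + T)) := by
              gcongr
              · exact (haρ _ _).trans hlt.le
              · rw [ha.comm]; exact t2
          _ = _ := by ring
      have hφ1 : Φ (x, avgPoint R x y η.1) = (a x (Z η.1) - T) ^ p := by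
        simp [hΦ, hG, segMap, hZ]
      have hφ2 : Φ (y, avgPoint R y x η.2) = (a y (Y η.2) - T) ^ p := by
        simp [hΦ, hG, segMap, hY]
      rw [hφ1, hφ2]
      exact (ENNReal.rpow_le_rpow htri hp0.le).trans (ENNReal.rpow_add_le_mul_rpow_add_rpow _ _ hp)
    have hm1 : Measurable fun η : E × E ↦ Φ (x, avgPoint R x y η.1) :=
      hΦm.comp (measurable_const.prodMk ((measurable_avgPoint_right R x y).comp measurable_fst))
    have hm2 : Measurable fun η : E × E ↦ Φ (y, avgPoint R y x η.2) :=
      hΦm.comp (measurable_const.prodMk ((measurable_avgPoint_right R y x).comp measurable_snd))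
    have hm1' : Measurable fun η ↦ Φ (x, avgPoint R x y η) :=
      hΦm.comp (measurable_const.prodMk (measurable_avgPoint_right R x y))
    have hm2' : Measurable fun η ↦ Φ (y, avgPoint R y x η) :=
      hΦm.comp (measurable_const.prodMk (measurable_avgPoint_right R y x))
    calc μ Ω * μ Ω / 2 * (a x y - 3 * T) ^ p
        ≤ P badᶜ * (a x y - 3 * T) ^ p := by gcongr
      _ = ∫⁻ _ in badᶜ, (a x y - 3 * T) ^ p ∂P := by rw [setLIntegral_const, mul_comm]
      _ ≤ ∫⁻ η in badᶜ, 2 ^ (p - 1) *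
        (Φ (x, avgPoint R x y η.1) + Φ (y, avgPoint R y x η.2)) ∂P :=
          setLIntegral_mono' hbm.compl hη
      _ ≤ ∫⁻ η, 2 ^ (p - 1) *
        (Φ (x, avgPoint R x y η.1) + Φ (y, avgPoint R y x η.2)) ∂P := setLIntegral_le_lintegral _ _
      _ = 2 ^ (p - 1) * (∫⁻ η, Φ (x, avgPoint R x y η.1) ∂P
          + ∫⁻ η, Φ (y, avgPoint R y x η.2) ∂P) := by
          rw [lintegral_const_mul' _ _ h2t, lintegral_add_left hm1]
      _ = 2 ^ (p - 1) * (μ Ω * A (x, y) + μ Ω * A (y, x)) := by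
          congr 2
          · rw [hP, lintegral_prod _ hm1.aemeasurable]
            simp only [lintegral_const, Measure.restrict_apply MeasurableSet.univ, Set.univ_inter]
            rw [lintegral_mul_const _ hm1', mul_comm]
          · rw [hP, lintegral_prod _ hm2.aemeasurable]
            simp only [lintegral_const, Measure.restrict_apply MeasurableSet.univ, Set.univ_inter]
            rw [mul_comm]
      _ = _ := by simp only [Prod.swap_prod_mk]; ring
  have hAle : ∫⁻ z, A z ∂(kernelMeasure μ Ω q) ≤ avgConst μ R q *
      (ENNReal.ofReal (lam ^ q) * ∫⁻ z, G z ∂(kernelMeasure μ Ω q)) := by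
    refine (lintegral_avgPoint_le μ hΩ hm hR hdiam hq hΦm hΦ0).trans ?_
    gcongr
    have := lintegral_segMap_kernelMeasure_le μ hΩ hm le_rfl hl0 (by linarith) q hGm
    rwa [sub_zero] at this
  rw [← lintegral_const_mul' _ _ (ENNReal.div_lt_top (ENNReal.mul_ne_top hμ hμ) (by simp)).ne]
  refine (lintegral_mono_ae ((ae_mem_kernelMeasure μ hm q).mono hpt)).trans ?_
  rw [lintegral_const_mul' _ _ (ENNReal.mul_ne_top h2t hμ), lintegral_add_left hAm,
    lintegral_kernelMeasure_swap μ Ω q hAm, ← two_mul]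
  calc _ ≤ 2 ^ (p - 1) * μ Ω * (2 * (avgConst μ R q *
      (ENNReal.ofReal (lam ^ q) * ∫⁻ z, G z ∂(kernelMeasure μ Ω q)))) := by gcongr
    _ = (2 ^ (p - 1) * 2) * μ Ω * avgConst μ R q * ENNReal.ofReal (lam ^ q)
        * ∫⁻ z, G z ∂(kernelMeasure μ Ω q) := by ring
    _ = _ := by
        congr 4
        nth_rw 2 [← ENNReal.rpow_one (2 : ℝ≥0∞)]
        rw [← ENNReal.rpow_add _ _ (by simp) (by simp)]
        congr 1; ring

/-- If the far pairs at level `T` have small measure for the scale invariant kernel, then the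
`p`-moment of the excess over `T` is controlled by the measure of the far pairs. -/
lemma exists_lintegral_excess_rpow_le [Nontrivial E] (hΩ : Convex ℝ Ω) (hm : MeasurableSet Ω)
    (hμ : μ Ω ≠ ⊤) (hμ0 : μ Ω ≠ 0) {R : ℝ} (hR : 0 < R)
    (hdiam : ∀ x ∈ Ω, ∀ y ∈ Ω, dist x y ≤ R) {p q : ℝ} (hp : 1 ≤ p) (hq : 0 < q) :
    ∃ ε : ℝ≥0∞, ε ≠ 0 ∧ ε ≠ ⊤ ∧ ∀ (ρ : E → E → ℝ≥0∞) (_ : IsPairDist ρ) (T : ℝ≥0∞), T ≠ 0 → T ≠ ⊤ →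
      kernelMeasure μ Ω (finrank ℝ E) (farSet ρ T) ≤ ε →
      ∫⁻ z, (ρ z.1 z.2 - T) ^ p ∂(kernelMeasure μ Ω q)
        ≤ 2 * (4 * T) ^ p * kernelMeasure μ Ω q (farSet ρ T) := by
  have hp0 : 0 < p := by linarith
  set H : ℝ≥0∞ := μ Ω * μ Ω / 2 with hH
  have hH0 : H ≠ 0 := by
    simp [hH, ENNReal.div_eq_zero_iff, hμ0]
  have hHt : H ≠ ⊤ := (ENNReal.div_lt_top (ENNReal.mul_ne_top hμ hμ) (by simp)).ne
  set C : ℝ≥0∞ := 2 ^ p * (2 ^ p * μ Ω * avgConst μ R q) / H with hC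
  have hCt : C ≠ ⊤ := by
    refine (ENNReal.div_lt_top ?_ hH0).ne
    refine ENNReal.mul_ne_top (by simp)
      (ENNReal.mul_ne_top (ENNReal.mul_ne_top (by simp) hμ) (avgConst_ne_top μ R q))
  -- choice of the ratio
  obtain ⟨lam, hl0, hl1, hlam⟩ : ∃ lam : ℝ, 0 < lam ∧ lam ≤ 1 / 4 ∧
      C * ENNReal.ofReal (lam ^ q) ≤ ENNReal.ofReal (1 / 2) := by
    set c : ℝ := C.toReal with hc
    have hc0 : 0 ≤ c := ENNReal.toReal_nonneg
    refine ⟨min (1 / 4) ((1 / (2 * (c + 1))) ^ q⁻¹), by positivity, min_le_left _ _, ?_⟩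
    rw [← ENNReal.ofReal_toReal hCt, ← ENNReal.ofReal_mul hc0]
    refine ENNReal.ofReal_le_ofReal ?_
    have h1 : (min (1 / 4) ((1 / (2 * (c + 1))) ^ q⁻¹)) ^ q ≤ 1 / (2 * (c + 1)) := by
      calc _ ≤ ((1 / (2 * (c + 1))) ^ q⁻¹) ^ q := by
            gcongr
            exact min_le_right _ _
        _ = _ := Real.rpow_inv_rpow (by positivity) hq.ne'
    calc c * _ ≤ c * (1 / (2 * (c + 1))) := by gcongr
      _ ≤ 1 / 2 := by
        rw [mul_one_div, div_le_div_iff₀ (by positivity) (by norm_num)]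
        linarith
  set B : ℝ≥0∞ := ENNReal.ofReal ((4 * R / lam) ^ (2 * finrank ℝ E)) with hB
  have hB0 : B ≠ 0 := by
    simp only [hB, ne_eq, ENNReal.ofReal_eq_zero, not_le]; positivity
  -- With this ε, the bad pairs around any x ≠ y have measure at most H, half of the total mass.
  refine ⟨H / B, ?_, (ENNReal.div_lt_top hHt hB0).ne, fun ρ h T hT0 hTt hsm ↦ ?_⟩
  · simp [ENNReal.div_eq_zero_iff, hH0, hB]
  have hsmall : B * kernelMeasure μ Ω (finrank ℝ E) (farSet ρ T) ≤ H := by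
    rw [mul_comm]
    exact (ENNReal.le_div_iff_mul_le (Or.inl hB0) (Or.inl ENNReal.ofReal_ne_top)).1 hsm
  have hS := h.measurableSet_farSet T
  by_cases hfin : kernelMeasure μ Ω q (farSet ρ T) = ⊤
  · rw [hfin, ENNReal.mul_top]
    · exact le_top
    · simp [hT0, ENNReal.rpow_eq_zero_iff, hTt, ENNReal.mul_eq_top]
  have := lintegral_mul_le_of_forall_min (ν := kernelMeasure μ Ω q) (w := 1) measurable_one
    h.measurable (g := fun t ↦ (t - T) ^ p)
    (fun a b hab ↦ ENNReal.rpow_le_rpow (tsub_le_tsub_right hab _) hp0.le)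
    ((ENNReal.continuous_rpow_const).comp (ENNReal.continuous_sub_right T))
    (C := 2 * (4 * T) ^ p * kernelMeasure μ Ω q (farSet ρ T))
  simp only [Pi.one_apply, one_mul] at this
  refine this fun n ↦ ?_
  have ha := h.min (n : ℝ≥0∞)
  have hstep := lintegral_excess_rpow_step μ hΩ hm hμ h ha (fun x y ↦ min_le_left _ _) hR hdiam
    hl0 hl1 hp hq hsmall
  have hGm : Measurable fun z : E × E ↦ (min (ρ z.1 z.2) (n : ℝ≥0∞) - T) ^ p :=
    (ha.measurable.sub_const T).pow_const p
  have hGm3 : Measurable fun z : E × E ↦ (min (ρ z.1 z.2) (n : ℝ≥0∞) - 3 * T) ^ p :=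
    (ha.measurable.sub_const _).pow_const p
  set G := ∫⁻ z, (min (ρ z.1 z.2) (n : ℝ≥0∞) - T) ^ p ∂(kernelMeasure μ Ω q) with hG
  set G3 := ∫⁻ z, (min (ρ z.1 z.2) (n : ℝ≥0∞) - 3 * T) ^ p ∂(kernelMeasure μ Ω q) with hG3
  have hGfin : G ≠ ⊤ := by
    refine ne_top_of_le_ne_top (ENNReal.mul_ne_top (a := (n : ℝ≥0∞) ^ p) (by simp [hp0.le]) hfin) ?_
    rw [← lintegral_indicator_const hS]
    refine lintegral_mono fun z ↦ ?_
    by_cases hz : z ∈ farSet ρ T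
    · rw [Set.indicator_of_mem hz]
      exact ENNReal.rpow_le_rpow (tsub_le_self.trans (min_le_right _ _)) hp0.le
    · have : ρ z.1 z.2 < T := not_le.1 hz
      rw [tsub_eq_zero_of_le ((min_le_left _ _).trans this.le), ENNReal.zero_rpow_of_pos hp0]
      exact bot_le
  -- If t ≥ 5T then t - 3T ≥ 2T, so t - T ≤ 2(t - 3T); if t < 5T the excess over T is at most 4T,
  -- and it vanishes off the far set.
  have hGG3 : G ≤ 2 ^ p * G3 + (4 * T) ^ p * kernelMeasure μ Ω q (farSet ρ T) := by
    rw [hG3, ← lintegral_const_mul _ hGm3, ← lintegral_indicator_const hS,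
      ← lintegral_add_left (hGm3.const_mul _)]
    refine lintegral_mono fun z ↦ ?_
    set t := min (ρ z.1 z.2) (n : ℝ≥0∞) with ht
    dsimp only
    rcases le_or_gt (5 * T) t with h5 | h5
    · refine le_trans ?_ le_self_add
      rw [← ENNReal.mul_rpow_of_nonneg _ _ hp0.le]
      refine ENNReal.rpow_le_rpow ?_ hp0.le
      rw [tsub_le_iff_right]
      have h3 : t - 3 * T + 3 * T = t := tsub_add_cancel_of_le (le_trans (by gcongr; norm_num) h5)
      have h2 : 2 * T ≤ t - 3 * T := by
        refine ENNReal.le_sub_of_add_le_right (ENNReal.mul_ne_top (by simp) hTt) ?_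
        calc 2 * T + 3 * T = 5 * T := by ring
          _ ≤ t := h5
      calc t = (t - 3 * T) + 2 * T + T := by
            conv_lhs => rw [← h3]
            ring
        _ ≤ (t - 3 * T) + (t - 3 * T) + T := by gcongr
        _ = _ := by ring
    · by_cases hz : z ∈ farSet ρ T
      · rw [Set.indicator_of_mem hz]
        refine le_trans ?_ le_add_self
        refine ENNReal.rpow_le_rpow ?_ hp0.le
        rw [tsub_le_iff_right]
        refine h5.le.trans (le_of_eq ?_)
        ring
      · have : ρ z.1 z.2 < T := not_le.1 hz
        rw [tsub_eq_zero_of_le ((min_le_left _ _).trans this.le), ENNReal.zero_rpow_of_pos hp0]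
        exact bot_le
  have hG3le : 2 ^ p * G3 ≤ ENNReal.ofReal (1 / 2) * G := by
    have h1 : G3 ≤ 2 ^ p * μ Ω * avgConst μ R q * ENNReal.ofReal (lam ^ q) * G / H := by
      rw [ENNReal.le_div_iff_mul_le (Or.inl hH0) (Or.inl hHt), mul_comm]
      exact hstep
    calc 2 ^ p * G3 ≤ 2 ^ p * (2 ^ p * μ Ω * avgConst μ R q * ENNReal.ofReal (lam ^ q) * G / H) := by
          gcongr
      _ = C * ENNReal.ofReal (lam ^ q) * G := by
          rw [hC]; simp only [div_eq_mul_inv]; ring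
      _ ≤ _ := by gcongr
  have := ENNReal.le_mul_of_le_mul_add (by norm_num) (by norm_num) hGfin
    (hGG3.trans (add_le_add_left hG3le _))
  refine this.trans (le_of_eq ?_)
  norm_num
  ring

end AbsorbMain


/-! ### The local lifting estimate -/

section Local

open Module

variable {E : Type*} [NormedAddCommGroup E] [NormedSpace ℝ E] [MeasurableSpace E] [BorelSpace E]
  [FiniteDimensional ℝ E] (μ : Measure E) [μ.IsAddHaarMeasure] {Ω : Set E} {ρ : E → E → ℝ≥0∞}

/-- At intermediate distance σ = ρ ≥ δ, so this is Markov's inequality. It is here that the energy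
of the projection enters. -/
lemma IsLiftPair.kernelMeasure_midSet_le {δ : ℝ≥0∞} {σ : E → E → ℝ≥0∞} (h : IsLiftPair δ ρ σ)
    (hδ : δ ≠ 0) (hδt : δ ≠ ⊤) {p : ℝ} (hp : 0 < p) (q : ℝ) :
    kernelMeasure μ Ω q (midSet ρ δ)
      ≤ (δ ^ p)⁻¹ * ∫⁻ z, σ z.1 z.2 ^ p ∂(kernelMeasure μ Ω q) := by
  have hD := h.dist.measurableSet_midSet δ
  have h0 : δ ^ p ≠ 0 := by simp [ENNReal.rpow_eq_zero_iff, hδ, hδt]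
  have ht : δ ^ p ≠ ⊤ := by simp [hp.le, hδt]
  have h1 : δ ^ p * kernelMeasure μ Ω q (midSet ρ δ)
      ≤ ∫⁻ z, σ z.1 z.2 ^ p ∂(kernelMeasure μ Ω q) := by
    rw [← setLIntegral_const]
    refine (setLIntegral_mono' hD fun z hz ↦ ?_).trans (setLIntegral_le_lintegral _ _)
    rw [h.eq _ _ hz.2]
    exact ENNReal.rpow_le_rpow hz.1 hp.le
  rw [mul_comm, ← div_eq_mul_inv, ENNReal.le_div_iff_mul_le (Or.inl h0) (Or.inl ht), mul_comm]
  exact h1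

lemma IsLiftPair.kernelMeasure_farSet_le (hΩ : Convex ℝ Ω) (hm : MeasurableSet Ω)
    {δ : ℝ≥0∞} {σ : E → E → ℝ≥0∞} (h : IsLiftPair δ ρ σ)
    (hδ : δ ≠ 0) (hδt : δ ≠ ⊤) (hfin : kernelMeasure μ Ω 1 (farSet ρ δ) ≠ ⊤)
    {p : ℝ} (hp : 0 < p) {q : ℝ} (hq : 1 < q) :
    kernelMeasure μ Ω q (farSet ρ δ)
      ≤ halvingConst q * (δ ^ p)⁻¹ * ∫⁻ z, σ z.1 z.2 ^ p ∂(kernelMeasure μ Ω q) := by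
  rw [mul_assoc]
  exact (_root_.kernelMeasure_farSet_le μ hΩ hm h.dist hδ hfin hq).trans
    (by gcongr; exact h.kernelMeasure_midSet_le μ hδ hδt hp q)

/-- Choice of the dyadic level: 2^{dn} is comparable to y from both sides, so smallness at level 2^n
and the power (p-q)/d of y come from the same n. -/
lemma ENNReal.exists_two_rpow_near {y : ℝ≥0∞} (hy : 1 ≤ y) (hyt : y ≠ ⊤) {d : ℝ} (hd : 0 < d) :
    ∃ n : ℕ, y ≤ (2 : ℝ≥0∞) ^ (d * n) ∧ (2 : ℝ≥0∞) ^ (d * n) ≤ 2 ^ d * y := by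
  have h1 : (1 : ℝ) ≤ y.toReal := by
    rw [← ENNReal.toReal_one]; exact ENNReal.toReal_mono hyt hy
  have h2 : (1 : ℝ) < 2 ^ d := Real.one_lt_rpow (by norm_num) hd
  obtain ⟨n, hn1, hn2⟩ := exists_nat_pow_near h1 h2
  have hcast : ∀ k : ℕ, (2 : ℝ≥0∞) ^ (d * k) = ENNReal.ofReal (((2 : ℝ) ^ d) ^ k) := fun k ↦ by
    rw [ENNReal.rpow_mul, ENNReal.rpow_natCast, ENNReal.ofReal_pow (by positivity),
      ← ENNReal.ofReal_rpow_of_pos (by norm_num), ENNReal.ofReal_ofNat]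
  refine ⟨n + 1, ?_, ?_⟩
  · rw [hcast, ← ENNReal.ofReal_toReal hyt]
    exact ENNReal.ofReal_le_ofReal hn2.le
  · have e : (2 : ℝ≥0∞) ^ (d * ((n + 1 : ℕ) : ℝ)) = 2 ^ d * (2 : ℝ≥0∞) ^ (d * n) := by
      rw [← ENNReal.rpow_add _ _ (by simp) (by simp)]
      congr 1; push_cast; ring
    rw [e, hcast]
    gcongr
    rw [← ENNReal.ofReal_toReal hyt]
    exact ENNReal.ofReal_le_ofReal hn1

/-- Reduction of the lifting estimate to a bound of the moment of the far pairs in terms of the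
measure of the far pairs. -/
lemma exists_lift_energy_le_of_moment (hΩ : Convex ℝ Ω) (hm : MeasurableSet Ω)
    {δ : ℝ≥0∞} (hδ : δ ≠ 0) (hδt : δ ≠ ⊤) {p q d : ℝ} (hq : 1 < q) (hqp : q < p) (hd : 0 < d)
    {C' B : ℝ≥0∞} (hC' : C' ≠ ⊤) (hB : B ≠ ⊤) (hB1 : 1 ≤ B)
    (H : ∀ (ρ σ : E → E → ℝ≥0∞), IsLiftPair δ ρ σ → kernelMeasure μ Ω 1 (farSet ρ δ) ≠ ⊤ →
      ∀ n : ℕ, B * (1 + ∫⁻ z, σ z.1 z.2 ^ p ∂(kernelMeasure μ Ω d)) ≤ (2 : ℝ≥0∞) ^ (d * n) →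
        ∫⁻ z in farSet ρ δ, ρ z.1 z.2 ^ p ∂(kernelMeasure μ Ω q)
          ≤ C' * (2 : ℝ≥0∞) ^ ((p - q) * n) * kernelMeasure μ Ω q (farSet ρ δ)) :
    ∃ C : ℝ≥0∞, C ≠ ⊤ ∧ ∀ (ρ σ : E → E → ℝ≥0∞), IsLiftPair δ ρ σ →
      kernelMeasure μ Ω 1 (farSet ρ δ) ≠ ⊤ →
      ∫⁻ z, ρ z.1 z.2 ^ p ∂(kernelMeasure μ Ω q)
        ≤ C * (1 + ∫⁻ z, σ z.1 z.2 ^ p ∂(kernelMeasure μ Ω d)) ^ ((p - q) / d)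
          * ∫⁻ z, σ z.1 z.2 ^ p ∂(kernelMeasure μ Ω q) := by
  have hp : 0 < p := by linarith
  have ha : 0 < (p - q) / d := div_pos (by linarith) hd
  have h0 : δ ^ p ≠ 0 := by simp [ENNReal.rpow_eq_zero_iff, hδ, hδt]
  set C0 : ℝ≥0∞ := halvingConst q * (δ ^ p)⁻¹ with hC0
  have hC0t : C0 ≠ ⊤ := ENNReal.mul_ne_top (halvingConst_ne_top q) (by simpa using h0)
  set b : ℝ≥0∞ := (2 ^ d * B) ^ ((p - q) / d) with hb
  have hbt : b ≠ ⊤ := by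
    refine ENNReal.rpow_ne_top_of_nonneg ha.le (ENNReal.mul_ne_top ?_ hB)
    exact ENNReal.rpow_ne_top_of_nonneg hd.le (by simp)
  refine ⟨1 + C' * b * C0, by simp [ENNReal.mul_eq_top, hC', hbt, hC0t], fun ρ σ h hfin ↦ ?_⟩
  have hS := h.dist.measurableSet_farSet δ
  set A := ∫⁻ z, σ z.1 z.2 ^ p ∂(kernelMeasure μ Ω q) with hA
  set 𝓔 := ∫⁻ z, σ z.1 z.2 ^ p ∂(kernelMeasure μ Ω d) with h𝓔
  have hKS : kernelMeasure μ Ω q (farSet ρ δ) ≤ C0 * A :=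
    h.kernelMeasure_farSet_le μ hΩ hm hδ hδt hfin hp hq
  have hnear : ∫⁻ z in (farSet ρ δ)ᶜ, ρ z.1 z.2 ^ p ∂(kernelMeasure μ Ω q) ≤ A := by
    refine (setLIntegral_mono' hS.compl fun z hz ↦ le_of_eq ?_).trans (setLIntegral_le_lintegral _ _)
    have h1 : ρ z.1 z.2 < δ := not_le.1 hz
    rw [h.eq _ _ (h1.trans_le (by rw [two_mul]; exact le_self_add))]
  rw [← lintegral_add_compl _ hS, add_comm]
  have hone : 1 ≤ (1 + 𝓔) ^ ((p - q) / d) := ENNReal.one_le_rpow le_self_add ha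
  -- If A = 0 the right-hand side vanishes even when 𝓔 is infinite, so the far set must be shown to
  -- be null. If A ≠ 0 and 𝓔 = ∞ the right-hand side is infinite.
  rcases eq_or_ne A 0 with hA0 | hA0
  · have hK0 : kernelMeasure μ Ω q (farSet ρ δ) = 0 := by
      rw [hA0, mul_zero] at hKS; exact le_antisymm hKS bot_le
    rw [setLIntegral_measure_zero _ _ hK0, add_zero]
    rw [hA0] at hnear ⊢
    simpa using hnear
  rcases eq_or_ne 𝓔 ⊤ with hE | hE
  · rw [hE, add_top, ENNReal.top_rpow_of_pos ha, ENNReal.mul_top (by simp), ENNReal.top_mul hA0]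
    exact le_top
  -- Now 2^{(p-q)n} is at most a constant times the power (p-q)/d of 1 + 𝓔.
  obtain ⟨n, hn1, hn2⟩ := ENNReal.exists_two_rpow_near (y := B * (1 + 𝓔)) (d := d)
    (one_le_mul hB1 le_self_add) (ENNReal.mul_ne_top hB (by simp [hE])) hd
  have hfar := H ρ σ h hfin n hn1
  have h2 : (2 : ℝ≥0∞) ^ ((p - q) * n) ≤ b * (1 + 𝓔) ^ ((p - q) / d) := by
    rw [hb, ← ENNReal.mul_rpow_of_nonneg _ _ ha.le, mul_assoc]
    refine le_trans (le_of_eq ?_) (ENNReal.rpow_le_rpow hn2 ha.le)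
    rw [← ENNReal.rpow_mul]
    congr 1; field_simp
  calc _ ≤ A + C' * (2 : ℝ≥0∞) ^ ((p - q) * n) * kernelMeasure μ Ω q (farSet ρ δ) :=
        add_le_add hnear hfar
    _ ≤ 1 * (1 + 𝓔) ^ ((p - q) / d) * A + C' * (b * (1 + 𝓔) ^ ((p - q) / d)) * (C0 * A) := by
        gcongr
        rw [one_mul]
        exact le_mul_of_one_le_left bot_le hone
    _ = _ := by ring

/-- The local lifting estimate in dimension at least two. -/
theorem exists_lift_energy_le_of_two_le (hd2 : 2 ≤ finrank ℝ E) (hΩ : Convex ℝ Ω)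
    (hm : MeasurableSet Ω)
    (hμ : μ Ω ≠ ⊤) (hμ0 : μ Ω ≠ 0) {R : ℝ} (hR : 0 < R)
    (hdiam : ∀ x ∈ Ω, ∀ y ∈ Ω, dist x y ≤ R)
    {δ : ℝ≥0∞} (hδ : δ ≠ 0) (hδt : δ ≠ ⊤) {p q : ℝ} (hq : 1 < q) (hqp : q < p) :
    ∃ C : ℝ≥0∞, C ≠ ⊤ ∧ ∀ (ρ σ : E → E → ℝ≥0∞), IsLiftPair δ ρ σ →
      kernelMeasure μ Ω 1 (farSet ρ δ) ≠ ⊤ →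
      ∫⁻ z, ρ z.1 z.2 ^ p ∂(kernelMeasure μ Ω q)
        ≤ C * (1 + ∫⁻ z, σ z.1 z.2 ^ p ∂(kernelMeasure μ Ω (finrank ℝ E))) ^
            ((p - q) / (finrank ℝ E : ℝ))
          * ∫⁻ z, σ z.1 z.2 ^ p ∂(kernelMeasure μ Ω q) := by
  have hp : 0 < p := by linarith
  have hnt : Nontrivial E := Module.nontrivial_of_finrank_pos (R := ℝ) (by omega)
  set d : ℝ := ((finrank ℝ E : ℕ) : ℝ) with hd
  have hd1 : 1 < d := by rw [hd]; exact_mod_cast hd2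
  have h0 : δ ^ p ≠ 0 := by simp [ENNReal.rpow_eq_zero_iff, hδ, hδt]
  obtain ⟨ε, hε0, hεt, hε⟩ := exists_lintegral_excess_rpow_le μ hΩ hm hμ hμ0 hR hdiam
    (p := p) (q := q) (by linarith) (by linarith)
  -- B is such that 2^{dn} ≥ B(1 + 𝓔) forces the ν_d-measure of {ρ ≥ 2^n δ} below ε. The tail
  -- estimate is applied with exponent d, hence the need for d > 1.
  set B : ℝ≥0∞ := 1 + tailConst d * (halvingConst d * (δ ^ p)⁻¹) / ε with hB
  have hBt : B ≠ ⊤ := by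
    refine ENNReal.add_ne_top.2 ⟨by simp, (ENNReal.div_lt_top ?_ hε0).ne⟩
    exact ENNReal.mul_ne_top (tailConst_ne_top d)
      (ENNReal.mul_ne_top (halvingConst_ne_top d) (by simpa using h0))
  set C' : ℝ≥0∞ := dyadicConst p q * δ ^ p * 2 ^ (p - q) + 2 ^ p * 2 * (4 ^ p * δ ^ p) * tailConst q
    with hC'
  have hδpt : δ ^ p ≠ ⊤ := by simp [hp.le, hδt]
  have hC't : C' ≠ ⊤ := by
    refine ENNReal.add_ne_top.2 ⟨?_, ?_⟩
    · exact ENNReal.mul_ne_top (ENNReal.mul_ne_top (dyadicConst_ne_top p q) hδpt)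
        (ENNReal.rpow_ne_top_of_nonneg (by linarith) (by simp))
    · exact ENNReal.mul_ne_top (ENNReal.mul_ne_top (ENNReal.mul_ne_top (by simp) (by simp))
        (ENNReal.mul_ne_top (ENNReal.rpow_ne_top_of_nonneg hp.le (by simp)) hδpt))
        (tailConst_ne_top q)
  refine exists_lift_energy_le_of_moment μ hΩ hm hδ hδt hq hqp (by linarith) hC't hBt le_self_add
    fun ρ σ h hfin n hn ↦ ?_
  have hS := h.dist.measurableSet_farSet δ
  set T : ℝ≥0∞ := 2 ^ n * δ with hT
  have hT0 : T ≠ 0 := mul_ne_zero (by simp) hδ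
  have hTt : T ≠ ⊤ := ENNReal.mul_ne_top (by simp) hδt
  have hsmall : kernelMeasure μ Ω d (farSet ρ T) ≤ ε := by
    refine (kernelMeasure_farSet_two_pow_le μ hΩ hm h.dist hδ hδt hd1 n).trans ?_
    have h1 := h.kernelMeasure_farSet_le μ hΩ hm hδ hδt hfin hp hd1
    set 𝓔 := ∫⁻ z, σ z.1 z.2 ^ p ∂(kernelMeasure μ Ω d) with h𝓔
    set c := tailConst d * (halvingConst d * (δ ^ p)⁻¹) with hc
    have h2 : c / ε * (1 + 𝓔) ≤ (2 : ℝ≥0∞) ^ (d * n) := le_trans (by gcongr; exact le_add_self) hn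
    have h3 : c * 𝓔 ≤ (2 : ℝ≥0∞) ^ (d * n) * ε := by
      calc c * 𝓔 = c / ε * ε * 𝓔 := by rw [ENNReal.div_mul_cancel hε0 hεt]
        _ = c / ε * 𝓔 * ε := by ring
        _ ≤ c / ε * (1 + 𝓔) * ε := by gcongr; exact le_add_self
        _ ≤ _ := by gcongr
    calc tailConst d * (2 : ℝ≥0∞) ^ (-(d * n)) * kernelMeasure μ Ω d (farSet ρ δ)
        ≤ tailConst d * (2 : ℝ≥0∞) ^ (-(d * n)) * (halvingConst d * (δ ^ p)⁻¹ * 𝓔) := by gcongr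
      _ = (2 : ℝ≥0∞) ^ (-(d * n)) * (c * 𝓔) := by rw [hc]; ring
      _ ≤ (2 : ℝ≥0∞) ^ (-(d * n)) * ((2 : ℝ≥0∞) ^ (d * n) * ε) := by gcongr
      _ = ε := by
        rw [← mul_assoc, ← ENNReal.rpow_add _ _ (by simp) (by simp)]
        simp
  have hexc := hε ρ h.dist T hT0 hTt hsmall
  have htail := kernelMeasure_farSet_two_pow_le μ hΩ hm h.dist hδ hδt hq n
  have hmid := setLIntegral_rpow_dyadic_le μ hΩ hm h.dist hδ hδt hq hqp (n + 1)
  -- Above 2T the distance is at most twice its excess over T; below 2T the dyadic moment estimate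
  -- is used.
  have hfar : ∫⁻ z in farSet ρ (2 * T), ρ z.1 z.2 ^ p ∂(kernelMeasure μ Ω q)
      ≤ 2 ^ p * ∫⁻ z, (ρ z.1 z.2 - T) ^ p ∂(kernelMeasure μ Ω q) := by
    rw [← lintegral_const_mul' _ _ (ENNReal.rpow_ne_top_of_nonneg hp.le (by simp))]
    refine (setLIntegral_mono' (h.dist.measurableSet_farSet _) fun z hz ↦ ?_).trans
      (setLIntegral_le_lintegral _ _)
    rw [← ENNReal.mul_rpow_of_nonneg _ _ hp.le]
    refine ENNReal.rpow_le_rpow ?_ hp.le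
    have hz' : 2 * T ≤ ρ z.1 z.2 := hz
    have h1 : T ≤ ρ z.1 z.2 - T := ENNReal.le_sub_of_add_le_right hTt (by rwa [← two_mul])
    calc ρ z.1 z.2 ≤ (ρ z.1 z.2 - T) + T := le_tsub_add
      _ ≤ (ρ z.1 z.2 - T) + (ρ z.1 z.2 - T) := by gcongr
      _ = _ := by rw [two_mul]
  have hsub : farSet ρ δ ⊆ {z : E × E | δ ≤ ρ z.1 z.2 ∧ ρ z.1 z.2 < 2 ^ (n + 1) * δ}
      ∪ farSet ρ (2 * T) := fun z hz ↦ by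
    rcases lt_or_ge (ρ z.1 z.2) (2 * T) with h1 | h1
    · exact Or.inl ⟨hz, by rw [pow_succ']; rwa [mul_assoc]⟩
    · exact Or.inr h1
  have e1 : (2 : ℝ≥0∞) ^ ((p - q) * ((n + 1 : ℕ) : ℝ))
      = 2 ^ (p - q) * (2 : ℝ≥0∞) ^ ((p - q) * n) := by
    rw [← ENNReal.rpow_add _ _ (by simp) (by simp)]
    congr 1; push_cast; ring
  have e2 : (4 * T) ^ p * (2 : ℝ≥0∞) ^ (-(q * n))
      = 4 ^ p * δ ^ p * (2 : ℝ≥0∞) ^ ((p - q) * n) := by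
    have : (2 : ℝ≥0∞) ^ ((p - q) * n) = (2 : ℝ≥0∞) ^ (p * n) * (2 : ℝ≥0∞) ^ (-(q * n)) := by
      rw [← ENNReal.rpow_add _ _ (by simp) (by simp)]
      congr 1; ring
    rw [this, hT, ENNReal.mul_rpow_of_nonneg _ _ hp.le, ENNReal.mul_rpow_of_nonneg _ _ hp.le,
      ← ENNReal.rpow_natCast, ← ENNReal.rpow_mul, mul_comm (n : ℝ) p]
    ring
  calc _ ≤ _ := lintegral_mono_set hsub
    _ ≤ _ := lintegral_union_le _ _ _
    _ ≤ dyadicConst p q * δ ^ p * (2 : ℝ≥0∞) ^ ((p - q) * ((n + 1 : ℕ) : ℝ))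
        * kernelMeasure μ Ω q (farSet ρ δ) + 2 ^ p * (2 * (4 * T) ^ p *
        (tailConst q * (2 : ℝ≥0∞) ^ (-(q * n)) * kernelMeasure μ Ω q (farSet ρ δ))) := by
        refine add_le_add hmid (hfar.trans ?_)
        gcongr
        exact hexc.trans (by gcongr)
    _ = dyadicConst p q * δ ^ p * 2 ^ (p - q) * (2 : ℝ≥0∞) ^ ((p - q) * n)
        * kernelMeasure μ Ω q (farSet ρ δ) + 2 ^ p * 2 * tailConst q *
        ((4 * T) ^ p * (2 : ℝ≥0∞) ^ (-(q * n))) * kernelMeasure μ Ω q (farSet ρ δ) := by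
        rw [e1]; ring
    _ = _ := by rw [e2, hC']; ring

end Local


/-! ### The local lifting estimate in dimension one -/

section Line

variable {Ω : Set ℝ} {ρ : ℝ → ℝ → ℝ≥0∞}

/-- Measure of the pairs at intermediate distance in the interval `(x, y]`. -/
def midMass (Ω : Set ℝ) (ρ : ℝ → ℝ → ℝ≥0∞) (δ : ℝ≥0∞) (x y : ℝ) : ℝ≥0∞ :=
  kernelMeasure volume Ω 1 (midSet ρ δ ∩ Set.Ioc x y ×ˢ Set.Ioc x y)

lemma measurable_midMass (h : IsPairDist ρ) (Ω : Set ℝ) (δ : ℝ≥0∞) :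
    Measurable fun z : ℝ × ℝ ↦ midMass Ω ρ δ z.1 z.2 := by
  have hs : MeasurableSet {w : (ℝ × ℝ) × (ℝ × ℝ) | w.2 ∈ midSet ρ δ ∧
      ((w.1.1 < w.2.1 ∧ w.2.1 ≤ w.1.2) ∧ (w.1.1 < w.2.2 ∧ w.2.2 ≤ w.1.2))} := by
    have h1 : MeasurableSet {w : (ℝ × ℝ) × (ℝ × ℝ) | w.1.1 < w.2.1} :=
      measurableSet_lt (by fun_prop) (by fun_prop)
    have h2 : MeasurableSet {w : (ℝ × ℝ) × (ℝ × ℝ) | w.2.1 ≤ w.1.2} :=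
      measurableSet_le (by fun_prop) (by fun_prop)
    have h3 : MeasurableSet {w : (ℝ × ℝ) × (ℝ × ℝ) | w.1.1 < w.2.2} :=
      measurableSet_lt (by fun_prop) (by fun_prop)
    have h4 : MeasurableSet {w : (ℝ × ℝ) × (ℝ × ℝ) | w.2.2 ≤ w.1.2} :=
      measurableSet_le (by fun_prop) (by fun_prop)
    exact (measurable_snd (h.measurableSet_midSet δ)).inter ((h1.inter h2).inter (h3.inter h4))
  exact measurable_measure_prodMk_left hs

lemma midMass_mono (δ : ℝ≥0∞) {x y x' y' : ℝ} (hx : x' ≤ x) (hy : y ≤ y') :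
    midMass Ω ρ δ x y ≤ midMass Ω ρ δ x' y' := by
  unfold midMass
  gcongr

/-- Superadditivity: the squares over consecutive half-open intervals are disjoint. -/
lemma midMass_add_le (h : IsPairDist ρ) (δ : ℝ≥0∞) {x y z : ℝ} (hxy : x ≤ y) (hyz : y ≤ z) :
    midMass Ω ρ δ x y + midMass Ω ρ δ y z ≤ midMass Ω ρ δ x z := by
  unfold midMass
  rw [← measure_union]
  · refine measure_mono ?_
    rintro w (⟨h1, h2, h3⟩ | ⟨h1, h2, h3⟩)
    · exact ⟨h1, ⟨h2.1, h2.2.trans hyz⟩, ⟨h3.1, h3.2.trans hyz⟩⟩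
    · exact ⟨h1, ⟨hxy.trans_lt h2.1, h2.2⟩, ⟨hxy.trans_lt h3.1, h3.2⟩⟩
  · rw [Set.disjoint_left]
    rintro w ⟨-, h2, -⟩ ⟨-, h3, -⟩
    exact absurd h2.2 (not_le.2 h3.1)
  · exact (h.measurableSet_midSet δ).inter (measurableSet_Ioc.prod measurableSet_Ioc)

lemma sum_midMass_le (h : IsPairDist ρ) (δ : ℝ≥0∞) {t : ℕ → ℝ} (ht : Monotone t) (n : ℕ) :
    ∑ i ∈ Finset.range n, midMass Ω ρ δ (t i) (t (i + 1)) ≤ midMass Ω ρ δ (t 0) (t n) := by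
  induction n with
  | zero => simp
  | succ n ih =>
    rw [Finset.sum_range_succ]
    exact (by gcongr : _ ≤ midMass Ω ρ δ (t 0) (t n) + _).trans
      (midMass_add_le h δ (ht (Nat.zero_le n)) (ht n.le_succ))

/-- The windows (t_i, t_{i+2}] overlap, but those of even index are consecutive, and so are those of
odd index; superadditivity applies to each family. -/
lemma sum_midMass_two_le (h : IsPairDist ρ) (δ : ℝ≥0∞) {t : ℕ → ℝ} (ht : Monotone t) (n : ℕ) :
    ∑ i ∈ Finset.range n, midMass Ω ρ δ (t i) (t (i + 2))
      ≤ midMass Ω ρ δ (t 0) (t n) + midMass Ω ρ δ (t 0) (t (n + 1)) := by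
  induction n with
  | zero => simp
  | succ n ih =>
    rw [Finset.sum_range_succ]
    calc _ ≤ midMass Ω ρ δ (t 0) (t n) + midMass Ω ρ δ (t 0) (t (n + 1))
          + midMass Ω ρ δ (t n) (t (n + 2)) := by gcongr
      _ = midMass Ω ρ δ (t 0) (t (n + 1)) + (midMass Ω ρ δ (t 0) (t n)
          + midMass Ω ρ δ (t n) (t (n + 2))) := by ring
      _ ≤ _ := by
          gcongr
          exact midMass_add_le h δ (ht (Nat.zero_le n)) (ht (by omega))

lemma lintegral_affine_le {A B : Set ℝ} (hA : MeasurableSet A) {c l : ℝ} (hl : 0 < l)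
    (hAB : ∀ s ∈ A, c + l * s ∈ B) (g : ℝ → ℝ≥0∞) :
    ENNReal.ofReal l * ∫⁻ s in A, g (c + l * s) ≤ ∫⁻ z in B, g z := by
  have hder : ∀ s ∈ A, HasDerivWithinAt (fun s ↦ c + l * s) l A s := fun s _ ↦ by
    simpa using ((hasDerivWithinAt_id s A).const_mul l).const_add c
  have hinj : Set.InjOn (fun s ↦ c + l * s) A := fun s _ t _ hst ↦ by
    have : l * s = l * t := add_left_cancel hst
    exact mul_left_cancel₀ hl.ne' this
  have := lintegral_image_eq_lintegral_abs_deriv_mul hA hder hinj g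
  rw [abs_of_pos hl, lintegral_const_mul' _ _ ENNReal.ofReal_ne_top] at this
  rw [← this]
  refine lintegral_mono_set ?_
  rintro _ ⟨s, hs, rfl⟩
  exact hAB s hs

lemma kernelMeasure_restrict {Q : Set ℝ} (hQ : Q ⊆ Ω) (hQm : MeasurableSet Q) (q : ℝ) :
    kernelMeasure volume Q q = (kernelMeasure volume Ω q).restrict (Q ×ˢ Q) := by
  unfold kernelMeasure
  rw [restrict_withDensity (hQm.prod hQm), ← Measure.prod_restrict, Measure.restrict_restrict hQm,
    Set.inter_eq_left.2 hQ]

/-- On average over the two shifts, the proportion of far pairs in consecutive intervals is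
controlled by the pairs at intermediate distance. -/
lemma lintegral_far_link_le (h : IsPairDist ρ) {δ : ℝ≥0∞}
    (hfin : kernelMeasure volume Ω 1 (farSet ρ δ) ≠ ⊤) {c l : ℝ} (hl : 0 < l)
    (hQ : Set.Ioc c (c + 3 / 2 * l) ⊆ Ω) :
    ∫⁻ s in Set.Ioc (0 : ℝ) (1 / 2), ∫⁻ t in Set.Ioc (0 : ℝ) (1 / 2),
        (farSet ρ δ).indicator 1 (c + l * s, c + l * (1 + t))
      ≤ 9 / 2 * midMass Ω ρ δ c (c + 3 / 2 * l) := by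
  set Q := Set.Ioc c (c + 3 / 2 * l) with hQdef
  have hQm : MeasurableSet Q := measurableSet_Ioc
  have hS := h.measurableSet_farSet δ
  -- The points c + ls and c + l(1+t), with s and t in (0, 1/2], are at distance l(1+t-s), between
  -- l/2 and 3l/2.
  set V : Set (ℝ × ℝ) := {w | l / 2 ≤ dist w.1 w.2 ∧ dist w.1 w.2 ≤ 3 / 2 * l} with hV
  have hV1 : MeasurableSet {w : ℝ × ℝ | l / 2 ≤ dist w.1 w.2} :=
    measurableSet_le (by fun_prop) (by fun_prop)
  have hV2 : MeasurableSet {w : ℝ × ℝ | dist w.1 w.2 ≤ 3 / 2 * l} :=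
    measurableSet_le (by fun_prop) (by fun_prop)
  have hVm : MeasurableSet V := hV1.inter hV2
  set f : ℝ × ℝ → ℝ≥0∞ := (farSet ρ δ ∩ V).indicator 1 with hf
  have hfm : Measurable f := measurable_one.indicator (hS.inter hVm)
  have hfin' : kernelMeasure volume Q 1 (farSet ρ δ) ≠ ⊤ := by
    rw [kernelMeasure_restrict hQ hQm]
    exact ne_top_of_le_ne_top hfin (Measure.restrict_apply_le _ _)
  have hmass : kernelMeasure volume Q 1 (midSet ρ δ) = midMass Ω ρ δ c (c + 3 / 2 * l) := by
    rw [kernelMeasure_restrict hQ hQm, Measure.restrict_apply (h.measurableSet_midSet δ)]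
    rfl
  -- the pairs of `V` lie in two dyadic annuli
  have hK : kernelMeasure volume Q 1 (farSet ρ δ ∩ V) ≤ 2 * midMass Ω ρ δ c (c + 3 / 2 * l) := by
    have hsub : farSet ρ δ ∩ V
        ⊆ (farSet ρ δ ∩ {p | ENNReal.ofReal (3 / 2 * l) < 2 * edist p.1 p.2 ∧
            edist p.1 p.2 ≤ ENNReal.ofReal (3 / 2 * l)})
          ∪ (farSet ρ δ ∩ {p | ENNReal.ofReal (3 / 4 * l) < 2 * edist p.1 p.2 ∧
            edist p.1 p.2 ≤ ENNReal.ofReal (3 / 4 * l)}) := by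
      rintro w ⟨hw, hw1, hw2⟩
      have e2 : 2 * edist w.1 w.2 = ENNReal.ofReal (2 * dist w.1 w.2) := by
        rw [edist_dist, ENNReal.ofReal_mul (by norm_num), ENNReal.ofReal_ofNat]
      rcases le_or_gt (dist w.1 w.2) (3 / 4 * l) with h3 | h3
      · refine Or.inr ⟨hw, ?_, ?_⟩
        · rw [e2]; exact (ENNReal.ofReal_lt_ofReal_iff (by linarith)).2 (by linarith)
        · rw [edist_dist]; exact ENNReal.ofReal_le_ofReal h3
      · refine Or.inl ⟨hw, ?_, ?_⟩
        · rw [e2]; exact (ENNReal.ofReal_lt_ofReal_iff (by linarith)).2 (by linarith)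
        · rw [edist_dist]; exact ENNReal.ofReal_le_ofReal hw2
    refine (measure_mono hsub).trans ((measure_union_le _ _).trans ?_)
    rw [two_mul, ← hmass]
    have hc : Convex ℝ Q := convex_Ioc _ _
    exact add_le_add (kernelMeasure_farSet_annulus_le volume hc hQm h hfin' _)
      (kernelMeasure_farSet_annulus_le volume hc hQm h hfin' _)
  have hVK : ∫⁻ z in Q, ∫⁻ w in Q, f (z, w)
      ≤ ENNReal.ofReal ((3 / 2 * l) ^ 2) * kernelMeasure volume Q 1 (farSet ρ δ ∩ V) := by
    rw [← lintegral_prod _ hfm.aemeasurable, ← lintegral_indicator_one (hS.inter hVm),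
      lintegral_kernelMeasure volume Q 1 (measurable_one.indicator (hS.inter hVm)),
      ← lintegral_const_mul' _ _ ENNReal.ofReal_ne_top]
    refine lintegral_mono fun w ↦ ?_
    by_cases hw : w ∈ farSet ρ δ ∩ V
    swap
    · simp [hf, hw]
    rw [hf, Set.indicator_of_mem hw]
    simp only [Pi.one_apply]
    rw [mul_one_div]
    have hle : edist w.1 w.2 ^ ((Module.finrank ℝ ℝ : ℝ) + 1)
        ≤ ENNReal.ofReal ((3 / 2 * l) ^ 2) := by
      rw [Module.finrank_self, Nat.cast_one, show ((1 : ℝ) + 1) = ((2 : ℕ) : ℝ) by norm_num,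
        ENNReal.rpow_natCast, edist_dist, ← ENNReal.ofReal_pow dist_nonneg]
      exact ENNReal.ofReal_le_ofReal (by gcongr; exact hw.2.2)
    rw [ENNReal.le_div_iff_mul_le]
    · simpa using hle
    · right
      simp only [ne_eq, ENNReal.ofReal_eq_zero, not_le]; positivity
    · right; exact ENNReal.ofReal_ne_top
  have hI : MeasurableSet (Set.Ioc (0 : ℝ) (1 / 2)) := measurableSet_Ioc
  have hscale : ENNReal.ofReal l * (ENNReal.ofReal l *
      ∫⁻ s in Set.Ioc (0 : ℝ) (1 / 2), ∫⁻ t in Set.Ioc (0 : ℝ) (1 / 2),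
        (farSet ρ δ).indicator 1 (c + l * s, c + l * (1 + t))) ≤ ∫⁻ z in Q, ∫⁻ w in Q, f (z, w) := by
    rw [← lintegral_const_mul' _ _ ENNReal.ofReal_ne_top]
    refine le_trans ?_ (lintegral_affine_le hI hl (c := c) (B := Q) (fun s hs ↦ ?_)
      fun z ↦ ∫⁻ w in Q, f (z, w))
    · gcongr ENNReal.ofReal l * ?_
      refine setLIntegral_mono' hI fun s hs ↦ ?_
      refine le_trans ?_ (lintegral_affine_le hI hl (c := c + l) (B := Q) (fun t ht ↦ ?_)
        fun w ↦ f (c + l * s, w))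
      · gcongr ENNReal.ofReal l * ?_
        refine setLIntegral_mono' hI fun t ht ↦ ?_
        have e : c + l * (1 + t) = c + l + l * t := by ring
        rw [e]
        by_cases hw : (c + l * s, c + l + l * t) ∈ farSet ρ δ
        swap
        · rw [Set.indicator_of_notMem hw]; exact bot_le
        have hw2 : (c + l * s, c + l + l * t) ∈ farSet ρ δ ∩ V := by
          have hd : dist (c + l * s) (c + l + l * t) = l * (1 + t - s) := by
            rw [dist_comm, Real.dist_eq, abs_of_nonneg]
            · ring
            · nlinarith [hs.1, hs.2, ht.1, ht.2]
          refine ⟨hw, ?_, ?_⟩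
          · rw [hd]; nlinarith [hs.1, hs.2, ht.1, ht.2]
          · rw [hd]; nlinarith [hs.1, hs.2, ht.1, ht.2]
        rw [hf, Set.indicator_of_mem hw, Set.indicator_of_mem hw2]
      · exact ⟨by nlinarith [ht.1], by nlinarith [ht.2]⟩
    · exact ⟨by nlinarith [hs.1], by nlinarith [hs.2]⟩
  have hl0 : ENNReal.ofReal l ≠ 0 := by simpa using hl
  have hfinal := hscale.trans (hVK.trans (mul_le_mul_right hK _))
  -- The constant 9/2 is 2·(3/2)²: two annuli, and the kernel |x-y|^{-2} at distance at most 3l/2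
  -- compared with the area factor l².
  have e : ENNReal.ofReal ((3 / 2 * l) ^ 2) * (2 * midMass Ω ρ δ c (c + 3 / 2 * l))
      = ENNReal.ofReal l * (ENNReal.ofReal l * (9 / 2 * midMass Ω ρ δ c (c + 3 / 2 * l))) := by
    have h1 : ENNReal.ofReal ((3 / 2 * l) ^ 2) * 2
        = ENNReal.ofReal l * (ENNReal.ofReal l * (9 / 2)) := by
      have : (9 / 2 : ℝ≥0∞) = ENNReal.ofReal (9 / 2) := by
        rw [ENNReal.ofReal_div_of_pos (by norm_num)]; norm_num
      rw [this, ← ENNReal.ofReal_mul hl.le, ← ENNReal.ofReal_mul hl.le,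
        ← ENNReal.ofReal_ofNat, ← ENNReal.ofReal_mul (by positivity)]
      congr 1; ring
    rw [← mul_assoc, h1]; ring
  rw [e] at hfinal
  exact (ENNReal.mul_le_mul_iff_right hl0 ENNReal.ofReal_ne_top).1
    ((ENNReal.mul_le_mul_iff_right hl0 ENNReal.ofReal_ne_top).1 hfinal)

end Line


/-! ### Chains with random nodes on an interval -/

section Chain

variable {Ω : Set ℝ} {ρ : ℝ → ℝ → ℝ≥0∞}

/-- Nodes of a subdivision of `[0, 1]` into `k` pieces; the node `i / k` is shifted by `σ.1 / k` or
`σ.2 / k`, according to the parity of `i`. -/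
def chainNode (k : ℕ) (i : ℕ) (σ : ℝ × ℝ) : ℝ :=
  if i = 0 then 0 else if i < k then (i + if Even i then σ.1 else σ.2) / k else 1

lemma measurable_chainNode (k i : ℕ) : Measurable (chainNode k i) := by
  unfold chainNode
  split_ifs <;> fun_prop

lemma chainNode_zero (k : ℕ) (σ : ℝ × ℝ) : chainNode k 0 σ = 0 := by simp [chainNode]

lemma chainNode_self {k : ℕ} (hk : k ≠ 0) (σ : ℝ × ℝ) : chainNode k k σ = 1 := by
  simp [chainNode, hk]

/-- The square of admissible shifts. -/
def shiftSquare : Set (ℝ × ℝ) := Set.Ioc (0 : ℝ) (1 / 2) ×ˢ Set.Ioc (0 : ℝ) (1 / 2)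

/-- Shifts of at most half a cell keep the nodes in order and the links at most 3/2 of a cell long.
-/
lemma chainNode_mem {k i : ℕ} (hk : 2 ≤ k) {σ : ℝ × ℝ} (hσ : σ ∈ shiftSquare) (hi : i < k) :
    0 < chainNode k (i + 1) σ - chainNode k i σ ∧
      chainNode k (i + 1) σ - chainNode k i σ ≤ 3 / 2 / k := by
  obtain ⟨⟨h1, h2⟩, h3, h4⟩ := hσ
  have hk0 : (0 : ℝ) < k := by exact_mod_cast (by omega : 0 < k)
  have hs : ∀ j : ℕ, 0 < (if Even j then σ.1 else σ.2) ∧ (if Even j then σ.1 else σ.2) ≤ 1 / 2 :=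
    fun j ↦ by split_ifs <;> exact ⟨by assumption, by assumption⟩
  unfold chainNode
  obtain ⟨a1, a2⟩ := hs i
  obtain ⟨b1, b2⟩ := hs (i + 1)
  generalize (if Even i then σ.1 else σ.2) = a at *
  generalize (if Even (i + 1) then σ.1 else σ.2) = b at *
  rcases Nat.eq_zero_or_pos i with rfl | hi0
  · rw [if_neg (by omega), if_pos (by omega), if_pos rfl]
    push_cast
    rw [sub_zero]
    exact ⟨by positivity, by gcongr; linarith⟩
  · rw [if_neg i.succ_ne_zero, if_neg hi0.ne', if_pos hi]
    rcases Nat.lt_or_ge (i + 1) k with h5 | h5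
    · rw [if_pos h5, ← sub_div]
      push_cast
      refine ⟨div_pos (by linarith) hk0, ?_⟩
      gcongr; linarith
    · rw [if_neg (by omega)]
      have : (k : ℝ) = i + 1 := by exact_mod_cast (by omega : k = i + 1)
      rw [one_sub_div hk0.ne']
      refine ⟨div_pos (by linarith) hk0, ?_⟩
      gcongr; linarith

lemma monotone_chainNode {k : ℕ} (hk : 2 ≤ k) {σ : ℝ × ℝ} (hσ : σ ∈ shiftSquare) :
    Monotone fun i ↦ chainNode k i σ := by
  refine monotone_nat_of_le_succ fun i ↦ ?_
  rcases Nat.lt_or_ge i k with h | h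
  · linarith [(chainNode_mem hk hσ h).1]
  · have e : ∀ j ≥ k, chainNode k j σ = 1 := fun j hj ↦ by
      simp only [chainNode]; rw [if_neg (by omega), if_neg (by omega)]
    rw [e i h, e (i + 1) (by omega)]

/-- The uniform measure on the admissible shifts. -/
def shiftMeasure : Measure (ℝ × ℝ) :=
  (volume.restrict (Set.Ioc (0 : ℝ) (1 / 2))).prod (volume.restrict (Set.Ioc (0 : ℝ) (1 / 2)))

lemma shiftMeasure_univ : shiftMeasure Set.univ = ENNReal.ofReal (1 / 4) := by
  unfold shiftMeasure
  rw [← Set.univ_prod_univ, Measure.prod_prod]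
  simp only [Measure.restrict_apply_univ, Real.volume_Ioc]
  rw [← ENNReal.ofReal_mul (by norm_num)]
  norm_num

instance : SFinite shiftMeasure := by unfold shiftMeasure; infer_instance

lemma ae_mem_shiftSquare : ∀ᵐ σ ∂shiftMeasure, σ ∈ shiftSquare := by
  unfold shiftMeasure shiftSquare
  rw [Measure.prod_restrict]
  exact ae_restrict_mem (measurableSet_Ioc.prod measurableSet_Ioc)

/-- The weighted integrand of the moment estimate in dimension one. -/
def chainWeight (Ω : Set ℝ) (ρ : ℝ → ℝ → ℝ≥0∞) (δ : ℝ≥0∞) (p : ℝ) (a : ℝ → ℝ → ℝ≥0∞)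
    (z : ℝ × ℝ) : ℝ≥0∞ :=
  ({z | z.1 < z.2} ∩ farSet ρ δ).indicator
    (fun z ↦ a z.1 z.2 ^ p * (1 + midMass Ω ρ δ z.1 z.2) ^ (1 - p)) z

lemma measurable_chainWeight (h : IsPairDist ρ) {a : ℝ → ℝ → ℝ≥0∞} (ha : IsPairDist a) (Ω : Set ℝ)
    (δ : ℝ≥0∞) (p : ℝ) : Measurable (chainWeight Ω ρ δ p a) := by
  refine Measurable.indicator ?_ (MeasurableSet.inter ?_ (h.measurableSet_farSet δ))
  · exact (ha.measurable.pow_const p).mul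
      ((measurable_const.add (measurable_midMass h Ω δ)).pow_const _)
  · exact measurableSet_lt measurable_fst measurable_snd

/-- Number of far links, weighted; its mean over the shifts is controlled. -/
lemma lintegral_sum_far_links_le (hΩ : Convex ℝ Ω) (h : IsPairDist ρ) {δ : ℝ≥0∞}
    (hfin : kernelMeasure volume Ω 1 (farSet ρ δ) ≠ ⊤) {k : ℕ} (hk : 2 ≤ k) {x y : ℝ} (hxy : x < y)
    (hx : x ∈ Ω) (hy : y ∈ Ω) :
    ∫⁻ σ, ∑ i ∈ Finset.range k, (farSet ρ δ).indicator 1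
        (segMap (chainNode k i σ) (chainNode k (i + 1) σ) (x, y)) ∂shiftMeasure
      ≤ ENNReal.ofReal (1 / 2) + 9 * midMass Ω ρ δ x y := by
  have hS := h.measurableSet_farSet δ
  have hk0 : (0 : ℝ) < k := by exact_mod_cast (by omega : 0 < k)
  have hm : ∀ i j, Measurable fun σ : ℝ × ℝ ↦ segMap (chainNode k i σ) (chainNode k j σ) (x, y) :=
    fun i j ↦ by
      have := measurable_chainNode k i
      have := measurable_chainNode k j
      unfold segMap
      fun_prop
  have hind : Measurable ((farSet ρ δ).indicator (1 : ℝ × ℝ → ℝ≥0∞)) :=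
    measurable_one.indicator hS
  rw [lintegral_finsetSum _ (f := fun i σ ↦ (farSet ρ δ).indicator 1
    (segMap (chainNode k i σ) (chainNode k (i + 1) σ) (x, y))) fun i _ ↦ hind.comp (hm i (i + 1))]
  set l := (y - x) / k with hl
  have hl0 : 0 < l := div_pos (by linarith) hk0
  set t : ℕ → ℝ := fun i ↦ x + l * i with ht
  have htm : Monotone t := fun i j hij ↦ by
    have : (i : ℝ) ≤ j := by exact_mod_cast hij
    simp only [ht]; gcongr
  have htk : t k = y := by simp only [ht, hl]; field_simp; ring
  have ht0 : t 0 = x := by simp [ht]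
  -- The first and last links have a fixed end, so averaging says nothing about them; each is
  -- bounded by the mass 1/4 of the shifts.
  have hend : ∀ i, ∫⁻ σ, (farSet ρ δ).indicator 1
        (segMap (chainNode k i σ) (chainNode k (i + 1) σ) (x, y)) ∂shiftMeasure
      ≤ ENNReal.ofReal (1 / 4) := fun i ↦ by
    have h1 : ∀ w, (farSet ρ δ).indicator (1 : ℝ × ℝ → ℝ≥0∞) w ≤ 1 := fun w ↦ by
      by_cases hw : w ∈ farSet ρ δ <;> simp [hw]
    refine (lintegral_mono (g := fun _ ↦ 1) fun σ ↦ h1 _).trans ?_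
    rw [lintegral_one, shiftMeasure_univ]
  -- Consecutive inner nodes have opposite parities, hence independent shifts. Two shifts therefore
  -- suffice for the whole chain.
  have hint : ∀ i, 0 < i → i + 1 < k → ∫⁻ σ, (farSet ρ δ).indicator 1
        (segMap (chainNode k i σ) (chainNode k (i + 1) σ) (x, y)) ∂shiftMeasure
      ≤ 9 / 2 * midMass Ω ρ δ (t i) (t (i + 2)) := fun i hi0 hik ↦ by
    have hti : t i + 3 / 2 * l ≤ t (i + 2) := by
      simp only [ht]; push_cast; nlinarith
    have hsub : Set.Ioc (t i) (t i + 3 / 2 * l) ⊆ Ω := by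
      refine Set.Subset.trans ?_ (hΩ.ordConnected.out hx hy)
      intro w hw
      refine ⟨(ht0 ▸ htm (Nat.zero_le i) : x ≤ t i).trans hw.1.le, hw.2.trans (hti.trans ?_)⟩
      exact htk ▸ htm (by omega)
    refine le_trans ?_ ((lintegral_far_link_le h hfin hl0 hsub).trans ?_)
    swap
    · gcongr
      exact midMass_mono δ le_rfl hti
    have hnode : ∀ σ : ℝ × ℝ, segMap (chainNode k i σ) (chainNode k (i + 1) σ) (x, y)
        = (t i + l * (if Even i then σ.1 else σ.2),
          t i + l * (1 + if Even i then σ.2 else σ.1)) := fun σ ↦ by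
      have e : (if Even (i + 1) then σ.1 else σ.2) = if Even i then σ.2 else σ.1 := by
        by_cases he : Even i <;> simp [he, Nat.even_add_one]
      simp only [segMap, chainNode, if_neg hi0.ne', if_pos (show i < k by omega), if_pos hik,
        if_neg (Nat.succ_ne_zero i), e, ht, hl, smul_eq_mul]
      push_cast
      ext <;> ring
    simp only [hnode]
    unfold shiftMeasure
    by_cases he : Even i
    · simp only [he, if_true]
      rw [lintegral_prod]
      exact (hind.comp (by fun_prop)).aemeasurable
    · simp only [he, if_false]
      rw [lintegral_prod_symm]
      exact (hind.comp (by fun_prop)).aemeasurable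
  obtain ⟨j, rfl⟩ : ∃ j, k = j + 2 := ⟨k - 2, by omega⟩
  rw [Finset.sum_range_succ, Finset.sum_range_succ']
  have hsum : ∑ i ∈ Finset.range j, ∫⁻ σ, (farSet ρ δ).indicator 1
        (segMap (chainNode (j + 2) (i + 1) σ) (chainNode (j + 2) (i + 1 + 1) σ) (x, y)) ∂shiftMeasure
      ≤ 9 * midMass Ω ρ δ x y := by
    calc _ ≤ ∑ i ∈ Finset.range j, 9 / 2 * midMass Ω ρ δ (t (i + 1)) (t (i + 2 + 1)) := by
          refine Finset.sum_le_sum fun i hi ↦ ?_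
          have := Finset.mem_range.1 hi
          exact hint (i + 1) (by omega) (by omega)
      _ = 9 / 2 * ∑ i ∈ Finset.range j, midMass Ω ρ δ (t (i + 1)) (t (i + 2 + 1)) := by
          rw [Finset.mul_sum]
      _ ≤ 9 / 2 * (midMass Ω ρ δ x y + midMass Ω ρ δ x y) := by
          gcongr
          refine (sum_midMass_two_le h δ (t := fun i ↦ t (i + 1))
            (fun a b hab ↦ htm (by omega)) j).trans ?_
          have hx' : x ≤ t (0 + 1) := ht0 ▸ htm (by omega)
          refine add_le_add (midMass_mono δ hx' ?_) (midMass_mono δ hx' ?_)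
          · exact htk ▸ htm (by omega)
          · exact htk ▸ htm (by omega)
      _ = 9 * midMass Ω ρ δ x y := by
          rw [← two_mul, ← mul_assoc]
          congr 1
          exact ENNReal.div_mul_cancel (by norm_num) (by norm_num)
  refine (add_le_add (add_le_add hsum (hend 0)) (hend (j + 1))).trans (le_of_eq ?_)
  rw [add_assoc, ← ENNReal.ofReal_add (by norm_num) (by norm_num), add_comm]
  norm_num

end Chain


/-! ### Weighted moments along random chains -/

section Moment

variable {Ω : Set ℝ} {ρ a : ℝ → ℝ → ℝ≥0∞}

lemma midMass_ne_top {δ : ℝ≥0∞} (hfin : kernelMeasure volume Ω 1 (farSet ρ δ) ≠ ⊤) (x y : ℝ) :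
    midMass Ω ρ δ x y ≠ ⊤ :=
  ne_top_of_le_ne_top hfin (measure_mono fun _ hw ↦ hw.1.1)

/-- Hölder's inequality along a chain. -/
lemma sub_le_chain_mul (h : IsPairDist ρ) (ha : IsPairDist a)
    (haρ : ∀ x y, a x y ≤ ρ x y) {δ : ℝ≥0∞}
    (hfin : kernelMeasure volume Ω 1 (farSet ρ δ) ≠ ⊤) {p : ℝ} (hp : 1 ≤ p) {k : ℕ} (hk : 2 ≤ k)
    {x y : ℝ} (hxy : x < y) {σ : ℝ × ℝ} (hσ : σ ∈ shiftSquare) :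
    a x y - k * δ ≤
      (∑ i ∈ Finset.range k, (farSet ρ δ).indicator 1
        (segMap (chainNode k i σ) (chainNode k (i + 1) σ) (x, y)) + midMass Ω ρ δ x y) ^ (1 - p⁻¹)
      * (∑ i ∈ Finset.range k, chainWeight Ω ρ δ p a
        (segMap (chainNode k i σ) (chainNode k (i + 1) σ) (x, y))) ^ p⁻¹ := by
  set z : ℕ → ℝ := fun i ↦ x + chainNode k i σ * (y - x) with hz
  have hseg : ∀ i, segMap (chainNode k i σ) (chainNode k (i + 1) σ) (x, y) = (z i, z (i + 1)) :=
    fun i ↦ rfl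
  simp only [hseg]
  have hz0 : z 0 = x := by simp [hz, chainNode_zero]
  have hzk : z k = y := by simp [hz, chainNode_self (show k ≠ 0 by omega)]
  have hzm : Monotone z := fun i j hij ↦ by
    have := monotone_chainNode hk hσ hij
    simp only [hz]
    have : 0 ≤ y - x := by linarith
    gcongr
  have hzlt : ∀ i < k, z i < z (i + 1) := fun i hi ↦ by
    have := (chainNode_mem hk hσ hi).1
    simp only [hz]
    nlinarith
  set e : ℕ → ℝ≥0∞ := fun i ↦ 1 + midMass Ω ρ δ (z i) (z (i + 1)) with he
  have he0 : ∀ i, e i ≠ 0 := fun i ↦ by simp [he]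
  have het : ∀ i, e i ≠ ⊤ := fun i ↦ ENNReal.add_ne_top.2 ⟨by simp, midMass_ne_top hfin _ _⟩
  set b : ℕ → ℝ≥0∞ := fun i ↦ (farSet ρ δ).indicator 1 (z i, z (i + 1)) with hb
  have hb1 : ∀ i, b i ≤ 1 := fun i ↦ by
    by_cases hw : (z i, z (i + 1)) ∈ farSet ρ δ <;> simp [hb, hw]
  -- Near links cost at most δ and disappear; the far ones are written as weight times quotient for
  -- Hölder's inequality.
  have hlink : ∀ i, a (z i) (z (i + 1)) - δ ≤ b i * e i * (a (z i) (z (i + 1)) / e i) := fun i ↦ by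
    by_cases hw : (z i, z (i + 1)) ∈ farSet ρ δ
    · rw [hb]
      simp only [Set.indicator_of_mem hw, Pi.one_apply, one_mul]
      rw [ENNReal.mul_div_cancel (he0 i) (het i)]
      exact tsub_le_self
    · have : a (z i) (z (i + 1)) ≤ δ := (haρ _ _).trans (not_le.1 hw).le
      rw [tsub_eq_zero_of_le this]
      exact bot_le
  have hchain := ha.le_sum_range z k
  rw [hz0, hzk] at hchain
  refine (ENNReal.sub_mul_le_sum_sub hchain).trans ((Finset.sum_le_sum fun i _ ↦ hlink i).trans ?_)
  -- Weights b_i e_i with e_i = 1 + m(link). Their sum is at most the number of far links plus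
  -- m(x,y), by superadditivity, and the other factor is the sum of b_i a^p e_i^{1-p}: the weight
  -- (1+m)^{1-p} reproduces itself.
  refine (ENNReal.inner_le_weight_mul_Lp_of_nonneg (Finset.range k) hp _ _).trans ?_
  have hp0 : 0 < p := by linarith
  have hp1 : 0 ≤ 1 - p⁻¹ := sub_nonneg.2 (inv_le_one_of_one_le₀ hp)
  refine mul_le_mul' (ENNReal.rpow_le_rpow ?_ hp1) (ENNReal.rpow_le_rpow ?_ (by positivity))
  · calc ∑ i ∈ Finset.range k, b i * e i
        ≤ ∑ i ∈ Finset.range k, (b i + midMass Ω ρ δ (z i) (z (i + 1))) := by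
          refine Finset.sum_le_sum fun i _ ↦ ?_
          rw [he]
          simp only [mul_add, mul_one]
          gcongr
          exact mul_le_of_le_one_left' (hb1 i)
      _ ≤ _ := by
          rw [Finset.sum_add_distrib]
          gcongr
          refine (sum_midMass_le h δ hzm k).trans ?_
          rw [hz0, hzk]
  · refine Finset.sum_le_sum fun i hi ↦ ?_
    have hlt := hzlt i (Finset.mem_range.1 hi)
    by_cases hw : (z i, z (i + 1)) ∈ farSet ρ δ
    · have hmem : (z i, z (i + 1)) ∈ {z : ℝ × ℝ | z.1 < z.2} ∩ farSet ρ δ := ⟨hlt, hw⟩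
      rw [hb, chainWeight, Set.indicator_of_mem hmem]
      simp only [Set.indicator_of_mem hw, Pi.one_apply, one_mul]
      rw [ENNReal.div_rpow_of_nonneg _ _ hp0.le, ENNReal.rpow_sub _ _ (he0 i) (het i),
        ENNReal.rpow_one, ← mul_div_assoc, ← mul_div_assoc, mul_comm]
    · rw [hb]
      simp [hw]

/-- The chain inequality is averaged over the shifts by Hölder's inequality. The mean of its first
factor is at most 10(1+m(x,y)) uniformly in k, and the power 1-p of 1+m(x,y) on the left compensates
it. The factor 4^p comes from the total mass 1/4 of the shifts. -/
lemma rpow_sub_le_lintegral_chain (hΩ : Convex ℝ Ω) (h : IsPairDist ρ) (ha : IsPairDist a)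
    (haρ : ∀ x y, a x y ≤ ρ x y) {δ : ℝ≥0∞}
    (hfin : kernelMeasure volume Ω 1 (farSet ρ δ) ≠ ⊤) {p : ℝ} (hp : 1 ≤ p) {k : ℕ} (hk : 2 ≤ k)
    {x y : ℝ} (hxy : x < y) (hx : x ∈ Ω) (hy : y ∈ Ω) :
    (a x y - k * δ) ^ p * (1 + midMass Ω ρ δ x y) ^ (1 - p)
      ≤ 4 ^ p * 10 ^ (p - 1) * ∫⁻ σ, ∑ i ∈ Finset.range k, chainWeight Ω ρ δ p a
        (segMap (chainNode k i σ) (chainNode k (i + 1) σ) (x, y)) ∂shiftMeasure := by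
  have hS := h.measurableSet_farSet δ
  have hp0 : 0 < p := by linarith
  have hm : ∀ i, Measurable fun σ : ℝ × ℝ ↦
      segMap (chainNode k i σ) (chainNode k (i + 1) σ) (x, y) := fun i ↦ by
    have := measurable_chainNode k i
    have := measurable_chainNode k (i + 1)
    unfold segMap
    fun_prop
  set ν := midMass Ω ρ δ x y
  have hν : ν ≠ ⊤ := midMass_ne_top hfin x y
  set Y : ℝ × ℝ → ℝ≥0∞ := fun σ ↦ ∑ i ∈ Finset.range k, (farSet ρ δ).indicator 1
        (segMap (chainNode k i σ) (chainNode k (i + 1) σ) (x, y)) + ν with hY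
  set X : ℝ × ℝ → ℝ≥0∞ := fun σ ↦ ∑ i ∈ Finset.range k, chainWeight Ω ρ δ p a
        (segMap (chainNode k i σ) (chainNode k (i + 1) σ) (x, y)) with hX
  have hind : Measurable ((farSet ρ δ).indicator (1 : ℝ × ℝ → ℝ≥0∞)) :=
    measurable_one.indicator hS
  have hYm : Measurable Y :=
    (Finset.measurable_fun_sum _ fun i _ ↦ hind.comp (hm i)).add_const _
  have hXm : Measurable X :=
    Finset.measurable_fun_sum _ fun i _ ↦ (measurable_chainWeight h ha Ω δ p).comp (hm i)
  have hYle : ∫⁻ σ, Y σ ∂shiftMeasure ≤ 10 * (1 + ν) := by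
    rw [hY, lintegral_add_right _ measurable_const, lintegral_const, shiftMeasure_univ]
    calc _ ≤ (ENNReal.ofReal (1 / 2) + 9 * ν) + ν * ENNReal.ofReal (1 / 4) := by
          gcongr
          exact lintegral_sum_far_links_le hΩ h hfin hk hxy hx hy
      _ ≤ (10 + 9 * ν) + ν * 1 := by
          gcongr
          · rw [← ENNReal.ofReal_ofNat]; exact ENNReal.ofReal_le_ofReal (by norm_num)
          · rw [← ENNReal.ofReal_one]; exact ENNReal.ofReal_le_ofReal (by norm_num)
      _ = 10 * (1 + ν) := by ring
  have hp1 : 0 ≤ 1 - p⁻¹ := sub_nonneg.2 (inv_le_one_of_one_le₀ hp)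
  have hmain : ENNReal.ofReal (1 / 4) * (a x y - k * δ)
      ≤ (10 * (1 + ν)) ^ (1 - p⁻¹) * (∫⁻ σ, X σ ∂shiftMeasure) ^ p⁻¹ := by
    calc ENNReal.ofReal (1 / 4) * (a x y - k * δ)
        = ∫⁻ _, (a x y - k * δ) ∂shiftMeasure := by
          rw [lintegral_const, shiftMeasure_univ, mul_comm]
      _ ≤ ∫⁻ σ, Y σ ^ (1 - p⁻¹) * X σ ^ p⁻¹ ∂shiftMeasure := by
          refine lintegral_mono_ae ?_
          filter_upwards [ae_mem_shiftSquare] with σ hσ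
          exact sub_le_chain_mul h ha haρ hfin hp hk hxy hσ
      _ ≤ (∫⁻ σ, Y σ ∂shiftMeasure) ^ (1 - p⁻¹) * (∫⁻ σ, X σ ∂shiftMeasure) ^ p⁻¹ :=
          ENNReal.lintegral_mul_norm_pow_le hYm.aemeasurable hXm.aemeasurable hp1 (by positivity)
            (by ring)
      _ ≤ _ := by gcongr
  have h4 : (4 : ℝ≥0∞) * ENNReal.ofReal (1 / 4) = 1 := by
    rw [← ENNReal.ofReal_ofNat, ← ENNReal.ofReal_mul (by norm_num)]; norm_num
  have e0 : (1 + ν) ≠ 0 := by simp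
  have et : (1 + ν) ≠ ⊤ := ENNReal.add_ne_top.2 ⟨by simp, hν⟩
  have hpow : (a x y - k * δ) ^ p
      ≤ 4 ^ p * (10 ^ (p - 1) * (1 + ν) ^ (p - 1) * ∫⁻ σ, X σ ∂shiftMeasure) := by
    calc (a x y - k * δ) ^ p = (4 * (ENNReal.ofReal (1 / 4) * (a x y - k * δ))) ^ p := by
          rw [← mul_assoc, h4, one_mul]
      _ ≤ (4 * ((10 * (1 + ν)) ^ (1 - p⁻¹) * (∫⁻ σ, X σ ∂shiftMeasure) ^ p⁻¹)) ^ p := by gcongr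
      _ = _ := by
          rw [ENNReal.mul_rpow_of_nonneg _ _ hp0.le, ENNReal.mul_rpow_of_nonneg _ _ hp0.le,
            ← ENNReal.rpow_mul, ← ENNReal.rpow_mul, inv_mul_cancel₀ hp0.ne', ENNReal.rpow_one,
            sub_mul, inv_mul_cancel₀ hp0.ne', one_mul,
            ENNReal.mul_rpow_of_nonneg _ _ (by linarith : 0 ≤ p - 1)]
  calc (a x y - k * δ) ^ p * (1 + ν) ^ (1 - p)
      ≤ 4 ^ p * (10 ^ (p - 1) * (1 + ν) ^ (p - 1) * ∫⁻ σ, X σ ∂shiftMeasure)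
          * (1 + ν) ^ (1 - p) := by gcongr
    _ = 4 ^ p * 10 ^ (p - 1) * (∫⁻ σ, X σ ∂shiftMeasure)
          * ((1 + ν) ^ (p - 1) * (1 + ν) ^ (1 - p)) := by ring
    _ = _ := by
        rw [← ENNReal.rpow_add _ _ e0 et]
        simp

/-- The constant of the chain inequality. -/
def chainConst (p q : ℝ) : ℝ≥0∞ := 4 ^ p * 10 ^ (p - 1) * ENNReal.ofReal ((3 / 2) ^ q)

lemma chainConst_ne_top {p : ℝ} (hp : 1 ≤ p) (q : ℝ) : chainConst p q ≠ ⊤ := by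
  unfold chainConst
  refine ENNReal.mul_ne_top (ENNReal.mul_ne_top ?_ ?_) ENNReal.ofReal_ne_top
  · exact ENNReal.rpow_ne_top_of_nonneg (by linarith) (by simp)
  · exact ENNReal.rpow_ne_top_of_nonneg (by linarith) (by simp)

/-- For a fixed shift each of the k links has relative length at most 3/(2k), and k (3/(2k))^q =
(3/2)^q k^{1-q}. -/
lemma lintegral_sub_weight_le (hΩ : Convex ℝ Ω) (hm : MeasurableSet Ω) (h : IsPairDist ρ)
    (ha : IsPairDist a) (haρ : ∀ x y, a x y ≤ ρ x y) {δ : ℝ≥0∞}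
    (hfin : kernelMeasure volume Ω 1 (farSet ρ δ) ≠ ⊤) {p q : ℝ} (hp : 1 ≤ p) (hq : 0 < q) {k : ℕ}
    (hk : 2 ≤ k) :
    ∫⁻ z in {z | z.1 < z.2}, (a z.1 z.2 - k * δ) ^ p * (1 + midMass Ω ρ δ z.1 z.2) ^ (1 - p)
        ∂(kernelMeasure volume Ω q)
      ≤ chainConst p q * ENNReal.ofReal ((k : ℝ) ^ (1 - q))
        * ∫⁻ z, chainWeight Ω ρ δ p a z ∂(kernelMeasure volume Ω q) := by
  have hF := measurable_chainWeight h ha Ω δ p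
  have hk0 : (0 : ℝ) < k := by exact_mod_cast (by omega : 0 < k)
  set I := ∫⁻ z, chainWeight Ω ρ δ p a z ∂(kernelMeasure volume Ω q)
  have hjoint : ∀ i, Measurable fun w : (ℝ × ℝ) × (ℝ × ℝ) ↦
      segMap (chainNode k i w.2) (chainNode k (i + 1) w.2) w.1 := fun i ↦ by
    have h1 : Measurable fun w : (ℝ × ℝ) × (ℝ × ℝ) ↦ chainNode k i w.2 :=
      (measurable_chainNode k i).comp measurable_snd
    have h2 : Measurable fun w : (ℝ × ℝ) × (ℝ × ℝ) ↦ chainNode k (i + 1) w.2 :=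
      (measurable_chainNode k (i + 1)).comp measurable_snd
    unfold segMap
    fun_prop
  have hlt : MeasurableSet {z : ℝ × ℝ | z.1 < z.2} := measurableSet_lt measurable_fst measurable_snd
  calc _ ≤ ∫⁻ z in {z | z.1 < z.2}, 4 ^ p * 10 ^ (p - 1) * ∫⁻ σ, ∑ i ∈ Finset.range k,
          chainWeight Ω ρ δ p a (segMap (chainNode k i σ) (chainNode k (i + 1) σ) z) ∂shiftMeasure
          ∂(kernelMeasure volume Ω q) := by
        refine lintegral_mono_ae ?_
        filter_upwards [ae_restrict_mem hlt, ae_restrict_of_ae (ae_mem_kernelMeasure volume hm q)]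
          with z hz hzΩ
        exact rpow_sub_le_lintegral_chain hΩ h ha haρ hfin hp hk hz hzΩ.1 hzΩ.2
    _ ≤ ∫⁻ z, 4 ^ p * 10 ^ (p - 1) * ∫⁻ σ, ∑ i ∈ Finset.range k,
          chainWeight Ω ρ δ p a (segMap (chainNode k i σ) (chainNode k (i + 1) σ) z) ∂shiftMeasure
          ∂(kernelMeasure volume Ω q) := setLIntegral_le_lintegral _ _
    _ = 4 ^ p * 10 ^ (p - 1) * ∫⁻ σ, ∑ i ∈ Finset.range k, ∫⁻ z,
          chainWeight Ω ρ δ p a (segMap (chainNode k i σ) (chainNode k (i + 1) σ) z)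
            ∂(kernelMeasure volume Ω q) ∂shiftMeasure := by
        rw [lintegral_const_mul', lintegral_lintegral_swap]
        · congr 1
          refine lintegral_congr fun σ ↦ ?_
          rw [lintegral_finsetSum]
          exact fun i _ ↦ hF.comp (measurable_segMap _ _)
        · exact (Finset.measurable_fun_sum _ fun i _ ↦ hF.comp (hjoint i)).aemeasurable
        · refine ENNReal.mul_ne_top ?_ ?_
          · exact ENNReal.rpow_ne_top_of_nonneg (by linarith) (by simp)
          · exact ENNReal.rpow_ne_top_of_nonneg (by linarith) (by simp)
    _ ≤ 4 ^ p * 10 ^ (p - 1) * ∫⁻ _, ENNReal.ofReal ((3 / 2) ^ q * (k : ℝ) ^ (1 - q)) * I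
          ∂shiftMeasure := by
        refine mul_le_mul_right (lintegral_mono_ae ?_) _
        filter_upwards [ae_mem_shiftSquare] with σ hσ
        have hmono := monotone_chainNode hk hσ
        have hle : ∀ i ∈ Finset.range k, ∫⁻ z,
            chainWeight Ω ρ δ p a (segMap (chainNode k i σ) (chainNode k (i + 1) σ) z)
              ∂(kernelMeasure volume Ω q) ≤ ENNReal.ofReal ((3 / 2 / k : ℝ) ^ q) * I := fun i hi ↦ by
          obtain ⟨h1, h2⟩ := chainNode_mem hk hσ (Finset.mem_range.1 hi)
          refine (lintegral_segMap_kernelMeasure_le volume hΩ hm ?_ (by linarith) ?_ q hF).trans ?_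
          · exact chainNode_zero k σ ▸ hmono (Nat.zero_le i)
          · have h3 : i + 1 ≤ k := Finset.mem_range.1 hi
            exact (hmono h3).trans (chainNode_self (by omega) σ).le
          · gcongr
        refine (Finset.sum_le_sum hle).trans (le_of_eq ?_)
        rw [Finset.sum_const, Finset.card_range, nsmul_eq_mul, ← mul_assoc]
        congr 1
        rw [← ENNReal.ofReal_natCast, ← ENNReal.ofReal_mul hk0.le]
        congr 1
        rw [Real.div_rpow (by norm_num) hk0.le, Real.rpow_sub hk0, Real.rpow_one]
        field_simp
    _ ≤ _ := by
        rw [lintegral_const, shiftMeasure_univ]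
        unfold chainConst
        rw [ENNReal.ofReal_mul (by positivity)]
        have : ENNReal.ofReal (1 / 4) ≤ 1 := ENNReal.ofReal_le_one.2 (by norm_num)
        calc _ ≤ 4 ^ p * 10 ^ (p - 1) * (ENNReal.ofReal ((3 / 2) ^ q)
              * ENNReal.ofReal ((k : ℝ) ^ (1 - q)) * I * 1) := by gcongr
          _ = _ := by ring

end Moment


/-! ### Moment bounds on an interval -/

section MomentBound

variable {Ω : Set ℝ} {ρ a : ℝ → ℝ → ℝ≥0∞}

lemma exists_chainConst_mul_le (p : ℝ) (hp : 1 ≤ p) {q : ℝ} (hq : 1 < q) :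
    ∃ k : ℕ, 2 ≤ k ∧ 2 ^ p * (chainConst p q * ENNReal.ofReal ((k : ℝ) ^ (1 - q)))
      ≤ ENNReal.ofReal (1 / 2) := by
  have hA : 2 ^ p * chainConst p q ≠ ⊤ :=
    ENNReal.mul_ne_top (ENNReal.rpow_ne_top_of_nonneg (by linarith) (by simp))
      (chainConst_ne_top hp q)
  set A := (2 ^ p * chainConst p q).toReal with hAd
  have ht : Filter.Tendsto (fun k : ℕ ↦ A * (k : ℝ) ^ (-(q - 1))) Filter.atTop (𝓝 (A * 0)) :=
    ((tendsto_rpow_neg_atTop (by linarith)).comp tendsto_natCast_atTop_atTop).const_mul A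
  rw [mul_zero] at ht
  obtain ⟨k, hk, hk2⟩ := ((ht.eventually_le_const (show (0 : ℝ) < 1 / 2 by norm_num)).and
    (Filter.eventually_ge_atTop 2)).exists
  refine ⟨k, hk2, ?_⟩
  rw [← mul_assoc, ← ENNReal.ofReal_toReal hA, ← ENNReal.ofReal_mul ENNReal.toReal_nonneg,
    show 1 - q = -(q - 1) by ring]
  exact ENNReal.ofReal_le_ofReal hk

lemma ENNReal.rpow_le_two_rpow_mul_sub_add {a T : ℝ≥0∞} {p : ℝ} (hp : 0 ≤ p) (hT : T ≠ ⊤) :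
    a ^ p ≤ 2 ^ p * (a - T) ^ p + (2 * T) ^ p := by
  rcases le_total a (2 * T) with h | h
  · exact (ENNReal.rpow_le_rpow h hp).trans le_add_self
  · refine le_trans ?_ le_self_add
    rw [← ENNReal.mul_rpow_of_nonneg _ _ hp]
    refine ENNReal.rpow_le_rpow ?_ hp
    have h1 : T ≤ a - T := ENNReal.le_sub_of_add_le_right hT (by rwa [← two_mul])
    calc a ≤ (a - T) + T := le_tsub_add
      _ ≤ (a - T) + (a - T) := by gcongr
      _ = _ := by rw [two_mul]

/-- Absorption with k fixed: ρ^p ≤ 2^p (ρ - kδ)^p + (2kδ)^p, the excess has a weighted moment at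
most half the original one by the choice of k, and the weight is at most 1 in the second term. The
argument runs for truncations of ρ in the first factor, the weight and the far set being those of ρ.
-/
lemma lintegral_chainWeight_le (hΩ : Convex ℝ Ω) (hm : MeasurableSet Ω) (h : IsPairDist ρ)
    {δ : ℝ≥0∞} (hδt : δ ≠ ⊤)
    (hfin : kernelMeasure volume Ω 1 (farSet ρ δ) ≠ ⊤) {p q : ℝ} (hp : 1 < p) (hq : 0 < q)
    (hfinq : kernelMeasure volume Ω q (farSet ρ δ) ≠ ⊤) {k : ℕ} (hk : 2 ≤ k)
    (hk' : 2 ^ p * (chainConst p q * ENNReal.ofReal ((k : ℝ) ^ (1 - q))) ≤ ENNReal.ofReal (1 / 2)) :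
    ∫⁻ z, chainWeight Ω ρ δ p ρ z ∂(kernelMeasure volume Ω q)
      ≤ 2 * ((2 * (k * δ)) ^ p * kernelMeasure volume Ω q (farSet ρ δ)) := by
  have hS := h.measurableSet_farSet δ
  have hp0 : 0 < p := by linarith
  have hlt : MeasurableSet {z : ℝ × ℝ | z.1 < z.2} := measurableSet_lt measurable_fst measurable_snd
  have hwle : ∀ z : ℝ × ℝ, (1 + midMass Ω ρ δ z.1 z.2) ^ (1 - p) ≤ 1 := fun z ↦
    ENNReal.rpow_le_one_of_one_le_of_neg le_self_add (by linarith)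
  set K := kernelMeasure volume Ω q (farSet ρ δ) with hK
  have key : ∀ N : ℕ, ∫⁻ z, chainWeight Ω ρ δ p (fun x y ↦ min (ρ x y) N) z
      ∂(kernelMeasure volume Ω q) ≤ 2 * ((2 * (k * δ)) ^ p * K) := fun N ↦ by
    have ha := h.min (N : ℝ≥0∞)
    set a : ℝ → ℝ → ℝ≥0∞ := fun x y ↦ min (ρ x y) N with had
    have hpos := lintegral_sub_weight_le hΩ hm h ha (fun x y ↦ min_le_left _ _) hfin hp.le hq hk
    set J := ∫⁻ z, chainWeight Ω ρ δ p a z ∂(kernelMeasure volume Ω q) with hJ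
    have hJt : J ≠ ⊤ := by
      refine ne_top_of_le_ne_top (b := (N : ℝ≥0∞) ^ p * K) ?_ ?_
      · exact ENNReal.mul_ne_top (ENNReal.rpow_ne_top_of_nonneg hp0.le (by simp)) hfinq
      · rw [hK, ← lintegral_indicator_const hS]
        refine lintegral_mono fun z ↦ ?_
        by_cases hz : z ∈ {z : ℝ × ℝ | z.1 < z.2} ∩ farSet ρ δ
        · rw [chainWeight, Set.indicator_of_mem hz, Set.indicator_of_mem hz.2]
          calc _ ≤ (N : ℝ≥0∞) ^ p * 1 := by
                gcongr
                · exact min_le_right _ _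
                · exact hwle z
            _ = _ := mul_one _
        · rw [chainWeight, Set.indicator_of_notMem hz]; exact bot_le
    have hstep : J ≤ ENNReal.ofReal (1 / 2) * J + (2 * (k * δ)) ^ p * K := by
      calc J ≤ ∫⁻ z, ({z : ℝ × ℝ | z.1 < z.2}.indicator (fun z ↦ 2 ^ p * ((a z.1 z.2 - k * δ) ^ p
              * (1 + midMass Ω ρ δ z.1 z.2) ^ (1 - p))) z
              + (farSet ρ δ).indicator (fun _ ↦ (2 * (k * δ)) ^ p) z)
              ∂(kernelMeasure volume Ω q) := by
            refine lintegral_mono fun z ↦ ?_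
            by_cases hz : z ∈ {z : ℝ × ℝ | z.1 < z.2} ∩ farSet ρ δ
            · rw [chainWeight, Set.indicator_of_mem hz, Set.indicator_of_mem hz.1,
                Set.indicator_of_mem hz.2]
              calc _ ≤ (2 ^ p * (a z.1 z.2 - k * δ) ^ p + (2 * (k * δ)) ^ p)
                    * (1 + midMass Ω ρ δ z.1 z.2) ^ (1 - p) := by
                    gcongr
                    refine ENNReal.rpow_le_two_rpow_mul_sub_add hp0.le ?_
                    exact ENNReal.mul_ne_top (by simp) hδt
                _ ≤ 2 ^ p * (a z.1 z.2 - k * δ) ^ p * (1 + midMass Ω ρ δ z.1 z.2) ^ (1 - p)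
                    + (2 * (k * δ)) ^ p * 1 := by
                    rw [add_mul]
                    gcongr
                    exact hwle z
                _ = _ := by rw [mul_one, mul_assoc]
            · rw [chainWeight, Set.indicator_of_notMem hz]; exact bot_le
        _ = 2 ^ p * ∫⁻ z in {z | z.1 < z.2}, (a z.1 z.2 - k * δ) ^ p
              * (1 + midMass Ω ρ δ z.1 z.2) ^ (1 - p) ∂(kernelMeasure volume Ω q)
              + (2 * (k * δ)) ^ p * K := by
            rw [lintegral_add_right _ (measurable_const.indicator hS), lintegral_indicator hlt,
              lintegral_indicator_const hS,
              lintegral_const_mul' _ _ (ENNReal.rpow_ne_top_of_nonneg hp0.le (by simp))]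
        _ ≤ 2 ^ p * (chainConst p q * ENNReal.ofReal ((k : ℝ) ^ (1 - q)) * J)
              + (2 * (k * δ)) ^ p * K := by gcongr
        _ = 2 ^ p * (chainConst p q * ENNReal.ofReal ((k : ℝ) ^ (1 - q))) * J
              + (2 * (k * δ)) ^ p * K := by ring
        _ ≤ _ := by gcongr
    have := ENNReal.le_mul_of_le_mul_add (by norm_num) (by norm_num) hJt hstep
    norm_num at this
    exact this
  have e : ∀ (a : ℝ → ℝ → ℝ≥0∞) (z : ℝ × ℝ), chainWeight Ω ρ δ p a z
      = ({z : ℝ × ℝ | z.1 < z.2} ∩ farSet ρ δ).indicator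
        (fun z ↦ (1 + midMass Ω ρ δ z.1 z.2) ^ (1 - p)) z * a z.1 z.2 ^ p := fun a z ↦ by
    by_cases hz : z ∈ {z : ℝ × ℝ | z.1 < z.2} ∩ farSet ρ δ
    · rw [chainWeight, Set.indicator_of_mem hz, Set.indicator_of_mem hz, mul_comm]
    · rw [chainWeight, Set.indicator_of_notMem hz, Set.indicator_of_notMem hz, zero_mul]
  simp only [e] at key ⊢
  refine lintegral_mul_le_of_forall_min (g := fun t ↦ t ^ p) (f := fun z : ℝ × ℝ ↦ ρ z.1 z.2) ?_
    h.measurable (ENNReal.monotone_rpow_of_nonneg hp0.le) ENNReal.continuous_rpow_const key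
  exact ((measurable_const.add (measurable_midMass h Ω δ)).pow_const _).indicator (hlt.inter hS)

/-- The chain inequality is used again, now with k = 2^n. As 1 + m ≤ 2^n, removing the weight costs
2^{n(p-1)}; the chain gains 2^{n(1-q)}; the product is 2^{n(p-q)}. -/
lemma setLIntegral_rpow_farSet_line_le (hΩ : Convex ℝ Ω) (hm : MeasurableSet Ω) (h : IsPairDist ρ)
    {δ : ℝ≥0∞} (hδ : δ ≠ 0) (hδt : δ ≠ ⊤)
    (hfin : kernelMeasure volume Ω 1 (farSet ρ δ) ≠ ⊤) {p q : ℝ} (hp : 1 < p) (hq : 0 < q)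
    {n : ℕ} (hn : n ≠ 0) (hmass : 1 + kernelMeasure volume Ω 1 (midSet ρ δ) ≤ 2 ^ n) :
    ∫⁻ z in farSet ρ (2 * (2 ^ n * δ)), ρ z.1 z.2 ^ p ∂(kernelMeasure volume Ω q)
      ≤ 2 * (2 ^ p * chainConst p q * (2 : ℝ≥0∞) ^ ((p - q) * n)
        * ∫⁻ z, chainWeight Ω ρ δ p ρ z ∂(kernelMeasure volume Ω q)) := by
  have hp0 : 0 < p := by linarith
  set T := 2 ^ n * δ with hT
  have hTt : T ≠ ⊤ := ENNReal.mul_ne_top (by simp) hδt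
  have hT0 : T ≠ 0 := mul_ne_zero (by simp) hδ
  have hlt : MeasurableSet {z : ℝ × ℝ | z.1 < z.2} := measurableSet_lt measurable_fst measurable_snd
  have hST := h.measurableSet_farSet (2 * T)
  have hk : 2 ≤ 2 ^ n := by
    calc 2 = 2 ^ 1 := by norm_num
      _ ≤ 2 ^ n := Nat.pow_le_pow_right (by norm_num) (by omega)
  have hpos := lintegral_sub_weight_le hΩ hm h h (fun x y ↦ le_rfl) hfin hp.le hq hk
  set J := ∫⁻ z, chainWeight Ω ρ δ p ρ z ∂(kernelMeasure volume Ω q)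
  set G : ℝ × ℝ → ℝ≥0∞ := ({z : ℝ × ℝ | z.1 < z.2} ∩ farSet ρ (2 * T)).indicator
    fun z ↦ ρ z.1 z.2 ^ p with hG
  have hGm : Measurable G := (h.measurable.pow_const p).indicator (hlt.inter hST)
  -- The weighted moments are taken over x < y only; the other half follows by exchanging the two
  -- points, and no far pair is on the diagonal.
  have hsymm : ∫⁻ z in farSet ρ (2 * T), ρ z.1 z.2 ^ p ∂(kernelMeasure volume Ω q)
      ≤ 2 * ∫⁻ z, G z ∂(kernelMeasure volume Ω q) := by
    rw [two_mul (∫⁻ z, G z ∂_)]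
    nth_rw 2 [← lintegral_kernelMeasure_swap volume Ω q hGm]
    rw [← lintegral_add_left hGm, ← lintegral_indicator hST]
    refine lintegral_mono fun z ↦ ?_
    by_cases hz : z ∈ farSet ρ (2 * T)
    swap
    · rw [Set.indicator_of_notMem hz]; exact bot_le
    rw [Set.indicator_of_mem hz]
    rcases lt_trichotomy z.1 z.2 with h1 | h1 | h1
    · refine le_trans (le_of_eq ?_) le_self_add
      have hz' : z ∈ {z : ℝ × ℝ | z.1 < z.2} ∩ farSet ρ (2 * T) := ⟨h1, hz⟩
      rw [hG, Set.indicator_of_mem hz']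
    · exact absurd h1 (h.ne_of_mem_farSet (by simpa using hT0) hz)
    · refine le_trans (le_of_eq ?_) le_add_self
      have hz' : z.swap ∈ {z : ℝ × ℝ | z.1 < z.2} ∩ farSet ρ (2 * T) := by
        refine ⟨h1, ?_⟩
        change 2 * T ≤ ρ z.2 z.1
        rw [h.comm]; exact hz
      rw [hG, Set.indicator_of_mem hz', Prod.fst_swap, Prod.snd_swap, h.comm]
  refine hsymm.trans ?_
  gcongr
  have e0 : ∀ z : ℝ × ℝ, (1 + midMass Ω ρ δ z.1 z.2) ≠ 0 := fun z ↦ by simp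
  have et : ∀ z : ℝ × ℝ, (1 + midMass Ω ρ δ z.1 z.2) ≠ ⊤ := fun z ↦
    ENNReal.add_ne_top.2 ⟨by simp, midMass_ne_top hfin _ _⟩
  have hGle : ∀ z, G z ≤ {z : ℝ × ℝ | z.1 < z.2}.indicator (fun z ↦ 2 ^ p * (2 ^ n) ^ (p - 1) *
      ((ρ z.1 z.2 - (2 ^ n : ℕ) * δ) ^ p * (1 + midMass Ω ρ δ z.1 z.2) ^ (1 - p))) z := fun z ↦ by
    by_cases hz : z ∈ {z : ℝ × ℝ | z.1 < z.2} ∩ farSet ρ (2 * T)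
    swap
    · rw [hG, Set.indicator_of_notMem hz]; exact bot_le
    rw [hG, Set.indicator_of_mem hz, Set.indicator_of_mem hz.1]
    have hz' : 2 * T ≤ ρ z.1 z.2 := hz.2
    have h1 : T ≤ ρ z.1 z.2 - T := ENNReal.le_sub_of_add_le_right hTt (by rwa [← two_mul])
    have h2 : ρ z.1 z.2 ≤ 2 * (ρ z.1 z.2 - T) := by
      calc ρ z.1 z.2 ≤ (ρ z.1 z.2 - T) + T := le_tsub_add
        _ ≤ (ρ z.1 z.2 - T) + (ρ z.1 z.2 - T) := by gcongr
        _ = _ := by rw [two_mul]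
    have h3 : (1 + midMass Ω ρ δ z.1 z.2) ≤ 2 ^ n := by
      refine le_trans ?_ hmass
      gcongr
      exact measure_mono Set.inter_subset_left
    have h4 : 1 ≤ (2 ^ n) ^ (p - 1) * (1 + midMass Ω ρ δ z.1 z.2) ^ (1 - p) := by
      calc 1 = (1 + midMass Ω ρ δ z.1 z.2) ^ (p - 1) * (1 + midMass Ω ρ δ z.1 z.2) ^ (1 - p) := by
            rw [← ENNReal.rpow_add _ _ (e0 z) (et z)]; simp
        _ ≤ _ := by
            gcongr
    calc ρ z.1 z.2 ^ p ≤ (2 * (ρ z.1 z.2 - T)) ^ p * 1 := by rw [mul_one]; gcongr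
      _ ≤ (2 * (ρ z.1 z.2 - T)) ^ p
          * ((2 ^ n) ^ (p - 1) * (1 + midMass Ω ρ δ z.1 z.2) ^ (1 - p)) := by gcongr
      _ = _ := by
          rw [ENNReal.mul_rpow_of_nonneg _ _ hp0.le, hT]
          push_cast
          ring
  have epow : ((2 : ℝ≥0∞) ^ n) ^ (p - 1) * ENNReal.ofReal (((2 ^ n : ℕ) : ℝ) ^ (1 - q))
      = (2 : ℝ≥0∞) ^ ((p - q) * n) := by
    have : ENNReal.ofReal (((2 ^ n : ℕ) : ℝ) ^ (1 - q)) = ((2 : ℝ≥0∞) ^ n) ^ (1 - q) := by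
      rw [← ENNReal.ofReal_rpow_of_pos (by positivity)]
      simp
    rw [this, ← ENNReal.rpow_add _ _ (by simp) (by simp), ← ENNReal.rpow_natCast, ← ENNReal.rpow_mul]
    congr 1; ring
  have hct : (2 : ℝ≥0∞) ^ p * (2 ^ n) ^ (p - 1) ≠ ⊤ :=
    ENNReal.mul_ne_top (ENNReal.rpow_ne_top_of_nonneg hp0.le (by simp))
      (ENNReal.rpow_ne_top_of_nonneg (by linarith) (by simp))
  calc ∫⁻ z, G z ∂(kernelMeasure volume Ω q) ≤ _ := lintegral_mono hGle
    _ = 2 ^ p * (2 ^ n) ^ (p - 1) * ∫⁻ z in {z | z.1 < z.2}, (ρ z.1 z.2 - (2 ^ n : ℕ) * δ) ^ p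
          * (1 + midMass Ω ρ δ z.1 z.2) ^ (1 - p) ∂(kernelMeasure volume Ω q) := by
        rw [lintegral_indicator hlt, lintegral_const_mul' _ _ hct]
    _ ≤ 2 ^ p * (2 ^ n) ^ (p - 1) * (chainConst p q
          * ENNReal.ofReal (((2 ^ n : ℕ) : ℝ) ^ (1 - q)) * J) := by gcongr
    _ = 2 ^ p * chainConst p q * ((2 ^ n) ^ (p - 1)
          * ENNReal.ofReal (((2 ^ n : ℕ) : ℝ) ^ (1 - q))) * J := by ring
    _ = _ := by rw [epow]

/-- The local lifting estimate on an interval. -/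
theorem exists_lift_energy_le_line (hΩ : Convex ℝ Ω) (hm : MeasurableSet Ω)
    {δ : ℝ≥0∞} (hδ : δ ≠ 0) (hδt : δ ≠ ⊤) {p q : ℝ} (hq : 1 < q) (hqp : q < p) :
    ∃ C : ℝ≥0∞, C ≠ ⊤ ∧ ∀ (ρ σ : ℝ → ℝ → ℝ≥0∞), IsLiftPair δ ρ σ →
      kernelMeasure volume Ω 1 (farSet ρ δ) ≠ ⊤ →
      ∫⁻ z, ρ z.1 z.2 ^ p ∂(kernelMeasure volume Ω q)
        ≤ C * (1 + ∫⁻ z, σ z.1 z.2 ^ p ∂(kernelMeasure volume Ω 1)) ^ ((p - q) / 1)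
          * ∫⁻ z, σ z.1 z.2 ^ p ∂(kernelMeasure volume Ω q) := by
  have hp1 : 1 < p := by linarith
  have hp : 0 < p := by linarith
  have h0 : δ ^ p ≠ 0 := by simp [ENNReal.rpow_eq_zero_iff, hδ, hδt]
  have hδpt : δ ^ p ≠ ⊤ := by simp [hp.le, hδt]
  have h2p : (2 : ℝ≥0∞) ^ p ≠ ⊤ := ENNReal.rpow_ne_top_of_nonneg hp.le (by simp)
  obtain ⟨k, hk, hk'⟩ := exists_chainConst_mul_le p hp1.le hq
  -- The summand 2 forces n ≥ 1, so that 2^n is an admissible number of links; the other one gives 1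
  -- + ν_1(intermediate pairs) ≤ 2^n. The final + 1 in C' keeps it nonzero when the far measure is
  -- infinite.
  set B : ℝ≥0∞ := 2 + (δ ^ p)⁻¹ with hB
  set C' : ℝ≥0∞ := dyadicConst p q * δ ^ p * 2 ^ (p - q)
    + 2 * (2 ^ p * chainConst p q * (2 * (2 * (k * δ)) ^ p)) + 1 with hC'
  have hC't : C' ≠ ⊤ := by
    refine ENNReal.add_ne_top.2 ⟨ENNReal.add_ne_top.2 ⟨?_, ?_⟩, by simp⟩
    · exact ENNReal.mul_ne_top (ENNReal.mul_ne_top (dyadicConst_ne_top p q) hδpt)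
        (ENNReal.rpow_ne_top_of_nonneg (by linarith) (by simp))
    · refine ENNReal.mul_ne_top (by simp) (ENNReal.mul_ne_top (ENNReal.mul_ne_top h2p
        (chainConst_ne_top hp1.le q)) (ENNReal.mul_ne_top (by simp) ?_))
      exact ENNReal.rpow_ne_top_of_nonneg hp.le
        (ENNReal.mul_ne_top (by simp) (ENNReal.mul_ne_top (by simp) hδt))
  have hBt : B ≠ ⊤ := ENNReal.add_ne_top.2 ⟨by simp, by simpa using h0⟩
  have hB1 : 1 ≤ B := le_trans (by norm_num) (le_self_add : (2 : ℝ≥0∞) ≤ B)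
  refine exists_lift_energy_le_of_moment volume hΩ hm hδ hδt hq hqp one_pos hC't hBt hB1
    fun ρ σ h hfin n hn ↦ ?_
  rcases eq_or_ne (kernelMeasure volume Ω q (farSet ρ δ)) ⊤ with htop | hfinq
  · rw [htop, ENNReal.mul_top]
    · exact le_top
    · refine mul_ne_zero (by simp [hC']) ?_
      simp [ENNReal.rpow_eq_zero_iff]
  rw [one_mul, ENNReal.rpow_natCast] at hn
  set 𝓔 := ∫⁻ z, σ z.1 z.2 ^ p ∂(kernelMeasure volume Ω 1) with h𝓔
  have hn0 : n ≠ 0 := by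
    rintro rfl
    have : (2 : ℝ≥0∞) ≤ 2 ^ 0 := le_trans (by
      calc (2 : ℝ≥0∞) = 2 * 1 := (mul_one _).symm
        _ ≤ B * (1 + 𝓔) := mul_le_mul' le_self_add le_self_add) hn
    norm_num at this
  have hmass : 1 + kernelMeasure volume Ω 1 (midSet ρ δ) ≤ 2 ^ n := by
    refine le_trans ?_ hn
    calc _ ≤ 1 + (δ ^ p)⁻¹ * 𝓔 := by
          gcongr
          exact h.kernelMeasure_midSet_le volume hδ hδt hp 1
      _ ≤ B + B * 𝓔 := by
          gcongr
          exact le_add_self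
      _ = _ := by ring
  have hfar := setLIntegral_rpow_farSet_line_le hΩ hm h.dist hδ hδt hfin hp1 (by linarith : 0 < q)
    hn0 hmass
  have hJ := lintegral_chainWeight_le hΩ hm h.dist hδt hfin hp1 (by linarith) hfinq hk hk'
  have hmid := setLIntegral_rpow_dyadic_le volume hΩ hm h.dist hδ hδt hq hqp (n + 1)
  have hsub : farSet ρ δ ⊆ {z : ℝ × ℝ | δ ≤ ρ z.1 z.2 ∧ ρ z.1 z.2 < 2 ^ (n + 1) * δ}
      ∪ farSet ρ (2 * (2 ^ n * δ)) := fun z hz ↦ by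
    rcases lt_or_ge (ρ z.1 z.2) (2 * (2 ^ n * δ)) with h1 | h1
    · exact Or.inl ⟨hz, by rw [pow_succ']; rwa [mul_assoc]⟩
    · exact Or.inr h1
  have e1 : (2 : ℝ≥0∞) ^ ((p - q) * ((n + 1 : ℕ) : ℝ))
      = 2 ^ (p - q) * (2 : ℝ≥0∞) ^ ((p - q) * n) := by
    rw [← ENNReal.rpow_add _ _ (by simp) (by simp)]
    congr 1; push_cast; ring
  set K := kernelMeasure volume Ω q (farSet ρ δ)
  calc _ ≤ _ := lintegral_mono_set hsub
    _ ≤ _ := lintegral_union_le _ _ _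
    _ ≤ dyadicConst p q * δ ^ p * (2 : ℝ≥0∞) ^ ((p - q) * ((n + 1 : ℕ) : ℝ)) * K
        + 2 * (2 ^ p * chainConst p q * (2 : ℝ≥0∞) ^ ((p - q) * n)
          * (2 * ((2 * (k * δ)) ^ p * K))) := by
        refine add_le_add hmid (hfar.trans ?_)
        gcongr
    _ = (dyadicConst p q * δ ^ p * 2 ^ (p - q)
          + 2 * (2 ^ p * chainConst p q * (2 * (2 * (k * δ)) ^ p)))
          * (2 : ℝ≥0∞) ^ ((p - q) * n) * K := by rw [e1]; ring
    _ ≤ _ := by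
        gcongr
        exact le_self_add

end MomentBound


/-! ### The local lifting estimate on balls -/

section Ball

open Module

lemma lintegral_kernelMeasure_isometry {E F : Type*} [NormedAddCommGroup E] [InnerProductSpace ℝ E]
    [MeasurableSpace E] [BorelSpace E] [FiniteDimensional ℝ E]
    [NormedAddCommGroup F] [InnerProductSpace ℝ F]
    [MeasurableSpace F] [BorelSpace F] [FiniteDimensional ℝ F] (L : E ≃ₗᵢ[ℝ] F) (Ω : Set E) (q : ℝ)
    {G : F × F → ℝ≥0∞} (hG : Measurable G) :
    ∫⁻ w, G w ∂(kernelMeasure volume (L '' Ω) q)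
      = ∫⁻ z, G (L z.1, L z.2) ∂(kernelMeasure volume Ω q) := by
  have hL : Measurable fun z : E × E ↦ (L z.1, L z.2) :=
    (L.continuous.measurable.comp measurable_fst).prodMk
      (L.continuous.measurable.comp measurable_snd)
  have hmp : MeasurePreserving L (volume.restrict Ω) (volume.restrict (L '' Ω)) :=
    L.measurePreserving.restrict_image_emb L.toHomeomorph.measurableEmbedding Ω
  have e := lintegral_kernelMeasure volume Ω q (F := fun z ↦ G (L z.1, L z.2)) (hG.comp hL)
  rw [lintegral_kernelMeasure volume _ q hG, e,
    ← (hmp.prod hmp).lintegral_comp (f := fun w ↦ G w / edist w.1 w.2 ^ ((finrank ℝ F : ℝ) + q))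
      (hG.div (measurable_edist_pair.pow_const _)), L.toLinearEquiv.finrank_eq]
  simp only [Prod.map_fst, Prod.map_snd, L.edist_map]
  rfl

lemma IsLiftPair.comp {X Y : Type*} [MeasurableSpace X] [MeasurableSpace Y] {δ : ℝ≥0∞}
    {ρ σ : Y → Y → ℝ≥0∞} (h : IsLiftPair δ ρ σ) {f : X → Y} (hf : Measurable f) :
    IsLiftPair δ (fun x y ↦ ρ (f x) (f y)) (fun x y ↦ σ (f x) (f y)) where
  dist :=
    { measurable := h.dist.measurable.comp (hf.prodMap hf)
      self := fun x ↦ h.dist.self _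
      comm := fun x y ↦ h.dist.comm _ _
      triangle := fun x y z ↦ h.dist.triangle _ _ _ }
  measurable := h.measurable.comp (hf.prodMap hf)
  le x y := h.le _ _
  eq x y := h.eq _ _

variable {E : Type*} [NormedAddCommGroup E] [NormedSpace ℝ E] [MeasurableSpace E] [BorelSpace E]
  [FiniteDimensional ℝ E] (μ : Measure E) [μ.IsAddHaarMeasure] {Ω : Set E} {ρ σ : E → E → ℝ≥0∞}

/-- Halving all segments shows that the total mass is at most half of itself. It is therefore zero
or infinite, and the kernel is positive. -/
lemma kernelMeasure_one_univ_eq_top (hΩ : Convex ℝ Ω) (hm : MeasurableSet Ω) (hμ0 : μ Ω ≠ 0) :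
    kernelMeasure μ Ω 1 Set.univ = ⊤ := by
  by_contra hfin
  have h := lintegral_segMap_kernelMeasure_le μ hΩ hm le_rfl (show (0 : ℝ) < 1 / 2 by norm_num)
    (by norm_num) 1 (measurable_const (a := (1 : ℝ≥0∞)))
  simp only [lintegral_one, sub_zero, Real.rpow_one] at h
  have h0 : kernelMeasure μ Ω 1 Set.univ = 0 := by
    have := ENNReal.le_mul_of_le_mul_add (b := 0) (by norm_num) (by norm_num) hfin
      (h.trans le_self_add)
    simpa using this
  rw [Measure.measure_univ_eq_zero, kernelMeasure,
    withDensity_eq_zero_iff (measurable_kernel _).aemeasurable] at h0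
  have h1 : ((μ.restrict Ω).prod (μ.restrict Ω)) Set.univ = 0 := by
    have hf : ∀ᵐ _ ∂((μ.restrict Ω).prod (μ.restrict Ω)), False := h0.mono fun z hz ↦ by
      simp only [Pi.zero_apply, ENNReal.inv_eq_zero] at hz
      exact ENNReal.rpow_ne_top_of_nonneg (by positivity) (edist_ne_top _ _) hz
    simpa [ae_iff] using hf
  rw [← Set.univ_prod_univ, Measure.prod_prod] at h1
  simp [hμ0] at h1

/-- With δ = ∞ no pair is intermediate, so the far pairs form a null set and σ = ρ almost
everywhere. -/
lemma IsLiftPair.lintegral_rpow_eq_of_top (hΩ : Convex ℝ Ω) (hm : MeasurableSet Ω)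
    (h : IsLiftPair ⊤ ρ σ) (hfin : kernelMeasure μ Ω 1 (farSet ρ ⊤) ≠ ⊤) (p : ℝ) {q : ℝ}
    (hq : 1 < q) :
    ∫⁻ z, ρ z.1 z.2 ^ p ∂(kernelMeasure μ Ω q) = ∫⁻ z, σ z.1 z.2 ^ p ∂(kernelMeasure μ Ω q) := by
  have h0 := _root_.kernelMeasure_farSet_le μ hΩ hm h.dist ENNReal.top_ne_zero hfin hq
  have hmid : midSet ρ ⊤ = ∅ := by
    ext z
    simp only [midSet, Set.mem_ofPred_eq, Set.mem_empty_iff_false, iff_false, not_and, not_lt,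
      top_le_iff]
    intro hz
    simp [hz]
  rw [hmid, measure_empty, mul_zero, le_zero_iff] at h0
  refine lintegral_congr_ae ?_
  filter_upwards [measure_eq_zero_iff_ae_notMem.1 h0] with z hz
  rw [h.eq]
  simpa [farSet, lt_top_iff_ne_top] using hz

/-- The local lifting estimate on balls. -/
theorem exists_lift_energy_le_ball {m : ℕ} (hm : 1 ≤ m) (z₀ : EuclideanSpace ℝ (Fin m)) {r : ℝ}
    (hr : 0 < r) (δ : ℝ≥0∞) {p q : ℝ} (hq : 1 < q) (hqp : q < p) :
    ∃ C : ℝ≥0∞, C ≠ ⊤ ∧ ∀ ρ σ : EuclideanSpace ℝ (Fin m) → EuclideanSpace ℝ (Fin m) → ℝ≥0∞,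
      IsLiftPair δ ρ σ → kernelMeasure volume (Metric.ball z₀ r) 1 (farSet ρ δ) ≠ ⊤ →
      ∫⁻ z, ρ z.1 z.2 ^ p ∂(kernelMeasure volume (Metric.ball z₀ r) q)
        ≤ C * (1 + ∫⁻ z, σ z.1 z.2 ^ p ∂(kernelMeasure volume (Metric.ball z₀ r) m)) ^
            ((p - q) / (m : ℝ))
          * ∫⁻ z, σ z.1 z.2 ^ p ∂(kernelMeasure volume (Metric.ball z₀ r) q) := by
  have hΩ : Convex ℝ (Metric.ball z₀ r) := convex_ball _ _
  have hΩm : MeasurableSet (Metric.ball z₀ r) := measurableSet_ball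
  have hμ0 : volume (Metric.ball z₀ r) ≠ 0 := (Metric.measure_ball_pos _ _ hr).ne'
  have hμt : volume (Metric.ball z₀ r) ≠ ⊤ := measure_ball_lt_top.ne
  -- For δ = 0 all pairs are far and have infinite ν_1-measure, so the hypothesis fails. Hence
  -- positivity of the injectivity radius is never needed here.
  rcases eq_or_ne δ 0 with rfl | hδ
  · refine ⟨0, by simp, fun ρ σ _ hfin ↦ ?_⟩
    have : farSet ρ 0 = Set.univ := by ext; simp [farSet]
    rw [this, kernelMeasure_one_univ_eq_top _ hΩ hΩm hμ0] at hfin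
    exact absurd rfl hfin
  rcases eq_or_ne δ ⊤ with rfl | hδt
  · refine ⟨1, by simp, fun ρ σ h hfin ↦ ?_⟩
    rw [h.lintegral_rpow_eq_of_top volume hΩ hΩm hfin p hq, one_mul]
    refine le_mul_of_one_le_left' (ENNReal.one_le_rpow le_self_add ?_)
    exact div_pos (by linarith) (by exact_mod_cast hm)
  rcases Nat.lt_or_ge m 2 with hm2 | hm2
  · obtain rfl : m = 1 := by omega
    -- The one-dimensional estimate uses the order of the real line; an isometry transports it.
    set L : EuclideanSpace ℝ (Fin 1) ≃ₗᵢ[ℝ] ℝ :=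
      (OrthonormalBasis.singleton (Fin 1) ℝ).repr.symm with hL
    have hLΩ : Convex ℝ (L '' Metric.ball z₀ r) := by
      rw [L.image_ball]; exact convex_ball _ _
    have hLm : MeasurableSet (L '' Metric.ball z₀ r) := by
      rw [L.image_ball]; exact measurableSet_ball
    obtain ⟨C, hC, H⟩ := exists_lift_energy_le_line hLΩ hLm hδ hδt hq hqp
    refine ⟨C, hC, fun ρ σ h hfin ↦ ?_⟩
    have h' := h.comp L.symm.continuous.measurable
    have e : ∀ {F : EuclideanSpace ℝ (Fin 1) → EuclideanSpace ℝ (Fin 1) → ℝ≥0∞} (κ : ℝ),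
        (Measurable fun z : EuclideanSpace ℝ (Fin 1) × EuclideanSpace ℝ (Fin 1) ↦ F z.1 z.2) →
        ∫⁻ w, F (L.symm w.1) (L.symm w.2) ∂(kernelMeasure volume (L '' Metric.ball z₀ r) κ)
          = ∫⁻ z, F z.1 z.2 ∂(kernelMeasure volume (Metric.ball z₀ r) κ) := fun {F} κ hF ↦ by
      have hLs := L.symm.continuous.measurable
      rw [lintegral_kernelMeasure_isometry L _ _
        (G := fun w ↦ F (L.symm w.1) (L.symm w.2)) (hF.comp (hLs.prodMap hLs))]
      simp
    have hfin' : kernelMeasure volume (L '' Metric.ball z₀ r) 1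
        (farSet (fun x y ↦ ρ (L.symm x) (L.symm y)) δ) ≠ ⊤ := by
      rw [← lintegral_indicator_one (h'.dist.measurableSet_farSet δ)]
      have := e (F := fun x y ↦ (farSet ρ δ).indicator 1 (x, y)) 1
        (measurable_one.indicator (h.dist.measurableSet_farSet δ))
      rw [← lintegral_indicator_one (h.dist.measurableSet_farSet δ)] at hfin
      exact fun hh ↦ hfin (this.symm.trans hh)
    have := H _ _ h' hfin'
    rw [e (F := fun x y ↦ ρ x y ^ p) q (h.dist.measurable.pow_const p),
      e (F := fun x y ↦ σ x y ^ p) 1 (h.measurable.pow_const p),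
      e (F := fun x y ↦ σ x y ^ p) q (h.measurable.pow_const p)] at this
    simpa using this
  · have hfr : finrank ℝ (EuclideanSpace ℝ (Fin m)) = m := by simp
    have := exists_lift_energy_le_of_two_le volume (by rw [hfr]; exact hm2) hΩ hΩm hμt hμ0
      (R := 2 * r) (by linarith) (fun x hx y hy ↦ ?_) hδ hδt hq hqp
    · rwa [hfr] at this
    · have := dist_triangle_right x y z₀
      linarith [Metric.mem_ball.1 hx, Metric.mem_ball.1 hy]

end Ball


/-! ### From local to global estimates -/

section Global

variable {M : Type*} [EMetricSpace M] [MeasurableSpace M] [BorelSpace M]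

/-- The pairs of points at distance less than `r`. -/
def nearSet (M : Type*) [EMetricSpace M] (r : ℝ≥0∞) : Set (M × M) := {z | edist z.1 z.2 < r}

lemma measurableSet_nearSet [SecondCountableTopology M] (r : ℝ≥0∞) :
    MeasurableSet (nearSet M r) :=
  measurableSet_lt (by fun_prop) measurable_const

/-- Inserting an intermediate point. -/
lemma lintegral_rpow_mul_measure_le {ρ : M → M → ℝ≥0∞} (h : IsPairDist ρ) (μ : Measure M)
    [SFinite μ] {p : ℝ} (hp : 1 ≤ p) {U V W : Set M} (hV : MeasurableSet V) :
    (∫⁻ x in U, ∫⁻ y in W, ρ x y ^ p ∂μ ∂μ) * μ V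
      ≤ 2 ^ (p - 1) * ((∫⁻ x in U, ∫⁻ z in V, ρ x z ^ p ∂μ ∂μ) * μ W
        + (∫⁻ y in W, ∫⁻ z in V, ρ y z ^ p ∂μ ∂μ) * μ U) := by
  have hmp : Measurable fun z : M × M ↦ ρ z.1 z.2 ^ p := h.measurable.pow_const p
  have hA : Measurable fun x ↦ ∫⁻ z in V, ρ x z ^ p ∂μ := hmp.lintegral_prod_right'
  have hB : Measurable fun x ↦ ∫⁻ z in W, ρ x z ^ p ∂μ := hmp.lintegral_prod_right'
  have h2 : (2 : ℝ≥0∞) ^ (p - 1) ≠ ⊤ := ENNReal.rpow_ne_top_of_nonneg (by linarith) (by simp)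
  have hpt : ∀ x y, ρ x y ^ p * μ V
      ≤ 2 ^ (p - 1) * ((∫⁻ z in V, ρ x z ^ p ∂μ) + ∫⁻ z in V, ρ y z ^ p ∂μ) := fun x y ↦ by
    have m1 : Measurable fun z ↦ ρ x z ^ p := hmp.comp measurable_prodMk_left
    rw [← lintegral_add_left m1, ← lintegral_const_mul' _ _ h2, ← setLIntegral_const]
    refine setLIntegral_mono' hV fun z _ ↦ ?_
    refine (ENNReal.rpow_le_rpow (h.triangle x z y) (by linarith)).trans ?_
    rw [h.comm z y]
    exact ENNReal.rpow_add_le_mul_rpow_add_rpow _ _ hp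
  rw [← lintegral_mul_const _ hB]
  calc ∫⁻ x in U, (∫⁻ y in W, ρ x y ^ p ∂μ) * μ V ∂μ
      = ∫⁻ x in U, ∫⁻ y in W, ρ x y ^ p * μ V ∂μ ∂μ := by
        refine lintegral_congr fun x ↦ ?_
        have m1 : Measurable fun y ↦ ρ x y ^ p := hmp.comp measurable_prodMk_left
        rw [lintegral_mul_const _ m1]
    _ ≤ ∫⁻ x in U, ∫⁻ y in W, 2 ^ (p - 1) * ((∫⁻ z in V, ρ x z ^ p ∂μ)
          + ∫⁻ z in V, ρ y z ^ p ∂μ) ∂μ ∂μ :=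
        lintegral_mono fun x ↦ lintegral_mono fun y ↦ hpt x y
    _ = _ := by
        simp_rw [lintegral_const_mul' _ _ h2, lintegral_add_left measurable_const, setLIntegral_const]
        rw [lintegral_add_right _ measurable_const, setLIntegral_const, lintegral_mul_const _ hA]

/-- On a compact connected space, the mean oscillation is controlled at small scales. -/
lemma exists_lintegral_rpow_le_near [CompactSpace M] [PreconnectedSpace M] (μ : Measure M)
    [IsFiniteMeasure μ] [μ.IsOpenPosMeasure] {p : ℝ} (hp : 1 ≤ p) {r : ℝ≥0∞} (hr : 0 < r) :
    ∃ C : ℝ≥0∞, C ≠ ⊤ ∧ ∀ ρ : M → M → ℝ≥0∞, IsPairDist ρ →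
      ∫⁻ z, ρ z.1 z.2 ^ p ∂(μ.prod μ) ≤ C * ∫⁻ z in nearSet M r, ρ z.1 z.2 ^ p ∂(μ.prod μ) := by
  have h2 : (2 : ℝ≥0∞) ^ (p - 1) ≠ ⊤ := ENNReal.rpow_ne_top_of_nonneg (by linarith) (by simp)
  -- Two points are related when they have neighbourhoods whose mutual oscillation is controlled at
  -- scale r. The relation holds locally, and connectedness extends it to all pairs.
  set P : M → M → Prop := fun x y ↦ ∃ U V : Set M, IsOpen U ∧ IsOpen V ∧ x ∈ U ∧ y ∈ V ∧
    ∃ C : ℝ≥0∞, C ≠ ⊤ ∧ ∀ ρ : M → M → ℝ≥0∞, IsPairDist ρ →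
      ∫⁻ x in U, ∫⁻ y in V, ρ x y ^ p ∂μ ∂μ
        ≤ C * ∫⁻ z in nearSet M r, ρ z.1 z.2 ^ p ∂(μ.prod μ) with hP
  have hsymm : ∀ x y, P x y → P y x := by
    rintro x y ⟨U, V, hU, hV, hx, hy, C, hC, H⟩
    refine ⟨V, U, hV, hU, hy, hx, C, hC, fun ρ h ↦ le_trans (le_of_eq ?_) (H ρ h)⟩
    rw [lintegral_lintegral_swap (h.measurable.pow_const p).aemeasurable]
    simp_rw [h.comm]
  have hall : ∀ x y, P x y := by
    intro x y
    refine isPreconnected_univ.induction₂ P (fun x _ ↦ ?_) (fun x y w _ _ _ ↦ ?_)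
      (fun x y _ _ ↦ hsymm x y) (Set.mem_univ x) (Set.mem_univ y)
    · rw [nhdsWithin_univ]
      have hr2 : 0 < r / 2 := ENNReal.half_pos hr.ne'
      filter_upwards [Metric.eball_mem_nhds x hr2] with y hy
      refine ⟨Metric.eball x (r / 2), Metric.eball x (r / 2), Metric.isOpen_eball,
        Metric.isOpen_eball, Metric.mem_eball_self hr2, hy, 1, by simp, fun ρ h ↦ ?_⟩
      rw [one_mul, lintegral_lintegral (h.measurable.pow_const p).aemeasurable,
        Measure.prod_restrict]
      refine lintegral_mono_set fun z hz ↦ ?_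
      calc edist z.1 z.2 ≤ edist z.1 x + edist z.2 x := edist_triangle_right _ _ _
        _ < r / 2 + r / 2 := ENNReal.add_lt_add hz.1 hz.2
        _ = r := ENNReal.add_halves r
    · rintro ⟨U, V, hU, hV, hx, hy, C, hC, H⟩ hyw
      obtain ⟨W, V', hW, hV', hw, hy', C', hC', H'⟩ := hsymm _ _ hyw
      -- Transitivity: averaging over intermediate points in the nonempty open set Z, which has
      -- positive measure.
      set Z := V ∩ V'
      have hZ : IsOpen Z := hV.inter hV'
      have hZ0 : μ Z ≠ 0 := (hZ.measure_pos μ ⟨y, hy, hy'⟩).ne'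
      refine ⟨U, W, hU, hW, hx, hw, 2 ^ (p - 1) * (C * μ W + C' * μ U) / μ Z, ?_, fun ρ h ↦ ?_⟩
      · refine (ENNReal.div_lt_top (ENNReal.mul_ne_top h2 (ENNReal.add_ne_top.2 ⟨?_, ?_⟩)) hZ0).ne
        · exact ENNReal.mul_ne_top hC (measure_ne_top _ _)
        · exact ENNReal.mul_ne_top hC' (measure_ne_top _ _)
      · set T := ∫⁻ z in nearSet M r, ρ z.1 z.2 ^ p ∂(μ.prod μ)
        have key := lintegral_rpow_mul_measure_le h μ hp (U := U) (W := W) hZ.measurableSet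
        rw [ENNReal.mul_comm_div, ← mul_div_assoc, ENNReal.le_div_iff_mul_le (Or.inl hZ0)
          (Or.inl (measure_ne_top _ _))]
        refine key.trans ?_
        calc _ ≤ 2 ^ (p - 1) * (C * T * μ W + C' * T * μ U) := by
              gcongr
              · refine le_trans (lintegral_mono fun x ↦ lintegral_mono_set Set.inter_subset_left)
                  (H ρ h)
              · refine le_trans (lintegral_mono fun x ↦ lintegral_mono_set Set.inter_subset_right)
                  (H' ρ h)
          _ = _ := by ring
  have := isCompact_univ (X := M × M) |>.induction_on (p := fun S ↦ ∃ C : ℝ≥0∞, C ≠ ⊤ ∧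
      ∀ ρ : M → M → ℝ≥0∞, IsPairDist ρ → ∫⁻ z in S, ρ z.1 z.2 ^ p ∂(μ.prod μ)
        ≤ C * ∫⁻ z in nearSet M r, ρ z.1 z.2 ^ p ∂(μ.prod μ))
    ⟨0, by simp, fun ρ _ ↦ by simp⟩
    (fun S S' hS ⟨C, hC, H⟩ ↦ ⟨C, hC, fun ρ h ↦ (lintegral_mono_set hS).trans (H ρ h)⟩)
    (fun S S' ⟨C, hC, H⟩ ⟨C', hC', H'⟩ ↦ ⟨C + C', ENNReal.add_ne_top.2 ⟨hC, hC'⟩, fun ρ h ↦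
      (lintegral_union_le _ _ _).trans (by rw [add_mul]; exact add_le_add (H ρ h) (H' ρ h))⟩)
    (fun z _ ↦ ?_)
  · simpa using this
  · obtain ⟨U, V, hU, hV, hx, hy, C, hC, H⟩ := hall z.1 z.2
    refine ⟨U ×ˢ V, mem_nhdsWithin_of_mem_nhds ((hU.prod hV).mem_nhds ⟨hx, hy⟩), C, hC,
      fun ρ h ↦ ?_⟩
    have := H ρ h
    rwa [lintegral_lintegral (h.measurable.pow_const p).aemeasurable,
        Measure.prod_restrict] at this

/-- Beyond distance r the kernel is at most r^{-κ}, and below r it is at least r^{-κ}, so the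
unweighted estimate suffices. -/
lemma exists_lintegral_le_near [CompactSpace M] [PreconnectedSpace M] (μ : Measure M)
    [IsFiniteMeasure μ] [μ.IsOpenPosMeasure] {p κ : ℝ} (hp : 1 ≤ p) (hκ : 0 ≤ κ) {r : ℝ≥0∞}
    (hr : 0 < r) (hrt : r ≠ ⊤) :
    ∃ C : ℝ≥0∞, C ≠ ⊤ ∧ ∀ ρ : M → M → ℝ≥0∞, IsPairDist ρ →
      ∫⁻ z, ρ z.1 z.2 ^ p / edist z.1 z.2 ^ κ ∂(μ.prod μ)
        ≤ C * ∫⁻ z in nearSet M r, ρ z.1 z.2 ^ p / edist z.1 z.2 ^ κ ∂(μ.prod μ) := by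
  obtain ⟨C, hC, H⟩ := exists_lintegral_rpow_le_near μ hp hr
  have hrκ : r ^ κ ≠ ⊤ := ENNReal.rpow_ne_top_of_nonneg hκ hrt
  have hrκ0 : r ^ κ ≠ 0 := by simp [ENNReal.rpow_eq_zero_iff, hr.ne', hrt]
  refine ⟨1 + C, ENNReal.add_ne_top.2 ⟨by simp, hC⟩, fun ρ h ↦ ?_⟩
  set N := nearSet M r
  have hN : MeasurableSet N := measurableSet_nearSet r
  set T := ∫⁻ z in N, ρ z.1 z.2 ^ p / edist z.1 z.2 ^ κ ∂(μ.prod μ)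
  have hnear : ∫⁻ z in N, ρ z.1 z.2 ^ p ∂(μ.prod μ) ≤ r ^ κ * T := by
    rw [← lintegral_const_mul' _ _ hrκ]
    refine setLIntegral_mono' hN fun z hz ↦ ?_
    rcases eq_or_ne (edist z.1 z.2) 0 with h0 | h0
    · rw [edist_eq_zero.1 h0, h.self, ENNReal.zero_rpow_of_pos (by linarith)]
      exact bot_le
    have hle : edist z.1 z.2 ^ κ ≤ r ^ κ := ENNReal.rpow_le_rpow (le_of_lt hz) hκ
    have ht : edist z.1 z.2 ≠ ⊤ := ne_top_of_lt hz
    calc ρ z.1 z.2 ^ p = edist z.1 z.2 ^ κ * (ρ z.1 z.2 ^ p / edist z.1 z.2 ^ κ) := by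
          rw [ENNReal.mul_div_cancel]
          · simp [ENNReal.rpow_eq_zero_iff, h0, ht]
          · exact ENNReal.rpow_ne_top_of_nonneg hκ ht
      _ ≤ _ := by gcongr
  have hfar : ∫⁻ z in Nᶜ, ρ z.1 z.2 ^ p / edist z.1 z.2 ^ κ ∂(μ.prod μ) ≤ C * T := by
    calc ∫⁻ z in Nᶜ, ρ z.1 z.2 ^ p / edist z.1 z.2 ^ κ ∂(μ.prod μ)
        ≤ ∫⁻ z in Nᶜ, (r ^ κ)⁻¹ * ρ z.1 z.2 ^ p ∂(μ.prod μ) := by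
          refine setLIntegral_mono' hN.compl fun z hz ↦ ?_
          rw [mul_comm, div_eq_mul_inv]
          gcongr
          exact not_lt.1 hz
      _ ≤ (r ^ κ)⁻¹ * ∫⁻ z, ρ z.1 z.2 ^ p ∂(μ.prod μ) := by
          rw [lintegral_const_mul' _ _ (by simpa using hrκ0)]
          gcongr
          exact Measure.restrict_le_self
      _ ≤ (r ^ κ)⁻¹ * (C * (r ^ κ * T)) := by
          gcongr
          exact (H ρ h).trans (by gcongr)
      _ = (r ^ κ)⁻¹ * r ^ κ * (C * T) := by ring
      _ = C * T := by rw [ENNReal.inv_mul_cancel hrκ0 hrκ, one_mul]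
  rw [← lintegral_add_compl _ hN, add_mul, one_mul]
  gcongr

end Global

/-! ### Transfer of energies through bi-Lipschitz parametrizations -/

section GoodChart

variable {m : ℕ} {M : Type*} [EMetricSpace M] [MeasurableSpace M] [BorelSpace M]

/-- A parametrization of an open set by a Euclidean ball that is bi-Lipschitz and compares the
measures. -/
structure IsGoodChart (μ : Measure M) (ψ : EuclideanSpace ℝ (Fin m) → M)
    (z₀ : EuclideanSpace ℝ (Fin m)) (r : ℝ) (C : ℝ≥0∞) : Prop where
  pos : 0 < r
  one_le : 1 ≤ C
  ne_top : C ≠ ⊤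
  measurable : Measurable ψ
  isOpen : IsOpen (ψ '' Metric.ball z₀ r)
  edist_le : ∀ a ∈ Metric.ball z₀ r, ∀ b ∈ Metric.ball z₀ r, edist (ψ a) (ψ b) ≤ C * edist a b
  le_edist : ∀ a ∈ Metric.ball z₀ r, ∀ b ∈ Metric.ball z₀ r, edist a b ≤ C * edist (ψ a) (ψ b)
  restrict_le : μ.restrict (ψ '' Metric.ball z₀ r)
    ≤ C • (volume.restrict (Metric.ball z₀ r)).map ψ
  map_le : (volume.restrict (Metric.ball z₀ r)).map ψ ≤ C • μ

variable {μ : Measure M} {ψ : EuclideanSpace ℝ (Fin m) → M} {z₀ : EuclideanSpace ℝ (Fin m)}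
  {r : ℝ} {C : ℝ≥0∞}

lemma IsGoodChart.measure_ne_top (h : IsGoodChart μ ψ z₀ r C) : μ (ψ '' Metric.ball z₀ r) ≠ ⊤ := by
  have h1 := h.restrict_le Set.univ
  rw [Measure.restrict_apply_univ, Measure.smul_apply, Measure.map_apply h.measurable .univ,
    Set.preimage_univ, Measure.restrict_apply_univ, smul_eq_mul] at h1
  exact ne_top_of_le_ne_top (ENNReal.mul_ne_top h.ne_top measure_ball_lt_top.ne) h1

lemma IsGoodChart.measure_pos (h : IsGoodChart μ ψ z₀ r C) {O : Set M} (hO : IsOpen O)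
    {x : M} (hx : x ∈ O) (hxU : x ∈ ψ '' Metric.ball z₀ r) : μ O ≠ 0 := by
  intro h0
  have h1 := h.map_le O
  rw [Measure.smul_apply, h0, smul_zero, Measure.map_apply h.measurable hO.measurableSet,
    Measure.restrict_apply (h.measurable hO.measurableSet)] at h1
  obtain ⟨a, ha, rfl⟩ := hxU
  have hcont : ContinuousOn ψ (Metric.ball z₀ r) := by
    lift C to ℝ≥0 using h.ne_top
    have : LipschitzOnWith C ψ (Metric.ball z₀ r) := fun a ha b hb ↦ h.edist_le a ha b hb
    exact this.continuousOn
  have hopen : IsOpen (Metric.ball z₀ r ∩ ψ ⁻¹' O) :=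
    hcont.isOpen_inter_preimage Metric.isOpen_ball hO
  rw [Set.inter_comm] at h1
  exact (hopen.measure_pos volume ⟨a, ha, hx⟩).not_ge h1

lemma ENNReal.div_rpow_le_of_le_mul {C e e' : ℝ≥0∞} (hC1 : 1 ≤ C) (hC : C ≠ ⊤) (h : e ≤ C * e')
    {κ : ℝ} (hκ : 0 ≤ κ) (x : ℝ≥0∞) : x / e' ^ κ ≤ C ^ κ * (x / e ^ κ) := by
  have hC0 : C ≠ 0 := (one_pos.trans_le hC1).ne'
  have h0 : C ^ κ ≠ 0 := by simp [ENNReal.rpow_eq_zero_iff, hC0, hC]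
  have ht : C ^ κ ≠ ⊤ := ENNReal.rpow_ne_top_of_nonneg hκ hC
  have h1 : e ^ κ ≤ C ^ κ * e' ^ κ := by
    rw [← ENNReal.mul_rpow_of_nonneg _ _ hκ]
    exact ENNReal.rpow_le_rpow h hκ
  calc x / e' ^ κ = C ^ κ * (x * ((C ^ κ)⁻¹ * (e' ^ κ)⁻¹)) := by
        rw [div_eq_mul_inv, mul_left_comm x, ← mul_assoc, ENNReal.mul_inv_cancel h0 ht, one_mul]
    _ = C ^ κ * (x / (C ^ κ * e' ^ κ)) := by
        rw [div_eq_mul_inv, ENNReal.mul_inv (Or.inl h0) (Or.inl ht)]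
    _ ≤ _ := by gcongr

variable [SecondCountableTopology M]

/-- Comparing the product measures costs C², comparing the kernels costs C^κ. -/
lemma IsGoodChart.lintegral_le [SFinite μ] (h : IsGoodChart μ ψ z₀ r C) {κ : ℝ} (hκ : 0 ≤ κ)
    {F : M × M → ℝ≥0∞} (hF : Measurable F) :
    ∫⁻ z in (ψ '' Metric.ball z₀ r) ×ˢ (ψ '' Metric.ball z₀ r), F z / edist z.1 z.2 ^ κ ∂(μ.prod μ)
      ≤ C ^ 2 * C ^ κ * ∫⁻ z, F (ψ z.1, ψ z.2) / edist z.1 z.2 ^ κ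
        ∂((volume.restrict (Metric.ball z₀ r)).prod (volume.restrict (Metric.ball z₀ r))) := by
  set ν := volume.restrict (Metric.ball z₀ r) with hν
  have hG : Measurable fun z : M × M ↦ F z / edist z.1 z.2 ^ κ := by fun_prop
  have hκt : C ^ κ ≠ ⊤ := ENNReal.rpow_ne_top_of_nonneg hκ h.ne_top
  rw [← Measure.prod_restrict, mul_assoc, ← lintegral_const_mul' _ _ hκt]
  calc _ ≤ ∫⁻ z, F z / edist z.1 z.2 ^ κ ∂((C • ν.map ψ).prod (C • ν.map ψ)) :=
        lintegral_mono' (Measure.prod_mono h.restrict_le h.restrict_le) le_rfl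
    _ = C ^ 2 * ∫⁻ z, F z / edist z.1 z.2 ^ κ ∂((ν.map ψ).prod (ν.map ψ)) := by
        rw [Measure.prod_smul_left, Measure.prod_smul_right, lintegral_smul_measure,
          lintegral_smul_measure, smul_eq_mul, smul_eq_mul, ← mul_assoc, pow_two]
    _ = C ^ 2 * ∫⁻ z, F (ψ z.1, ψ z.2) / edist (ψ z.1) (ψ z.2) ^ κ ∂(ν.prod ν) := by
        rw [Measure.map_prod_map _ _ h.measurable h.measurable,
          lintegral_map hG (h.measurable.prodMap h.measurable)]
        rfl
    _ ≤ _ := by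
        refine mul_le_mul_right (lintegral_mono_ae ?_) _
        rw [hν, Measure.prod_restrict]
        filter_upwards [ae_restrict_mem (measurableSet_ball.prod measurableSet_ball)] with z hz
        exact ENNReal.div_rpow_le_of_le_mul h.one_le h.ne_top (h.le_edist _ hz.1 _ hz.2) hκ _

lemma IsGoodChart.le_lintegral [SFinite μ] (h : IsGoodChart μ ψ z₀ r C) {κ : ℝ} (hκ : 0 ≤ κ)
    {F : M × M → ℝ≥0∞} (hF : Measurable F) :
    ∫⁻ z, F (ψ z.1, ψ z.2) / edist z.1 z.2 ^ κ
        ∂((volume.restrict (Metric.ball z₀ r)).prod (volume.restrict (Metric.ball z₀ r)))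
      ≤ C ^ 2 * C ^ κ * ∫⁻ z, F z / edist z.1 z.2 ^ κ ∂(μ.prod μ) := by
  set ν := volume.restrict (Metric.ball z₀ r) with hν
  have hG : Measurable fun z : M × M ↦ F z / edist z.1 z.2 ^ κ := by fun_prop
  have hκt : C ^ κ ≠ ⊤ := ENNReal.rpow_ne_top_of_nonneg hκ h.ne_top
  calc ∫⁻ z, F (ψ z.1, ψ z.2) / edist z.1 z.2 ^ κ ∂(ν.prod ν)
      ≤ ∫⁻ z, C ^ κ * (F (ψ z.1, ψ z.2) / edist (ψ z.1) (ψ z.2) ^ κ) ∂(ν.prod ν) := by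
        refine lintegral_mono_ae ?_
        rw [hν, Measure.prod_restrict]
        filter_upwards [ae_restrict_mem (measurableSet_ball.prod measurableSet_ball)] with z hz
        exact ENNReal.div_rpow_le_of_le_mul h.one_le h.ne_top (h.edist_le _ hz.1 _ hz.2) hκ _
    _ = C ^ κ * ∫⁻ z, F z / edist z.1 z.2 ^ κ ∂((ν.map ψ).prod (ν.map ψ)) := by
        rw [lintegral_const_mul' _ _ hκt, Measure.map_prod_map _ _ h.measurable h.measurable,
          lintegral_map hG (h.measurable.prodMap h.measurable)]
        rfl
    _ ≤ C ^ κ * ∫⁻ z, F z / edist z.1 z.2 ^ κ ∂((C • μ).prod (C • μ)) := by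
        gcongr
        · exact h.map_le
        · exact h.map_le
    _ = _ := by
        rw [Measure.prod_smul_left, Measure.prod_smul_right, lintegral_smul_measure,
          lintegral_smul_measure, smul_eq_mul, smul_eq_mul]
        ring

/-- The local lifting estimate in a good chart. -/
lemma IsGoodChart.exists_lift_energy_le [SFinite μ] (h : IsGoodChart μ ψ z₀ r C) (hm : 1 ≤ m)
    (δ : ℝ≥0∞) {p q : ℝ} (hq : 1 < q) (hqp : q < p) :
    ∃ C' : ℝ≥0∞, C' ≠ ⊤ ∧ ∀ ρ σ : M → M → ℝ≥0∞, IsLiftPair δ ρ σ →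
      ∫⁻ z in farSet ρ δ, 1 / edist z.1 z.2 ^ ((m : ℝ) + 1) ∂(μ.prod μ) ≠ ⊤ →
      ∫⁻ z in (ψ '' Metric.ball z₀ r) ×ˢ (ψ '' Metric.ball z₀ r),
          ρ z.1 z.2 ^ p / edist z.1 z.2 ^ ((m : ℝ) + q) ∂(μ.prod μ)
        ≤ C' * (1 + ∫⁻ z, σ z.1 z.2 ^ p / edist z.1 z.2 ^ (2 * (m : ℝ)) ∂(μ.prod μ)) ^
            ((p - q) / (m : ℝ))
          * ∫⁻ z, σ z.1 z.2 ^ p / edist z.1 z.2 ^ ((m : ℝ) + q) ∂(μ.prod μ) := by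
  have hm0 : (0 : ℝ) < m := by exact_mod_cast hm
  have hexp : 0 ≤ (p - q) / (m : ℝ) := div_nonneg (by linarith) hm0.le
  have hD : ∀ κ : ℝ, 0 < κ → C ^ 2 * C ^ κ ≠ ⊤ ∧ 1 ≤ C ^ 2 * C ^ κ := fun κ hκ ↦
    ⟨ENNReal.mul_ne_top (ENNReal.pow_ne_top h.ne_top) (ENNReal.rpow_ne_top_of_nonneg hκ.le h.ne_top),
      one_le_mul (one_le_pow₀ h.one_le) (ENNReal.one_le_rpow h.one_le hκ)⟩
  obtain ⟨A, hA, H⟩ := exists_lift_energy_le_ball hm z₀ h.pos δ hq hqp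
  have hq0 : 0 < (m : ℝ) + q := by linarith
  have hm2 : 0 < 2 * (m : ℝ) := by linarith
  set D := C ^ 2 * C ^ ((m : ℝ) + q) with hDdef
  set D' := C ^ 2 * C ^ (2 * (m : ℝ)) with hDdef'
  refine ⟨D * (A * D' ^ ((p - q) / (m : ℝ)) * D), ?_, fun ρ σ hl hfin ↦ ?_⟩
  · exact ENNReal.mul_ne_top (hD _ hq0).1 (ENNReal.mul_ne_top (ENNReal.mul_ne_top hA
      (ENNReal.rpow_ne_top_of_nonneg hexp (hD _ hm2).1)) (hD _ hq0).1)
  have hfr : Module.finrank ℝ (EuclideanSpace ℝ (Fin m)) = m := by simp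
  have hl' := hl.comp h.measurable
  have e : ∀ (κ : ℝ) {F : EuclideanSpace ℝ (Fin m) × EuclideanSpace ℝ (Fin m) → ℝ≥0∞},
      Measurable F → ∫⁻ z, F z ∂(kernelMeasure volume (Metric.ball z₀ r) κ)
      = ∫⁻ z, F z / edist z.1 z.2 ^ ((m : ℝ) + κ)
        ∂((volume.restrict (Metric.ball z₀ r)).prod (volume.restrict (Metric.ball z₀ r))) :=
    fun κ {F} hF ↦ by rw [lintegral_kernelMeasure _ _ _ hF, hfr]
  have hρm := hl.dist.measurable.pow_const p
  have hσm := hl.measurable.pow_const p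
  have hS := hl.dist.measurableSet_farSet δ
  have hfin' : kernelMeasure volume (Metric.ball z₀ r) 1
      (farSet (fun x y ↦ ρ (ψ x) (ψ y)) δ) ≠ ⊤ := by
    rw [← lintegral_indicator_one (hl'.dist.measurableSet_farSet δ),
      e 1 (measurable_one.indicator (hl'.dist.measurableSet_farSet δ))]
    refine ne_top_of_le_ne_top (ENNReal.mul_ne_top (hD ((m : ℝ) + 1) (by linarith)).1 hfin) ?_
    have := h.le_lintegral (κ := (m : ℝ) + 1) (by linarith)
      (measurable_one.indicator hS : Measurable ((farSet ρ δ).indicator (1 : M × M → ℝ≥0∞)))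
    refine this.trans (le_of_eq ?_)
    congr 1
    rw [← lintegral_indicator hS]
    refine lintegral_congr fun z ↦ ?_
    by_cases hz : z ∈ farSet ρ δ <;> simp [hz]
  have key := H _ _ hl' hfin'
  have e1 := e q (hl'.dist.measurable.pow_const p)
  have e2 := e m (hl'.measurable.pow_const p)
  have e3 := e q (hl'.measurable.pow_const p)
  rw [e1, e2, e3, ← two_mul] at key
  have b1 := h.lintegral_le hq0.le hρm
  have b2 := h.le_lintegral hm2.le hσm
  have b3 := h.le_lintegral hq0.le hσm
  set X := ∫⁻ z, σ z.1 z.2 ^ p / edist z.1 z.2 ^ (2 * (m : ℝ)) ∂(μ.prod μ)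
  set Y := ∫⁻ z, σ z.1 z.2 ^ p / edist z.1 z.2 ^ ((m : ℝ) + q) ∂(μ.prod μ)
  calc _ ≤ D * _ := b1
    _ ≤ D * (A * (1 + D' * X) ^ ((p - q) / (m : ℝ)) * (D * Y)) := by
        refine mul_le_mul_right (key.trans ?_) _
        refine mul_le_mul' (mul_le_mul_right (ENNReal.rpow_le_rpow ?_ hexp) _) b3
        exact add_le_add le_rfl b2
    _ ≤ D * (A * (D' * (1 + X)) ^ ((p - q) / (m : ℝ)) * (D * Y)) := by
        gcongr
        rw [mul_add, mul_one]
        gcongr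
        exact (hD _ hm2).2
    _ = _ := by
        rw [ENNReal.mul_rpow_of_nonneg _ _ hexp]
        ring

end GoodChart


/-! ### The lifting estimate on a compact connected space -/

section GlobalLift

variable {m : ℕ} {M : Type*} [EMetricSpace M] [MeasurableSpace M] [BorelSpace M]

/-- Every point lies in the domain of a good chart. -/
def HasGoodCharts (m : ℕ) (μ : Measure M) : Prop :=
  ∀ x : M, ∃ (ψ : EuclideanSpace ℝ (Fin m) → M) (z₀ : EuclideanSpace ℝ (Fin m)) (r : ℝ) (C : ℝ≥0∞),
    IsGoodChart μ ψ z₀ r C ∧ x ∈ ψ '' Metric.ball z₀ r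

variable {μ : Measure M}

lemma HasGoodCharts.isFiniteMeasure [CompactSpace M] (h : HasGoodCharts m μ) :
    IsFiniteMeasure μ := by
  refine ⟨isCompact_univ.measure_lt_top_of_nhdsWithin fun x _ ↦ ?_⟩
  obtain ⟨ψ, z₀, r, C, hc, hx⟩ := h x
  exact ⟨_, mem_nhdsWithin_of_mem_nhds (hc.isOpen.mem_nhds hx), hc.measure_ne_top.lt_top⟩

lemma HasGoodCharts.isOpenPosMeasure (h : HasGoodCharts m μ) : μ.IsOpenPosMeasure := by
  refine ⟨fun O hO ⟨x, hx⟩ ↦ ?_⟩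
  obtain ⟨ψ, z₀, r, C, hc, hxU⟩ := h x
  exact hc.measure_pos hO hx hxU

/-- The lifting estimate for pairs of distances on a compact connected space with good charts. -/
theorem HasGoodCharts.exists_lift_energy_le [CompactSpace M] [PreconnectedSpace M]
    (h : HasGoodCharts m μ) (hm : 1 ≤ m) (δ : ℝ≥0∞) {p q : ℝ} (hq : 1 < q) (hqp : q < p) :
    ∃ C : ℝ≥0∞, C ≠ ⊤ ∧ ∀ ρ σ : M → M → ℝ≥0∞, IsLiftPair δ ρ σ →
      ∫⁻ z in farSet ρ δ, 1 / edist z.1 z.2 ^ ((m : ℝ) + 1) ∂(μ.prod μ) ≠ ⊤ →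
      ∫⁻ z, ρ z.1 z.2 ^ p / edist z.1 z.2 ^ ((m : ℝ) + q) ∂(μ.prod μ)
        ≤ C * (1 + ∫⁻ z, σ z.1 z.2 ^ p / edist z.1 z.2 ^ (2 * (m : ℝ)) ∂(μ.prod μ)) ^
            ((p - q) / (m : ℝ))
          * ∫⁻ z, σ z.1 z.2 ^ p / edist z.1 z.2 ^ ((m : ℝ) + q) ∂(μ.prod μ) := by
  have := h.isFiniteMeasure
  have := h.isOpenPosMeasure
  choose ψ z₀ r c hc hx using h
  set U : M → Set M := fun x ↦ ψ x '' Metric.ball (z₀ x) (r x) with hU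
  choose C' hC' H using fun x ↦ (hc x).exists_lift_energy_le hm δ hq hqp
  obtain ⟨t, ht⟩ := isCompact_univ.elim_finite_subcover U (fun x ↦ (hc x).isOpen)
    (fun x _ ↦ Set.mem_iUnion.2 ⟨x, hx x⟩)
  -- Below the Lebesgue number, both points of a pair lie in a common chart, where the local
  -- estimate applies.
  obtain ⟨ε, hε, hleb⟩ := lebesgue_number_lemma_of_emetric (isCompact_univ (X := M))
    (c := fun x : t ↦ U x) (fun x ↦ (hc x).isOpen) (by simpa [Set.iUnion_subtype] using ht)
  set ε' := min ε 1
  have hε' : 0 < ε' := lt_min hε one_pos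
  obtain ⟨A, hA, HA⟩ := exists_lintegral_le_near μ (p := p) (κ := (m : ℝ) + q) (by linarith)
    (by positivity) hε' (ne_top_of_le_ne_top ENNReal.one_ne_top (min_le_right _ _))
  refine ⟨A * ∑ x : t, C' x, ENNReal.mul_ne_top hA (ENNReal.sum_ne_top.2 fun x _ ↦ hC' x),
    fun ρ σ hl hfin ↦ ?_⟩
  have hsub : nearSet M ε' ⊆ ⋃ x : t, U x ×ˢ U x := fun z hz ↦ by
    obtain ⟨i, hi⟩ := hleb z.1 (Set.mem_univ _)
    refine Set.mem_iUnion.2 ⟨i, hi (Metric.mem_eball_self hε), hi ?_⟩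
    rw [Metric.mem_eball, edist_comm]
    exact lt_of_lt_of_le hz (min_le_left _ _)
  calc _ ≤ A * _ := HA ρ hl.dist
    _ ≤ A * ∑ x : t, ∫⁻ z in U x ×ˢ U x, ρ z.1 z.2 ^ p / edist z.1 z.2 ^ ((m : ℝ) + q)
          ∂(μ.prod μ) := by
        gcongr
        refine (lintegral_mono_set hsub).trans ((lintegral_iUnion_le _ _).trans ?_)
        rw [tsum_fintype]
    _ ≤ A * ∑ x : t, C' x * (1 + ∫⁻ z, σ z.1 z.2 ^ p / edist z.1 z.2 ^ (2 * (m : ℝ)) ∂(μ.prod μ)) ^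
            ((p - q) / (m : ℝ))
          * ∫⁻ z, σ z.1 z.2 ^ p / edist z.1 z.2 ^ ((m : ℝ) + q) ∂(μ.prod μ) := by
        gcongr with x
        exact H x ρ σ hl hfin
    _ = _ := by
        rw [← Finset.sum_mul, ← Finset.sum_mul]
        ring

variable [SecondCountableTopology M]

lemma gagliardoEnergy_eq_lintegral_prod [SFinite μ] {E : Type*} [EMetricSpace E] {u : M → E}
    (hu : Measurable fun z : M × M ↦ edist (u z.1) (u z.2)) (p κ : ℝ) :
    gagliardoEnergy μ p κ u = ∫⁻ z, edist (u z.1) (u z.2) ^ p / edist z.1 z.2 ^ κ ∂(μ.prod μ) := by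
  rw [lintegral_prod _ (by fun_prop)]
  unfold gagliardoEnergy
  simp_rw [edist_comm]

lemma gagliardoEnergy_congr {E : Type*} [EMetricSpace E] {u v : M → E} (h : u =ᵐ[μ] v) (p κ : ℝ) :
    gagliardoEnergy μ p κ u = gagliardoEnergy μ p κ v := by
  unfold gagliardoEnergy
  refine lintegral_congr_ae ?_
  filter_upwards [h] with x hx
  refine lintegral_congr_ae ?_
  filter_upwards [h] with y hy
  rw [hx, hy]

lemma MemLiftingSpace.congr {E N : Type*} [EMetricSpace E] [MeasurableSpace E] [EMetricSpace N]
    {u v : M → E} (hu : MemLiftingSpace m μ N u) (h : u =ᵐ[μ] v) : MemLiftingSpace m μ N v := by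
  refine ⟨hu.1.congr h, lt_of_eq_of_lt (lintegral_congr_ae ?_) hu.2⟩
  filter_upwards [h] with x hx
  refine setLIntegral_congr (Filter.eventuallyEq_set.2 ?_)
  filter_upwards [h] with y hy
  simp only [hx, hy]

/-- The lifting estimate for maps, for a map that is isometric at distances less than the
injectivity radius. -/
theorem HasGoodCharts.exists_gagliardoEnergy_le [CompactSpace M] [PreconnectedSpace M]
    (h : HasGoodCharts m μ) (hm : 1 ≤ m) {s p : ℝ} (hs₁ : s < 1)
    (hp : 1 < p) (hsp : 1 < s * p) {N N' : Type*} [EMetricSpace N] [EMetricSpace N']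
    [SecondCountableTopology N'] [MeasurableSpace N'] [BorelSpace N'] {cov : N' → N}
    (hle : ∀ a b, edist (cov a) (cov b) ≤ edist a b)
    (heq : ∀ a b, edist a b < injectivityRadius N → edist (cov a) (cov b) = edist a b) :
    ∃ C : ℝ, 0 < C ∧ ∀ v : M → N', MemLiftingSpace m μ N v →
      gagliardoEnergy μ p (m + s * p) v ≤ ENNReal.ofReal C
        * (1 + gagliardoEnergy μ p (2 * m) (cov ∘ v)) ^ ((1 - s) * p / m)
        * gagliardoEnergy μ p (m + s * p) (cov ∘ v) := by
  have := h.isFiniteMeasure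
  have hcov : Continuous cov := by
    have : LipschitzWith 1 cov := fun a b ↦ by simpa using hle a b
    exact this.continuous
  -- Here q = sp, so that p - q = (1-s)p.
  obtain ⟨C, hC, H⟩ := h.exists_lift_energy_le hm (injectivityRadius N / 2) hsp
    (show s * p < p by nlinarith)
  refine ⟨C.toReal + 1, by positivity, fun v hv ↦ ?_⟩
  -- Energies and membership in X do not see null sets, so a measurable representative may be used.
  obtain ⟨v', hv'm, hvv'⟩ := hv.1
  have hv' := hv.congr hvv'
  rw [gagliardoEnergy_congr hvv', gagliardoEnergy_congr (hvv'.fun_comp cov),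
    gagliardoEnergy_congr (hvv'.fun_comp cov)]
  have hm1 : Measurable fun z : M × M ↦ edist (v' z.1) (v' z.2) := by fun_prop
  have hm2 : Measurable fun z : M × M ↦ edist (cov (v' z.1)) (cov (v' z.2)) := by
    have h2 : Measurable fun w : N' × N' ↦ edist (cov w.1) (cov w.2) :=
      Continuous.measurable (by fun_prop)
    exact h2.comp (hv'm.prodMap hv'm)
  have hl : IsLiftPair (injectivityRadius N / 2) (fun x y ↦ edist (v' x) (v' y))
      (fun x y ↦ edist (cov (v' x)) (cov (v' y))) :=
    { dist := ⟨hm1, fun x ↦ edist_self _, fun x y ↦ edist_comm _ _,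
        fun x y z ↦ edist_triangle _ _ _⟩
      measurable := hm2
      le := fun x y ↦ hle _ _
      eq := fun x y hxy ↦ heq _ _ (by rwa [ENNReal.mul_div_cancel two_ne_zero (by simp)] at hxy) }
  have hS := hl.dist.measurableSet_farSet (injectivityRadius N / 2)
  have hfin : ∫⁻ z in farSet (fun x y ↦ edist (v' x) (v' y)) (injectivityRadius N / 2),
      1 / edist z.1 z.2 ^ ((m : ℝ) + 1) ∂(μ.prod μ) ≠ ⊤ := by
    refine ne_of_eq_of_ne ?_ hv'.2.ne
    rw [← lintegral_indicator hS, lintegral_prod _ ?_]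
    · refine lintegral_congr fun x ↦ ?_
      rw [← lintegral_indicator]
      · rfl
      · exact measurableSet_le measurable_const (by fun_prop)
    · exact ((measurable_const.div (by fun_prop)).indicator hS).aemeasurable
  have key := H _ _ hl hfin
  rw [gagliardoEnergy_eq_lintegral_prod hm1, gagliardoEnergy_eq_lintegral_prod hm2,
    gagliardoEnergy_eq_lintegral_prod hm2]
  rw [show (1 - s) * p = p - s * p by ring]
  refine key.trans ?_
  refine mul_le_mul' (mul_le_mul' ?_ le_rfl) le_rfl
  exact ENNReal.le_ofReal_iff_toReal_le hC (by positivity) |>.2 (by linarith)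

end GlobalLift


/-! ### Charts of a Riemannian manifold -/

section Charts

variable {E : Type*} [NormedAddCommGroup E] [NormedSpace ℝ E]
  {M : Type*} [EMetricSpace M] [ChartedSpace E M] [IsManifold 𝓘(ℝ, E) 1 M]
  [RiemannianBundle (fun x : M ↦ TangentSpace 𝓘(ℝ, E) x)]
  [IsContinuousRiemannianBundle E (fun x : M ↦ TangentSpace 𝓘(ℝ, E) x)]

attribute [local instance] normedAddCommGroupTangentSpaceVectorSpace
attribute [local instance] normedSpaceTangentSpaceVectorSpace

/-- Near its centre, the derivatives of a chart and of its inverse are bounded. -/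
lemma exists_chart_derivative_bounds (x : M) :
    ∃ C : ℝ≥0, 0 < C ∧ ∃ r > 0, Metric.ball (chartAt E x x) r ⊆ (chartAt E x).target ∧
      ∀ z ∈ Metric.ball (chartAt E x x) r,
        (∀ v : E, ‖(mfderiv 𝓘(ℝ, E) 𝓘(ℝ, E) (chartAt E x).symm z v :
          TangentSpace 𝓘(ℝ, E) ((chartAt E x).symm z))‖ₑ ≤ C * ‖v‖ₑ) ∧
        ∀ w : TangentSpace 𝓘(ℝ, E) ((chartAt E x).symm z),
          ‖(mfderiv 𝓘(ℝ, E) 𝓘(ℝ, E) (chartAt E x) ((chartAt E x).symm z) w : E)‖ₑ ≤ C * ‖w‖ₑ := by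
  obtain ⟨C₁, hC₁, h₁⟩ := eventually_enorm_mfderivWithin_symm_extChartAt_lt 𝓘(ℝ, E) x
  obtain ⟨C₂, hC₂, h₂⟩ := eventually_enorm_mfderiv_extChartAt_lt 𝓘(ℝ, E) x
  have hcont : ContinuousAt (chartAt E x).symm (chartAt E x x) :=
    (chartAt E x).continuousAt_symm (mem_chart_target E x)
  rw [ContinuousAt, (chartAt E x).left_inv (mem_chart_source E x)] at hcont
  have h₃ := hcont.eventually h₂
  have h₄ : (chartAt E x).target ∈ 𝓝 (chartAt E x x) :=
    (chartAt E x).open_target.mem_nhds (mem_chart_target E x)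
  simp only [mfld_simps, nhdsWithin_univ, mfderivWithin_univ] at h₁ h₃
  obtain ⟨r, hr, hsub⟩ := Metric.mem_nhds_iff.1 (Filter.inter_mem h₄ (Filter.inter_mem h₁ h₃))
  refine ⟨max C₁ C₂, lt_max_of_lt_left hC₁, r, hr, fun z hz ↦ (hsub hz).1, fun z hz ↦ ⟨fun v ↦ ?_,
    fun w ↦ ?_⟩⟩
  · refine (ContinuousLinearMap.le_opENorm _ _).trans ?_
    refine mul_le_mul' (((hsub hz).2.1.le).trans ?_) le_rfl
    exact_mod_cast le_max_left _ _
  · refine (ContinuousLinearMap.le_opENorm _ _).trans ?_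
    refine mul_le_mul' (((hsub hz).2.2.le).trans ?_) le_rfl
    exact_mod_cast le_max_right _ _

end Charts


/-! ### Lengths of paths and distances in charts -/

section PathLength

variable {E : Type*} [NormedAddCommGroup E] [NormedSpace ℝ E]
  {M : Type*} [TopologicalSpace M] [ChartedSpace E M]
  [∀ x : M, ENorm (TangentSpace 𝓘(ℝ, E) x)]
  {F : Type*} [NormedAddCommGroup F] [NormedSpace ℝ F]
  {N : Type*} [TopologicalSpace N] [ChartedSpace F N]
  [∀ x : N, ENorm (TangentSpace 𝓘(ℝ, F) x)]

lemma pathELength_comp_le {γ : ℝ → M} {f : M → N} {a b : ℝ} {C : ℝ≥0}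
    (hγ : ∀ t ∈ Set.Ioo a b, MDifferentiableAt 𝓘(ℝ, ℝ) 𝓘(ℝ, E) γ t)
    (hf : ∀ t ∈ Set.Ioo a b, MDifferentiableAt 𝓘(ℝ, E) 𝓘(ℝ, F) f (γ t))
    (hC : ∀ t ∈ Set.Ioo a b, ∀ w : TangentSpace 𝓘(ℝ, E) (γ t),
      ‖mfderiv 𝓘(ℝ, E) 𝓘(ℝ, F) f (γ t) w‖ₑ ≤ C * ‖w‖ₑ) :
    pathELength 𝓘(ℝ, F) (f ∘ γ) a b ≤ C * pathELength 𝓘(ℝ, E) γ a b := by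
  rw [pathELength_eq_lintegral_mfderiv_Ioo, pathELength_eq_lintegral_mfderiv_Ioo,
    ← lintegral_const_mul' _ _ ENNReal.coe_ne_top]
  refine setLIntegral_mono' measurableSet_Ioo fun t ht ↦ ?_
  rw [mfderiv_comp t (hf t ht) (hγ t ht)]
  exact hC t ht _

end PathLength

section ChartDistance

variable {E : Type*} [NormedAddCommGroup E] [NormedSpace ℝ E]
  {M : Type*} [EMetricSpace M] [ChartedSpace E M] [IsManifold 𝓘(ℝ, E) 1 M]
  [RiemannianBundle (fun x : M ↦ TangentSpace 𝓘(ℝ, E) x)]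
  [IsContinuousRiemannianBundle E (fun x : M ↦ TangentSpace 𝓘(ℝ, E) x)]
  [IsRiemannianManifold 𝓘(ℝ, E) M]

attribute [local instance] normedAddCommGroupTangentSpaceVectorSpace
attribute [local instance] normedSpaceTangentSpaceVectorSpace

omit [IsManifold 𝓘(ℝ, E) 1 M] [IsContinuousRiemannianBundle E (fun x : M ↦ TangentSpace 𝓘(ℝ, E) x)] in
lemma edist_le_pathELength {γ : ℝ → M} {a b : ℝ} (hab : a ≤ b)
    (hγ : ContMDiffOn 𝓘(ℝ, ℝ) 𝓘(ℝ, E) 1 γ (Set.Icc a b)) :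
    edist (γ a) (γ b) ≤ pathELength 𝓘(ℝ, E) γ a b := by
  rw [IsRiemannianManifold.out (I := 𝓘(ℝ, E))]
  exact riemannianEDist_le_pathELength hγ rfl rfl hab

omit [IsManifold 𝓘(ℝ, E) 1 M] [IsContinuousRiemannianBundle E (fun x : M ↦ TangentSpace 𝓘(ℝ, E) x)] in
lemma exists_path_of_edist_lt {x y : M} {c : ℝ≥0∞} (h : edist x y < c) :
    ∃ γ : ℝ → M, γ 0 = x ∧ γ 1 = y ∧ ContMDiff 𝓘(ℝ, ℝ) 𝓘(ℝ, E) 1 γ ∧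
      pathELength 𝓘(ℝ, E) γ 0 1 < c := by
  rw [IsRiemannianManifold.out (I := 𝓘(ℝ, E))] at h
  obtain ⟨γ, h0, h1, hγ, hl, -⟩ := exists_lt_locally_constant_of_riemannianEDist_lt h zero_lt_one
  exact ⟨γ, h0, h1, hγ, hl⟩

/-- The parametrization by a chart is Lipschitz near the centre. -/
lemma edist_chart_symm_le {x : M} {C : ℝ≥0} {r : ℝ}
    (hr : Metric.ball (chartAt E x x) r ⊆ (chartAt E x).target)
    (hC : ∀ z ∈ Metric.ball (chartAt E x x) r, ∀ v : E,
      ‖(mfderiv 𝓘(ℝ, E) 𝓘(ℝ, E) (chartAt E x).symm z v :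
          TangentSpace 𝓘(ℝ, E) ((chartAt E x).symm z))‖ₑ ≤ C * ‖v‖ₑ)
    {a b : E} (ha : a ∈ Metric.ball (chartAt E x x) r) (hb : b ∈ Metric.ball (chartAt E x x) r) :
    edist ((chartAt E x).symm a) ((chartAt E x).symm b) ≤ C * edist a b := by
  set η : ℝ →ᴬ[ℝ] E := ContinuousAffineMap.lineMap a b
  have hη : ContMDiff 𝓘(ℝ, ℝ) 𝓘(ℝ, E) 1 η := by
    rw [contMDiff_iff_contDiff]; exact η.contDiff
  have hmem : ∀ t ∈ Set.Icc (0 : ℝ) 1, η t ∈ Metric.ball (chartAt E x x) r := fun t ht ↦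
    (convex_ball _ _).lineMap_mem ha hb ht
  have h0 : η 0 = a := AffineMap.lineMap_apply_zero a b
  have h1 : η 1 = b := AffineMap.lineMap_apply_one a b
  have hlen := edist_le_pathELength (M := M) (γ := (chartAt E x).symm ∘ η) zero_le_one
    ((contMDiffOn_chart_symm (I := 𝓘(ℝ, E)) (n := 1)).comp hη.contMDiffOn
      fun t ht ↦ hr (hmem t ht))
  simp only [Function.comp_apply, h0, h1] at hlen
  have hcomp : pathELength 𝓘(ℝ, E) ((chartAt E x).symm ∘ η) 0 1
      ≤ C * pathELength 𝓘(ℝ, E) η 0 1 := by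
    refine pathELength_comp_le (fun t _ ↦ hη.mdifferentiable one_ne_zero t) (fun t ht ↦ ?_)
      (fun t ht w ↦ ?_)
    · exact mdifferentiableAt_atlas_symm (chart_mem_atlas E x) (hr (hmem t ⟨ht.1.le, ht.2.le⟩))
    · exact hC _ (hmem t ⟨ht.1.le, ht.2.le⟩) w
  refine hlen.trans (hcomp.trans ?_)
  gcongr
  rw [← lintegral_fderiv_lineMap_eq_edist, pathELength_eq_lintegral_mfderivWithin_Icc]
  simp only [mfderivWithin_eq_fderivWithin]
  exact le_of_eq rfl

/-- A chart is Lipschitz along paths that stay near its centre. -/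
lemma edist_chart_le_pathELength {x : M} {C : ℝ≥0} {S : Set M} (hS : S ⊆ (chartAt E x).source)
    (hC : ∀ y ∈ S, ∀ w : TangentSpace 𝓘(ℝ, E) y,
      ‖(mfderiv 𝓘(ℝ, E) 𝓘(ℝ, E) (chartAt E x) y w : E)‖ₑ ≤ C * ‖w‖ₑ)
    {γ : ℝ → M} (hγ : ContMDiff 𝓘(ℝ, ℝ) 𝓘(ℝ, E) 1 γ) {a b : ℝ} (hab : a ≤ b)
    (hmem : ∀ t ∈ Set.Icc a b, γ t ∈ S) :
    edist (chartAt E x (γ a)) (chartAt E x (γ b)) ≤ C * pathELength 𝓘(ℝ, E) γ a b := by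
  have h1 : ContMDiffOn 𝓘(ℝ, ℝ) 𝓘(ℝ, E) 1 (chartAt E x ∘ γ) (Set.Icc a b) :=
    (contMDiffOn_chart (I := 𝓘(ℝ, E)) (n := 1)).comp hγ.contMDiffOn fun t ht ↦ hS (hmem t ht)
  have h2 := pathELength_comp_le (C := C) (γ := γ) (f := chartAt E x) (a := a) (b := b)
    (fun t _ ↦ hγ.mdifferentiable one_ne_zero t)
    (fun t ht ↦ mdifferentiableAt_atlas (chart_mem_atlas E x) (hS (hmem t ⟨ht.1.le, ht.2.le⟩)))
    (fun t ht w ↦ hC _ (hmem t ⟨ht.1.le, ht.2.le⟩) w)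
  refine le_trans ?_ h2
  rw [edist_comm, edist_eq_enorm_sub, pathELength_eq_lintegral_mfderivWithin_Icc]
  refine (enorm_sub_le_lintegral_derivWithin_Icc_of_contDiffOn_Icc
    (contMDiffOn_iff_contDiffOn.1 h1) hab).trans (le_of_eq ?_)
  simp_rw [← fderivWithin_derivWithin, mfderivWithin_eq_fderivWithin]
  rfl

end ChartDistance


/-! ### Charts are locally bi-Lipschitz -/

section BiLipschitz

variable {E : Type*} [NormedAddCommGroup E] [NormedSpace ℝ E]
  {M : Type*} [EMetricSpace M] [ChartedSpace E M] [IsManifold 𝓘(ℝ, E) 1 M]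
  [RiemannianBundle (fun x : M ↦ TangentSpace 𝓘(ℝ, E) x)]
  [IsContinuousRiemannianBundle E (fun x : M ↦ TangentSpace 𝓘(ℝ, E) x)]
  [IsRiemannianManifold 𝓘(ℝ, E) M]

attribute [local instance] normedAddCommGroupTangentSpaceVectorSpace
attribute [local instance] normedSpaceTangentSpaceVectorSpace

/-- Near its centre, a chart is bi-Lipschitz and its derivatives are bounded. -/
lemma exists_biLipschitz_chart (x : M) :
    ∃ C : ℝ≥0, 1 ≤ C ∧ ∃ r > 0, Metric.ball (chartAt E x x) r ⊆ (chartAt E x).target ∧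
      (∀ z ∈ Metric.ball (chartAt E x x) r,
        (∀ v : E, ‖(mfderiv 𝓘(ℝ, E) 𝓘(ℝ, E) (chartAt E x).symm z v :
          TangentSpace 𝓘(ℝ, E) ((chartAt E x).symm z))‖ₑ ≤ C * ‖v‖ₑ) ∧
        ∀ w : TangentSpace 𝓘(ℝ, E) ((chartAt E x).symm z),
          ‖(mfderiv 𝓘(ℝ, E) 𝓘(ℝ, E) (chartAt E x) ((chartAt E x).symm z) w : E)‖ₑ ≤ C * ‖w‖ₑ) ∧
      ∀ a ∈ Metric.ball (chartAt E x x) r, ∀ b ∈ Metric.ball (chartAt E x x) r,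
        edist ((chartAt E x).symm a) ((chartAt E x).symm b) ≤ C * edist a b ∧
        edist a b ≤ C * edist ((chartAt E x).symm a) ((chartAt E x).symm b) := by
  obtain ⟨C₀, hC₀, r₀, hr₀, hsub, hbd⟩ := exists_chart_derivative_bounds (E := E) x
  set e := chartAt E x with he
  set C := max C₀ 1 with hC
  have hC0 : (C : ℝ≥0∞) ≠ 0 := by simp [hC]
  have hCle : (C₀ : ℝ≥0∞) ≤ C := by exact_mod_cast le_max_left _ _
  set S : Set M := e.source ∩ e ⁻¹' Metric.ball (e x) r₀ with hS
  have hSo : IsOpen S := e.isOpen_inter_preimage Metric.isOpen_ball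
  have hxS : x ∈ S := ⟨mem_chart_source E x, Metric.mem_ball_self hr₀⟩
  obtain ⟨η, hη, hηS⟩ := EMetric.mem_nhds_iff.1 (hSo.mem_nhds hxS)
  have hη4 : 0 < η / 4 := ENNReal.div_pos hη.ne' (by simp)
  have hcont : ContinuousAt e.symm (e x) := e.continuousAt_symm (mem_chart_target E x)
  rw [ContinuousAt, e.left_inv (mem_chart_source E x)] at hcont
  obtain ⟨r₁, hr₁, hr₁S⟩ := Metric.mem_nhds_iff.1
    (hcont.eventually (Metric.eball_mem_nhds x hη4))
  have hsub' : Metric.ball (e x) (min r₀ r₁) ⊆ Metric.ball (e x) r₀ :=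
    Metric.ball_subset_ball (min_le_left _ _)
  have hbd' : ∀ z ∈ Metric.ball (e x) r₀,
        (∀ v : E, ‖(mfderiv 𝓘(ℝ, E) 𝓘(ℝ, E) e.symm z v :
          TangentSpace 𝓘(ℝ, E) (e.symm z))‖ₑ ≤ C * ‖v‖ₑ) ∧
        ∀ w : TangentSpace 𝓘(ℝ, E) (e.symm z),
          ‖(mfderiv 𝓘(ℝ, E) 𝓘(ℝ, E) e (e.symm z) w : E)‖ₑ ≤ C * ‖w‖ₑ := fun z hz ↦
    ⟨fun v ↦ ((hbd z hz).1 v).trans (by gcongr), fun w ↦ ((hbd z hz).2 w).trans (by gcongr)⟩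
  refine ⟨C, le_max_right _ _, min r₀ r₁, lt_min hr₀ hr₁, hsub'.trans hsub,
    fun z hz ↦ hbd' z (hsub' hz), fun a ha b hb ↦ ⟨?_, ?_⟩⟩
  · exact edist_chart_symm_le hsub (fun z hz ↦ (hbd' z hz).1) (hsub' ha) (hsub' hb)
  -- Otherwise some path from `e.symm a` to `e.symm b` has length less than |a-b|/C and less than
  -- η/2. Its ends being within η/4 of x, it stays in S, where the chart stretches lengths by at
  -- most C; so |a-b| < |a-b|.
  · by_contra! hlt
    have hnear : ∀ z ∈ Metric.ball (e x) (min r₀ r₁), edist (e.symm z) x < η / 4 := fun z hz ↦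
      hr₁S (Metric.ball_subset_ball (min_le_right _ _) hz)
    have hηt : η / 4 + η / 4 = η / 2 := by
      have : η / 4 = η / 2 / 2 := by
        rw [ENNReal.div_eq_inv_mul, ENNReal.div_eq_inv_mul, ENNReal.div_eq_inv_mul, ← mul_assoc,
          ← ENNReal.mul_inv (by simp) (by simp)]
        norm_num
      rw [this, ENNReal.add_halves]
    have hd1 : edist (e.symm a) (e.symm b) < edist a b / C := by
      rw [ENNReal.lt_div_iff_mul_lt (Or.inl hC0) (Or.inl ENNReal.coe_ne_top), mul_comm]
      exact hlt
    have hd2 : edist (e.symm a) (e.symm b) < η / 2 := by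
      rw [← hηt]
      exact (edist_triangle_right _ _ x).trans_lt (ENNReal.add_lt_add (hnear a ha) (hnear b hb))
    obtain ⟨γ, h0, h1, hγ, hlen⟩ := exists_path_of_edist_lt (E := E) (lt_min hd1 hd2)
    have hmem : ∀ t ∈ Set.Icc (0 : ℝ) 1, γ t ∈ S := fun t ht ↦ by
      refine hηS ?_
      calc edist (γ t) x ≤ edist (γ 0) (γ t) + edist (γ 0) x := edist_triangle_left _ _ _
        _ < η / 2 + η / 2 := by
            refine ENNReal.add_lt_add ?_ ?_
            · refine ((edist_le_pathELength (E := E) ht.1 hγ.contMDiffOn).trans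
                (pathELength_mono le_rfl ht.2)).trans_lt (hlen.trans_le (min_le_right _ _))
            · rw [h0]
              refine (hnear a ha).trans_le ?_
              rw [← hηt]; exact le_self_add
        _ = η := ENNReal.add_halves η
    have hfin := edist_chart_le_pathELength (C := C) (S := S) Set.inter_subset_left
      (fun y hy w ↦ by
        have := (hbd' (e y) hy.2).2
        rw [e.left_inv hy.1] at this
        exact this w) hγ zero_le_one hmem
    rw [h0, h1, e.right_inv (hsub (hsub' ha)), e.right_inv (hsub (hsub' hb))] at hfin
    have : edist a b < edist a b := by
      refine hfin.trans_lt ?_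
      calc C * pathELength 𝓘(ℝ, E) γ 0 1 < C * (edist a b / C) := by
            refine ENNReal.mul_lt_mul_right hC0 ENNReal.coe_ne_top ?_
            exact hlen.trans_le (min_le_left _ _)
        _ = edist a b := ENNReal.mul_div_cancel hC0 ENNReal.coe_ne_top
    exact lt_irrefl _ this

end BiLipschitz


/-! ### Gram determinants -/

section Gram

variable {m : ℕ} {T : Type*} [NormedAddCommGroup T] [InnerProductSpace ℝ T]

/-- Gram matrix of the images of the standard basis. -/
def gramMatrix (A : EuclideanSpace ℝ (Fin m) →ₗ[ℝ] T) : Matrix (Fin m) (Fin m) ℝ :=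
  Matrix.of fun i j ↦ inner ℝ (A (EuclideanSpace.single i 1)) (A (EuclideanSpace.single j 1))

lemma inner_map_eq_gramMatrix (A : EuclideanSpace ℝ (Fin m) →ₗ[ℝ] T)
    (v w : EuclideanSpace ℝ (Fin m)) :
    inner ℝ (A v) (A w) = ∑ i, ∑ j, v i * w j * gramMatrix A i j := by
  have e : ∀ v : EuclideanSpace ℝ (Fin m), A v = ∑ i, v i • A (EuclideanSpace.single i 1) :=
    fun v ↦ by
      conv_lhs => rw [← (EuclideanSpace.basisFun (Fin m) ℝ).sum_repr v]
      simp
  rw [e v, e w, sum_inner]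
  simp_rw [inner_sum, real_inner_smul_left, real_inner_smul_right, gramMatrix, Matrix.of_apply,
    mul_assoc]

lemma gramMatrix_isHermitian (A : EuclideanSpace ℝ (Fin m) →ₗ[ℝ] T) :
    (gramMatrix A).IsHermitian := by
  ext i j
  simp [gramMatrix, real_inner_comm]

lemma gramMatrix_eigenvalues (A : EuclideanSpace ℝ (Fin m) →ₗ[ℝ] T) (i : Fin m) :
    (gramMatrix_isHermitian A).eigenvalues i
      = ‖A ((gramMatrix_isHermitian A).eigenvectorBasis i)‖ ^ 2 := by
  rw [(gramMatrix_isHermitian A).eigenvalues_eq, ← real_inner_self_eq_norm_sq,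
    inner_map_eq_gramMatrix]
  simp only [dotProduct, Matrix.mulVec, star_trivial, Finset.mul_sum, RCLike.re_to_real]
  refine Finset.sum_congr rfl fun j _ ↦ Finset.sum_congr rfl fun k _ ↦ by ring

/-- The eigenvalues of the Gram matrix are the numbers ‖Av‖² for unit eigenvectors v, so each lies
between C^{-2} and C^2. -/
lemma det_gramMatrix_bounds (A : EuclideanSpace ℝ (Fin m) →ₗ[ℝ] T) {C : ℝ} (hC : 0 < C)
    (h₁ : ∀ v, ‖A v‖ ≤ C * ‖v‖) (h₂ : ∀ v, ‖v‖ ≤ C * ‖A v‖) :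
    (C⁻¹ ^ m) ^ 2 ≤ (gramMatrix A).det ∧ (gramMatrix A).det ≤ (C ^ m) ^ 2 := by
  have hdet := (gramMatrix_isHermitian A).det_eq_prod_eigenvalues
  simp only [RCLike.ofReal_real_eq_id, id, gramMatrix_eigenvalues] at hdet
  have hn : ∀ i, ‖(gramMatrix_isHermitian A).eigenvectorBasis i‖ = 1 := fun i ↦
    (gramMatrix_isHermitian A).eigenvectorBasis.orthonormal.1 i
  have hb : ∀ i, C⁻¹ ≤ ‖A ((gramMatrix_isHermitian A).eigenvectorBasis i)‖ ∧
      ‖A ((gramMatrix_isHermitian A).eigenvectorBasis i)‖ ≤ C := fun i ↦ by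
    have a1 := h₁ ((gramMatrix_isHermitian A).eigenvectorBasis i)
    have a2 := h₂ ((gramMatrix_isHermitian A).eigenvectorBasis i)
    rw [hn] at a1 a2
    refine ⟨?_, by simpa using a1⟩
    rwa [inv_le_iff_one_le_mul₀' hC]
  rw [hdet, Finset.prod_pow]
  have c1 : C⁻¹ ^ m = ∏ _i : Fin m, C⁻¹ := by simp
  have c2 : C ^ m = ∏ _i : Fin m, C := by simp
  rw [c1, c2]
  constructor
  · gcongr with i
    exact (hb i).1
  · gcongr with i
    exact (hb i).2

lemma det_gramMatrix_comp (A : EuclideanSpace ℝ (Fin m) →ₗ[ℝ] T)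
    (L : EuclideanSpace ℝ (Fin m) →ₗ[ℝ] EuclideanSpace ℝ (Fin m)) :
    (gramMatrix (A ∘ₗ L)).det = LinearMap.det L ^ 2 * (gramMatrix A).det := by
  set b := (EuclideanSpace.basisFun (Fin m) ℝ).toBasis
  set P := LinearMap.toMatrix b b L with hP
  have hPe : ∀ i j, P i j = L (EuclideanSpace.single j 1) i := fun i j ↦ by
    simp [hP, b, LinearMap.toMatrix_apply]
  have : gramMatrix (A ∘ₗ L) = P.transpose * gramMatrix A * P := by
    ext i j
    rw [gramMatrix, Matrix.of_apply, LinearMap.comp_apply, LinearMap.comp_apply,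
      inner_map_eq_gramMatrix, Matrix.mul_apply, Finset.sum_comm]
    refine Finset.sum_congr rfl fun l _ ↦ ?_
    rw [Matrix.mul_apply, Finset.sum_mul]
    refine Finset.sum_congr rfl fun k _ ↦ ?_
    rw [Matrix.transpose_apply, hPe, hPe]
    ring
  rw [this, Matrix.det_mul, Matrix.det_mul, Matrix.det_transpose, hP, LinearMap.det_toMatrix]
  ring

end Gram

/-! ### The Riemannian volume in charts -/

section Volume

variable {m : ℕ} {M : Type*} [EMetricSpace M] [MeasurableSpace M] [BorelSpace M]
  [ChartedSpace (EuclideanSpace ℝ (Fin m)) M]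
  [RiemannianBundle (fun x : M ↦ TangentSpace (𝓡 m) x)]

/-- The derivative of the parametrization by a chart. -/
def chartFrame (x : M) (z : EuclideanSpace ℝ (Fin m)) :
    EuclideanSpace ℝ (Fin m) →ₗ[ℝ]
      TangentSpace (𝓡 m) ((chartAt (EuclideanSpace ℝ (Fin m)) x).symm z) :=
  (mfderiv (𝓡 m) (𝓡 m) (chartAt (EuclideanSpace ℝ (Fin m)) x).symm z).toLinearMap

omit [MeasurableSpace M] [BorelSpace M] in
lemma metricCoeff_eq_gramMatrix (x : M) (z : EuclideanSpace ℝ (Fin m)) :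
    metricCoeff x z = gramMatrix (chartFrame x z) := rfl

lemma measurable_chart_symm_piecewise {x : M} {B : Set (EuclideanSpace ℝ (Fin m))}
    (hB : MeasurableSet B) (hsub : B ⊆ (chartAt (EuclideanSpace ℝ (Fin m)) x).target)
    [∀ z, Decidable (z ∈ B)] :
    Measurable (B.piecewise (chartAt (EuclideanSpace ℝ (Fin m)) x).symm fun _ ↦ x) :=
  ContinuousOn.measurable_piecewise
    ((chartAt (EuclideanSpace ℝ (Fin m)) x).continuousOn_symm.mono hsub) continuousOn_const hB

lemma chartVolume_apply (x : M) {A : Set M} (hA : MeasurableSet A) :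
    chartVolume m M x A = ∫⁻ z in (chartAt (EuclideanSpace ℝ (Fin m)) x).symm ⁻¹' A ∩
      (chartAt (EuclideanSpace ℝ (Fin m)) x).target, ENNReal.ofReal √(metricCoeff x z).det := by
  have hT : MeasurableSet (chartAt (EuclideanSpace ℝ (Fin m)) x).target :=
    (chartAt (EuclideanSpace ℝ (Fin m)) x).open_target.measurableSet
  have hae : AEMeasurable (chartAt (EuclideanSpace ℝ (Fin m)) x).symm
      (volume.restrict (chartAt (EuclideanSpace ℝ (Fin m)) x).target) :=
    (chartAt (EuclideanSpace ℝ (Fin m)) x).continuousOn_symm.aemeasurable hT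
  rw [chartVolume, Measure.map_apply_of_aemeasurable
    (hae.mono_ac (withDensity_absolutelyContinuous _ _)) hA, withDensity_apply',
    Measure.restrict_restrict' hT]

lemma chartVolume_le_riemannianVolume (x : M) : chartVolume m M x ≤ riemannianVolume m M :=
  le_iSup (fun x ↦ chartVolume m M x) x

-- The supremum of measures is not computed set by set. It is enough that ν plus the part of the
-- supremum outside U is an upper bound of the family.
omit [EMetricSpace M] [BorelSpace M] [ChartedSpace (EuclideanSpace ℝ (Fin m)) M]
  [RiemannianBundle (fun x : M ↦ TangentSpace (𝓡 m) x)] in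
lemma iSup_restrict_le {ι : Type*} {μ : ι → Measure M} {ν : Measure M} {U : Set M}
    (hU : MeasurableSet U) (h : ∀ i, (μ i).restrict U ≤ ν) : (⨆ i, μ i).restrict U ≤ ν := by
  have h1 : (⨆ i, μ i) ≤ ν + (⨆ i, μ i).restrict Uᶜ := by
    refine iSup_le fun i ↦ ?_
    rw [← Measure.restrict_add_restrict_compl (μ := μ i) hU]
    exact add_le_add (h i) (Measure.restrict_mono_measure (le_iSup μ i) _)
  calc (⨆ i, μ i).restrict U ≤ (ν + (⨆ i, μ i).restrict Uᶜ).restrict U :=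
        Measure.restrict_mono_measure h1 _
    _ = ν.restrict U := by
        rw [Measure.restrict_add, Measure.restrict_restrict hU, Set.inter_compl_self,
          Measure.restrict_empty, add_zero]
    _ ≤ ν := Measure.restrict_le_self

variable [IsManifold (𝓡 m) 1 M]

/-- Transition to another chart. -/
lemma sqrt_det_metricCoeff_eq {x x₀ : M} {w : EuclideanSpace ℝ (Fin m)}
    (hw : w ∈ (chartAt (EuclideanSpace ℝ (Fin m)) x₀).target)
    (hw' : (chartAt (EuclideanSpace ℝ (Fin m)) x₀).symm w
      ∈ (chartAt (EuclideanSpace ℝ (Fin m)) x).source) :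
    ∃ L : EuclideanSpace ℝ (Fin m) →L[ℝ] EuclideanSpace ℝ (Fin m),
      HasFDerivAt (chartAt (EuclideanSpace ℝ (Fin m)) x
        ∘ (chartAt (EuclideanSpace ℝ (Fin m)) x₀).symm) L w ∧
      √(metricCoeff x₀ w).det = |L.det| * √(metricCoeff x (chartAt (EuclideanSpace ℝ (Fin m)) x
        ((chartAt (EuclideanSpace ℝ (Fin m)) x₀).symm w))).det := by
  set e₀ := chartAt (EuclideanSpace ℝ (Fin m)) x₀
  set e := chartAt (EuclideanSpace ℝ (Fin m)) x
  have d1 : MDifferentiableAt (𝓡 m) (𝓡 m) e₀.symm w :=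
    mdifferentiableAt_atlas_symm (chart_mem_atlas _ x₀) hw
  have d2 : MDifferentiableAt (𝓡 m) (𝓡 m) e (e₀.symm w) :=
    mdifferentiableAt_atlas (chart_mem_atlas _ x) hw'
  have hcomp := d2.hasMFDerivAt.comp w d1.hasMFDerivAt
  refine ⟨_, hcomp.hasFDerivAt, ?_⟩
  have hid := (mdifferentiable_chart (I := 𝓡 m) x).symm_comp_deriv hw'
  set L : EuclideanSpace ℝ (Fin m) →L[ℝ] EuclideanSpace ℝ (Fin m) :=
    (mfderiv (𝓡 m) (𝓡 m) e (e₀.symm w)).comp (mfderiv (𝓡 m) (𝓡 m) e₀.symm w) with hL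
  have hAL : ∀ v : EuclideanSpace ℝ (Fin m), (chartFrame x (e (e₀.symm w)) (L v) :
      EuclideanSpace ℝ (Fin m)) = chartFrame x₀ w v := fun v ↦
    DFunLike.congr_fun hid (mfderiv (𝓡 m) (𝓡 m) e₀.symm w v)
  have hgram : gramMatrix (chartFrame x₀ w)
      = gramMatrix (chartFrame x (e (e₀.symm w)) ∘ₗ L.toLinearMap) := by
    ext i j
    -- The two inner products live in tangent spaces at base points that are equal only
    -- propositionally; G makes the base point a variable so that it can be rewritten.
    set G : M → EuclideanSpace ℝ (Fin m) → EuclideanSpace ℝ (Fin m) → ℝ := fun y v v' ↦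
      inner ℝ (show TangentSpace (𝓡 m) y from v) (show TangentSpace (𝓡 m) y from v') with hG
    have h1 : gramMatrix (chartFrame x₀ w) i j = G (e₀.symm w)
      (chartFrame x₀ w (EuclideanSpace.single i 1)) (chartFrame x₀ w (EuclideanSpace.single j 1)) :=
      rfl
    have h2 : gramMatrix (chartFrame x (e (e₀.symm w)) ∘ₗ L.toLinearMap) i j
      = G (e.symm (e (e₀.symm w))) (chartFrame x (e (e₀.symm w)) (L (EuclideanSpace.single i 1)))
        (chartFrame x (e (e₀.symm w)) (L (EuclideanSpace.single j 1))) := rfl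
    rw [h1, h2, hAL, hAL]
    exact congrArg (fun y ↦ G y _ _) (e.left_inv hw').symm
  rw [metricCoeff_eq_gramMatrix, metricCoeff_eq_gramMatrix, hgram, det_gramMatrix_comp,
    Real.sqrt_mul (sq_nonneg _), Real.sqrt_sq_eq_abs]
  rfl

end Volume


section GoodVolume

variable {m : ℕ} {M : Type*} [EMetricSpace M] [MeasurableSpace M] [BorelSpace M]
  [ChartedSpace (EuclideanSpace ℝ (Fin m)) M] [IsManifold (𝓡 m) 1 M]
  [RiemannianBundle (fun x : M ↦ TangentSpace (𝓡 m) x)]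

lemma sqrt_det_metricCoeff_bounds {x : M} {C : ℝ≥0} (hC : 0 < C) {z : EuclideanSpace ℝ (Fin m)}
    (hz : z ∈ (chartAt (EuclideanSpace ℝ (Fin m)) x).target)
    (h₁ : ∀ v : EuclideanSpace ℝ (Fin m), ‖(mfderiv (𝓡 m) (𝓡 m)
      (chartAt (EuclideanSpace ℝ (Fin m)) x).symm z v :
      TangentSpace (𝓡 m) ((chartAt (EuclideanSpace ℝ (Fin m)) x).symm z))‖ₑ ≤ C * ‖v‖ₑ)
    (h₂ : ∀ w : TangentSpace (𝓡 m) ((chartAt (EuclideanSpace ℝ (Fin m)) x).symm z),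
      ‖(id (mfderiv (𝓡 m) (𝓡 m) (chartAt (EuclideanSpace ℝ (Fin m)) x)
        ((chartAt (EuclideanSpace ℝ (Fin m)) x).symm z) w) : EuclideanSpace ℝ (Fin m))‖ₑ
        ≤ C * ‖w‖ₑ) :
    (C : ℝ)⁻¹ ^ m ≤ √(metricCoeff x z).det ∧ √(metricCoeff x z).det ≤ (C : ℝ) ^ m := by
  have hid := (mdifferentiable_chart (I := 𝓡 m) x).comp_symm_deriv hz
  have hC' : (0 : ℝ) < C := hC
  have key := det_gramMatrix_bounds (chartFrame x z) hC' (fun v ↦ ?_) (fun v ↦ ?_)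
  · rw [metricCoeff_eq_gramMatrix]
    exact ⟨Real.le_sqrt_of_sq_le key.1, Real.sqrt_le_left (by positivity) |>.2 key.2⟩
  · have := h₁ v
    rw [← ofReal_norm, ← ofReal_norm, ← ENNReal.ofReal_coe_nnreal,
      ← ENNReal.ofReal_mul hC'.le, ENNReal.ofReal_le_ofReal_iff (by positivity)] at this
    exact this
  · have := h₂ (chartFrame x z v)
    have e : (id (mfderiv (𝓡 m) (𝓡 m) (chartAt (EuclideanSpace ℝ (Fin m)) x)
        ((chartAt (EuclideanSpace ℝ (Fin m)) x).symm z) (chartFrame x z v)) :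
        EuclideanSpace ℝ (Fin m)) = v := DFunLike.congr_fun hid v
    rw [e, ← ofReal_norm, ← ofReal_norm, ← ENNReal.ofReal_coe_nnreal,
      ← ENNReal.ofReal_mul hC'.le, ENNReal.ofReal_le_ofReal_iff (by positivity)] at this
    exact this

/-- The transition map turns the density of the chart at x into that of the chart at x₀, which is at
most K on B. The bound does not depend on x and therefore passes to the supremum defining the
volume. -/
lemma chartVolume_restrict_le {x₀ x : M} {B : Set (EuclideanSpace ℝ (Fin m))} (hB : IsOpen B)
    (hsub : B ⊆ (chartAt (EuclideanSpace ℝ (Fin m)) x₀).target) {K : ℝ≥0∞}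
    (hK : ∀ z ∈ B, ENNReal.ofReal √(metricCoeff x₀ z).det ≤ K) [∀ z, Decidable (z ∈ B)] :
    (chartVolume m M x).restrict (B.piecewise (chartAt (EuclideanSpace ℝ (Fin m)) x₀).symm
        (fun _ ↦ x₀) '' B)
      ≤ K • (volume.restrict B).map
        (B.piecewise (chartAt (EuclideanSpace ℝ (Fin m)) x₀).symm fun _ ↦ x₀) := by
  set e₀ := chartAt (EuclideanSpace ℝ (Fin m)) x₀ with he₀
  set e := chartAt (EuclideanSpace ℝ (Fin m)) x with he
  set ψ : EuclideanSpace ℝ (Fin m) → M := B.piecewise e₀.symm fun _ ↦ x₀ with hψ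
  have hψm : Measurable ψ := measurable_chart_symm_piecewise hB.measurableSet hsub
  have hψB : ∀ z ∈ B, ψ z = e₀.symm z := fun z hz ↦ Set.piecewise_eq_of_mem _ _ _ hz
  have himg : ψ '' B = e₀.symm '' B := Set.image_congr hψB
  have hUo : IsOpen (ψ '' B) := by
    rw [himg]
    exact e₀.isOpen_image_symm_of_subset_target hB hsub
  refine Measure.le_iff.2 fun A hA ↦ ?_
  rw [Measure.restrict_apply hA, chartVolume_apply x (hA.inter hUo.measurableSet),
    Measure.smul_apply, Measure.map_apply hψm hA, Measure.restrict_apply (hψm hA), smul_eq_mul]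
  set W := (ψ ⁻¹' A ∩ B) ∩ (B ∩ e₀.symm ⁻¹' e.source) with hW
  have hWm : MeasurableSet W := ((hψm hA).inter hB.measurableSet).inter
    ((e₀.continuousOn_symm.mono hsub).isOpen_inter_preimage hB e.open_source).measurableSet
  have hWB : W ⊆ B := fun w hw ↦ hw.2.1
  have hset : e.symm ⁻¹' (A ∩ ψ '' B) ∩ e.target ⊆ (e ∘ e₀.symm) '' W := by
    rintro z ⟨⟨hzA, w, hwB, hwz⟩, hzt⟩
    have hwz' : e₀.symm w = e.symm z := by rw [← hψB w hwB, hwz]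
    refine ⟨w, ⟨⟨?_, hwB⟩, hwB, ?_⟩, ?_⟩
    · change ψ w ∈ A
      rw [hwz]; exact hzA
    · change e₀.symm w ∈ e.source
      rw [hwz']; exact e.map_target hzt
    · rw [Function.comp_apply, hwz', e.right_inv hzt]
  choose! L hL hdet using fun w (hw : w ∈ W) ↦
    sqrt_det_metricCoeff_eq (x := x) (hsub (hWB hw)) hw.2.2
  have hinj : Set.InjOn (e ∘ e₀.symm) W := fun w hw w' hw' hww ↦
    e₀.symm.injOn (hsub (hWB hw)) (hsub (hWB hw')) (e.injOn hw.2.2 hw'.2.2 hww)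
  calc _ ≤ ∫⁻ z in (e ∘ e₀.symm) '' W, ENNReal.ofReal √(metricCoeff x z).det :=
        lintegral_mono_set hset
    _ = ∫⁻ w in W, ENNReal.ofReal √(metricCoeff x₀ w).det := by
        rw [lintegral_image_eq_lintegral_abs_det_fderiv_mul volume hWm
          (fun w hw ↦ (hL w hw).hasFDerivWithinAt) hinj]
        refine setLIntegral_congr_fun hWm fun w hw ↦ ?_
        rw [hdet w hw, ENNReal.ofReal_mul (abs_nonneg _)]
        rfl
    _ ≤ ∫⁻ _ in W, K := setLIntegral_mono' hWm fun w hw ↦ hK w (hWB hw)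
    _ = K * volume W := setLIntegral_const _ _
    _ ≤ _ := by
        gcongr
        exact Set.inter_subset_left

lemma map_le_chartVolume {x₀ : M} {B : Set (EuclideanSpace ℝ (Fin m))} (hB : IsOpen B)
    (hsub : B ⊆ (chartAt (EuclideanSpace ℝ (Fin m)) x₀).target) {K : ℝ≥0∞} (hKt : K ≠ ⊤)
    (hK : ∀ z ∈ B, 1 ≤ K * ENNReal.ofReal √(metricCoeff x₀ z).det) [∀ z, Decidable (z ∈ B)] :
    (volume.restrict B).map (B.piecewise (chartAt (EuclideanSpace ℝ (Fin m)) x₀).symm fun _ ↦ x₀)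
      ≤ K • chartVolume m M x₀ := by
  have hψm := measurable_chart_symm_piecewise hB.measurableSet hsub
  refine Measure.le_iff.2 fun A hA ↦ ?_
  rw [Measure.map_apply hψm hA, Measure.restrict_apply (hψm hA), Measure.smul_apply, smul_eq_mul,
    chartVolume_apply x₀ hA, ← lintegral_const_mul' _ _ hKt, ← setLIntegral_one]
  refine (setLIntegral_mono' ((hψm hA).inter hB.measurableSet) fun z hz ↦ hK z hz.2).trans
    (lintegral_mono_set ?_)
  rintro z ⟨hzA, hzB⟩
  refine ⟨?_, hsub hzB⟩
  rw [Set.mem_preimage, Set.piecewise_eq_of_mem _ _ _ hzB] at hzA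
  exact hzA

/-- The Riemannian volume has good charts. -/
theorem hasGoodCharts_riemannianVolume
    [IsContinuousRiemannianBundle (EuclideanSpace ℝ (Fin m)) (fun x : M ↦ TangentSpace (𝓡 m) x)]
    [IsRiemannianManifold (𝓡 m) M] : HasGoodCharts m (riemannianVolume m M) := by
  classical
  intro x₀
  obtain ⟨C, hC1, r, hr, hsub, hbd, hlip⟩ :=
    exists_biLipschitz_chart (E := EuclideanSpace ℝ (Fin m)) x₀
  set e₀ := chartAt (EuclideanSpace ℝ (Fin m)) x₀ with he₀
  set B := Metric.ball (e₀ x₀) r with hB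
  have hBo : IsOpen B := Metric.isOpen_ball
  -- The value outside the ball is irrelevant; a constant makes the parametrization measurable
  -- everywhere.
  set ψ : EuclideanSpace ℝ (Fin m) → M := B.piecewise e₀.symm fun _ ↦ x₀ with hψ
  have hψB : ∀ z ∈ B, ψ z = e₀.symm z := fun z hz ↦ Set.piecewise_eq_of_mem _ _ _ hz
  have himg : ψ '' B = e₀.symm '' B := Set.image_congr hψB
  have hC0 : 0 < C := one_pos.trans_le hC1
  have hCr : (0 : ℝ) < C := hC0
  have hdet : ∀ z ∈ B, (C : ℝ)⁻¹ ^ m ≤ √(metricCoeff x₀ z).det ∧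
      √(metricCoeff x₀ z).det ≤ (C : ℝ) ^ m := fun z hz ↦
    sqrt_det_metricCoeff_bounds hC0 (hsub hz) (hbd z hz).1 (hbd z hz).2
  -- A single constant for the distances, which need C, and for the volume, which needs C^m.
  set K : ℝ≥0∞ := (C : ℝ≥0∞) ^ (m + 1) with hK
  have hCe : (1 : ℝ≥0∞) ≤ C := by exact_mod_cast hC1
  have hCK : (C : ℝ≥0∞) ≤ K := le_self_pow₀ hCe (by omega)
  have hCmK : (C : ℝ≥0∞) ^ m ≤ K := pow_le_pow_right₀ hCe (by omega)
  have hKt : K ≠ ⊤ := ENNReal.pow_ne_top ENNReal.coe_ne_top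
  have hofR : ENNReal.ofReal ((C : ℝ) ^ m) = (C : ℝ≥0∞) ^ m := by
    rw [ENNReal.ofReal_pow hCr.le, ENNReal.ofReal_coe_nnreal]
  refine ⟨ψ, e₀ x₀, r, K, ⟨hr, one_le_pow₀ hCe, hKt,
    measurable_chart_symm_piecewise hBo.measurableSet hsub, ?_, fun a ha b hb ↦ ?_,
    fun a ha b hb ↦ ?_, ?_, ?_⟩, ?_⟩
  · change IsOpen (ψ '' B)
    rw [himg]
    exact e₀.isOpen_image_symm_of_subset_target hBo hsub
  · rw [hψB a ha, hψB b hb]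
    exact ((hlip a ha b hb).1).trans (by gcongr)
  · rw [hψB a ha, hψB b hb]
    exact ((hlip a ha b hb).2).trans (by gcongr)
  · refine iSup_restrict_le ?_ fun x ↦ chartVolume_restrict_le hBo hsub fun z hz ↦ ?_
    · change MeasurableSet (ψ '' B)
      rw [himg]
      exact (e₀.isOpen_image_symm_of_subset_target hBo hsub).measurableSet
    · refine le_trans ?_ hCmK
      rw [← hofR]
      exact ENNReal.ofReal_le_ofReal (hdet z hz).2
  · refine (map_le_chartVolume hBo hsub hKt fun z hz ↦ ?_).trans ?_
    · calc (1 : ℝ≥0∞) = ENNReal.ofReal ((C : ℝ) ^ m * (C : ℝ)⁻¹ ^ m) := by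
            rw [← mul_pow, mul_inv_cancel₀ hCr.ne']; simp
        _ = (C : ℝ≥0∞) ^ m * ENNReal.ofReal ((C : ℝ)⁻¹ ^ m) := by
            rw [ENNReal.ofReal_mul (by positivity), hofR]
        _ ≤ _ := by
            gcongr
            exact (hdet z hz).1
    · refine Measure.le_iff.2 fun A _ ↦ ?_
      rw [Measure.smul_apply, Measure.smul_apply]
      exact mul_le_mul_right (chartVolume_le_riemannianVolume x₀ A) _
  · exact ⟨e₀ x₀, Metric.mem_ball_self hr, by
      rw [hψB _ (Metric.mem_ball_self hr), e₀.left_inv (mem_chart_source _ x₀)]⟩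

end GoodVolume

/-! ### Smooth local inverses -/

section LocalInverse

variable {E : Type*} [NormedAddCommGroup E] [NormedSpace ℝ E] [FiniteDimensional ℝ E]
  {N' N : Type*} [TopologicalSpace N'] [ChartedSpace E N'] [IsManifold 𝓘(ℝ, E) 1 N']
  [TopologicalSpace N] [ChartedSpace E N] [IsManifold 𝓘(ℝ, E) 1 N]

/-- The inverse of a local homeomorphism is `C^1` where its derivative is injective. -/
lemma OpenPartialHomeomorph.contMDiffAt_symm_of_injective (φ : OpenPartialHomeomorph N' N) {x : N'}
    (hx : x ∈ φ.source) (hφ : ContMDiffAt 𝓘(ℝ, E) 𝓘(ℝ, E) 1 φ x)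
    (hinj : ∀ w : TangentSpace 𝓘(ℝ, E) x, mfderiv 𝓘(ℝ, E) 𝓘(ℝ, E) φ x w = 0 → w = 0) :
    ContMDiffAt 𝓘(ℝ, E) 𝓘(ℝ, E) 1 φ.symm (φ x) := by
  set e' := chartAt E x
  set e := chartAt E (φ x)
  set F : OpenPartialHomeomorph E E := (e'.symm.trans φ).trans e with hF
  have hz : e' x ∈ e'.target := e'.map_source (mem_chart_source E x)
  have hxe : e'.symm (e' x) = x := e'.left_inv (mem_chart_source E x)
  have hFz : F (e' x) = e (φ x) := by simp [hF, hxe]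
  have hzF : e' x ∈ F.source := by
    simp only [hF, OpenPartialHomeomorph.trans_source, OpenPartialHomeomorph.symm_source,
      Set.mem_inter_iff, Set.mem_preimage, OpenPartialHomeomorph.coe_trans, Function.comp_apply,
      hxe]
    exact ⟨⟨hz, hx⟩, mem_chart_source E (φ x)⟩
  have hFd : ContDiffAt ℝ 1 F (e' x) := by
    have := contMDiffAt_iff.1 hφ
    simpa [Function.comp_def, hF, e, e', contDiffWithinAt_univ] using this.2
  have hfd : fderiv ℝ F (e' x) = (mfderiv 𝓘(ℝ, E) 𝓘(ℝ, E) φ x : E →L[ℝ] E) := by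
    rw [(hφ.mdifferentiableAt one_ne_zero).mfderiv]
    simp [hF, e, e', Function.comp_def, fderivWithin_univ, writtenInExtChartAt]
  have hinj' : Function.Injective (fderiv ℝ F (e' x)) := by
    rw [hfd]
    exact (injective_iff_map_eq_zero (mfderiv 𝓘(ℝ, E) 𝓘(ℝ, E) φ x : E →L[ℝ] E)).2 hinj
  set L : E ≃L[ℝ] E := (LinearEquiv.ofInjectiveEndo
    (fderiv ℝ F (e' x) : E →ₗ[ℝ] E) hinj').toContinuousLinearEquiv
  have hL : (L : E →L[ℝ] E) = fderiv ℝ F (e' x) := by ext v; rfl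
  have hFs : ContDiffAt ℝ 1 F.symm (F (e' x)) := by
    refine F.contDiffAt_symm (f₀' := L) (F.map_source hzF) ?_ ?_
    · rw [F.left_inv hzF, hL]
      exact (hFd.differentiableAt one_ne_zero).hasFDerivAt
    · rwa [F.left_inv hzF]
  have hcomp : ContMDiffAt 𝓘(ℝ, E) 𝓘(ℝ, E) 1 (e'.symm ∘ F.symm ∘ e) (φ x) := by
    have h1 : ContMDiffAt 𝓘(ℝ, E) 𝓘(ℝ, E) 1 e (φ x) :=
      contMDiffAt_of_mem_maximalAtlas (IsManifold.chart_mem_maximalAtlas (φ x))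
        (mem_chart_source E (φ x))
    have h2 : ContMDiffAt 𝓘(ℝ, E) 𝓘(ℝ, E) 1 F.symm (e (φ x)) := by
      rw [← hFz]; exact hFs.contMDiffAt
    have h3 : ContMDiffAt 𝓘(ℝ, E) 𝓘(ℝ, E) 1 e'.symm (F.symm (e (φ x))) := by
      rw [← hFz, F.left_inv hzF]
      exact contMDiffAt_symm_of_mem_maximalAtlas (IsManifold.chart_mem_maximalAtlas x) hz
    exact h3.comp (φ x) (h2.comp (φ x) h1)
  refine hcomp.congr_of_eventuallyEq ?_
  have hxs : φ.symm (φ x) = x := φ.left_inv hx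
  have hcont := φ.symm.continuousAt (φ.map_source hx)
  have h1 : ∀ᶠ y in 𝓝 (φ x), φ.symm y ∈ e'.source :=
    hcont.eventually_mem (by rw [hxs]; exact chart_source_mem_nhds E x)
  filter_upwards [h1, φ.open_target.mem_nhds (φ.map_source hx), chart_source_mem_nhds E (φ x)]
    with y hy1 hy2 hy3
  simp only [hF, Function.comp_apply, OpenPartialHomeomorph.trans_symm_eq_symm_trans_symm,
    OpenPartialHomeomorph.coe_trans, OpenPartialHomeomorph.symm_symm, e.left_inv hy3,
    e'.left_inv hy1]

end LocalInverse

/-! ### Projecting and lifting paths through a Riemannian covering -/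

section Covering

variable {E : Type*} [NormedAddCommGroup E] [NormedSpace ℝ E] [FiniteDimensional ℝ E]
  {N' : Type*} [EMetricSpace N'] [ChartedSpace E N'] [IsManifold 𝓘(ℝ, E) 1 N']
  [RiemannianBundle (fun x : N' ↦ TangentSpace 𝓘(ℝ, E) x)]
  [IsRiemannianManifold 𝓘(ℝ, E) N']
  {N : Type*} [EMetricSpace N] [ChartedSpace E N] [IsManifold 𝓘(ℝ, E) 1 N]
  [RiemannianBundle (fun x : N ↦ TangentSpace 𝓘(ℝ, E) x)]
  [IsRiemannianManifold 𝓘(ℝ, E) N]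
  {cov : N' → N}

omit [FiniteDimensional ℝ E] [IsManifold 𝓘(ℝ, E) 1 N'] [IsManifold 𝓘(ℝ, E) 1 N] in
/-- Paths upstairs project to paths of the same length. -/
lemma edist_cov_le (hsmooth : ContMDiff 𝓘(ℝ, E) 𝓘(ℝ, E) 1 cov)
    (hnorm : ∀ (y : N') (w : TangentSpace 𝓘(ℝ, E) y),
      ‖mfderiv 𝓘(ℝ, E) 𝓘(ℝ, E) cov y w‖ₑ = ‖w‖ₑ) (a b : N') :
    edist (cov a) (cov b) ≤ edist a b := by
  refine le_of_forall_gt fun c hc ↦ ?_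
  obtain ⟨γ, h0, h1, hγ, hl⟩ := exists_path_of_edist_lt (E := E) hc
  have h2 := edist_le_pathELength (M := N) (γ := cov ∘ γ) zero_le_one (hsmooth.comp hγ).contMDiffOn
  have h3 : pathELength 𝓘(ℝ, E) (cov ∘ γ) 0 1 ≤ (1 : ℝ≥0) * pathELength 𝓘(ℝ, E) γ 0 1 :=
    pathELength_comp_le (fun t _ ↦ hγ.mdifferentiable one_ne_zero t)
      (fun t _ ↦ hsmooth.mdifferentiable one_ne_zero _) (fun t _ w ↦ by simp [hnorm])
  simp only [Function.comp_apply, h0, h1, ENNReal.coe_one, one_mul] at h2 h3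
  exact h2.trans_lt (h3.trans_lt hl)

/-- Every point near the projection of `a` is the projection of a point at most as far from `a`. -/
lemma exists_edist_lt_of_edist_cov_lt (hcov : IsCoveringMap cov)
    (hsmooth : ContMDiff 𝓘(ℝ, E) 𝓘(ℝ, E) 1 cov)
    (hnorm : ∀ (y : N') (w : TangentSpace 𝓘(ℝ, E) y),
      ‖mfderiv 𝓘(ℝ, E) 𝓘(ℝ, E) cov y w‖ₑ = ‖w‖ₑ) {a : N'} {y : N} {c : ℝ≥0∞}
    (h : edist (cov a) y < c) : ∃ b, cov b = y ∧ edist a b < c := by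
  obtain ⟨γ, h0, h1, hγ, hl⟩ := exists_path_of_edist_lt (E := E) h
  set γI : C(unitInterval, N) := ⟨fun t ↦ γ t, by have := hγ.continuous; fun_prop⟩
  have hγ0 : γI 0 = cov a := h0
  set Γ := hcov.liftPath γI a hγ0
  have hΓ : ∀ t, cov (Γ t) = γ t := fun t ↦ congrFun (hcov.liftPath_lifts γI a hγ0) t
  have hΓ0 : Γ 0 = a := hcov.liftPath_zero γI a hγ0
  set G : ℝ → N' := fun t ↦ Γ (Set.projIcc 0 1 zero_le_one t)
  have hG : Continuous G := Γ.continuous.comp continuous_projIcc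
  have hcG : ∀ t ∈ Set.Icc (0 : ℝ) 1, cov (G t) = γ t := fun t ht ↦ by
    simp [G, hΓ, Set.projIcc_of_mem zero_le_one ht]
  have hsm : ContMDiffOn 𝓘(ℝ, ℝ) 𝓘(ℝ, E) 1 G (Set.Icc 0 1) := by
    intro t ht
    -- Locally the lift is the path followed by a local inverse of the covering, which is C^1
    -- because an isometric derivative is injective.
    obtain ⟨φ, hφs, hφ⟩ := hcov.isLocalHomeomorph (G t)
    have hsy : ContMDiffAt 𝓘(ℝ, E) 𝓘(ℝ, E) 1 φ.symm (γ t) := by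
      rw [← hcG t ht, hφ]
      refine φ.contMDiffAt_symm_of_injective hφs (by rw [← hφ]; exact hsmooth _) fun w hw ↦ ?_
      rw [← hφ] at hw
      have := hnorm _ w
      rw [hw, enorm_zero] at this
      exact enorm_eq_zero.1 this.symm
    refine ((hsy.comp t (hγ t)).contMDiffWithinAt (s := Set.Icc 0 1)).congr_of_eventuallyEq ?_ ?_
    · filter_upwards [nhdsWithin_le_nhds (hG.continuousAt.eventually_mem
        (φ.open_source.mem_nhds hφs)), self_mem_nhdsWithin] with s hs hs'
      simp only [Function.comp_apply, ← hcG s hs', hφ, φ.left_inv hs]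
    · simp only [Function.comp_apply, ← hcG t ht, hφ, φ.left_inv hφs]
  have hle := edist_le_pathELength (M := N') zero_le_one hsm
  have hG0 : G 0 = a := by simp [G, hΓ0]
  refine ⟨G 1, by rw [hcG 1 (by simp), h1], ?_⟩
  rw [hG0] at hle
  refine hle.trans_lt (lt_of_le_of_lt (le_of_eq ?_) hl)
  rw [← pathELength_congr_Ioo (γ := cov ∘ G) fun t ht ↦ hcG t ⟨ht.1.le, ht.2.le⟩,
    pathELength_eq_lintegral_mfderiv_Ioo, pathELength_eq_lintegral_mfderiv_Ioo]
  refine setLIntegral_congr_fun measurableSet_Ioo fun t ht ↦ ?_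
  have hGt : MDifferentiableAt 𝓘(ℝ, ℝ) 𝓘(ℝ, E) G t :=
    (hsm.contMDiffAt (Icc_mem_nhds ht.1 ht.2)).mdifferentiableAt one_ne_zero
  simp only [mfderiv_comp t (hsmooth.mdifferentiable one_ne_zero (G t)) hGt]
  exact (hnorm _ _).symm

end Covering

/-! ### Almost minimizing curves -/

section AlmostGeodesic

variable {E : Type*} [NormedAddCommGroup E] [NormedSpace ℝ E]
  {M : Type*} [EMetricSpace M] [ChartedSpace E M]
  [RiemannianBundle (fun x : M ↦ TangentSpace 𝓘(ℝ, E) x)]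

lemma edist_unitInterval {s t : unitInterval} (h : s ≤ t) :
    edist s t = ENNReal.ofReal ((t : ℝ) - s) := by
  rw [Subtype.edist_eq, edist_comm, edist_dist, Real.dist_eq, abs_of_nonneg (by simpa using h)]

variable (E) in
/-- Two points at finite distance are joined by a (not necessarily continuous) curve that is
almost a minimizing geodesic. -/
lemma exists_almost_geodesic [IsRiemannianManifold 𝓘(ℝ, E) M] {x y : M} {ℓ ε : ℝ≥0} (hℓ : edist x y = ℓ) (hε : 0 < ε) :
    ∃ P : unitInterval → M, P 0 = x ∧ P 1 = y ∧ ∀ s t,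
      ℓ * edist s t ≤ edist (P s) (P t) ∧ edist (P s) (P t) ≤ ℓ * edist s t + ε := by
  have hlt : edist x y < ℓ + ε := by
    rw [hℓ]; exact_mod_cast lt_add_of_pos_right ℓ hε
  obtain ⟨Γ, h0, h1, hΓ, hlen⟩ := exists_path_of_edist_lt (E := E) hlt
  have hcont : Continuous fun τ ↦ edist x (Γ τ) := by have := hΓ.continuous; fun_prop
  -- The curve is reparametrized by the distance to x: at time t one picks a point at distance ℓt.
  -- Taking τ = 1 at t = 1 makes the curve end at y.
  have hτ : ∀ t : unitInterval, ∃ τ ∈ Set.Icc (0 : ℝ) 1,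
      edist x (Γ τ) = ℓ * ENNReal.ofReal t ∧ (t = 1 → τ = 1) := by
    intro t
    by_cases ht : t = 1
    · exact ⟨1, by simp, by simp [ht, h1, hℓ], fun _ ↦ rfl⟩
    · have hmem : (ℓ : ℝ≥0∞) * ENNReal.ofReal t ∈ Set.Icc (edist x (Γ 0)) (edist x (Γ 1)) := by
        rw [h0, h1, edist_self, hℓ]
        refine ⟨zero_le, mul_le_of_le_one_right (zero_le) ?_⟩
        simpa using ENNReal.ofReal_le_ofReal t.2.2
      obtain ⟨τ, hτ, he⟩ := intermediate_value_Icc (zero_le_one' ℝ) hcont.continuousOn hmem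
      exact ⟨τ, hτ, he, fun h ↦ absurd h ht⟩
  choose τ hτI hτe hτ1 using hτ
  -- A path of length less than ℓ + ε leaves at most ε of excess in the triangle inequality along
  -- it.
  have hchain : ∀ a ∈ Set.Icc (0 : ℝ) 1, ∀ b ∈ Set.Icc (0 : ℝ) 1, a ≤ b →
      edist x (Γ a) + edist (Γ a) (Γ b) + edist (Γ b) y ≤ ℓ + ε := by
    intro a ha b hb hab
    have e1 := edist_le_pathELength (E := E) (M := M) ha.1 hΓ.contMDiffOn
    have e2 := edist_le_pathELength (E := E) (M := M) hab hΓ.contMDiffOn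
    have e3 := edist_le_pathELength (E := E) (M := M) hb.2 hΓ.contMDiffOn
    rw [h0] at e1
    rw [h1] at e3
    refine (add_le_add (add_le_add e1 e2) e3).trans ?_
    rw [pathELength_add ha.1 hab, pathELength_add hb.1 hb.2]
    exact hlen.le
  have hmono : ∀ s t : unitInterval, s ≤ t →
      ℓ * edist s t ≤ edist (Γ (τ s)) (Γ (τ t)) ∧
        edist (Γ (τ s)) (Γ (τ t)) ≤ ℓ * edist s t + ε := by
    intro s t hst
    rw [edist_unitInterval hst]
    have hadd : (ℓ : ℝ≥0∞) * ENNReal.ofReal t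
        = ℓ * ENNReal.ofReal s + ℓ * ENNReal.ofReal ((t : ℝ) - s) := by
      rw [← mul_add, ← ENNReal.ofReal_add s.2.1 (sub_nonneg.2 hst), add_sub_cancel]
    have hfin : ∀ t : ℝ, (ℓ : ℝ≥0∞) * ENNReal.ofReal t ≠ ⊤ := fun t ↦ by finiteness
    have tri : ∀ u : unitInterval, (ℓ : ℝ≥0∞) ≤ ℓ * ENNReal.ofReal u + edist (Γ (τ u)) y :=
      fun u ↦ by rw [← hℓ, hℓ, ← hτe u, ← hℓ]; exact edist_triangle _ _ _
    refine ⟨?_, ?_⟩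
    · have := edist_triangle x (Γ (τ s)) (Γ (τ t))
      rw [hτe, hτe, hadd] at this
      exact (ENNReal.add_le_add_iff_left (hfin s)).1 this
    · rcases le_total (τ s) (τ t) with h | h
      · have h1 := hchain _ (hτI s) _ (hτI t) h
        rw [hτe] at h1
        have h2 := tri t
        rw [hadd] at h2
        have h3 : (ℓ * ENNReal.ofReal s + ℓ) + edist (Γ (τ s)) (Γ (τ t))
            ≤ (ℓ * ENNReal.ofReal s + ℓ) + (ℓ * ENNReal.ofReal ((t : ℝ) - s) + ε) :=
          calc (ℓ * ENNReal.ofReal s + ℓ) + edist (Γ (τ s)) (Γ (τ t))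
              ≤ (ℓ * ENNReal.ofReal s + (ℓ * ENNReal.ofReal s + ℓ * ENNReal.ofReal ((t : ℝ) - s)
                + edist (Γ (τ t)) y)) + edist (Γ (τ s)) (Γ (τ t)) := by gcongr
            _ = ℓ * ENNReal.ofReal s + ℓ * ENNReal.ofReal ((t : ℝ) - s) + (ℓ * ENNReal.ofReal s
                + edist (Γ (τ s)) (Γ (τ t)) + edist (Γ (τ t)) y) := by ring
            _ ≤ ℓ * ENNReal.ofReal s + ℓ * ENNReal.ofReal ((t : ℝ) - s) + (ℓ + ε) := by gcongr
            _ = _ := by ring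
        exact (ENNReal.add_le_add_iff_left
          (ENNReal.add_ne_top.2 ⟨hfin s, ENNReal.coe_ne_top⟩)).1 h3
      · have h1 := hchain _ (hτI t) _ (hτI s) h
        rw [hτe, hadd, edist_comm (Γ (τ t))] at h1
        have h2 := tri s
        have h3 : (ℓ : ℝ≥0∞) + edist (Γ (τ s)) (Γ (τ t)) ≤ ℓ + ε :=
          calc (ℓ : ℝ≥0∞) + edist (Γ (τ s)) (Γ (τ t))
              ≤ (ℓ * ENNReal.ofReal s + edist (Γ (τ s)) y) + edist (Γ (τ s)) (Γ (τ t)) := by gcongr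
            _ ≤ (ℓ * ENNReal.ofReal s + edist (Γ (τ s)) y) + edist (Γ (τ s)) (Γ (τ t))
                + ℓ * ENNReal.ofReal ((t : ℝ) - s) := le_self_add
            _ = ℓ * ENNReal.ofReal s + ℓ * ENNReal.ofReal ((t : ℝ) - s)
                + edist (Γ (τ s)) (Γ (τ t)) + edist (Γ (τ s)) y := by ring
            _ ≤ ℓ + ε := h1
        exact ((ENNReal.add_le_add_iff_left ENNReal.coe_ne_top).1 h3).trans le_add_self
  refine ⟨fun t ↦ Γ (τ t), ?_, by simp [hτ1, h1], fun s t ↦ ?_⟩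
  · have := hτe 0
    simp only [Set.Icc.coe_zero, ENNReal.ofReal_zero, mul_zero, edist_eq_zero] at this
    exact this.symm
  · rcases le_total s t with h | h
    · exact hmono s t h
    · rw [edist_comm s, edist_comm (Γ _)]; exact hmono t s h

end AlmostGeodesic

/-! ### Geodesic loops and the injectivity radius -/

section GeodesicLoop

/-- The first half of the unit interval. -/
def halfTime (t : unitInterval) : unitInterval :=
  ⟨t / 2, by have := t.2.1; have := t.2.2; constructor <;> linarith⟩

lemma continuous_halfTime : Continuous halfTime :=
  Continuous.subtype_mk (by fun_prop) _

lemma edist_halfTime (s t : unitInterval) :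
    edist (halfTime s) (halfTime t) = ((1 / 2 : ℝ≥0) : ℝ≥0∞) * edist s t := by
  have h : dist (halfTime s) (halfTime t) = ((1 / 2 : ℝ≥0) : ℝ) * dist s t := by
    simp only [Subtype.dist_eq, halfTime, Real.dist_eq, ← sub_div, abs_div]
    norm_num
    ring
  rw [edist_dist, h, ENNReal.ofReal_mul (by positivity), ← edist_dist, ENNReal.ofReal_coe_nnreal]

lemma unitInterval.edist_symm (s t : unitInterval) :
    edist (unitInterval.symm s) (unitInterval.symm t) = edist s t := by
  rw [Subtype.edist_eq, Subtype.edist_eq, edist_dist, edist_dist, Real.dist_eq, Real.dist_eq,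
    unitInterval.coe_symm_eq, unitInterval.coe_symm_eq, abs_sub_comm (s : ℝ)]
  congr 2
  ring

variable {N : Type*} [EMetricSpace N]

lemma IsGeodesicPath.comp {γ : unitInterval → N} {ℓ c : ℝ≥0} (h : IsGeodesicPath γ ℓ)
    {f : unitInterval → unitInterval} (hf : Continuous f)
    (hfe : ∀ s t, edist (f s) (f t) = c * edist s t) : IsGeodesicPath (γ ∘ f) (ℓ * c) := by
  intro t
  have hc : Filter.Tendsto (Prod.map f f) (𝓝 (t, t)) (𝓝 (f t, f t)) :=
    (hf.prodMap hf).tendsto (t, t)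
  filter_upwards [hc.eventually (h (f t))] with q hq
  simp only [Prod.map_fst, Prod.map_snd] at hq
  rw [Function.comp_apply, Function.comp_apply, hq, hfe, ENNReal.coe_mul, mul_assoc]

/-- A geodesic loop is at least twice as long as the injectivity radius. -/
lemma IsGeodesicPath.two_mul_injectivityRadius_le {γ : unitInterval → N} {ℓ : ℝ≥0}
    (h : IsGeodesicPath γ ℓ) (hloop : γ 0 = γ 1) (hℓ : 0 < ℓ) : 2 * injectivityRadius N ≤ ℓ := by
  by_contra! hlt
  have hhalf : ((ℓ * (1 / 2) : ℝ≥0) : ℝ≥0∞) < injectivityRadius N := by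
    have h2 : (2 : ℝ≥0∞) * ((ℓ * (1 / 2) : ℝ≥0) : ℝ≥0∞) = ℓ := by
      rw [← ENNReal.coe_ofNat, ← ENNReal.coe_mul]
      congr 1
      field_simp
    rw [← h2] at hlt
    exact (ENNReal.mul_lt_mul_iff_right two_ne_zero ENNReal.ofNat_ne_top).1 hlt
  have hat := hhalf.trans_le (iInf_le injectivityRadiusAt (γ 0))
  obtain ⟨r, hr, hlr⟩ := lt_sSup_iff.1 hat
  -- The loop is run from its base point in the two directions up to the midpoint: two geodesics of
  -- length ℓ/2 with the same ends, which must coincide.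
  have h1 : IsGeodesicPath (γ ∘ halfTime) (ℓ * (1 / 2)) :=
    h.comp continuous_halfTime edist_halfTime
  have h2 : IsGeodesicPath (γ ∘ fun t ↦ unitInterval.symm (halfTime t)) (ℓ * (1 / 2)) :=
    h.comp (unitInterval.continuous_symm.comp continuous_halfTime)
      fun s t ↦ by rw [unitInterval.edist_symm, edist_halfTime]
  have e0 : halfTime 0 = 0 := Subtype.ext (by simp [halfTime])
  have e1 : unitInterval.symm (halfTime 1) = halfTime 1 :=
    Subtype.ext (by simp [halfTime]; norm_num)
  have heq := hr _ _ _ _ h1 h2 (by simp [e0]) (by simp [e0, hloop]) hlr hlr (by simp [e1])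
  -- The loop would then retrace its path after the midpoint, which contradicts its local isometry
  -- there.
  have hloc := h (halfTime 1)
  have hmap : Filter.Tendsto (fun t : unitInterval ↦ ((halfTime t), unitInterval.symm (halfTime t))) (𝓝 1)
      (𝓝 (halfTime 1, halfTime 1)) := by
    have hc : Continuous fun t : unitInterval ↦ ((halfTime t), unitInterval.symm (halfTime t)) :=
      continuous_halfTime.prodMk
        (unitInterval.continuous_symm.comp continuous_halfTime)
    simpa [e1] using hc.tendsto 1
  obtain ⟨δ, hδ, hball⟩ := Metric.eventually_nhds_iff.1 (hmap.eventually hloc)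
  set u : unitInterval := ⟨max 0 (1 - δ / 2), le_max_left _ _, max_le zero_le_one (by linarith)⟩
  have hu1 : (u : ℝ) < 1 := max_lt zero_lt_one (by linarith)
  have hu : dist u 1 < δ := by
    rw [Subtype.dist_eq, Real.dist_eq, abs_sub_comm, abs_of_nonneg (by simpa using hu1.le)]
    have : 1 - δ / 2 ≤ (u : ℝ) := le_max_right _ _
    simp only [Set.Icc.coe_one]
    linarith
  have hfin := hball hu
  have hγ := congrFun heq u
  simp only [Function.comp_apply] at hγ
  simp only [hγ, edist_self] at hfin
  rcases mul_eq_zero.1 hfin.symm with h0 | h0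
  · exact hℓ.ne' (by exact_mod_cast h0)
  · rw [edist_eq_zero] at h0
    have := congrArg Subtype.val h0
    simp only [halfTime, unitInterval.coe_symm_eq] at this
    linarith

end GeodesicLoop

/-! ### Local isometry of coverings and limits of curves -/

section FibreSeparation

variable (E : Type*) [NormedAddCommGroup E] [NormedSpace ℝ E]
  {N' : Type*} [EMetricSpace N'] [ChartedSpace E N']
  [RiemannianBundle (fun x : N' ↦ TangentSpace 𝓘(ℝ, E) x)]
  {N : Type*} [EMetricSpace N] {cov : N' → N}

/-- The points of a fibre of a covering of a compact space are uniformly separated. -/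
lemma exists_pos_le_edist_of_cov_eq [CompactSpace N] [IsRiemannianManifold 𝓘(ℝ, E) N']
    (hcov : IsCoveringMap cov) (hle : ∀ a b, edist (cov a) (cov b) ≤ edist a b) :
    ∃ r : ℝ≥0∞, 0 < r ∧ ∀ a b, cov a = cov b → edist a b < r → a = b := by
  have hev : ∀ x : N, ∃ U : Set N, x ∈ U ∧ IsOpen U ∧
      ∃ H : cov ⁻¹' U ≃ₜ U × (cov ⁻¹' {x}), ∀ z, (H z).1.1 = cov z := fun x ↦ by
    obtain ⟨-, U, h1, h2, -, h3⟩ := hcov x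
    exact ⟨U, h1, h2, h3⟩
  choose U hxU hUo H hH using hev
  -- A path shorter than the Lebesgue number projects into one evenly covered set; its sheet is then
  -- constant, so its ends coincide if they are in the same fibre.
  obtain ⟨δ, hδ, hleb⟩ := lebesgue_number_lemma_of_emetric (isCompact_univ (X := N)) hUo
    fun x _ ↦ Set.mem_iUnion.2 ⟨x, hxU x⟩
  refine ⟨δ, hδ, fun a b hab hlt ↦ ?_⟩
  obtain ⟨x, hx⟩ := hleb (cov a) (Set.mem_univ _)
  obtain ⟨γ, h0, h1, hγ, hl⟩ := exists_path_of_edist_lt (E := E) hlt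
  have hmem : ∀ t : unitInterval, cov (γ t) ∈ U x := fun t ↦ by
    refine hx ?_
    rw [Metric.mem_eball, edist_comm]
    refine (hle _ _).trans_lt (lt_of_le_of_lt ?_ hl)
    have h2 := edist_le_pathELength (E := E) (M := N') t.2.1 hγ.contMDiffOn
    rw [h0] at h2
    refine h2.trans ?_
    exact pathELength_mono le_rfl t.2.2
  have : DiscreteTopology (cov ⁻¹' {x}) := (hcov x).1
  have hγc := hγ.continuous
  have hconst : ∀ s t : unitInterval, (H x ⟨γ s, hmem s⟩).2 = (H x ⟨γ t, hmem t⟩).2 := by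
    intro s t
    have hc : Continuous fun t : unitInterval ↦ (H x ⟨γ t, hmem t⟩).2 := by fun_prop
    exact PreconnectedSpace.constant inferInstance hc
  have hinj : (⟨γ (0 : unitInterval), hmem 0⟩ : cov ⁻¹' U x) = ⟨γ (1 : unitInterval), hmem 1⟩ := by
    refine (H x).injective (Prod.ext (Subtype.ext ?_) (hconst 0 1))
    rw [hH, hH]
    simp [h0, h1, hab]
  simpa [h0, h1] using congrArg Subtype.val hinj

end FibreSeparation

section LocalIsometry

variable {N' N : Type*} [EMetricSpace N'] [EMetricSpace N] {cov : N' → N}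

/-- If the distance of a and b decreased, lifting would give a point of the fibre of b strictly
closer to a than b, hence different from b, yet within the separation of the fibres. -/
lemma exists_isometric_scale (hle : ∀ a b, edist (cov a) (cov b) ≤ edist a b)
    (hlift : ∀ (a : N') (y : N) (c : ℝ≥0∞), edist (cov a) y < c → ∃ b, cov b = y ∧ edist a b < c)
    (hsep : ∃ r : ℝ≥0∞, 0 < r ∧ ∀ a b, cov a = cov b → edist a b < r → a = b) :
    ∃ r : ℝ≥0∞, 0 < r ∧ ∀ a b, edist a b < r → edist (cov a) (cov b) = edist a b := by
  obtain ⟨r, hr, hsep⟩ := hsep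
  refine ⟨r / 2, ENNReal.half_pos hr.ne', fun a b hab ↦ (hle a b).antisymm ?_⟩
  by_contra! hlt
  obtain ⟨b', hb', hlt'⟩ := hlift a (cov b) _ hlt
  have : b' = b := hsep b' b hb' <| by
    calc edist b' b ≤ edist b' a + edist a b := edist_triangle _ _ _
      _ < r / 2 + r / 2 := by
        rw [edist_comm b']
        exact ENNReal.add_lt_add (hlt'.trans hab) hab
      _ = r := ENNReal.add_halves r
  rw [this] at hlt'
  exact lt_irrefl _ hlt'

variable [CompactSpace N]

/-- A minimizing sequence of curves between two points of a fibre projects to a sequence that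
subconverges to a geodesic loop. -/
lemma exists_geodesic_loop (hscale : ∃ r : ℝ≥0∞, 0 < r ∧
      ∀ a b, edist a b < r → edist (cov a) (cov b) = edist a b)
    {x y : N'} {ℓ : ℝ≥0} (hxy : cov x = cov y)
    (hP : ∀ ε : ℝ≥0, 0 < ε → ∃ P : unitInterval → N', P 0 = x ∧ P 1 = y ∧ ∀ s t,
      ℓ * edist s t ≤ edist (P s) (P t) ∧ edist (P s) (P t) ≤ ℓ * edist s t + ε) :
    ∃ γ : unitInterval → N, IsGeodesicPath γ ℓ ∧ γ 0 = γ 1 := by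
  obtain ⟨r, hr, hiso⟩ := hscale
  choose P hP0 hP1 hPe using fun n : ℕ ↦ hP (1 / (n + 1)) (by positivity)
  -- Limits along an ultrafilter exist at all times simultaneously by compactness of N; no
  -- equicontinuity or subsequence is needed.
  have hlim : ∀ t, ∃ z : N, Filter.Tendsto (fun n ↦ cov (P n t)) (Filter.hyperfilter ℕ) (𝓝 z) :=
    fun t ↦ by
      obtain ⟨z, -, hz⟩ := isCompact_univ.ultrafilter_le_nhds
        ((Filter.hyperfilter ℕ).map fun n ↦ cov (P n t)) (by simp)
      exact ⟨z, hz⟩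
  choose γ hγ using hlim
  have hε : Filter.Tendsto (fun n : ℕ ↦ (((1 / (n + 1) : ℝ≥0)) : ℝ≥0∞)) (Filter.hyperfilter ℕ)
      (𝓝 0) := by
    have h1 : Filter.Tendsto (fun n : ℕ ↦ (1 / (n + 1) : ℝ≥0)) Filter.atTop (𝓝 0) := by
      exact_mod_cast tendsto_one_div_add_atTop_nhds_zero_nat (𝕜 := ℝ≥0)
    exact (ENNReal.tendsto_coe.2 h1).mono_left Nat.hyperfilter_le_atTop
  refine ⟨γ, fun t ↦ ?_, ?_⟩
  · have hnear : ∀ᶠ q : unitInterval × unitInterval in 𝓝 (t, t), ℓ * edist q.1 q.2 < r := by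
      have hc : Continuous fun q : unitInterval × unitInterval ↦ (ℓ : ℝ≥0∞) * edist q.1 q.2 :=
        (ENNReal.continuous_const_mul ENNReal.coe_ne_top).comp continuous_edist
      refine hc.continuousAt.eventually_lt continuousAt_const ?_
      simpa using hr
    filter_upwards [hnear] with q hq
    have hup : Filter.Tendsto (fun n : ℕ ↦ ℓ * edist q.1 q.2 + ((1 / (n + 1) : ℝ≥0) : ℝ≥0∞))
        (Filter.hyperfilter ℕ) (𝓝 (ℓ * edist q.1 q.2)) := by
      simpa using tendsto_const_nhds.add hε
    have hsq := tendsto_of_tendsto_of_tendsto_of_le_of_le tendsto_const_nhds hup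
      (fun n ↦ (hPe n q.1 q.2).1) (fun n ↦ (hPe n q.1 q.2).2)
    -- For close times the upstairs distances tend to ℓ|s-t| and are eventually below the scale at
    -- which the covering is isometric.
    refine tendsto_nhds_unique ((hγ q.1).edist (hγ q.2)) (hsq.congr' ?_)
    filter_upwards [hup.eventually_lt_const hq] with n hn
    exact (hiso _ _ ((hPe n q.1 q.2).2.trans_lt hn)).symm
  · refine tendsto_nhds_unique (hγ 0) ((hγ 1).congr fun n ↦ ?_)
    rw [hP0, hP1, hxy]

end LocalIsometry

/-! ### Riemannian coverings preserve small distances -/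

section RiemannianCovering

variable {n : ℕ} {N' : Type*} [EMetricSpace N'] [ChartedSpace (EuclideanSpace ℝ (Fin n)) N']
  [IsManifold (𝓡 n) ∞ N']
  [RiemannianBundle (fun x : N' ↦ TangentSpace (𝓡 n) x)] [IsRiemannianManifold (𝓡 n) N']
  {N : Type*} [EMetricSpace N] [ChartedSpace (EuclideanSpace ℝ (Fin n)) N]
  [IsManifold (𝓡 n) ∞ N]
  [RiemannianBundle (fun x : N ↦ TangentSpace (𝓡 n) x)] [IsRiemannianManifold (𝓡 n) N]
  {cov : N' → N}

lemma IsRiemannianCovering.enorm_mfderiv (h : IsRiemannianCovering (n := n) cov) (y : N')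
    (w : TangentSpace (𝓡 n) y) : ‖mfderiv (𝓡 n) (𝓡 n) cov y w‖ₑ = ‖w‖ₑ := by
  rw [← ofReal_norm, ← ofReal_norm, norm_eq_sqrt_real_inner (mfderiv (𝓡 n) (𝓡 n) cov y w),
    h.inner_mfderiv, norm_eq_sqrt_real_inner w]

lemma IsRiemannianCovering.edist_le (h : IsRiemannianCovering (n := n) cov) (a b : N') :
    edist (cov a) (cov b) ≤ edist a b :=
  edist_cov_le (E := EuclideanSpace ℝ (Fin n)) (h.contMDiff.of_le (by simp)) h.enorm_mfderiv a b

/-- A Riemannian covering preserves distances below the injectivity radius. -/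
theorem IsRiemannianCovering.edist_eq [CompactSpace N] (h : IsRiemannianCovering (n := n) cov)
    {a b : N'} (hab : edist a b < injectivityRadius N) : edist (cov a) (cov b) = edist a b := by
  refine (h.edist_le a b).antisymm ?_
  by_contra! hlt
  have hsm : ContMDiff (𝓡 n) (𝓡 n) 1 cov := h.contMDiff.of_le (by simp)
  have hlift : ∀ (a : N') (y : N) (c : ℝ≥0∞), edist (cov a) y < c →
      ∃ b, cov b = y ∧ edist a b < c := fun a y c hc ↦
    exists_edist_lt_of_edist_cov_lt (E := EuclideanSpace ℝ (Fin n)) h.isCoveringMap hsm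
      h.enorm_mfderiv hc
  -- A second point b' of the fibre of b, strictly closer to a; then b and b' are less than twice
  -- the injectivity radius apart.
  obtain ⟨b', hb', hlt'⟩ := hlift a (cov b) _ hlt
  have hne : b ≠ b' := by rintro rfl; exact lt_irrefl _ hlt'
  have hsum : edist b b' < 2 * injectivityRadius N := by
    calc edist b b' ≤ edist b a + edist a b' := edist_triangle _ _ _
      _ < injectivityRadius N + injectivityRadius N := by
        rw [edist_comm b]
        exact ENNReal.add_lt_add hab (hlt'.trans hab)
      _ = _ := (two_mul _).symm
  lift edist b b' to ℝ≥0 using hsum.ne_top with ℓ hℓ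
  obtain ⟨γ, hγ, hloop⟩ := exists_geodesic_loop
    (exists_isometric_scale h.edist_le hlift (exists_pos_le_edist_of_cov_eq
      (EuclideanSpace ℝ (Fin n)) h.isCoveringMap h.edist_le)) hb'.symm
    fun ε hε ↦ exists_almost_geodesic (EuclideanSpace ℝ (Fin n)) hℓ.symm hε
  refine hsum.not_ge (hγ.two_mul_injectivityRadius_le hloop ?_)
  rw [← ENNReal.coe_pos, hℓ]
  exact edist_pos.2 hne

end RiemannianCovering

/-! ### Geodesics and injectivity radius of the circle -/

section CircleGeodesics

lemma IsGeodesicPath.continuous {N : Type*} [EMetricSpace N] {γ : unitInterval → N} {ℓ : ℝ≥0}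
    (h : IsGeodesicPath γ ℓ) : Continuous γ := by
  refine continuous_iff_continuousAt.2 fun t ↦ ?_
  rw [ContinuousAt, tendsto_iff_edist_tendsto_0]
  have h1 : ∀ᶠ s in 𝓝 t, (ℓ : ℝ≥0∞) * edist s t = edist (γ s) (γ t) := by
    have hc : Continuous fun s : unitInterval ↦ (s, t) := by fun_prop
    filter_upwards [(hc.tendsto t).eventually (h t)] with s hs using hs.symm
  refine Filter.Tendsto.congr' h1 ?_
  have hc : Continuous fun s : unitInterval ↦ (ℓ : ℝ≥0∞) * edist s t :=
    (ENNReal.continuous_const_mul ENNReal.coe_ne_top).comp (by fun_prop)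
  simpa using hc.tendsto t

lemma IsGeodesicPath.exists_uniform {N : Type*} [EMetricSpace N] {γ : unitInterval → N} {ℓ : ℝ≥0}
    (h : IsGeodesicPath γ ℓ) :
    ∃ δ > 0, ∀ s t : unitInterval, dist s t < δ → edist (γ s) (γ t) = ℓ * edist s t := by
  have hmem : {q : unitInterval × unitInterval | edist (γ q.1) (γ q.2) = ℓ * edist q.1 q.2}
      ∈ uniformity unitInterval := by
    rw [← nhdsSet_diagonal_eq_uniformity, mem_nhdsSet_iff_forall]
    rintro ⟨s, t⟩ (rfl : s = t)
    exact h s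
  obtain ⟨δ, hδ, H⟩ := Metric.mem_uniformity_dist.1 hmem
  exact ⟨δ, hδ, fun s t hst ↦ H hst⟩

/-- A function on an interval that multiplies small distances by a constant is affine. -/
lemma exists_affine_of_local_similarity {g : ℝ → ℝ} {ℓ δ : ℝ} (hδ : 0 < δ)
    (h : ∀ s ∈ Set.Icc (0 : ℝ) 1, ∀ t ∈ Set.Icc (0 : ℝ) 1, |s - t| < δ →
      |g s - g t| = ℓ * |s - t|) :
    ∃ κ : ℝ, |κ| = |ℓ| ∧ ∀ t ∈ Set.Icc (0 : ℝ) 1, g t = g 0 + κ * t := by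
  set d := min (δ / 4) (1 / 2) with hd
  have hd0 : 0 < d := lt_min (by linarith) (by norm_num)
  have hdδ : 4 * d ≤ δ := by linarith [min_le_left (δ / 4) (1 / 2)]
  have hd1 : 2 * d ≤ 1 := by linarith [min_le_right (δ / 4) (1 / 2)]
  have hsq : ∀ s ∈ Set.Icc (0 : ℝ) 1, ∀ t ∈ Set.Icc (0 : ℝ) 1, |s - t| < δ →
      (g s - g t) ^ 2 = ℓ ^ 2 * (s - t) ^ 2 := fun s hs t ht hst ↦ by
    rw [← sq_abs (g s - g t), h s hs t ht hst, mul_pow, sq_abs]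
  set κ := (g d - g 0) / d with hκ
  have hκd : g d - g 0 = κ * d := by rw [hκ]; field_simp
  have hκℓ : κ ^ 2 = ℓ ^ 2 := by
    have := hsq d ⟨hd0.le, by linarith⟩ 0 (by simp) (by
      rw [sub_zero, abs_of_pos hd0]; linarith)
    rw [hκd, sub_zero, mul_pow] at this
    exact mul_right_cancel₀ (by positivity) this
  -- A real number is determined by its distances to two distinct points. So the affine formula
  -- passes from a ≠ b to a nearby c; if κ = 0 the distances vanish and the conclusion is immediate.
  have hext : ∀ a ∈ Set.Icc (0 : ℝ) 1, ∀ b ∈ Set.Icc (0 : ℝ) 1, ∀ c ∈ Set.Icc (0 : ℝ) 1, a ≠ b →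
      |c - a| < δ → |c - b| < δ → g a = g 0 + κ * a → g b = g 0 + κ * b → g c = g 0 + κ * c := by
    intro a ha b hb c hc hab hca hcb ea eb
    have e1 := hsq c hc a ha hca
    have e2 := hsq c hc b hb hcb
    rw [ea, ← hκℓ] at e1
    rw [eb, ← hκℓ] at e2
    set x := g c - g 0 - κ * c with hx
    have f1 : x * (x + 2 * κ * (c - a)) = 0 := by rw [hx]; linear_combination e1
    have f2 : x * (x + 2 * κ * (c - b)) = 0 := by rw [hx]; linear_combination e2
    rcases mul_eq_zero.1 f1 with h0 | h1
    · linarith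
    rcases mul_eq_zero.1 f2 with h0 | h2
    · linarith
    have h3 : κ * (b - a) = 0 := by linarith
    rcases mul_eq_zero.1 h3 with h4 | h4
    · rw [h4] at h1; linarith
    · exact absurd (sub_eq_zero.1 h4).symm hab
  refine ⟨κ, (sq_eq_sq_iff_abs_eq_abs _ _).1 hκℓ, ?_⟩
  have hind : ∀ n : ℕ, ∀ t ∈ Set.Icc (0 : ℝ) 1, t ≤ (n + 1) * d → g t = g 0 + κ * t := by
    intro n
    induction n with
    | zero =>
      intro t ht htd
      simp only [CharP.cast_eq_zero, zero_add, one_mul] at htd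
      refine hext 0 (by simp) d ⟨hd0.le, by linarith⟩ t ht hd0.ne ?_ ?_ (by simp) (by linarith)
      · rw [abs_lt]; constructor <;> linarith [ht.1]
      · rw [abs_lt]; constructor <;> linarith [ht.1]
    | succ n ih =>
      intro t ht htd
      push_cast at htd
      rcases le_or_gt t ((n + 1) * d) with h1 | h1
      · exact ih t ht h1
      have hn : 0 ≤ (n : ℝ) * d := by positivity
      have htd' : d ≤ t := by linarith
      have ha : t - d ∈ Set.Icc (0 : ℝ) 1 := ⟨by linarith, by linarith [ht.2]⟩
      by_cases h2 : t - d = 0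
      · refine hext 0 (by simp) d ⟨hd0.le, by linarith⟩ t ht hd0.ne ?_ ?_ (by simp) (by linarith)
        · rw [abs_lt]; constructor <;> linarith [ht.1]
        · rw [abs_lt]; constructor <;> linarith [ht.1]
      have hpos : 0 < t - d := lt_of_le_of_ne ha.1 (Ne.symm h2)
      set b := max 0 (t - 2 * d) with hb
      have hb1 : t - 2 * d ≤ b := le_max_right _ _
      have hb2 : b < t - d := max_lt hpos (by linarith)
      have hb0 : 0 ≤ b := le_max_left _ _
      refine hext b ⟨hb0, by linarith [ht.2]⟩ (t - d) ha t ht hb2.ne ?_ ?_ (ih _ ?_ ?_) (ih _ ha ?_)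
      · rw [abs_lt]; constructor <;> linarith
      · rw [abs_lt]; constructor <;> linarith
      · exact ⟨hb0, by linarith [ht.2]⟩
      · linarith
      · linarith
  intro t ht
  obtain ⟨n, hn⟩ := exists_nat_ge (1 / d)
  refine hind n t ht ?_
  have : 1 ≤ n * d := by rwa [div_le_iff₀ hd0] at hn
  linarith [ht.2]

/-- The geodesics of the circle are the images of affine functions. -/
lemma IsGeodesicPath.exists_eq_coe_affine {γ : unitInterval → AddCircle (2 * Real.pi)} {ℓ : ℝ≥0}
    (h : IsGeodesicPath γ ℓ) :
    ∃ κ : ℝ, |κ| = ℓ ∧ ∀ t : unitInterval, γ t = γ 0 + ((κ * t : ℝ) : AddCircle (2 * Real.pi)) := by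
  have hcov := AddCircle.isCoveringMap_coe (2 * Real.pi)
  obtain ⟨g₀, hg₀⟩ := QuotientAddGroup.mk_surjective (γ 0)
  set γI : C(unitInterval, AddCircle (2 * Real.pi)) := ⟨γ, h.continuous⟩
  set Γ := hcov.liftPath γI g₀ hg₀.symm
  have hΓ : ∀ t, (Γ t : AddCircle (2 * Real.pi)) = γ t :=
    fun t ↦ congrFun (hcov.liftPath_lifts γI g₀ hg₀.symm) t
  set g : ℝ → ℝ := fun t ↦ Γ (Set.projIcc 0 1 zero_le_one t)
  have hgΓ : ∀ t : unitInterval, g t = Γ t := fun t ↦ by simp [g]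
  obtain ⟨δ₁, hδ₁, H₁⟩ := h.exists_uniform
  have huc : UniformContinuous Γ := CompactSpace.uniformContinuous_of_continuous Γ.continuous
  obtain ⟨δ₂, hδ₂, H₂⟩ := Metric.uniformContinuous_iff.1 huc Real.pi Real.pi_pos
  -- Where the lift moves by less than π, distances on the circle and on the line agree.
  obtain ⟨κ, hκ, H⟩ := exists_affine_of_local_similarity (g := g) (ℓ := ℓ) (lt_min hδ₁ hδ₂)
    (fun s hs t ht hst ↦ by
      have e1 := H₁ ⟨s, hs⟩ ⟨t, ht⟩ (hst.trans_le (min_le_left _ _))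
      have e2 := H₂ (a := ⟨s, hs⟩) (b := ⟨t, ht⟩) (hst.trans_le (min_le_right _ _))
      have es := hgΓ ⟨s, hs⟩
      have et := hgΓ ⟨t, ht⟩
      simp only at es et
      rw [← es, ← et, Real.dist_eq] at e2
      rw [← hΓ, ← hΓ, ← es, ← et, edist_dist, edist_dist, ← ENNReal.ofReal_coe_nnreal,
        ← ENNReal.ofReal_mul ℓ.coe_nonneg, ENNReal.ofReal_eq_ofReal_iff dist_nonneg
        (by positivity), dist_eq_norm, ← AddCircle.coe_sub,
        (AddCircle.norm_coe_eq_abs_iff _ (by positivity)).2 ?_] at e1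
      · exact e1
      · rw [abs_of_pos (by positivity : (0 : ℝ) < 2 * Real.pi)]
        linarith)
  refine ⟨κ, by simpa using hκ, fun t ↦ ?_⟩
  have h0 := hgΓ 0
  rw [← hΓ, ← hΓ, ← AddCircle.coe_add, ← hgΓ, H t t.2, ← h0]
  simp

/-- Two geodesics shorter than π from the same point have slopes differing by less than 2π in
absolute value; equal endpoints make this difference a multiple of 2π, hence zero. Only this lower
bound is needed, to place Lipschitz functions in X. -/
lemma pi_le_injectivityRadius_addCircle :
    ENNReal.ofReal Real.pi ≤ injectivityRadius (AddCircle (2 * Real.pi)) := by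
  refine le_iInf fun x ↦ le_sSup ?_
  intro γ₁ γ₂ ℓ₁ ℓ₂ h₁ h₂ e₁ e₂ hℓ₁ hℓ₂ he
  obtain ⟨κ₁, hκ₁, H₁⟩ := h₁.exists_eq_coe_affine
  obtain ⟨κ₂, hκ₂, H₂⟩ := h₂.exists_eq_coe_affine
  rw [← ENNReal.ofReal_coe_nnreal, ENNReal.ofReal_lt_ofReal_iff Real.pi_pos] at hℓ₁ hℓ₂
  have hκ : κ₁ = κ₂ := by
    have h1 := H₁ 1
    rw [he, H₂ 1, e₁, e₂, add_right_inj] at h1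
    simp only [Set.Icc.coe_one, mul_one] at h1
    have h2 : ‖((κ₂ - κ₁ : ℝ) : AddCircle (2 * Real.pi))‖ = 0 := by
      rw [AddCircle.coe_sub, h1, sub_self, norm_zero]
    have h3 := abs_lt.1 (hκ₁.trans_lt hℓ₁)
    have h4 := abs_lt.1 (hκ₂.trans_lt hℓ₂)
    obtain ⟨n, hn⟩ := (AddCircle.coe_eq_zero_iff (2 * Real.pi)).1 (norm_eq_zero.1 h2)
    simp only [zsmul_eq_mul] at hn
    have hpi := Real.pi_pos
    have hn0 : n = 0 := by
      have h5 : (n : ℝ) < 1 := by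
        by_contra! hc
        nlinarith
      have h6 : (-1 : ℝ) < n := by
        by_contra! hc
        nlinarith
      have h5' : n < 1 := by exact_mod_cast h5
      have h6' : -1 < n := by exact_mod_cast h6
      omega
    rw [hn0] at hn
    simp only [Int.cast_zero, zero_mul] at hn
    linarith
  funext t
  rw [H₁, H₂, e₁, e₂, hκ]

end CircleGeodesics

/-! ### Energies of rescaled Lipschitz functions -/

section SmoothEnergy

/-- For each x, translation reduces the inner integral to that of |z|^{-a} over a ball of radius 2r
about the origin, finite because a < m. -/
lemma lintegral_ball_inv_edist_ne_top {m : ℕ} (hm : 1 ≤ m) (z₀ : EuclideanSpace ℝ (Fin m)) (r : ℝ)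
    {a : ℝ} (ham : a < m) :
    ∫⁻ z, 1 / edist z.1 z.2 ^ a ∂((volume.restrict (Metric.ball z₀ r)).prod
      (volume.restrict (Metric.ball z₀ r))) ≠ ⊤ := by
  have hmeas : Measurable fun z : EuclideanSpace ℝ (Fin m) × EuclideanSpace ℝ (Fin m) ↦
      1 / edist z.1 z.2 ^ a := by fun_prop
  have hint : IntegrableOn (fun z : EuclideanSpace ℝ (Fin m) ↦ ‖z‖ ^ (-a))
      (Metric.ball 0 (2 * r)) := by
    refine integrableOn_ball_of_norm_le_rpow (C := 1) (α := a) (by simpa using hm) (by simpa using ham)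
      (ae_of_all _ fun z ↦ ?_)
      (measurable_norm.pow_const _).aestronglyMeasurable
    rw [one_mul, Real.norm_of_nonneg (by positivity)]
  set J := ∫⁻ z in Metric.ball (0 : EuclideanSpace ℝ (Fin m)) (2 * r),
    ‖(‖z‖ ^ (-a) : ℝ)‖ₑ with hJ
  have hJt : J ≠ ⊤ := hint.2.ne
  have hne : Nontrivial (EuclideanSpace ℝ (Fin m)) :=
    Module.nontrivial_of_finrank_pos (R := ℝ) (by simp; omega)
  have hpt : ∀ z : EuclideanSpace ℝ (Fin m), z ≠ 0 →
      1 / edist z 0 ^ a = ‖(‖z‖ ^ (-a) : ℝ)‖ₑ := fun z hz ↦ by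
    have h0 : 0 < ‖z‖ := norm_pos_iff.2 hz
    rw [Real.enorm_of_nonneg (by positivity), ← ENNReal.ofReal_rpow_of_pos h0, ENNReal.rpow_neg,
      one_div, edist_zero_right, ofReal_norm]
  have hx : ∀ x ∈ Metric.ball z₀ r, ∫⁻ y in Metric.ball z₀ r, 1 / edist x y ^ a ≤ J := by
    intro x hx
    calc ∫⁻ y in Metric.ball z₀ r, 1 / edist x y ^ a
        ≤ ∫⁻ y in Metric.ball x (2 * r), 1 / edist x y ^ a := by
          refine lintegral_mono_set fun y hy ↦ ?_
          have := dist_triangle_right y x z₀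
          rw [Metric.mem_ball] at *
          linarith
      _ = ∫⁻ z in Metric.ball (0 : EuclideanSpace ℝ (Fin m)) (2 * r), 1 / edist z 0 ^ a := by
          rw [← lintegral_indicator measurableSet_ball, ← lintegral_indicator measurableSet_ball,
            ← lintegral_add_right_eq_self _ x]
          refine lintegral_congr fun z ↦ ?_
          simp only [Set.indicator, Metric.mem_ball, dist_add_self_left, dist_zero_right]
          congr 2
          rw [edist_comm, edist_eq_enorm_sub, edist_eq_enorm_sub]
          simp
      _ = J := by
          refine setLIntegral_congr_fun_ae measurableSet_ball ?_
          filter_upwards [Measure.ae_ne volume (0 : EuclideanSpace ℝ (Fin m))] with z hz _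
            using hpt z hz
  rw [lintegral_prod _ hmeas.aemeasurable]
  refine ne_top_of_le_ne_top (ENNReal.mul_ne_top hJt measure_ball_lt_top.ne)
    ((setLIntegral_mono' measurableSet_ball hx).trans (le_of_eq (setLIntegral_const _ _)))

variable {m : ℕ} {M : Type*} [EMetricSpace M] [MeasurableSpace M] [BorelSpace M]
  [CompactSpace M] {μ : Measure M}

lemma HasGoodCharts.lintegral_inv_edist_ne_top (h : HasGoodCharts m μ) (hm : 1 ≤ m) {a : ℝ}
    (ha : 0 ≤ a) (ham : a < m) : ∫⁻ z, 1 / edist z.1 z.2 ^ a ∂(μ.prod μ) ≠ ⊤ := by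
  have := h.isFiniteMeasure
  choose ψ z₀ r c hc hx using h
  set U : M → Set M := fun x ↦ ψ x '' Metric.ball (z₀ x) (r x) with hU
  obtain ⟨t, ht⟩ := isCompact_univ.elim_finite_subcover U (fun x ↦ (hc x).isOpen)
    (fun x _ ↦ Set.mem_iUnion.2 ⟨x, hx x⟩)
  obtain ⟨ε, hε, hleb⟩ := lebesgue_number_lemma_of_emetric (isCompact_univ (X := M))
    (c := fun x : t ↦ U x) (fun x ↦ (hc x).isOpen) (by simpa [Set.iUnion_subtype] using ht)
  have hsub : nearSet M ε ⊆ ⋃ x : t, U x ×ˢ U x := fun z hz ↦ by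
    obtain ⟨i, hi⟩ := hleb z.1 (Set.mem_univ _)
    refine Set.mem_iUnion.2 ⟨i, hi (Metric.mem_eball_self hε), hi ?_⟩
    rw [Metric.mem_eball, edist_comm]
    exact hz
  have hnear : ∫⁻ z in nearSet M ε, 1 / edist z.1 z.2 ^ a ∂(μ.prod μ) ≠ ⊤ := by
    refine ne_top_of_le_ne_top ?_ ((lintegral_mono_set hsub).trans (lintegral_iUnion_le _ _))
    rw [tsum_fintype]
    refine ENNReal.sum_ne_top.2 fun x _ ↦ ?_
    refine ne_top_of_le_ne_top ?_ ((hc x).lintegral_le ha (F := fun _ ↦ 1) measurable_const)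
    exact ENNReal.mul_ne_top (ENNReal.mul_ne_top (ENNReal.pow_ne_top (hc x).ne_top)
      (ENNReal.rpow_ne_top_of_nonneg ha (hc x).ne_top)) (lintegral_ball_inv_edist_ne_top hm _ _ ham)
  have hfar : ∫⁻ z in (nearSet M ε)ᶜ, 1 / edist z.1 z.2 ^ a ∂(μ.prod μ) ≠ ⊤ := by
    refine ne_top_of_le_ne_top (b := ∫⁻ z in (nearSet M ε)ᶜ, 1 / ε ^ a ∂(μ.prod μ)) ?_
      (setLIntegral_mono' (measurableSet_nearSet ε).compl fun z hz ↦ ?_)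
    · rw [setLIntegral_const]
      refine ENNReal.mul_ne_top (ENNReal.div_ne_top ENNReal.one_ne_top ?_) (measure_ne_top _ _)
      intro h0
      rcases ENNReal.rpow_eq_zero_iff.1 h0 with h1 | h1
      · exact hε.ne' h1.1
      · exact h1.2.not_ge ha
    · gcongr
      exact not_lt.1 hz
  rw [← lintegral_add_compl _ (measurableSet_nearSet ε)]
  exact ENNReal.add_ne_top.2 ⟨hnear, hfar⟩

lemma ENNReal.rpow_div_rpow_le (d : ℝ≥0∞) {a κ : ℝ} (ha : 0 < a) (hκ : a < κ) :
    d ^ a / d ^ κ ≤ 1 / d ^ (κ - a) := by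
  rcases eq_or_ne d 0 with rfl | h0
  · simp [ENNReal.zero_rpow_of_pos ha]
  rcases eq_or_ne d ⊤ with rfl | ht
  · simp [ENNReal.top_rpow_of_pos (ha.trans hκ)]
  · rw [← ENNReal.rpow_sub _ _ h0 ht, one_div, ← ENNReal.rpow_neg, neg_sub]

/-- The energies of the circle-valued maps of bounded range grow slowly with the Lipschitz
constant. -/
lemma HasGoodCharts.exists_gagliardoEnergy_circle_le (h : HasGoodCharts m μ) (hm : 1 ≤ m)
    {φ : M → ℝ} {Λ : ℝ≥0} (hφ : LipschitzWith Λ φ) {p κ a : ℝ} (ha : 0 < a) (hap : a ≤ p)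
    (haκ : a < κ) (hκ : κ < m + a) :
    ∃ A : ℝ≥0∞, A ≠ ⊤ ∧ ∀ L : ℝ≥0,
      gagliardoEnergy μ p κ (fun x ↦ ((L * φ x : ℝ) : AddCircle (2 * Real.pi)))
        ≤ A * (L : ℝ≥0∞) ^ a := by
  have := h.isFiniteMeasure
  have hJ := h.lintegral_inv_edist_ne_top hm (a := κ - a) (by linarith) (by linarith)
  set J := ∫⁻ z, 1 / edist z.1 z.2 ^ (κ - a) ∂(μ.prod μ)
  set K : ℝ≥0∞ := ENNReal.ofReal Real.pi ^ (p - a) * (Λ : ℝ≥0∞) ^ a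
  have hK : K ≠ ⊤ := ENNReal.mul_ne_top
    (ENNReal.rpow_ne_top_of_nonneg (by linarith) ENNReal.ofReal_ne_top)
    (ENNReal.rpow_ne_top_of_nonneg ha.le ENNReal.coe_ne_top)
  refine ⟨K * J, ENNReal.mul_ne_top hK hJ, fun L ↦ ?_⟩
  have hLt : (L : ℝ≥0∞) ^ a ≠ ⊤ := ENNReal.rpow_ne_top_of_nonneg ha.le ENNReal.coe_ne_top
  have hcont : Continuous fun x ↦ ((L * φ x : ℝ) : AddCircle (2 * Real.pi)) :=
    (AddCircle.continuous_mk' _).comp (continuous_const.mul hφ.continuous)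
  rw [gagliardoEnergy_eq_lintegral_prod
    ((hcont.comp continuous_fst).edist (hcont.comp continuous_snd)).measurable]
  calc _ ≤ ∫⁻ z, (K * (L : ℝ≥0∞) ^ a) * (1 / edist z.1 z.2 ^ (κ - a)) ∂(μ.prod μ) := ?_
    _ = K * (L : ℝ≥0∞) ^ a * J := lintegral_const_mul' _ _ (ENNReal.mul_ne_top hK hLt)
    _ = _ := by ring
  refine lintegral_mono fun z ↦ ?_
  set d := edist z.1 z.2
  set e := edist ((L * φ z.1 : ℝ) : AddCircle (2 * Real.pi)) ((L * φ z.2 : ℝ) : AddCircle (2 * Real.pi))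
    with he
  have e1 : e ≤ ENNReal.ofReal Real.pi := by
    rw [he, edist_dist, dist_eq_norm]
    refine ENNReal.ofReal_le_ofReal ((AddCircle.norm_le_half_period _ (by positivity)).trans ?_)
    rw [abs_of_pos (by positivity)]
    linarith
  have e2 : e ≤ L * (Λ * d) := by
    calc e ≤ edist (L * φ z.1) (L * φ z.2) := by
          rw [he, edist_dist, edist_dist, dist_eq_norm, ← AddCircle.coe_sub, Real.dist_eq]
          exact ENNReal.ofReal_le_ofReal (QuotientAddGroup.norm_mk_le_norm)
      _ = L * edist (φ z.1) (φ z.2) := by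
          rw [edist_dist, edist_dist, Real.dist_eq, ← mul_sub, abs_mul,
            ENNReal.ofReal_mul (abs_nonneg _), Real.dist_eq, NNReal.abs_eq,
            ENNReal.ofReal_coe_nnreal]
      _ ≤ _ := by gcongr; exact hφ _ _
  -- Interpolation between the two bounds e ≤ π, used with the power p - a, and e ≤ LΛd, used with
  -- the power a: only L^a appears instead of L^p.
  have e3 : e ^ p ≤ K * (L : ℝ≥0∞) ^ a * d ^ a := by
    calc e ^ p = e ^ (p - a) * e ^ a := by
          rw [← ENNReal.rpow_add_of_nonneg _ _ (by linarith) ha.le, sub_add_cancel]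
      _ ≤ ENNReal.ofReal Real.pi ^ (p - a) * (L * (Λ * d)) ^ a := by
          gcongr
      _ = _ := by
          rw [ENNReal.mul_rpow_of_nonneg _ _ ha.le, ENNReal.mul_rpow_of_nonneg _ _ ha.le]
          ring
  calc e ^ p / d ^ κ ≤ K * (L : ℝ≥0∞) ^ a * d ^ a / d ^ κ := by gcongr
    _ = K * (L : ℝ≥0∞) ^ a * (d ^ a / d ^ κ) := mul_div_assoc _ _ _
    _ ≤ _ := mul_le_mul' le_rfl (ENNReal.rpow_div_rpow_le d ha haκ)

omit [BorelSpace M] [CompactSpace M] in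
lemma gagliardoEnergy_const_mul (μ : Measure M) {p : ℝ} (hp : 0 ≤ p) (κ : ℝ) (L : ℝ≥0) (φ : M → ℝ) :
    gagliardoEnergy μ p κ (fun x ↦ L * φ x) = (L : ℝ≥0∞) ^ p * gagliardoEnergy μ p κ φ := by
  have hL : (L : ℝ≥0∞) ^ p ≠ ⊤ := ENNReal.rpow_ne_top_of_nonneg hp ENNReal.coe_ne_top
  unfold gagliardoEnergy
  rw [← lintegral_const_mul' _ _ hL]
  refine lintegral_congr fun x ↦ ?_
  rw [← lintegral_const_mul' _ _ hL]
  refine lintegral_congr fun y ↦ ?_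
  rw [← mul_div_assoc, ← ENNReal.mul_rpow_of_nonneg _ _ hp]
  congr 2
  rw [edist_dist, edist_dist, Real.dist_eq, ← mul_sub, abs_mul,
    ENNReal.ofReal_mul (abs_nonneg _), Real.dist_eq, NNReal.abs_eq, ENNReal.ofReal_coe_nnreal]

omit [CompactSpace M] in
/-- Lipschitz functions belong to the lifting space of the circle. -/
lemma LipschitzWith.memLiftingSpace {v : M → ℝ} {Λ : ℝ≥0} (hv : LipschitzWith Λ v)
    [IsFiniteMeasure μ] : MemLiftingSpace m μ (AddCircle (2 * Real.pi)) v := by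
  refine ⟨hv.continuous.measurable.aemeasurable, ?_⟩
  set ι := injectivityRadius (AddCircle (2 * Real.pi)) / 2 with hι
  have hι0 : 0 < ι := ENNReal.half_pos
    ((ENNReal.ofReal_pos.2 Real.pi_pos).trans_le pi_le_injectivityRadius_addCircle).ne'
  -- Far values of a Lipschitz function require points at distance at least c, where the kernel is
  -- bounded. Adding 1 to Λ avoids a division by zero.
  set c : ℝ≥0∞ := ι / (Λ + 1 : ℝ≥0) with hc
  have hc0 : 0 < c := ENNReal.div_pos hι0.ne' ENNReal.coe_ne_top
  have hcm : 1 / c ^ ((m : ℝ) + 1) ≠ ⊤ := by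
    refine ENNReal.div_ne_top ENNReal.one_ne_top fun h0 ↦ ?_
    rcases ENNReal.rpow_eq_zero_iff.1 h0 with h1 | h1
    · exact hc0.ne' h1.1
    · have : (0 : ℝ) ≤ m := Nat.cast_nonneg m
      linarith [h1.2]
  calc _ ≤ ∫⁻ _, ∫⁻ _, 1 / c ^ ((m : ℝ) + 1) ∂μ ∂μ := by
        refine lintegral_mono fun x ↦ ?_
        refine (setLIntegral_mono' (hs := ?_) fun y hy ↦ ?_).trans
          (lintegral_mono' Measure.restrict_le_self le_rfl)
        · exact measurableSet_le measurable_const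
            (continuous_const.edist hv.continuous).measurable
        · gcongr
          refine ENNReal.div_le_of_le_mul' (le_trans hy ((hv x y).trans ?_))
          gcongr
          exact le_self_add
    _ < ⊤ := by
        simp only [lintegral_const]
        exact (ENNReal.mul_ne_top (ENNReal.mul_ne_top hcm (measure_ne_top _ _))
          (measure_ne_top _ _)).lt_top

/-- Balls of infinite radius are clopen. -/
lemma edist_ne_top_of_preconnectedSpace {X : Type*} [EMetricSpace X] [PreconnectedSpace X]
    (x y : X) : edist x y ≠ ⊤ := by
  have hcl : IsClopen (Metric.eball x ⊤) := ⟨Metric.isClosed_eball_top, Metric.isOpen_eball⟩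
  have hu := hcl.eq_univ ⟨x, Metric.mem_eball_self (by simp)⟩
  have hy : y ∈ Metric.eball x ⊤ := hu ▸ Set.mem_univ y
  rw [edist_comm]
  exact (Metric.mem_eball.1 hy).ne

/-- Nonconstant continuous functions have positive energy. -/
lemma gagliardoEnergy_pos [PreconnectedSpace M] [SFinite μ] [μ.IsOpenPosMeasure] {φ : M → ℝ}
    (hφ : Continuous φ) {x₀ y₀ : M} (hne : φ x₀ ≠ φ y₀) {p κ : ℝ} :
    gagliardoEnergy μ p κ φ ≠ 0 := by
  rw [gagliardoEnergy_eq_lintegral_prod (by fun_prop)]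
  intro h0
  rw [lintegral_eq_zero_iff (by fun_prop)] at h0
  set O : Set (M × M) := {z | φ z.1 ≠ φ z.2}
  have hO : IsOpen O := isOpen_ne_fun (by fun_prop) (by fun_prop)
  refine (hO.measure_pos (μ.prod μ) ⟨(x₀, y₀), hne⟩).ne' ?_
  refine measure_mono_null (fun z hz ↦ ?_) (ae_iff.1 h0)
  simp only [Set.mem_ofPred_eq, Pi.zero_apply, ENNReal.div_eq_zero_iff, ENNReal.rpow_eq_zero_iff,
    ENNReal.rpow_eq_top_iff, edist_eq_zero, not_or, not_and]
  refine ⟨⟨fun h1 ↦ absurd h1 hz, fun h1 ↦ absurd h1 (edist_ne_top _ _)⟩,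
    fun h1 ↦ absurd (congrArg φ h1) hz, fun h1 ↦ absurd h1 (edist_ne_top_of_preconnectedSpace _ _)⟩

end SmoothEnergy

/-! ### Optimality of the exponent -/

section Optimality

variable {m : ℕ} {M : Type*} [EMetricSpace M] [CompactSpace M]
  [ChartedSpace (EuclideanSpace ℝ (Fin m)) M]

/-- In a bi-Lipschitz chart a C^1 function is locally Lipschitz; compactness makes the constant
global, once the distance is known to be finite. -/
lemma exists_lipschitzWith_of_contMDiff [PreconnectedSpace M] [IsManifold (𝓡 m) 1 M]
    [RiemannianBundle (fun x : M ↦ TangentSpace (𝓡 m) x)]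
    [IsContinuousRiemannianBundle (EuclideanSpace ℝ (Fin m)) (fun x : M ↦ TangentSpace (𝓡 m) x)]
    [IsRiemannianManifold (𝓡 m) M] {φ : M → ℝ} (hφ : ContMDiff (𝓡 m) 𝓘(ℝ, ℝ) 1 φ) :
    ∃ Λ, LipschitzWith Λ φ := by
  have hloc : LocallyLipschitz φ := by
    intro x
    obtain ⟨C, -, r, hr, hsub, -, hlip⟩ :=
      exists_biLipschitz_chart (E := EuclideanSpace ℝ (Fin m)) x
    set e := chartAt (EuclideanSpace ℝ (Fin m)) x with he
    have hF : ContDiffAt ℝ 1 (φ ∘ e.symm) (e x) := by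
      have h1 : ContMDiffAt (𝓡 m) 𝓘(ℝ, ℝ) 1 (φ ∘ e.symm) (e x) :=
        (hφ _).comp _ (contMDiffAt_symm_of_mem_maximalAtlas
          (IsManifold.chart_mem_maximalAtlas x) (mem_chart_target _ x))
      exact h1.contDiffAt
    obtain ⟨K, t, ht, hK⟩ := hF.exists_lipschitzOnWith
    refine ⟨K * C, e.source ∩ e ⁻¹' (t ∩ Metric.ball (e x) r), ?_, ?_⟩
    · exact Filter.inter_mem (chart_source_mem_nhds _ x)
        ((e.continuousAt (mem_chart_source _ x)).preimage_mem_nhds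
          (Filter.inter_mem ht (Metric.ball_mem_nhds _ hr)))
    · intro a ha b hb
      have h1 := hK ha.2.1 hb.2.1
      have h2 := (hlip _ ha.2.2 _ hb.2.2).2
      simp only [Function.comp_apply, e.left_inv ha.1, e.left_inv hb.1] at h1 h2
      refine h1.trans ?_
      rw [ENNReal.coe_mul, mul_assoc]
      gcongr
  let : MetricSpace M := EMetricSpace.toMetricSpace edist_ne_top_of_preconnectedSpace
  obtain ⟨Λ, hΛ⟩ := LocallyLipschitzOn.exists_lipschitzOnWith_of_compact (isCompact_univ (X := M))
    (locallyLipschitzOn_univ.2 hloc)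
  exact ⟨Λ, lipschitzOnWith_univ.1 hΛ⟩

lemma exists_contMDiff_ne [IsManifold (𝓡 m) ∞ M] [Nonempty M] (hm : 1 ≤ m) :
    ∃ φ : M → ℝ, ContMDiff (𝓡 m) 𝓘(ℝ, ℝ) ∞ φ ∧ ∃ x y, φ x ≠ φ y := by
  have hnt : ∃ x y : M, x ≠ y := by
    obtain ⟨x⟩ := ‹Nonempty M›
    set e := chartAt (EuclideanSpace ℝ (Fin m)) x
    have : Nontrivial (EuclideanSpace ℝ (Fin m)) :=
      Module.nontrivial_of_finrank_pos (R := ℝ) (by simp; omega)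
    have hnhds : e.target ∈ 𝓝 (e x) := e.open_target.mem_nhds (mem_chart_target _ x)
    have hinf := infinite_of_mem_nhds (e x) hnhds
    obtain ⟨b, hb, hbne⟩ := hinf.nontrivial.exists_ne (e x)
    refine ⟨e.symm b, x, fun h ↦ hbne ?_⟩
    rw [← h, e.right_inv hb]
  obtain ⟨x, y, hxy⟩ := hnt
  obtain ⟨f, hf, -, h0, h1⟩ := exists_contMDiff_zero_iff_one_iff_of_isClosed (𝓡 m) (n := (⊤ : ℕ∞))
    (isClosed_singleton (x := x)) (isClosed_singleton (x := y)) (by simpa using hxy)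
  refine ⟨f, hf, x, y, ?_⟩
  rw [(h0 x).1 rfl, (h1 y).1 rfl]
  exact zero_ne_one

lemma exists_nnreal_mul_rpow_lt {c e : ℝ≥0∞} (hc : c ≠ ⊤) (he : e ≠ 0) {β p : ℝ} (hβ : β < p) :
    ∃ L : ℝ≥0, 1 ≤ L ∧ c * (L : ℝ≥0∞) ^ β < (L : ℝ≥0∞) ^ p * e := by
  have hlim : Filter.Tendsto (fun L : ℝ≥0 ↦ (L : ℝ≥0∞) ^ (p - β) * e) Filter.atTop (𝓝 ⊤) := by
    have h1 : Filter.Tendsto (fun L : ℝ≥0 ↦ (L : ℝ≥0∞) ^ (p - β)) Filter.atTop (𝓝 ⊤) :=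
      (ENNReal.tendsto_rpow_at_top (by linarith)).comp (ENNReal.tendsto_coe_nhds_top.2 Filter.tendsto_id)
    simpa [ENNReal.top_mul he] using ENNReal.Tendsto.mul_const (b := e) h1 (Or.inl ENNReal.top_ne_zero)
  obtain ⟨L, hL, hL1⟩ := ((hlim.eventually_const_lt hc.lt_top).and
    (Filter.eventually_ge_atTop 1)).exists
  refine ⟨L, hL1, ?_⟩
  have hL0 : (L : ℝ≥0∞) ≠ 0 := by
    exact_mod_cast (zero_lt_one.trans_le hL1).ne'
  have hLt : (L : ℝ≥0∞) ≠ ⊤ := ENNReal.coe_ne_top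
  calc c * (L : ℝ≥0∞) ^ β < (L : ℝ≥0∞) ^ (p - β) * e * (L : ℝ≥0∞) ^ β :=
        ENNReal.mul_lt_mul_left (by simp [ENNReal.rpow_eq_zero_iff, hL0, hLt])
          (by simp [ENNReal.rpow_eq_top_iff, hL0, hLt]) hL
    _ = _ := by
        rw [mul_right_comm, ← ENNReal.rpow_add _ _ hL0 hLt, sub_add_cancel]

/-- For γ = (1-s)p/m and η = 0 the power of L on the right, mγ + sp, would be exactly p. The strict
inequality leaves room for a small η > 0, which makes the kernels integrable. The assumption m < p
is what allows m + η ≤ p. Replacing γ by max(γ, 0) is harmless because 1 + energy is at least 1. -/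
lemma exists_exponents {m s p γ : ℝ} (hm : 1 ≤ m) (hs₀ : 0 < s) (hs₁ : s < 1) (hmp : m < p)
    (hγ : γ < (1 - s) * p / m) :
    ∃ γ' η : ℝ, 0 ≤ γ' ∧ γ ≤ γ' ∧ 0 < η ∧ η < m ∧ m + η ≤ p ∧ s * p + η ≤ p ∧
      (m + η) * γ' + (s * p + η) < p := by
  have hp : 0 < p := by linarith
  have hpos : 0 < (1 - s) * p / m := by
    have : 0 < 1 - s := by linarith
    positivity
  set γ' := max γ 0
  have hγ' : γ' < (1 - s) * p / m := max_lt hγ hpos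
  have hγ0 : 0 ≤ γ' := le_max_right _ _
  have h1 : γ' * m < (1 - s) * p := by rwa [lt_div_iff₀ (by linarith)] at hγ'
  set ζ := (1 - s) * p - γ' * m
  have hζ : 0 < ζ := sub_pos.2 h1
  set η := min (min (m / 2) (p - m)) (ζ / (2 * (γ' + 1)))
  have hη1 : η ≤ m / 2 := (min_le_left _ _).trans (min_le_left _ _)
  have hη2 : η ≤ p - m := (min_le_left _ _).trans (min_le_right _ _)
  have hη3 : η ≤ ζ / (2 * (γ' + 1)) := min_le_right _ _
  have hη0 : 0 < η := lt_min (lt_min (by linarith) (by linarith)) (by positivity)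
  have h3 : η * (2 * (γ' + 1)) ≤ ζ := by rwa [le_div_iff₀ (by positivity)] at hη3
  have h4 : 0 < η * (γ' + 1) := by positivity
  have hγη : 0 ≤ γ' * m := by positivity
  have hη5 : η ≤ η * (γ' + 1) := by nlinarith
  refine ⟨γ', η, hγ0, le_max_left _ _, hη0, by linarith, by linarith, ?_, ?_⟩
  · simp only [ζ] at h3
    nlinarith
  · simp only [ζ] at h3
    nlinarith

omit [ChartedSpace (EuclideanSpace ℝ (Fin m)) M] in
/-- Rescaled Lipschitz functions show that the exponent cannot be lowered. -/
theorem HasGoodCharts.exists_energy_circle_lt [MeasurableSpace M] [BorelSpace M] [ConnectedSpace M]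
    {μ : Measure M} (h : HasGoodCharts m μ) (hm : 1 ≤ m) {φ : M → ℝ} {Λ : ℝ≥0}
    (hφ : LipschitzWith Λ φ) {x₀ y₀ : M} (hne : φ x₀ ≠ φ y₀) {s p γ : ℝ} (hs₀ : 0 < s)
    (hs₁ : s < 1) (hmp : (m : ℝ) < p) (hγ : γ < (1 - s) * p / m) {C : ℝ≥0∞} (hC : C ≠ ⊤) :
    ∃ L : ℝ≥0,
      gagliardoEnergy μ p (m + s * p) (fun x ↦ ((L * φ x : ℝ) : AddCircle (2 * Real.pi))) < ⊤ ∧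
      gagliardoEnergy μ p (2 * m) (fun x ↦ ((L * φ x : ℝ) : AddCircle (2 * Real.pi))) < ⊤ ∧
      C * (1 + gagliardoEnergy μ p (2 * m)
            (fun x ↦ ((L * φ x : ℝ) : AddCircle (2 * Real.pi)))) ^ γ
          * gagliardoEnergy μ p (m + s * p)
            (fun x ↦ ((L * φ x : ℝ) : AddCircle (2 * Real.pi)))
        < gagliardoEnergy μ p (m + s * p) (fun x ↦ L * φ x) := by
  have := h.isFiniteMeasure
  have := h.isOpenPosMeasure
  have hm1 : (1 : ℝ) ≤ m := by exact_mod_cast hm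
  have hsp : 0 < s * p := by nlinarith
  obtain ⟨γ', η, hγ0, hγγ', hη, hηm, h1, h2, h3⟩ := exists_exponents hm1 hs₀ hs₁ hmp hγ
  obtain ⟨A, hA, HA⟩ := h.exists_gagliardoEnergy_circle_le hm hφ (p := p) (κ := 2 * m)
    (a := m + η) (by linarith) h1 (by linarith) (by linarith)
  obtain ⟨B, hB, HB⟩ := h.exists_gagliardoEnergy_circle_le hm hφ (p := p) (κ := m + s * p)
    (a := s * p + η) (by linarith) h2 (by linarith) (by linarith)
  have hpos := gagliardoEnergy_pos (μ := μ) hφ.continuous hne (p := p) (κ := m + s * p)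
  have hAγ : (1 + A) ^ γ' ≠ ⊤ := ENNReal.rpow_ne_top_of_nonneg hγ0
    (ENNReal.add_ne_top.2 ⟨ENNReal.one_ne_top, hA⟩)
  -- The energy of Lφ is L^p times a positive number and beats any multiple of a smaller power of L.
  obtain ⟨L, hL1, hL⟩ := exists_nnreal_mul_rpow_lt (c := C * (1 + A) ^ γ' * B)
    (ENNReal.mul_ne_top (ENNReal.mul_ne_top hC hAγ) hB) hpos h3
  have hLt : ∀ a : ℝ, 0 ≤ a → (L : ℝ≥0∞) ^ a ≠ ⊤ := fun a ha ↦
    ENNReal.rpow_ne_top_of_nonneg ha ENNReal.coe_ne_top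
  have hL1' : (1 : ℝ≥0∞) ≤ L := by exact_mod_cast hL1
  have hL0 : (L : ℝ≥0∞) ≠ 0 := (zero_lt_one.trans_le hL1').ne'
  refine ⟨L, (HB L).trans_lt (ENNReal.mul_ne_top hB (hLt _ (by linarith))).lt_top,
    (HA L).trans_lt (ENNReal.mul_ne_top hA (hLt _ (by linarith))).lt_top, ?_⟩
  rw [gagliardoEnergy_const_mul μ (by linarith)]
  refine lt_of_le_of_lt ?_ hL
  set X := gagliardoEnergy μ p (2 * m) (fun x ↦ ((L * φ x : ℝ) : AddCircle (2 * Real.pi)))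
  have hX : (1 + X) ^ γ ≤ (1 + A) ^ γ' * (L : ℝ≥0∞) ^ ((m + η) * γ') := by
    calc (1 + X) ^ γ ≤ (1 + X) ^ γ' := ENNReal.rpow_le_rpow_of_exponent_le le_self_add hγγ'
      _ ≤ ((1 + A) * (L : ℝ≥0∞) ^ (m + η)) ^ γ' := by
        refine ENNReal.rpow_le_rpow ?_ hγ0
        rw [add_mul, one_mul]
        exact add_le_add (ENNReal.one_le_rpow hL1' (by linarith)) (HA L)
      _ = _ := by rw [ENNReal.mul_rpow_of_nonneg _ _ hγ0, ← ENNReal.rpow_mul]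
  calc _ ≤ C * ((1 + A) ^ γ' * (L : ℝ≥0∞) ^ ((m + η) * γ')) * (B * (L : ℝ≥0∞) ^ (s * p + η)) := by
        gcongr
        exact HB L
    _ = C * (1 + A) ^ γ' * B
          * ((L : ℝ≥0∞) ^ ((m + η) * γ') * (L : ℝ≥0∞) ^ (s * p + η)) := by ring
    _ = _ := by rw [← ENNReal.rpow_add _ _ hL0 ENNReal.coe_ne_top]

end Optimality

end

/-! ### The theorem -/

theorem mainTheorem9
    (m : ℕ) (hm : 1 ≤ m)
    (M : Type*) [EMetricSpace M] [CompactSpace M] [ConnectedSpace M]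
    [MeasurableSpace M] [BorelSpace M]
    [ChartedSpace (EuclideanSpace ℝ (Fin m)) M] [IsManifold (𝓡 m) ∞ M]
    [RiemannianBundle (fun x : M ↦ TangentSpace (𝓡 m) x)]
    [IsContMDiffRiemannianBundle (𝓡 m) ∞ (EuclideanSpace ℝ (Fin m))
      (fun x : M ↦ TangentSpace (𝓡 m) x)]
    [IsRiemannianManifold (𝓡 m) M]
    (s p : ℝ) (hs₀ : 0 < s) (hs₁ : s < 1) (hp : 1 < p) (hsp : 1 < s * p) :
    -- the lifting estimate, for every Riemannian covering of a compact manifold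
    (∀ (n : ℕ)
      (N : Type*) [EMetricSpace N] [CompactSpace N] [ConnectedSpace N]
      [ChartedSpace (EuclideanSpace ℝ (Fin n)) N] [IsManifold (𝓡 n) ∞ N]
      [RiemannianBundle (fun x : N ↦ TangentSpace (𝓡 n) x)]
      [IsContMDiffRiemannianBundle (𝓡 n) ∞ (EuclideanSpace ℝ (Fin n))
        (fun x : N ↦ TangentSpace (𝓡 n) x)]
      [IsRiemannianManifold (𝓡 n) N]
      (N' : Type*) [EMetricSpace N'] [SecondCountableTopology N']
      [MeasurableSpace N'] [BorelSpace N']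
      [ChartedSpace (EuclideanSpace ℝ (Fin n)) N'] [IsManifold (𝓡 n) ∞ N']
      [RiemannianBundle (fun x : N' ↦ TangentSpace (𝓡 n) x)]
      [IsContMDiffRiemannianBundle (𝓡 n) ∞ (EuclideanSpace ℝ (Fin n))
        (fun x : N' ↦ TangentSpace (𝓡 n) x)]
      [IsRiemannianManifold (𝓡 n) N']
      (cov : N' → N) (_ : IsRiemannianCovering (n := n) cov),
      ∃ C : ℝ, 0 < C ∧
        ∀ v : M → N', MemLiftingSpace m (riemannianVolume m M) N v →
          gagliardoEnergy (riemannianVolume m M) p (m + s * p) v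
            ≤ ENNReal.ofReal C
              * (1 + gagliardoEnergy (riemannianVolume m M) p (2 * m) (cov ∘ v))
                  ^ ((1 - s) * p / m)
              * gagliardoEnergy (riemannianVolume m M) p (m + s * p) (cov ∘ v) ∧
          (gagliardoEnergy (riemannianVolume m M) p (m + s * p) (cov ∘ v) < ⊤ →
            gagliardoEnergy (riemannianVolume m M) p (2 * m) (cov ∘ v) < ⊤ →
            MemFracSobolev m (riemannianVolume m M) s p v)) ∧
    -- optimality of the exponent, for the universal covering of the unit circle
    ((m : ℝ) < p → ∀ γ : ℝ, γ < (1 - s) * p / m → ∀ C : ℝ, 0 < C →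
      ∃ v : M → ℝ, ContMDiff (𝓡 m) 𝓘(ℝ, ℝ) ∞ v ∧
        MemLiftingSpace m (riemannianVolume m M) (AddCircle (2 * Real.pi)) v ∧
        gagliardoEnergy (riemannianVolume m M) p (m + s * p)
          (fun x ↦ (v x : AddCircle (2 * Real.pi))) < ⊤ ∧
        gagliardoEnergy (riemannianVolume m M) p (2 * m)
          (fun x ↦ (v x : AddCircle (2 * Real.pi))) < ⊤ ∧
        ENNReal.ofReal C
          * (1 + gagliardoEnergy (riemannianVolume m M) p (2 * m)
              (fun x ↦ (v x : AddCircle (2 * Real.pi)))) ^ γ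
          * gagliardoEnergy (riemannianVolume m M) p (m + s * p)
              (fun x ↦ (v x : AddCircle (2 * Real.pi)))
          < gagliardoEnergy (riemannianVolume m M) p (m + s * p) v) := by
  have : IsContinuousRiemannianBundle (EuclideanSpace ℝ (Fin m))
      (fun x : M ↦ TangentSpace (𝓡 m) x) := by
    obtain ⟨g, hgs, hg⟩ := ‹IsContMDiffRiemannianBundle (𝓡 m) ∞ (EuclideanSpace ℝ (Fin m))
      (fun x : M ↦ TangentSpace (𝓡 m) x)›.exists_contMDiff
    exact ⟨g, hgs.continuous, hg⟩
  have hcharts : HasGoodCharts m (riemannianVolume m M) := hasGoodCharts_riemannianVolume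
  have := hcharts.isFiniteMeasure
  refine ⟨?_, ?_⟩
  · intro n N _ _ _ _ _ _ _ _ N' _ _ _ _ _ _ _ _ _ cov hcov
    obtain ⟨C, hC, H⟩ := hcharts.exists_gagliardoEnergy_le hm hs₁ hp hsp (cov := cov)
      hcov.edist_le fun a b ↦ hcov.edist_eq
    refine ⟨C, hC, fun v hv ↦ ⟨H v hv, fun h₁ h₂ ↦ ⟨hv.1, (H v hv).trans_lt ?_⟩⟩⟩
    have hexp : 0 ≤ (1 - s) * p / m :=
      div_nonneg (mul_nonneg (by linarith) (by linarith)) (Nat.cast_nonneg m)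
    exact ENNReal.mul_lt_top (ENNReal.mul_lt_top ENNReal.ofReal_lt_top
      (ENNReal.rpow_lt_top_of_nonneg hexp (ENNReal.add_ne_top.2 ⟨ENNReal.one_ne_top, h₂.ne⟩))) h₁
  · intro hmp γ hγ C _
    obtain ⟨φ, hφ, x₀, y₀, hne⟩ := exists_contMDiff_ne (M := M) hm
    obtain ⟨Λ, hΛ⟩ := exists_lipschitzWith_of_contMDiff (hφ.of_le (by simp))
    obtain ⟨L, h₁, h₂, h₃⟩ := hcharts.exists_energy_circle_lt hm hΛ hne hs₀ hs₁ hmp hγ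
      (ENNReal.ofReal_ne_top (r := C))
    have hv : ContMDiff (𝓡 m) 𝓘(ℝ, ℝ) ∞ fun x ↦ (L : ℝ) * φ x := contMDiff_const.mul hφ
    obtain ⟨Λ', hΛ'⟩ := exists_lipschitzWith_of_contMDiff (hv.of_le (by simp))
    exact ⟨_, hv, hΛ'.memLiftingSpace, h₁, h₂, h₃⟩
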